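/- **Setting.** Fix a localization function $\chi\in C_c^\infty(\mathbb R^3)$ that is even and satisfies $\chi\ge 0$, $\int\chi^2=1$, $\operatorname{supp}\chi\subset[-\frac12,\frac12]^3$; fix constants $b,C_{\rm kin}>0$ and a number $D>0$ with $|\chi*\chi(x)-1|\le\frac12$ for $|x|\le D$. Let $v:\mathbb R^3\to[0,\infty)$ be spherically symmetric and integrable with $v(x)=0$ for $|x|>R$, where $R>0$. Its scattering length $a$ is defined, for any $\widetilde R>R$, by $$\frac{4\pi a}{1-a/\widetilde R}=\inf\Big\{\int_{|x|\le\widetilde R}|\nabla\phi|^2+\tfrac12 v|\phi|^2\,dx\ :\ \phi\in H^1(B(0,\widetilde R)),\ \phi|_{|x|=\widetilde R}=1\Big\},$$ and its scattering solution $\omega$ is the weak solution of locally finite energy of $(-\Delta+\frac12 v)(1-\omega)=0$ on $\mathbb R^3$ with $\omega(x)\to0$ as $|x|\to\infty$. Assume $a>0$. For $\rho_\mu>0$ and $K>0$ put $\ell=K(\rho_\mu a)^{-1/2}$, $\chi_B(x)=\chi(x/\ell)$, $B=[-\frac\ell2,\frac\ell2]^3$, $\theta=\mathbf 1_B$, and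 $$Q\varphi=\theta\varphi-\ell^{-3}\langle\theta,\varphi\rangle\theta,\qquad \mathcal T=Q\big[\chi_B(-\Delta-C_{\rm kin}\ell^{-2})_+\chi_B+b\ell^{-2}\big]Q,$$ $$W(x)=\frac{v(x)}{\chi*\chi(x/\ell)},\qquad w(x,y)=\chi_B(x)W(x-y)\chi_B(y),\qquad w_1(x,y)=w(x,y)\big(1-\omega(x-y)\big).$$ The box Hamiltonian $\mathcal H_B(\rho_\mu)$ is the particle-number preserving operator on the symmetric Fock space over $L^2(\mathbb R^3)$ which on the $N$-particle space is the self-adjoint operator defined by the quadratic form (on all vectors of finite kinetic and repulsive energy) of $$(\mathcal H_B(\rho_\mu))_N=\sum_{i=1}^N\mathcal T_i-\rho_\mu\sum_{i=1}^N\int w_1(x_i,y)\,dy+\sum_{i<j}w(x_i,x_j),$$ and the box energy density is $e_B(\rho_\mu)=\ell^{-3}\inf\operatorname{Spec}\mathcal H_B(\rho_\mu)$. **Theorem.** For given $\chi$, $b$, $C_{\rm kin}$, $D$ as above there exist constants $K_0,C',C>0$, depending only on these data, such that the following holds for all $v$, $R$ and $\rho_\mu>0$ as above, with $\ell$ defined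 with $K=K_0$: if $R/\ell\le C'$ and $\rho_\mu aR^2\le(K_0D)^2$, then $$e_B(\rho_\mu)\ \ge\ -4\pi\rho_\mu^2a-C\rho_\mu^2a(\rho_\mu a^3)^{1/2}-C\rho_\mu^3a^2R^2 .$$ -/

import Mathlib

open MeasureTheory Filter Topology
open scoped ENNReal Convolution FourierTransform ComplexConjugate InnerProductSpace Gradient

noncomputable section

namespace BoseBox

/-- Physical space `ℝ³`. -/
abbrev E3 : Type := EuclideanSpace ℝ (Fin 3)

/-! ### The interaction potential and its scattering length -/

/-- `v` is non-negative, spherically symmetric, integrable, and vanishes outside the ball of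
radius `R > 0`. -/
structure IsPotential (v : E3 → ℝ) (R : ℝ) : Prop where
  range_pos : 0 < R
  nonneg : ∀ x, 0 ≤ v x
  radial : ∀ x y, ‖x‖ = ‖y‖ → v x = v y
  integrable : Integrable v
  finite_range : ∀ x, R < ‖x‖ → v x = 0

/-- Smooth compactly supported real functions on `ℝ³` with support in `Ω`. -/
structure IsTestFunction (Ω : Set E3) (η : E3 → ℝ) : Prop where
  smooth : ContDiff ℝ (⊤ : ℕ∞) η
  compact : HasCompactSupport η
  support : tsupport η ⊆ Ω

/-- `f ∈ H₀¹(Ω)` with gradient `G`: the pair `(f, G)` is the `L²(Ω)`-limit of pairs `(η, ∇η)`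
with `η ∈ C_c^∞(Ω)`. -/
def IsH10 (Ω : Set E3) (f : E3 → ℝ) (G : E3 → E3) : Prop :=
  MemLp f 2 (volume.restrict Ω) ∧ MemLp G 2 (volume.restrict Ω) ∧
    ∃ η : ℕ → E3 → ℝ, (∀ n, IsTestFunction Ω (η n)) ∧
      Tendsto (fun n => eLpNorm (fun x => η n x - f x) 2 (volume.restrict Ω)) atTop (𝓝 0) ∧
      Tendsto (fun n => eLpNorm (fun x => ∇ (η n) x - G x) 2 (volume.restrict Ω)) atTop (𝓝 0)

/-- The infimum of `∫_{|x| ≤ r} |∇φ|² + ½ v |φ|²` over the `φ ∈ H¹(B(0,r))` with boundary value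
`1` on the sphere `|x| = r`, that is with `φ - 1 ∈ H₀¹(B(0,r))`. -/
def scatteringEnergy (v : E3 → ℝ) (r : ℝ) : ℝ≥0∞ :=
  ⨅ (φ : E3 → ℝ) (G : E3 → E3) (_ : IsH10 (Metric.ball 0 r) (fun x => φ x - 1) G),
    ∫⁻ x in Metric.ball 0 r, ENNReal.ofReal (‖G x‖ ^ 2 + 1 / 2 * v x * φ x ^ 2)

/-- The scattering length computed in the ball of radius `r` (any radius larger than the range
of `v`): the solution `a` of `4πa / (1 - a/r) = scatteringEnergy v r`,
see `scatteringLength_spec`. -/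
def scatteringLength (v : E3 → ℝ) (r : ℝ) : ℝ :=
  (scatteringEnergy v r).toReal / (4 * Real.pi + (scatteringEnergy v r).toReal / r)

theorem scatteringLength_spec (v : E3 → ℝ) {r : ℝ} (hr : 0 < r) :
    scatteringLength v r < r ∧
      4 * Real.pi * scatteringLength v r / (1 - scatteringLength v r / r) =
        (scatteringEnergy v r).toReal := by
  have hI : 0 ≤ (scatteringEnergy v r).toReal := ENNReal.toReal_nonneg
  have hpi := Real.pi_pos
  unfold scatteringLength
  generalize (scatteringEnergy v r).toReal = I at hI ⊢
  have hden : 0 < 4 * Real.pi + I / r := by positivity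
  have hden' : 0 < 4 * Real.pi * r + I := by positivity
  have h1 : I / (4 * Real.pi + I / r) = I * r / (4 * Real.pi * r + I) := by
    field_simp
  have h2 : 1 - I * r / (4 * Real.pi * r + I) / r = 4 * Real.pi * r / (4 * Real.pi * r + I) := by
    field_simp
    ring
  rw [h1]
  refine ⟨?_, ?_⟩
  · rw [div_lt_iff₀ hden']
    nlinarith [mul_pos hpi (mul_pos hr hr)]
  · rw [h2]
    field_simp

/-- `G` is the weak gradient of `f` on `ℝ³`. -/
def IsWeakGradient (f : E3 → ℝ) (G : E3 → E3) : Prop :=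
  ∀ η, IsTestFunction Set.univ η → ∫ x, f x • ∇ η x = -∫ x, η x • G x

/-- `ω` is the scattering solution of `v`: the weak solution, of locally finite energy, of
`(-Δ + ½ v)(1 - ω) = 0` on `ℝ³` with `ω → 0` at infinity. -/
structure IsScatteringSolution (v ω : E3 → ℝ) : Prop where
  tendsto_zero : Tendsto ω (cocompact E3) (𝓝 0)
  finite_energy : Integrable (fun x => v x * (1 - ω x) ^ 2)
  weak_solution : ∃ G : E3 → E3, IsWeakGradient ω G ∧
    (∀ r : ℝ, MemLp ω 2 (volume.restrict (Metric.ball 0 r)) ∧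
      MemLp G 2 (volume.restrict (Metric.ball 0 r))) ∧
    ∀ η, IsTestFunction Set.univ η →
      ∫ x, (-⟪G x, ∇ η x⟫_ℝ + 1 / 2 * v x * (1 - ω x) * η x) = 0

/-! ### Localization to the box `[-ℓ/2, ℓ/2]³` -/

/-- The cube `[-ℓ/2, ℓ/2]³`. -/
def cube (ℓ : ℝ) : Set E3 := {x | ∀ i, |x i| ≤ ℓ / 2}

/-- The localization functions: smooth, even, non-negative, supported in `[-1/2, 1/2]³`, with
`∫ χ² = 1`. -/
structure IsLocalization (χ : E3 → ℝ) : Prop where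
  smooth : ContDiff ℝ (⊤ : ℕ∞) χ
  even : ∀ x, χ (-x) = χ x
  nonneg : ∀ x, 0 ≤ χ x
  integral_sq : ∫ x, χ x ^ 2 = 1
  support : tsupport χ ⊆ cube 1

/-- `χ * χ`. -/
def selfConv (χ : E3 → ℝ) : E3 → ℝ := χ ⋆[ContinuousLinearMap.mul ℝ ℝ, volume] χ

/-- `χ_B(x) = χ(x/ℓ)`. -/
def chiB (χ : E3 → ℝ) (ℓ : ℝ) (x : E3) : ℝ := χ (ℓ⁻¹ • x)

/-- `W(x) = v(x) / (χ * χ)(x/ℓ)`. -/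
def bigW (χ : E3 → ℝ) (ℓ : ℝ) (v : E3 → ℝ) (x : E3) : ℝ := v x / selfConv χ (ℓ⁻¹ • x)

/-- `w(x,y) = χ_B(x) W(x-y) χ_B(y)`. -/
def pairW (χ : E3 → ℝ) (ℓ : ℝ) (v : E3 → ℝ) (x y : E3) : ℝ :=
  chiB χ ℓ x * bigW χ ℓ v (x - y) * chiB χ ℓ y

/-- `w₁(x,y) = w(x,y) (1 - ω(x-y))`. -/
def pairW1 (χ : E3 → ℝ) (ℓ : ℝ) (v ω : E3 → ℝ) (x y : E3) : ℝ :=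
  pairW χ ℓ v x y * (1 - ω (x - y))

/-! ### The `N`-particle sectors -/

/-- Configurations of `N` particles, with Lebesgue measure. -/
abbrev Conf (N : ℕ) : Type := Fin N → E3

/-- `∑_{i<j} w(x_i,x_j)`. -/
def repulsion (χ : E3 → ℝ) (ℓ : ℝ) (v : E3 → ℝ) {N : ℕ} (x : Conf N) : ℝ :=
  ∑ i, ∑ j ∈ Finset.Ioi i, pairW χ ℓ v (x i) (x j)

/-- `𝒲(x₁,…,x_N) = -ρ ∑_i ∫ w₁(x_i,y) dy + ∑_{i<j} w(x_i,x_j)`. -/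
def potential (χ : E3 → ℝ) (ℓ ρ : ℝ) (v ω : E3 → ℝ) {N : ℕ} (x : Conf N) : ℝ :=
  (∑ i, -ρ * ∫ y, pairW1 χ ℓ v ω (x i) y) + repulsion χ ℓ v x

/-- The projection `Q φ = θ φ - ℓ⁻³ ⟨θ, φ⟩ θ`, `θ` the indicator function of the box, acting on
the `i`-th particle. -/
def projQ (ℓ : ℝ) {N : ℕ} (i : Fin N) (Ψ : Conf N → ℂ) (x : Conf N) : ℂ :=
  (cube ℓ).indicator
    (fun _ => Ψ x - ((ℓ ^ 3)⁻¹ : ℝ) * ∫ y in cube ℓ, Ψ (Function.update x i y)) (x i)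

/-- The Fourier transform, in the variable of the `i`-th particle, of `χ_B Q Ψ`; the value at `x`
has the frequency `x i`, for the kernel `exp(-2πi⟨y, ξ⟩)`. -/
def fourierQ (χ : E3 → ℝ) (ℓ : ℝ) {N : ℕ} (i : Fin N) (Ψ : Conf N → ℂ) (x : Conf N) : ℂ :=
  𝓕 (fun y : E3 => (chiB χ ℓ y : ℂ) * projQ ℓ i Ψ (Function.update x i y)) (x i)

/-- The symbol of `(-Δ - C_kin ℓ⁻²)₊` for the kernel `exp(-2πi⟨y, ξ⟩)`, for which `-Δ` is
multiplication by `|2πξ|²`. -/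
def kinSymbol (Ckin ℓ : ℝ) (ξ : E3) : ℝ :=
  max ((2 * Real.pi * ‖ξ‖) ^ 2 - Ckin * (ℓ ^ 2)⁻¹) 0

/-- Membership in the bosonic `N`-particle space: square integrable and symmetric. Functions that
agree almost everywhere represent the same vector. -/
def InSector {N : ℕ} (Ψ : Conf N → ℂ) : Prop :=
  MemLp Ψ 2 volume ∧ ∀ σ : Equiv.Perm (Fin N), (fun x : Conf N => Ψ (x ∘ σ)) =ᵐ[volume] Ψ

/-- The quadratic form domain of `(H_B)_N`: all vectors of finite kinetic and repulsive energy. -/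
def InFormDomain (χ : E3 → ℝ) (Ckin ℓ : ℝ) (v : E3 → ℝ) {N : ℕ} (Ψ : Conf N → ℂ) : Prop :=
  InSector Ψ ∧
    (∀ i, Integrable (fun x : Conf N => kinSymbol Ckin ℓ (x i) * ‖fourierQ χ ℓ i Ψ x‖ ^ 2)) ∧
    Integrable (fun x : Conf N => repulsion χ ℓ v x * ‖Ψ x‖ ^ 2)

/-- The form `⟨Φ, 𝒯_i Ψ⟩` of `𝒯 = Q [χ_B (-Δ - C_kin ℓ⁻²)₊ χ_B + b ℓ⁻²] Q`, acting on the `i`-th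
particle. -/
def kineticForm (χ : E3 → ℝ) (b Ckin ℓ : ℝ) {N : ℕ} (i : Fin N) (Φ Ψ : Conf N → ℂ) : ℂ :=
  (∫ x, (kinSymbol Ckin ℓ (x i) : ℂ) * (conj (fourierQ χ ℓ i Φ x) * fourierQ χ ℓ i Ψ x)) +
    (b * (ℓ ^ 2)⁻¹ : ℝ) * ∫ x, conj (projQ ℓ i Φ x) * projQ ℓ i Ψ x

/-- The form `⟨Φ, (H_B)_N Ψ⟩` of `(H_B)_N = ∑_i 𝒯_i + 𝒲`. -/
def boxForm (χ : E3 → ℝ) (b Ckin ℓ ρ : ℝ) (v ω : E3 → ℝ) {N : ℕ} (Φ Ψ : Conf N → ℂ) : ℂ :=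
  (∑ i, kineticForm χ b Ckin ℓ i Φ Ψ) +
    ∫ x, (potential χ ℓ ρ v ω x : ℂ) * (conj (Φ x) * Ψ x)

/-- `(H_B)_N Ψ = f` for the operator defined by the form `boxForm` on its form domain: `Ψ` is in
the form domain and `⟨Φ, (H_B)_N Ψ⟩ = ⟨Φ, f⟩` for all `Φ` in the form domain. -/
def SectorOp (χ : E3 → ℝ) (b Ckin ℓ ρ : ℝ) (v ω : E3 → ℝ) {N : ℕ} (Ψ f : Conf N → ℂ) : Prop :=
  InFormDomain χ Ckin ℓ v Ψ ∧ InSector f ∧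
    ∀ Φ : Conf N → ℂ, InFormDomain χ Ckin ℓ v Φ →
      boxForm χ b Ckin ℓ ρ v ω Φ Ψ = ∫ x, conj (Φ x) * f x

/-! ### The box Hamiltonian on Fock space, its spectrum and its ground state energy -/

/-- Sequences of `N`-particle functions, `N = 0, 1, 2, …`. -/
abbrev FockFun : Type := (N : ℕ) → Conf N → ℂ

/-- `‖Ψ‖²` in Fock space. -/
def fockNormSq (Ψ : FockFun) : ℝ := ∑' N, ∫ x, ‖Ψ N x‖ ^ 2

/-- Membership in the symmetric Fock space over `L²(ℝ³)`. -/
def InFock (Ψ : FockFun) : Prop :=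
  (∀ N, InSector (Ψ N)) ∧ Summable (fun N => ∫ x, ‖Ψ N x‖ ^ 2)

/-- `H_B Ψ = f`, where `H_B` preserves the particle number and is `(H_B)_N` on the `N`-particle
space, with its maximal domain. -/
def BoxOp (χ : E3 → ℝ) (b Ckin ℓ ρ : ℝ) (v ω : E3 → ℝ) (Ψ f : FockFun) : Prop :=
  InFock Ψ ∧ InFock f ∧ ∀ N, SectorOp χ b Ckin ℓ ρ v ω (Ψ N) (f N)

/-- `μ` is in the resolvent set of `H_B`: for every `f` in Fock space `(H_B - μ) Ψ = f` has a
solution, and solutions are bounded by `f` (so that they are unique, and the inverse of `H_B - μ`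
is bounded). -/
def InResolventSet (χ : E3 → ℝ) (b Ckin ℓ ρ : ℝ) (v ω : E3 → ℝ) (μ : ℝ) : Prop :=
  ∃ C : ℝ, ∀ f : FockFun, InFock f →
    (∃ Ψ, BoxOp χ b Ckin ℓ ρ v ω Ψ (fun N x => f N x + μ * Ψ N x)) ∧
    ∀ Ψ, BoxOp χ b Ckin ℓ ρ v ω Ψ (fun N x => f N x + μ * Ψ N x) →
      fockNormSq Ψ ≤ C * fockNormSq f

/-- The (real) spectrum of the self-adjoint operator `H_B`. -/
def boxSpectrum (χ : E3 → ℝ) (b Ckin ℓ ρ : ℝ) (v ω : E3 → ℝ) : Set ℝ :=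
  {μ | ¬ InResolventSet χ b Ckin ℓ ρ v ω μ}

/-- The box energy `E_B = inf Spec H_B`, as an extended real number. -/
def boxEnergy (χ : E3 → ℝ) (b Ckin ℓ ρ : ℝ) (v ω : E3 → ℝ) : EReal :=
  ⨅ μ ∈ boxSpectrum χ b Ckin ℓ ρ v ω, (μ : EReal)

/-- The box energy density `e_B = ℓ⁻³ E_B`. -/
def boxEnergyDensity (χ : E3 → ℝ) (b Ckin ℓ ρ : ℝ) (v ω : E3 → ℝ) : EReal :=
  (((ℓ ^ 3)⁻¹ : ℝ) : EReal) * boxEnergy χ b Ckin ℓ ρ v ω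

end BoseBox

end

/-!
The energy of the box is bounded below by Bogoliubov's method, made rigorous by two squares.

*Scattering.* A weak minimum principle shows that `0 ≤ ω ≤ 1` and that `ω` is even almost
everywhere. Since `-Δ ω = ½ v (1 - ω)` and `ω ≥ 0`, the function `ω` dominates the Newtonian
potential of `½ v (1 - ω)`; hence the Coulomb energy of `v (1 - ω)` is at most `∫ v (1 - ω) ω`
(`coulomb_vone_le`). By duality with the Dirichlet integral this also gives
`½ ∫ v (1 - ω) ≤ 4 π a` (`half_integral_vone_le_scatteringLength`).

*Particles in the box.* Configuration space is cut into cells according to which particles lie in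
the box. On a cell, averaging over the position of a particle is an orthogonal projection `P i`, the
projection to the condensate, and these projections commute. Writing `Φ` for the condensate part of
`Ψ` in two variables, `w |Ψ - (1 - ω) Φ|² ≥ 0` (`re_inner_pairOp_ge`) replaces the possibly
singular `w` by the integrable `w (1 - ω)`. There remain a quadratic polynomial in the number of
condensate particles, which is minimized near `ρ ℓ³` (`condensate_lower_bound`), and the creation
of pairs out of the condensate. The second square (`bogoliubov_pairing`) bounds the latter,
frequency by frequency, against the kinetic energy. The loss is the Coulomb energy of `v (1 - ω)`
up to `O(a² / ℓ)` (`DispersionBound`), and the Coulomb bound cancels it against the term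
`∫ v (1 - ω) ω` that the first square produces. What is left is, to leading order,
`½ ℓ⁻³ ∫ v (1 - ω)` times `n₀² - 2 ρ ℓ³ n₀ ≥ -(ρ ℓ³)²` for `n₀` condensate particles. Errors
proportional to the number of excitations are absorbed by the gap `b ℓ⁻²`, because `ρ a ℓ² = K₀²`
is small.

*Many particles.* This works for at most `20 ρ ℓ³` particles, and gives a nonnegative energy from
`6 ρ ℓ³` particles on (`group_energy_ge`). As the interaction is nonnegative, a larger number of
particles may be divided into groups of such sizes (`le_groupEnergy`); so the bound holds for every
number of particles (`boxForm_ge`). The form is closed on its domain, and a lower bound uniform in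
the sectors gives resolvents of uniformly bounded norm, that is, a bound for the spectrum
(`IsBoxSetup.le_boxEnergy`).

*Size of the errors.* Dividing by `ℓ³`, the errors are of order `ρ a / ℓ³`, which is
`ρ² a √(ρ a³)` up to a constant, and, from `|χ * χ - 1| ≤ C (R / ℓ)²` on the range of the
potential, `ρ² a (R / ℓ)²`, that is `ρ³ a² R²` up to a constant (`groundBound_div_le`).
-/

open MeasureTheory Filter Topology
open scoped ENNReal Convolution FourierTransform ComplexConjugate InnerProductSpace Gradient

noncomputable section

open scoped Real
open Function (update)
open ENNReal (ofReal ofReal_mul ofReal_ne_top)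
open Complex (norm_real re_ofReal_mul conj_ofReal)
open Finset (sum_congr mul_sum sum_mul sum_add_distrib sum_le_sum sum_nonneg univ)

namespace BoseBox

/-! ### Plancherel's theorem and Gaussian averages -/

theorem continuous_fourier {f : E3 → ℂ} (hf : Integrable f) : Continuous (𝓕 f) :=
  VectorFourier.fourierIntegral_continuous Real.continuous_fourierChar
    (by simpa using continuous_inner) hf

theorem norm_fourier_le (f : E3 → ℂ) (k : E3) : ‖𝓕 f k‖ ≤ ∫ x, ‖f x‖ :=
  VectorFourier.norm_fourierIntegral_le_integral_norm _ _ _ _ _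

theorem integral_fourier_mul {f g : E3 → ℂ} (hf : Integrable f) (hg : Integrable g) :
    ∫ k, 𝓕 f k * g k = ∫ x, f x * 𝓕 g x := by
  have := VectorFourier.integral_fourierIntegral_smul_eq_flip (L := innerₗ E3)
    (μ := volume) (ν := volume) Real.continuous_fourierChar continuous_inner hf hg
  simpa [Real.fourier_eq, VectorFourier.fourierIntegral, real_inner_comm] using this

/-- On `L¹ ∩ L²` the Fourier integral represents the `L²` Fourier transform. -/
theorem fourier_toLp_ae {f : E3 → ℂ} (h1 : Integrable f) (h2 : MemLp f 2) :
    (𝓕 (h2.toLp f) : Lp ℂ 2 (volume : Measure E3)) =ᵐ[volume] 𝓕 f := by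
  refine ae_eq_of_integral_contDiff_smul_eq ((Lp.memLp _).locallyIntegrable (by norm_num))
    (continuous_fourier h1).locallyIntegrable fun g hg hgc => ?_
  have hg₁ : HasCompactSupport (Complex.ofRealCLM ∘ g) := hgc.comp_left rfl
  have hg₂ : ContDiff ℝ (⊤ : ℕ∞) (Complex.ofRealCLM ∘ g) := by fun_prop
  have key := DFunLike.congr_fun (Lp.fourier_toTemperedDistribution_eq (h2.toLp f))
    (hg₁.toSchwartzMap hg₂)
  rw [TemperedDistribution.fourier_apply] at key
  rw [Lp.toTemperedDistribution_apply, Lp.toTemperedDistribution_apply] at key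
  have h3 : ∀ x, (hg₁.toSchwartzMap hg₂) x = (g x : ℂ) := fun x => rfl
  simp only [h3, smul_eq_mul] at key
  have h4 : ∫ x, g x • 𝓕 f x = ∫ k, 𝓕 f k * (hg₁.toSchwartzMap hg₂) k := by
    refine integral_congr_ae (.of_forall fun x => ?_)
    simp [h3, mul_comm]
  have h5 : ∫ x, g x • (𝓕 (h2.toLp f) : Lp ℂ 2 (volume : Measure E3)) x =
      ∫ x, (g x : ℂ) * (𝓕 (h2.toLp f) : Lp ℂ 2 (volume : Measure E3)) x := by
    refine integral_congr_ae (.of_forall fun x => ?_)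
    simp
  rw [h5, ← key, h4, integral_fourier_mul h1 (SchwartzMap.integrable _)]
  refine integral_congr_ae ?_
  filter_upwards [h2.coeFn_toLp] with x hx
  rw [hx, SchwartzMap.fourier_coe, mul_comm]

theorem lintegral_enorm_sq_eq_eLpNorm {α : Type*} [MeasurableSpace α] {ν : Measure α}
    {F : Type*} [NormedAddCommGroup F] (f : α → F) :
    ∫⁻ x, ‖f x‖ₑ ^ 2 ∂ν = eLpNorm f 2 ν ^ 2 := by
  rw [eLpNorm_eq_lintegral_rpow_enorm_toReal (by norm_num) (by norm_num)]
  simp only [ENNReal.toReal_ofNat, ENNReal.rpow_ofNat, one_div]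
  rw [← ENNReal.rpow_natCast, ← ENNReal.rpow_mul]
  norm_num

theorem integral_norm_sq_eq_eLpNorm {α : Type*} [MeasurableSpace α] {ν : Measure α}
    {F : Type*} [NormedAddCommGroup F] {f : α → F} (hf : AEStronglyMeasurable f ν) :
    ∫ x, ‖f x‖ ^ 2 ∂ν = (eLpNorm f 2 ν).toReal ^ 2 := by
  rw [← ENNReal.toReal_pow, ← lintegral_enorm_sq_eq_eLpNorm, integral_eq_lintegral_of_nonneg_ae
    (.of_forall fun x => sq_nonneg _) (hf.norm.pow 2)]
  simp [ENNReal.ofReal_pow]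

theorem memLp_two_of_lintegral_lt_top {α : Type*} [MeasurableSpace α] {ν : Measure α}
    {F : Type*} [NormedAddCommGroup F] {f : α → F} (hf : AEStronglyMeasurable f ν)
    (h : ∫⁻ x, ‖f x‖ₑ ^ 2 ∂ν < ∞) : MemLp f 2 ν := by
  rw [lintegral_enorm_sq_eq_eLpNorm] at h
  exact ⟨hf, by simpa using h⟩

theorem lintegral_enorm_sq_fourier {f : E3 → ℂ} (h1 : Integrable f) (h2 : MemLp f 2) :
    ∫⁻ k, ‖𝓕 f k‖ₑ ^ 2 = ∫⁻ x, ‖f x‖ₑ ^ 2 := by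
  rw [lintegral_enorm_sq_eq_eLpNorm, lintegral_enorm_sq_eq_eLpNorm,
    ← eLpNorm_congr_ae (fourier_toLp_ae h1 h2), ← eLpNorm_congr_ae h2.coeFn_toLp]
  have := Lp.norm_fourier_eq (h2.toLp f)
  rw [Lp.norm_def, Lp.norm_def, ENNReal.toReal_eq_toReal_iff' (Lp.eLpNorm_ne_top _)
    (Lp.eLpNorm_ne_top _)] at this
  rw [this]

/-- The standard Gaussian, which is its own Fourier transform. -/
def gauss (z : E3) : ℝ := Real.exp (-π * ‖z‖ ^ 2)

theorem gauss_pos (z : E3) : 0 < gauss z := Real.exp_pos _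

theorem continuous_gauss : Continuous gauss := by unfold gauss; fun_prop

theorem integrable_gauss_smul {s : ℝ} (hs : s ≠ 0) : Integrable fun k : E3 => gauss (s • k) := by
  have h := GaussianFourier.integrable_cexp_neg_mul_sq_norm_add (V := E3)
    (b := ((π * s ^ 2 : ℝ) : ℂ)) (by
      rw [Complex.ofReal_re]; have := Real.pi_pos; positivity) 0 0
  refine h.norm.congr (.of_forall fun k => ?_)
  simp only [inner_zero_left, Complex.ofReal_zero, mul_zero, add_zero, gauss, norm_smul]
  rw [Complex.norm_exp]
  congr 1
  rw [← Complex.ofReal_neg, ← Complex.ofReal_pow, ← Complex.ofReal_mul, Complex.ofReal_re, mul_pow,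
    Real.norm_eq_abs, sq_abs]
  ring

theorem integrable_gauss : Integrable gauss := by
  simpa using integrable_gauss_smul one_ne_zero

theorem integral_gauss : ∫ z, gauss z = 1 := by
  have h := GaussianFourier.integral_rexp_neg_mul_sq_norm (V := E3) Real.pi_pos
  simpa [gauss, div_self Real.pi_ne_zero] using h

/-- The Gaussian average of `W` at scale `s` has the Fourier transform `Ŵ(k) exp(-π s² |k|²)`. -/
theorem integral_gauss_mul_comp {W : E3 → ℂ} (hW : Integrable W) {s : ℝ} (hs : 0 < s) (x : E3) :
    ∫ z, (gauss z : ℂ) * W (x + s • z) =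
      ∫ k, 𝓕 W k * ((gauss (s • k) : ℂ) * Complex.exp (2 * π * Complex.I * ⟪x, k⟫_ℝ)) := by
  have hb : 0 < ((π * s ^ 2 : ℝ) : ℂ).re := by
    rw [Complex.ofReal_re]; have := Real.pi_pos; positivity
  have hfun : (fun k : E3 => (gauss (s • k) : ℂ) *
      Complex.exp (2 * π * Complex.I * ⟪x, k⟫_ℝ)) =
      fun k => Complex.exp (-((π * s ^ 2 : ℝ) : ℂ) * ‖k‖ ^ 2 +
        2 * π * Complex.I * ⟪x, k⟫_ℝ) := by
    funext k
    rw [Complex.exp_add]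
    congr 1
    simp only [gauss, norm_smul, Complex.ofReal_exp]
    congr 1
    push_cast
    rw [Real.norm_eq_abs, mul_pow, ← Complex.ofReal_pow |s|, sq_abs]
    push_cast
    ring
  have hg : Integrable (fun k : E3 => (gauss (s • k) : ℂ) *
      Complex.exp (2 * π * Complex.I * ⟪x, k⟫_ℝ)) := by
    rw [hfun]
    exact GaussianFourier.integrable_cexp_neg_mul_sq_norm_add hb _ _
  rw [integral_fourier_mul hW hg]
  have h1 : ∀ w, 𝓕 (fun k : E3 => (gauss (s • k) : ℂ) *
      Complex.exp (2 * π * Complex.I * ⟪x, k⟫_ℝ)) w =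
      ((s ^ 3)⁻¹ : ℝ) * (gauss (s⁻¹ • (w - x)) : ℂ) := by
    intro w
    rw [hfun, fourier_gaussian_innerProductSpace' hb]
    congr 1
    · have : ((π : ℂ) / ((π * s ^ 2 : ℝ) : ℂ)) = (((s ^ 2)⁻¹ : ℝ) : ℂ) := by
        have := Real.pi_pos
        rw [← Complex.ofReal_div]
        congr 1
        field_simp
      rw [this, show ((Module.finrank ℝ E3 : ℂ) / 2) = ((3 / 2 : ℝ) : ℂ) by simp,
        ← Complex.ofReal_cpow (by positivity)]
      congr 1
      rw [Real.inv_rpow (by positivity), ← Real.rpow_natCast s 2, ← Real.rpow_mul hs.le,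
        ← Real.rpow_natCast s 3]
      norm_num
    · simp only [gauss, norm_smul, Complex.ofReal_exp]
      congr 1
      have := Real.pi_pos
      rw [← norm_sub_rev x w, Real.norm_of_nonneg (by positivity)]
      push_cast
      field_simp
  simp_rw [h1]
  have h2 := Measure.integral_comp_smul (volume : Measure E3)
    (fun u => (gauss (s⁻¹ • u) : ℂ) * W (x + u)) s
  simp only [finrank_euclideanSpace, Fintype.card_fin, inv_smul_smul₀ hs.ne'] at h2
  rw [h2, abs_of_pos (by positivity), ← integral_add_left_eq_self (μ := volume)
    (fun w => W w * (((s ^ 3)⁻¹ : ℝ) * (gauss (s⁻¹ • (w - x)) : ℂ))) x, ← integral_smul]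
  refine integral_congr_ae (.of_forall fun u => ?_)
  simp only [add_sub_cancel_left, Complex.real_smul]
  ring

/-- The Gaussian interaction energy `∬ g(y) γ(z) g(y + sz) dz dy` in Fourier space. -/
theorem integral_mul_gauss_average {g : E3 → ℝ} (hg : Integrable g) {s : ℝ} (hs : 0 < s) :
    ∫ y, g y * ∫ z, gauss z * g (y + s • z) =
      ∫ k, ‖𝓕 (fun x => (g x : ℂ)) k‖ ^ 2 * gauss (s • k) := by
  set W : E3 → ℂ := fun x => (g x : ℂ)
  have hW : Integrable W := hg.ofReal
  have h1 : ∀ y, ((g y * ∫ z, gauss z * g (y + s • z) : ℝ) : ℂ) =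
      ∫ k, W y * (𝓕 W k * ((gauss (s • k) : ℂ) *
        Complex.exp (2 * π * Complex.I * ⟪y, k⟫_ℝ))) := by
    intro y
    rw [integral_const_mul, ← integral_gauss_mul_comp hW hs]
    push_cast [W]
    rw [← integral_complex_ofReal]
    simp
  apply Complex.ofReal_injective
  rw [← integral_complex_ofReal, ← integral_complex_ofReal]
  simp_rw [h1]
  rw [integral_integral_swap]
  · refine integral_congr_ae (.of_forall fun k => ?_)
    have h2 : ∀ y, W y * (𝓕 W k * ((gauss (s • k) : ℂ) *
        Complex.exp (2 * π * Complex.I * ⟪y, k⟫_ℝ))) =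
        (𝓕 W k * (gauss (s • k) : ℂ)) *
          conj (Complex.exp (2 * π * Complex.I * (-⟪y, k⟫_ℝ : ℝ)) * W y) := by
      intro y
      simp only [W, map_mul, conj_ofReal, ← Complex.exp_conj, Complex.conj_I, map_ofNat]
      push_cast
      ring_nf
    simp only [h2]
    rw [integral_const_mul, integral_conj]
    have h3 : ∫ y, Complex.exp (2 * π * Complex.I * (-⟪y, k⟫_ℝ : ℝ)) * W y = 𝓕 W k := by
      rw [Real.fourier_eq']
      refine integral_congr_ae (.of_forall fun y => ?_)
      simp only [smul_eq_mul]
      congr 2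
      push_cast
      ring
    rw [h3, Complex.ofReal_mul, Complex.ofReal_pow, ← Complex.mul_conj']
    ring
  · have hmeas : Integrable (fun p : E3 × E3 => W p.1 * (𝓕 W p.2 * (gauss (s • p.2) : ℂ)))
        (volume.prod volume) := by
      refine hW.mul_prod (g := fun k => 𝓕 W k * (gauss (s • k) : ℂ)) ?_
      exact ((integrable_gauss_smul hs.ne').ofReal).bdd_mul
        (continuous_fourier hW).aestronglyMeasurable (.of_forall (norm_fourier_le W))
    refine (hmeas.bdd_mul (c := 1) (f := fun p : E3 × E3 =>
      Complex.exp (2 * π * Complex.I * ⟪p.1, p.2⟫_ℝ)) ?_ ?_).congr ?_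
    · exact (by fun_prop : Continuous _).aestronglyMeasurable
    · refine .of_forall fun p => ?_
      rw [show (2 * π * Complex.I * ⟪p.1, p.2⟫_ℝ : ℂ) =
        ((2 * π * ⟪p.1, p.2⟫_ℝ : ℝ) : ℂ) * Complex.I by push_cast; ring,
        Complex.norm_exp_ofReal_mul_I]
    · refine .of_forall fun p => ?_
      simp only [Function.uncurry]
      ring

/-! ### Partial derivatives, the Laplacian and mollification -/

/-- The partial derivative `∂f/∂x_i`. -/
def pd (i : Fin 3) (f : E3 → ℝ) (x : E3) : ℝ := fderiv ℝ f x (EuclideanSpace.single i 1)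

/-- The Laplacian `∑_i ∂_i ∂_i f`. -/
def lap (f : E3 → ℝ) (x : E3) : ℝ := ∑ i, pd i (pd i f) x

theorem gradient_apply {f : E3 → ℝ} {x : E3} (i : Fin 3) : (∇ f x) i = pd i f x := by
  have : ⟪∇ f x, EuclideanSpace.single i (1 : ℝ)⟫_ℝ = pd i f x := by
    simp [gradient, pd]
  rw [← this, EuclideanSpace.inner_single_right]
  simp

theorem norm_gradient_sq (f : E3 → ℝ) (x : E3) : ‖∇ f x‖ ^ 2 = ∑ i, pd i f x ^ 2 := by
  rw [EuclideanSpace.norm_sq_eq]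
  simp [gradient_apply]

theorem contDiff_pd {f : E3 → ℝ} (hf : ContDiff ℝ (⊤ : ℕ∞) f) (i : Fin 3) :
    ContDiff ℝ (⊤ : ℕ∞) (pd i f) := by
  unfold pd
  exact (hf.fderiv_right (m := ((⊤ : ℕ∞) : WithTop ℕ∞)) (by simp)).clm_apply contDiff_const

theorem contDiff_lap {f : E3 → ℝ} (hf : ContDiff ℝ (⊤ : ℕ∞) f) :
    ContDiff ℝ (⊤ : ℕ∞) (lap f) := by
  unfold lap
  exact ContDiff.sum fun i _ => contDiff_pd (contDiff_pd hf i) i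

theorem hasCompactSupport_pd {f : E3 → ℝ} (hf : HasCompactSupport f) (i : Fin 3) :
    HasCompactSupport (pd i f) := by
  unfold pd
  exact (hf.fderiv ℝ).comp_left (g := fun L : E3 →L[ℝ] ℝ => L (EuclideanSpace.single i 1)) rfl

theorem hasCompactSupport_lap {f : E3 → ℝ} (hf : HasCompactSupport f) :
    HasCompactSupport (lap f) := by
  have h : lap f = pd 0 (pd 0 f) + pd 1 (pd 1 f) + pd 2 (pd 2 f) := by
    funext x; simp [lap, Fin.sum_univ_three]
  rw [h]
  exact ((hasCompactSupport_pd (hasCompactSupport_pd hf 0) 0).add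
    (hasCompactSupport_pd (hasCompactSupport_pd hf 1) 1)).add
    (hasCompactSupport_pd (hasCompactSupport_pd hf 2) 2)

theorem isTestFunction_pd {η : E3 → ℝ} (h : IsTestFunction Set.univ η) (i : Fin 3) :
    IsTestFunction Set.univ (pd i η) :=
  ⟨contDiff_pd h.smooth i, hasCompactSupport_pd h.compact i, Set.subset_univ _⟩

theorem IsTestFunction.continuous_gradient {Ω : Set E3} {η : E3 → ℝ} (h : IsTestFunction Ω η) :
    Continuous (∇ η) :=
  (InnerProductSpace.toDual ℝ E3).symm.continuous.comp (h.smooth.continuous_fderiv (by simp))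

theorem IsTestFunction.hasCompactSupport_gradient {Ω : Set E3} {η : E3 → ℝ}
    (h : IsTestFunction Ω η) : HasCompactSupport (∇ η) :=
  (h.compact.fderiv ℝ).comp_left (g := (InnerProductSpace.toDual ℝ E3).symm) (map_zero _)

theorem integral_mul_pd {f g : E3 → ℝ} (hf : ContDiff ℝ (⊤ : ℕ∞) f) (hg : ContDiff ℝ (⊤ : ℕ∞) g)
    (hc : HasCompactSupport g) (i : Fin 3) :
    ∫ x, f x * pd i g x = -∫ x, pd i f x * g x := by
  refine integral_mul_fderiv_eq_neg_fderiv_mul_of_integrable ?_ ?_ ?_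
    (fun x _ => hf.differentiable (by simp) x) (fun x _ => hg.differentiable (by simp) x)
  · exact ((contDiff_pd hf i).continuous.mul hg.continuous).integrable_of_hasCompactSupport
      hc.mul_left
  · exact (hf.continuous.mul (contDiff_pd hg i).continuous).integrable_of_hasCompactSupport
      (hasCompactSupport_pd hc i).mul_left
  · exact (hf.continuous.mul hg.continuous).integrable_of_hasCompactSupport hc.mul_left

theorem integral_mul_lap {f η : E3 → ℝ} (hf : ContDiff ℝ (⊤ : ℕ∞) f)
    (hη : IsTestFunction Set.univ η) : ∫ x, f x * lap η x = ∫ x, lap f x * η x := by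
  have hI : ∀ i, Integrable fun x => f x * pd i (pd i η) x := fun i =>
    (hf.continuous.mul (contDiff_pd (contDiff_pd hη.smooth i) i).continuous).integrable_of_hasCompactSupport
      (hasCompactSupport_pd (hasCompactSupport_pd hη.compact i) i).mul_left
  have hJ : ∀ i, Integrable fun x => pd i (pd i f) x * η x := fun i =>
    ((contDiff_pd (contDiff_pd hf i) i).continuous.mul
      hη.smooth.continuous).integrable_of_hasCompactSupport hη.compact.mul_left
  simp only [lap, mul_sum, sum_mul]
  rw [integral_finsetSum _ fun i _ => hI i, integral_finsetSum _ fun i _ => hJ i]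
  refine sum_congr rfl fun i _ => ?_
  rw [integral_mul_pd hf (contDiff_pd hη.smooth i) (hasCompactSupport_pd hη.compact i),
    integral_mul_pd (contDiff_pd hf i) hη.smooth hη.compact, neg_neg]

theorem pd_comp {F : ℝ → ℝ} {f : E3 → ℝ} (hF : Differentiable ℝ F) (hf : Differentiable ℝ f)
    (i : Fin 3) (x : E3) : pd i (fun y => F (f y)) x = deriv F (f x) * pd i f x := by
  have h := (hF (f x)).hasDerivAt.hasFDerivAt.comp x (hf x).hasFDerivAt
  unfold pd
  rw [show (fun y => F (f y)) = F ∘ f from rfl, h.fderiv]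
  simp [mul_comm]

theorem pd_mul {f g : E3 → ℝ} (hf : Differentiable ℝ f) (hg : Differentiable ℝ g)
    (i : Fin 3) (x : E3) : pd i (fun y => f y * g y) x = f x * pd i g x + pd i f x * g x := by
  unfold pd
  rw [fderiv_fun_mul (hf x) (hg x)]
  simp [mul_comm]

/-- The chain rule for a convex function drops a non-negative term. -/
theorem lap_comp_ge {F : ℝ → ℝ} {f : E3 → ℝ} (hF : ContDiff ℝ (⊤ : ℕ∞) F)
    (hconv : ∀ t, 0 ≤ deriv (deriv F) t) (hf : ContDiff ℝ (⊤ : ℕ∞) f) (x : E3) :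
    deriv F (f x) * lap f x ≤ lap (fun y => F (f y)) x := by
  have hF' : ContDiff ℝ (⊤ : ℕ∞) (deriv F) := by
    have := hF.iterate_deriv 1
    simpa using this
  have hd : Differentiable ℝ f := hf.differentiable (by simp)
  have h1 : ∀ i, pd i (fun y => F (f y)) = fun y => deriv F (f y) * pd i f y := fun i => by
    funext y; exact pd_comp (hF.differentiable (by simp)) hd i y
  have h2 : lap (fun y => F (f y)) x =
      ∑ i, (deriv F (f x) * pd i (pd i f) x + deriv (deriv F) (f x) * pd i f x ^ 2) := by
    unfold lap
    refine sum_congr rfl fun i _ => ?_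
    rw [h1, pd_mul (f := fun y => deriv F (f y)) ((hF'.comp hf).differentiable (by simp))
      ((contDiff_pd hf i).differentiable (by simp)), pd_comp (hF'.differentiable (by simp)) hd]
    ring
  rw [h2, lap, mul_sum]
  exact sum_le_sum fun i _ => le_add_of_nonneg_right
    (mul_nonneg (hconv _) (sq_nonneg _))

/-- The bump function of radius `2/(n+1)`, plateau radius `1/(n+1)`. -/
def bump (n : ℕ) : ContDiffBump (0 : E3) :=
  ⟨1 / (n + 1), 2 / (n + 1), by positivity, by
    rw [div_lt_div_iff_of_pos_right (by positivity)]; norm_num⟩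

/-- A smooth even probability density supported in the ball of radius `2/(n+1)`. -/
def molK (n : ℕ) : E3 → ℝ := (bump n).normed volume

/-- Mollification at scale `1/n`. -/
def mol (n : ℕ) (u : E3 → ℝ) : E3 → ℝ := molK n ⋆[ContinuousLinearMap.lsmul ℝ ℝ, volume] u

theorem molK_nonneg (n : ℕ) (x : E3) : 0 ≤ molK n x := (bump n).nonneg_normed x

theorem molK_smooth (n : ℕ) : ContDiff ℝ (⊤ : ℕ∞) (molK n) := (bump n).contDiff_normed

theorem molK_compact (n : ℕ) : HasCompactSupport (molK n) := (bump n).hasCompactSupport_normed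

theorem molK_integrable (n : ℕ) : Integrable (molK n) := (bump n).integrable_normed

theorem molK_integral (n : ℕ) : ∫ x, molK n x = 1 := (bump n).integral_normed

theorem norm_lt_of_molK_ne_zero {n : ℕ} {x : E3} (h : molK n x ≠ 0) : ‖x‖ < 2 := by
  have h1 : x ∈ Function.support (molK n) := h
  rw [molK, ContDiffBump.support_normed_eq, mem_ball_zero_iff] at h1
  refine h1.trans_le ?_
  change (2 : ℝ) / (n + 1) ≤ 2
  rw [div_le_iff₀ (by positivity)]
  have : (0 : ℝ) ≤ n := Nat.cast_nonneg n
  linarith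

theorem mol_apply (n : ℕ) (u : E3 → ℝ) (x : E3) : mol n u x = ∫ t, molK n t * u (x - t) := rfl

theorem mol_apply' (n : ℕ) (u : E3 → ℝ) (x : E3) : mol n u x = ∫ t, molK n (x - t) * u t := by
  rw [mol, convolution_eq_swap]; rfl

theorem ae_tendsto_mol {u : E3 → ℝ} (hu : LocallyIntegrable u) :
    ∀ᵐ x, Tendsto (fun n => mol n u x) atTop (𝓝 (u x)) := by
  refine ContDiffBump.ae_convolution_tendsto_right_of_locallyIntegrable (K := 2) ?_
    (.of_forall fun n => ?_) hu
  · have := (tendsto_one_div_add_atTop_nhds_zero_nat (𝕜 := ℝ)).const_mul 2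
    simp only [mul_zero] at this
    refine this.congr fun n => ?_
    change _ = (2 : ℝ) / (n + 1)
    ring
  · change (2 : ℝ) / (n + 1) ≤ 2 * (1 / (n + 1))
    apply le_of_eq; ring

theorem mol_smooth {u : E3 → ℝ} (hu : LocallyIntegrable u) (n : ℕ) :
    ContDiff ℝ (⊤ : ℕ∞) (mol n u) :=
  (molK_compact n).contDiff_convolution_left _ (molK_smooth n) hu

theorem mol_integrable {u : E3 → ℝ} (hu : Integrable u) (n : ℕ) : Integrable (mol n u) :=
  (molK_integrable n).integrable_convolution _ hu

theorem mol_integral {u : E3 → ℝ} (hu : Integrable u) (n : ℕ) : ∫ x, mol n u x = ∫ x, u x := by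
  have := integral_convolution (L := ContinuousLinearMap.lsmul ℝ ℝ) (μ := volume) (ν := volume)
    (molK_integrable n) hu
  rw [mol, this, molK_integral]
  simp

/-- Convolution with a test function commutes with partial derivatives. -/
theorem pd_convolution {J u : E3 → ℝ} (hJ : ContDiff ℝ (⊤ : ℕ∞) J) (hc : HasCompactSupport J)
    (hu : LocallyIntegrable u) (i : Fin 3) :
    pd i (J ⋆[ContinuousLinearMap.lsmul ℝ ℝ, volume] u) =
      pd i J ⋆[ContinuousLinearMap.lsmul ℝ ℝ, volume] u := by
  funext x
  have h := hc.hasFDerivAt_convolution_left (ContinuousLinearMap.lsmul ℝ ℝ)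
    (hJ.of_le (by simp)) hu x
  rw [pd, h.fderiv, convolution_def, convolution_def,
    ContinuousLinearMap.integral_apply]
  · rfl
  · exact ((hc.fderiv ℝ).convolutionExists_left _ (hJ.continuous_fderiv (by simp)) hu x)

theorem lap_mol {u : E3 → ℝ} (hu : LocallyIntegrable u) (n : ℕ) (x : E3) :
    lap (mol n u) x = ∫ t, lap (molK n) (x - t) * u t := by
  have h1 : ∀ i, pd i (pd i (mol n u)) x = ∫ t, pd i (pd i (molK n)) (x - t) * u t := by
    intro i
    rw [mol, pd_convolution (molK_smooth n) (molK_compact n) hu,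
      pd_convolution (contDiff_pd (molK_smooth n) i) (hasCompactSupport_pd (molK_compact n) i) hu,
      convolution_eq_swap]
    rfl
  simp only [lap, h1, sum_mul]
  rw [integral_finsetSum]
  intro i _
  have := ((hasCompactSupport_pd (hasCompactSupport_pd (molK_compact n) i) i).convolutionExists_left
    (ContinuousLinearMap.lsmul ℝ ℝ)
    (contDiff_pd (contDiff_pd (molK_smooth n) i) i).continuous hu x)
  exact this.integrable_swap

theorem pd_comp_const_sub {f : E3 → ℝ} (hf : Differentiable ℝ f) (i : Fin 3) (x : E3) :
    pd i (fun y => f (x - y)) = fun y => -pd i f (x - y) := by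
  funext y
  have h := (hf (x - y)).hasFDerivAt.comp y ((hasFDerivAt_id y).const_sub x)
  unfold pd
  rw [show (fun y => f (x - y)) = f ∘ fun y => x - y from rfl, h.fderiv]
  simp

theorem lap_comp_const_sub {f : E3 → ℝ} (hf : ContDiff ℝ (⊤ : ℕ∞) f) (x y : E3) :
    lap (fun y => f (x - y)) y = lap f (x - y) := by
  unfold lap
  refine sum_congr rfl fun i _ => ?_
  have h1 := contDiff_pd hf i
  rw [pd_comp_const_sub (hf.differentiable (by simp)),
    pd_comp_const_sub (f := fun z => -pd i f z) (h1.neg.differentiable (by simp))]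
  change -fderiv ℝ (fun z => -pd i f z) (x - y) _ = _
  rw [fderiv_fun_neg]
  simp [pd]

/-- `Δ u = g` in the sense of distributions. -/
def WeakLap (u g : E3 → ℝ) : Prop :=
  ∀ η, IsTestFunction Set.univ η → ∫ x, u x * lap η x = ∫ x, g x * η x

theorem isTestFunction_const_sub {f : E3 → ℝ} (hf : ContDiff ℝ (⊤ : ℕ∞) f)
    (hc : HasCompactSupport f) (x : E3) : IsTestFunction Set.univ fun y => f (x - y) :=
  ⟨hf.comp (contDiff_const.sub contDiff_id),
    hc.comp_homeomorph (Homeomorph.subLeft x), Set.subset_univ _⟩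

theorem lap_mol_of_weakLap {u g : E3 → ℝ} (hu : LocallyIntegrable u) (h : WeakLap u g) (n : ℕ) :
    lap (mol n u) = mol n g := by
  funext x
  rw [lap_mol hu, mol_apply']
  have := h _ (isTestFunction_const_sub (molK_smooth n) (molK_compact n) x)
  simp only [lap_comp_const_sub (molK_smooth n)] at this
  simpa [mul_comm] using this

theorem mol_nonneg {u : E3 → ℝ} (hu : ∀ᵐ x, 0 ≤ u x) (n : ℕ) (x : E3) : 0 ≤ mol n u x := by
  rw [mol_apply']
  refine integral_nonneg_of_ae ?_
  filter_upwards [hu] with t ht using mul_nonneg (molK_nonneg n _) ht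

theorem integrable_molK_mul {u : E3 → ℝ} (hu : LocallyIntegrable u) (n : ℕ) (x : E3) :
    Integrable fun t => molK n (x - t) * u t :=
  ((molK_compact n).convolutionExists_left (ContinuousLinearMap.lsmul ℝ ℝ)
    (molK_smooth n).continuous hu x).integrable_swap

theorem molK_sub_integral (n : ℕ) (x : E3) : ∫ t, molK n (x - t) = 1 := by
  rw [integral_sub_left_eq_self (molK n) volume x, molK_integral]

/-- Mollification preserves a lower bound on the part of space that it sees. -/
theorem le_mol {u : E3 → ℝ} (hu : LocallyIntegrable u) {c : ℝ} (n : ℕ) (x : E3)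
    (h : ∀ᵐ t, ‖x - t‖ < 2 → c ≤ u t) : c ≤ mol n u x := by
  have h1 : ∫ t, molK n (x - t) * c = c := by rw [integral_mul_const, molK_sub_integral, one_mul]
  rw [mol_apply', ← h1]
  refine integral_mono_ae ?_ (integrable_molK_mul hu n x) ?_
  · exact ((molK_integrable n).comp_sub_left x).mul_const c
  · filter_upwards [h] with t ht
    by_cases h0 : molK n (x - t) = 0
    · simp [h0]
    · exact mul_le_mul_of_nonneg_left (ht (norm_lt_of_molK_ne_zero h0)) (molK_nonneg n _)

theorem mol_mono {u g : E3 → ℝ} (hu : LocallyIntegrable u) (hg : LocallyIntegrable g)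
    (h : ∀ᵐ x, u x ≤ g x) (n : ℕ) (x : E3) : mol n u x ≤ mol n g x := by
  rw [mol_apply', mol_apply']
  refine integral_mono_ae (integrable_molK_mul hu n x) (integrable_molK_mul hg n x) ?_
  filter_upwards [h] with t ht using mul_le_mul_of_nonneg_left ht (molK_nonneg n _)

/-! ### A weak minimum principle -/

/-- Mollifications of a non-negative integrable function converge in `L¹`. -/
theorem tendsto_integral_abs_mol_sub {g : E3 → ℝ} (hg : Integrable g) (h0 : ∀ᵐ x, 0 ≤ g x) :
    Tendsto (fun n => ∫ x, |mol n g x - g x|) atTop (𝓝 0) := by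
  -- `|a - b| = a - b + 2 (b - a)⁺`, and the positive part is dominated by `g`.
  have h1 : ∀ n, ∫ x, |mol n g x - g x| = 2 * ∫ x, max (g x - mol n g x) 0 := by
    intro n
    have hs : Integrable fun x => max (g x - mol n g x) 0 :=
      (hg.sub (mol_integrable hg n)).pos_part
    have hd : Integrable fun x => mol n g x - g x := (mol_integrable hg n).sub hg
    have : ∀ x, |mol n g x - g x| = mol n g x - g x + 2 * max (g x - mol n g x) 0 := by
      intro x
      rcases le_total (g x) (mol n g x) with h | h
      · rw [abs_of_nonneg (by linarith), max_eq_right (by linarith)]; ring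
      · rw [abs_of_nonpos (by linarith), max_eq_left (by linarith)]; ring
    simp_rw [this]
    rw [integral_add hd (hs.const_mul 2),
      integral_sub (mol_integrable hg n) hg, mol_integral hg, sub_self, zero_add,
      integral_const_mul]
  simp_rw [h1]
  have h2 : Tendsto (fun n => ∫ x, max (g x - mol n g x) 0) atTop (𝓝 (∫ _ : E3, (0 : ℝ))) := by
    refine tendsto_integral_of_dominated_convergence g
      (fun n => (hg.sub (mol_integrable hg n)).pos_part.aestronglyMeasurable) hg ?_ ?_
    · intro n
      filter_upwards [h0] with x hx
      rw [Real.norm_of_nonneg (le_max_right _ _)]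
      exact max_le (by linarith [mol_nonneg h0 n x]) hx
    · filter_upwards [ae_tendsto_mol hg.locallyIntegrable] with x hx
      have := ((tendsto_const_nhds (x := g x)).sub hx).max (tendsto_const_nhds (x := (0 : ℝ)))
      simpa using this
  simpa using h2.const_mul 2

/-- A smooth convex function that vanishes exactly on `[-δ, ∞)`. -/
def convexCut (δ t : ℝ) : ℝ := ∫ s in t..(-δ), Real.smoothTransition (-s - δ)

theorem continuous_cutSlope (δ : ℝ) : Continuous fun s : ℝ => Real.smoothTransition (-s - δ) :=
  Real.smoothTransition.continuous.comp (by fun_prop)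

theorem hasDerivAt_convexCut (δ t : ℝ) :
    HasDerivAt (convexCut δ) (-Real.smoothTransition (-t - δ)) t :=
  intervalIntegral.integral_hasDerivAt_left ((continuous_cutSlope δ).intervalIntegrable _ _)
    ((continuous_cutSlope δ).stronglyMeasurableAtFilter _ _) (continuous_cutSlope δ).continuousAt

theorem deriv_convexCut (δ : ℝ) :
    deriv (convexCut δ) = fun t => -Real.smoothTransition (-t - δ) :=
  funext fun t => (hasDerivAt_convexCut δ t).deriv

theorem contDiff_convexCut (δ : ℝ) : ContDiff ℝ (⊤ : ℕ∞) (convexCut δ) := by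
  rw [contDiff_infty_iff_deriv]
  refine ⟨fun t => (hasDerivAt_convexCut δ t).differentiableAt, ?_⟩
  rw [deriv_convexCut]
  exact (Real.smoothTransition.contDiff.comp (by fun_prop)).neg

theorem deriv_deriv_convexCut_nonneg (δ t : ℝ) : 0 ≤ deriv (deriv (convexCut δ)) t := by
  have : Monotone (deriv (convexCut δ)) := by
    rw [deriv_convexCut]
    intro a b hab
    exact neg_le_neg (Real.smoothTransition.monotone (by linarith))
  exact this.deriv_nonneg

theorem convexCut_eq_zero {δ t : ℝ} (h : -δ ≤ t) : convexCut δ t = 0 := by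
  unfold convexCut
  rw [intervalIntegral.integral_congr (g := fun _ => (0 : ℝ)), intervalIntegral.integral_zero]
  intro s hs
  rw [Set.uIcc_of_ge h] at hs
  exact Real.smoothTransition.zero_of_nonpos (by linarith [hs.1])

theorem convexCut_pos {δ t : ℝ} (h : t < -δ) : 0 < convexCut δ t :=
  intervalIntegral.intervalIntegral_pos_of_pos_on ((continuous_cutSlope δ).intervalIntegrable _ _)
    (fun s hs => Real.smoothTransition.pos_of_pos (by linarith [hs.2])) h

theorem convexCut_nonneg (δ t : ℝ) : 0 ≤ convexCut δ t := by
  rcases le_or_gt (-δ) t with h | h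
  · rw [convexCut_eq_zero h]
  · exact (convexCut_pos h).le

theorem pd_norm_sq (i : Fin 3) (M : ℝ) :
    pd i (fun x : E3 => M - ‖x‖ ^ 2) = fun x => -2 * x i := by
  funext x
  unfold pd
  have h := ((hasStrictFDerivAt_norm_sq x).hasFDerivAt).const_sub M
  rw [h.fderiv]
  simp [EuclideanSpace.inner_single_right]

theorem pd_coord (i : Fin 3) (x : E3) : pd i (fun x : E3 => -2 * x i) x = -2 := by
  have h : HasFDerivAt (fun x : E3 => -2 * x i)
      ((-2 : ℝ) • (EuclideanSpace.proj i : E3 →L[ℝ] ℝ)) x :=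
    ((EuclideanSpace.proj i : E3 →L[ℝ] ℝ).hasFDerivAt (x := x)).const_mul (-2)
  unfold pd
  rw [h.fderiv]
  simp

theorem pd_congr {f g : E3 → ℝ} {x : E3} (h : f =ᶠ[𝓝 x] g) (i : Fin 3) :
    pd i f =ᶠ[𝓝 x] pd i g := by
  filter_upwards [h.fderiv (𝕜 := ℝ)] with y hy
  rw [pd, pd, hy]

theorem lap_congr {f g : E3 → ℝ} {x : E3} (h : f =ᶠ[𝓝 x] g) : lap f x = lap g x := by
  unfold lap
  exact sum_congr rfl fun i _ => (pd_congr (pd_congr h i) i).eq_of_nhds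

/-- On every ball there is a non-negative test function with `Δη = -6`. -/
theorem exists_testFunction_lap (r : ℝ) (hr : 0 < r) :
    ∃ η, IsTestFunction Set.univ η ∧ (∀ x, 0 ≤ η x) ∧ ∀ x, ‖x‖ ≤ r → lap η x = -6 := by
  let cut : ContDiffBump (0 : E3) := ⟨r + 1, r + 2, by positivity, by linarith⟩
  refine ⟨fun x => ((r + 2) ^ 2 - ‖x‖ ^ 2) * cut x, ⟨?_, ?_, Set.subset_univ _⟩, ?_, ?_⟩
  · exact (contDiff_const.sub (contDiff_norm_sq ℝ)).mul cut.contDiff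
  · exact cut.hasCompactSupport.mul_left
  · intro x
    by_cases hx : x ∈ Metric.ball (0 : E3) (r + 2)
    · rw [mem_ball_zero_iff] at hx
      refine mul_nonneg ?_ cut.nonneg
      nlinarith [norm_nonneg x]
    · have : cut x = 0 := cut.zero_of_le_dist (by
        rw [Metric.mem_ball, not_lt] at hx; exact hx)
      simp [this]
  · intro x hx
    have h1 : (fun x : E3 => ((r + 2) ^ 2 - ‖x‖ ^ 2) * cut x) =ᶠ[𝓝 x]
        fun x => (r + 2) ^ 2 - ‖x‖ ^ 2 := by
      have : x ∈ Metric.ball (0 : E3) (r + 1) := by rw [mem_ball_zero_iff]; linarith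
      filter_upwards [cut.eventuallyEq_one_of_mem_ball this] with y hy
      rw [hy]; simp
    rw [lap_congr h1]
    unfold lap
    simp only [pd_norm_sq, pd_coord]
    norm_num

/-- A weak minimum principle: if `Δu = g` with `g ≤ 0` wherever `u < 0`, and `u` is
asymptotically non-negative, then `u ≥ 0`. -/
theorem nonneg_of_weakLap {u g : E3 → ℝ} (hu : LocallyIntegrable u) (hg : Integrable g)
    (h : WeakLap u g) (hsign : ∀ᵐ x, u x < 0 → g x ≤ 0)
    (hinf : ∀ δ : ℝ, 0 < δ → ∀ᶠ x in cocompact E3, -δ ≤ u x) : ∀ᵐ x, 0 ≤ u x := by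
  suffices H : ∀ δ : ℝ, 0 < δ → ∀ᵐ x, -δ ≤ u x by
    have h1 : ∀ᵐ x, ∀ m : ℕ, -(1 / ((m : ℝ) + 1)) ≤ u x :=
      ae_all_iff.2 fun m => H _ (by positivity)
    filter_upwards [h1] with x hx
    have := (tendsto_one_div_add_atTop_nhds_zero_nat (𝕜 := ℝ)).neg
    rw [neg_zero] at this
    exact le_of_tendsto' this hx
  intro δ hδ
  obtain ⟨K, hK, hKu⟩ := mem_cocompact.1 (hinf δ hδ)
  obtain ⟨ρ, hρ⟩ := hK.isBounded.subset_closedBall (0 : E3)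
  set r := max ρ 0 + 2 with hr
  have hrpos : 0 < r := by positivity
  obtain ⟨η, hη, hη0, hηlap⟩ := exists_testFunction_lap r hrpos
  have hout : ∀ t : E3, ρ < ‖t‖ → -δ ≤ u t := by
    intro t ht
    by_contra hc
    have : t ∈ K := by
      by_contra htK
      exact hc (hKu htK)
    have := hρ this
    rw [mem_closedBall_zero_iff] at this
    linarith
  have hmol : ∀ n x, r < ‖x‖ → -δ ≤ mol n u x := by
    intro n x hx
    refine le_mol hu n x (.of_forall fun t ht => hout t ?_)
    have : ‖x‖ ≤ ‖x - t‖ + ‖t‖ := by simpa using norm_add_le (x - t) t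
    have := le_max_left ρ 0
    linarith
  set F := convexCut δ
  set S : ℝ → ℝ := fun t => Real.smoothTransition (-t - δ) with hS
  have hScont : Continuous S := continuous_cutSlope δ
  have hSabs : ∀ t, |S t| ≤ 1 := fun t => by
    rw [abs_of_nonneg (Real.smoothTransition.nonneg _)]; exact Real.smoothTransition.le_one _
  have hun : ∀ n, ContDiff ℝ (⊤ : ℕ∞) (mol n u) := mol_smooth hu
  have hFun : ∀ n, ContDiff ℝ (⊤ : ℕ∞) fun x => F (mol n u x) := fun n =>
    (contDiff_convexCut δ).comp (hun n)
  have hFc : ∀ n, HasCompactSupport fun x => F (mol n u x) := fun n => by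
    refine HasCompactSupport.of_support_subset_isCompact (isCompact_closedBall (0 : E3) r) ?_
    intro x hx
    rw [mem_closedBall_zero_iff]
    by_contra hc
    exact hx (convexCut_eq_zero (hmol n x (not_le.1 hc)))
  set gp : E3 → ℝ := fun x => max (g x) 0 with hgp
  have hgpI : Integrable gp := hg.pos_part
  have hgp0 : ∀ x, 0 ≤ gp x := fun x => le_max_right _ _
  obtain ⟨C, hC⟩ := hη.compact.exists_bound_of_continuous hη.smooth.continuous
  have hC' : ∀ x, |η x| ≤ C := hC
  have hcη : Continuous η := hη.smooth.continuous
  have hint1 : ∀ n, Integrable fun x => S (mol n u x) * η x * mol n gp x := fun n =>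
    (((hScont.comp (hun n).continuous).mul hcη).mul
      (mol_smooth hgpI.locallyIntegrable n).continuous).integrable_of_hasCompactSupport
      (HasCompactSupport.mul_right (hη.compact.mul_left))
  -- The energy inequality for the mollified functions.
  have hmain : ∀ n, 6 * ∫ x, F (mol n u x) ≤ ∫ x, S (mol n u x) * η x * mol n gp x := by
    intro n
    have e1 : ∫ x, F (mol n u x) * lap η x = -6 * ∫ x, F (mol n u x) := by
      rw [← integral_const_mul]
      refine integral_congr_ae (.of_forall fun x => ?_)
      by_cases hx : ‖x‖ ≤ r
      · simp only [hηlap x hx]; ring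
      · simp only [F, convexCut_eq_zero (hmol n x (not_le.1 hx))]; ring
    have e2 := integral_mul_lap (hFun n) hη
    have e3 : -∫ x, S (mol n u x) * η x * mol n gp x ≤
        ∫ x, lap (fun x => F (mol n u x)) x * η x := by
      rw [← integral_neg]
      refine integral_mono (hint1 n).neg
        (((contDiff_lap (hFun n)).continuous.mul hcη).integrable_of_hasCompactSupport
          hη.compact.mul_left) fun x => ?_
      have l1 := lap_comp_ge (contDiff_convexCut δ) (deriv_deriv_convexCut_nonneg δ) (hun n) x
      rw [deriv_convexCut, lap_mol_of_weakLap hu h] at l1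
      have l2 : mol n g x ≤ mol n gp x := mol_mono hg.locallyIntegrable hgpI.locallyIntegrable
        (.of_forall fun x => le_max_left _ _) n x
      have l3 : 0 ≤ S (mol n u x) := Real.smoothTransition.nonneg _
      have l4 := mul_le_mul_of_nonneg_right l1 (hη0 x)
      have l5 := mul_le_mul_of_nonneg_left l2 (mul_nonneg l3 (hη0 x))
      simp only [F]
      change -(S (mol n u x) * η x * mol n gp x) ≤ _
      have l6 : -S (mol n u x) * mol n g x * η x ≤
          lap (fun y => convexCut δ (mol n u y)) x * η x := l4
      nlinarith
    linarith
  -- The right-hand side tends to zero.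
  have hlim : Tendsto (fun n => C * ∫ x, |mol n gp x - gp x|) atTop (𝓝 0) := by
    simpa using (tendsto_integral_abs_mol_sub hgpI (.of_forall hgp0)).const_mul C
  have hint2 : ∀ n, Integrable fun x => S (mol n u x) * η x * gp x := fun n =>
    hgpI.bdd_mul (c := C) ((hScont.comp (hun n).continuous).mul hcη).aestronglyMeasurable
      (.of_forall fun x => by
        rw [Real.norm_eq_abs, abs_mul]
        have := mul_le_mul (hSabs (mol n u x)) (hC' x) (abs_nonneg _) zero_le_one
        linarith)
  have hlim2 : Tendsto (fun n => ∫ x, S (mol n u x) * η x * gp x) atTop (𝓝 0) := by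
    have h0 : ∫ _ : E3, (0 : ℝ) = 0 := by simp
    rw [← h0]
    refine tendsto_integral_of_dominated_convergence (fun x => C * gp x)
      (fun n => (hint2 n).aestronglyMeasurable) (hgpI.const_mul C) ?_ ?_
    · intro n
      refine .of_forall fun x => ?_
      rw [Real.norm_eq_abs, abs_mul, abs_mul, abs_of_nonneg (hgp0 x)]
      have := mul_le_mul (hSabs (mol n u x)) (hC' x) (abs_nonneg _) zero_le_one
      exact mul_le_mul_of_nonneg_right (by linarith) (hgp0 x)
    · filter_upwards [ae_tendsto_mol hu, hsign] with x hx hs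
      have h1 : Tendsto (fun n => S (mol n u x) * η x * gp x) atTop (𝓝 (S (u x) * η x * gp x)) :=
        (((hScont.tendsto _).comp hx).mul_const _).mul_const _
      have h2 : S (u x) * η x * gp x = 0 := by
        rcases lt_or_ge (u x) 0 with hneg | hpos
        · have : gp x = 0 := max_eq_right (hs hneg)
          rw [this, mul_zero]
        · have : S (u x) = 0 := Real.smoothTransition.zero_of_nonpos (by linarith)
          rw [this]; ring
      rwa [h2] at h1
  have hbound : ∀ n, ∫ x, F (mol n u x) ≤
      C * (∫ x, |mol n gp x - gp x|) + ∫ x, S (mol n u x) * η x * gp x := by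
    intro n
    have hd : Integrable fun x => C * |mol n gp x - gp x| :=
      ((mol_integrable hgpI n).sub hgpI).abs.const_mul C
    have h1 : ∫ x, S (mol n u x) * η x * mol n gp x ≤
        ∫ x, (C * |mol n gp x - gp x| + S (mol n u x) * η x * gp x) := by
      refine integral_mono (hint1 n)
        (hd.add (hint2 n)) fun x => ?_
      have h3 : |S (mol n u x) * η x * (mol n gp x - gp x)| ≤ C * |mol n gp x - gp x| := by
        rw [abs_mul, abs_mul]
        have := mul_le_mul (hSabs (mol n u x)) (hC' x) (abs_nonneg _) zero_le_one
        exact mul_le_mul_of_nonneg_right (by linarith) (abs_nonneg _)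
      have h4 := le_of_abs_le h3
      change S (mol n u x) * η x * mol n gp x ≤ C * |mol n gp x - gp x| + S (mol n u x) * η x * gp x
      linarith
    rw [integral_add hd (hint2 n),
      integral_const_mul] at h1
    have h5 : 0 ≤ ∫ x, F (mol n u x) := integral_nonneg fun x => convexCut_nonneg δ _
    linarith [hmain n]
  have hF0 : Tendsto (fun n => ∫ x, F (mol n u x)) atTop (𝓝 0) := by
    refine squeeze_zero (fun n => integral_nonneg fun x => convexCut_nonneg δ _) hbound ?_
    simpa using hlim.add hlim2
  -- Fatou's lemma gives `F(u) = 0` almost everywhere.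
  have hFatou : ∫⁻ x, ofReal (F (u x)) = 0 := by
    have h1 : ∫⁻ x, ofReal (F (u x)) ≤
        liminf (fun n => ∫⁻ x, ofReal (F (mol n u x))) atTop := by
      refine le_trans (lintegral_mono_ae ?_) (lintegral_liminf_le' fun n =>
        (hFun n).continuous.measurable.ennreal_ofReal.aemeasurable)
      filter_upwards [ae_tendsto_mol hu] with x hx
      have := (ENNReal.continuous_ofReal.comp (contDiff_convexCut δ).continuous).tendsto (u x)
      exact ((this.comp hx).liminf_eq).ge
    have h2 : Tendsto (fun n => ∫⁻ x, ofReal (F (mol n u x))) atTop (𝓝 0) := by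
      have h3 := ENNReal.tendsto_ofReal hF0
      rw [ENNReal.ofReal_zero] at h3
      refine h3.congr fun n => ?_
      exact ofReal_integral_eq_lintegral_ofReal
        ((hFun n).continuous.integrable_of_hasCompactSupport (hFc n))
        (.of_forall fun x => convexCut_nonneg δ _)
    rw [h2.liminf_eq] at h1
    exact le_antisymm h1 bot_le
  have hmeas : AEMeasurable (fun x => ofReal (F (u x))) volume :=
    ((contDiff_convexCut δ).continuous.measurable.comp_aemeasurable
      hu.aestronglyMeasurable.aemeasurable).ennreal_ofReal
  rw [lintegral_eq_zero_iff' hmeas] at hFatou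
  filter_upwards [hFatou] with x hx
  by_contra hc
  have := convexCut_pos (not_le.1 hc)
  simp only [Pi.zero_apply, ENNReal.ofReal_eq_zero] at hx
  exact absurd hx (not_le.2 this)

/-! ### The scattering solution -/

/-- `v (1 - ω)`, whose integral is `8π` times the scattering length. -/
def vone (v ω : E3 → ℝ) (x : E3) : ℝ := v x * (1 - ω x)

theorem integrable_mul_lap {u η : E3 → ℝ} (hu : LocallyIntegrable u)
    (hη : IsTestFunction Set.univ η) : Integrable fun x => u x * lap η x := by
  have := hu.integrable_smul_left_of_hasCompactSupport
    (contDiff_lap hη.smooth).continuous (hasCompactSupport_lap hη.compact)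
  simpa [mul_comm] using this

theorem WeakLap.sub {u u' g g' : E3 → ℝ} (h : WeakLap u g) (h' : WeakLap u' g')
    (hu : LocallyIntegrable u) (hu' : LocallyIntegrable u') (hg : Integrable g)
    (hg' : Integrable g') : WeakLap (fun x => u x - u' x) fun x => g x - g' x := by
  intro η hη
  obtain ⟨C, hC⟩ := hη.compact.exists_bound_of_continuous hη.smooth.continuous
  have i : ∀ {f : E3 → ℝ}, Integrable f → Integrable fun x => f x * η x := fun hf =>
    hf.mul_bdd hη.smooth.continuous.aestronglyMeasurable (.of_forall hC)
  simp only [sub_mul]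
  rw [integral_sub (integrable_mul_lap hu hη) (integrable_mul_lap hu' hη), h η hη, h' η hη,
    integral_sub (i hg) (i hg')]

theorem isTestFunction_neg {η : E3 → ℝ} (h : IsTestFunction Set.univ η) :
    IsTestFunction Set.univ fun x => η (-x) := by
  have := isTestFunction_const_sub h.smooth h.compact 0
  simpa using this

theorem locallyIntegrable_of_memLp_ball {F : Type*} [NormedAddCommGroup F] {f : E3 → F}
    (h : ∀ r : ℝ, MemLp f 2 (volume.restrict (Metric.ball 0 r))) : LocallyIntegrable f := by
  intro x
  refine ⟨Metric.ball 0 (‖x‖ + 1), Metric.isOpen_ball.mem_nhds (by simp), ?_⟩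
  have : IsFiniteMeasure (volume.restrict (Metric.ball (0 : E3) (‖x‖ + 1))) :=
    ⟨by rw [Measure.restrict_apply_univ]; exact measure_ball_lt_top⟩
  exact (h _).integrable (by norm_num)

section Scattering

variable {v ω : E3 → ℝ} {R : ℝ}

theorem IsScatteringSolution.locallyIntegrable (hω : IsScatteringSolution v ω) :
    LocallyIntegrable ω := by
  obtain ⟨G, -, hL, -⟩ := hω.weak_solution
  exact locallyIntegrable_of_memLp_ball fun r => (hL r).1

theorem IsScatteringSolution.integrable_vone (hv : IsPotential v R)
    (hω : IsScatteringSolution v ω) : Integrable (vone v ω) := by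
  have h1 : Integrable fun x => v x + v x * (1 - ω x) ^ 2 := hv.integrable.add hω.finite_energy
  refine h1.mono' (hv.integrable.aestronglyMeasurable.mul
    (aestronglyMeasurable_const.sub hω.locallyIntegrable.aestronglyMeasurable)) ?_
  refine .of_forall fun x => ?_
  rw [vone, Real.norm_eq_abs, abs_mul, abs_of_nonneg (hv.nonneg x)]
  have := hv.nonneg x
  have h2 : |1 - ω x| ≤ 1 + (1 - ω x) ^ 2 := by
    rw [← sq_abs (1 - ω x)]
    nlinarith [sq_nonneg (|1 - ω x| - 1), abs_nonneg (1 - ω x)]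
  nlinarith

theorem IsScatteringSolution.weakLap (hv : IsPotential v R) (hω : IsScatteringSolution v ω) :
    WeakLap ω fun x => -(1 / 2) * vone v ω x := by
  obtain ⟨G, hG, hL, hweak⟩ := hω.weak_solution
  have hGloc : LocallyIntegrable G :=
    locallyIntegrable_of_memLp_ball fun r => (hL r).2
  intro η hη
  have hI1 : ∀ i, Integrable fun x => pd i η x * G x i := fun i => by
    have h := hGloc.integrable_smul_left_of_hasCompactSupport
      (isTestFunction_pd hη i).smooth.continuous (isTestFunction_pd hη i).compact
    have h2 := (EuclideanSpace.proj i : E3 →L[ℝ] ℝ).integrable_comp h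
    simpa using h2
  have hI2 : ∀ i, Integrable fun x => ω x * pd i (pd i η) x := fun i => by
    have hp := isTestFunction_pd (isTestFunction_pd hη i) i
    have h := hω.locallyIntegrable.integrable_smul_left_of_hasCompactSupport
      hp.smooth.continuous hp.compact
    simpa [mul_comm] using h
  have hcomp : ∀ i, ∫ x, ω x * pd i (pd i η) x = -∫ x, pd i η x * G x i := by
    intro i
    have h1 := hG _ (isTestFunction_pd hη i)
    have hp := isTestFunction_pd hη i
    have hint : Integrable fun x => ω x • ∇ (pd i η) x :=
      hω.locallyIntegrable.integrable_smul_right_of_hasCompactSupport hp.continuous_gradient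
        hp.hasCompactSupport_gradient
    have hint2 : Integrable fun x => pd i η x • G x :=
      hGloc.integrable_smul_left_of_hasCompactSupport hp.smooth.continuous hp.compact
    have h2 := congrArg (EuclideanSpace.proj i : E3 →L[ℝ] ℝ) h1
    rw [map_neg, ← ContinuousLinearMap.integral_comp_comm _ hint,
      ← ContinuousLinearMap.integral_comp_comm _ hint2] at h2
    simpa [gradient_apply] using h2
  have e1 : ∀ x, ⟪G x, ∇ η x⟫_ℝ = ∑ i, pd i η x * G x i := fun x => by
    rw [PiLp.inner_apply]
    simp [gradient_apply]
  have h3 : ∫ x, ω x * lap η x = -∫ x, ⟪G x, ∇ η x⟫_ℝ := by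
    simp only [lap, mul_sum, e1]
    rw [integral_finsetSum _ fun i _ => hI2 i, integral_finsetSum _ fun i _ => hI1 i,
      ← Finset.sum_neg_distrib]
    exact sum_congr rfl fun i _ => hcomp i
  have hI3 : Integrable fun x => ⟪G x, ∇ η x⟫_ℝ := by
    rw [funext e1]
    exact integrable_finsetSum _ fun i _ => hI1 i
  have hI4 : Integrable fun x => 1 / 2 * v x * (1 - ω x) * η x := by
    obtain ⟨C, hC⟩ := hη.compact.exists_bound_of_continuous hη.smooth.continuous
    refine (((hω.integrable_vone hv).const_mul (1 / 2)).mul_bdd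
      hη.smooth.continuous.aestronglyMeasurable (.of_forall hC)).congr ?_
    exact .of_forall fun x => by simp only [vone]; ring
  have h4 := hweak η hη
  have hI3' : Integrable fun x => -⟪G x, ∇ η x⟫_ℝ := hI3.neg
  rw [integral_add hI3' hI4, integral_neg] at h4
  rw [h3, eq_neg_of_add_eq_zero_left h4, ← integral_neg]
  refine integral_congr_ae (.of_forall fun x => ?_)
  simp only [vone]; ring

theorem integral_lap {η : E3 → ℝ} (hη : IsTestFunction Set.univ η) : ∫ x, lap η x = 0 := by
  have := integral_mul_lap (f := fun _ => 1) contDiff_const hη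
  have h1 : lap (fun _ : E3 => (1 : ℝ)) = 0 := by
    have h2 : ∀ (i : Fin 3) (c : ℝ), pd i (fun _ : E3 => c) = fun _ => 0 := fun i c => by
      funext x; simp [pd]
    funext x
    simp [lap, h2]
  simpa [h1] using this

theorem IsScatteringSolution.le_one (hv : IsPotential v R) (hω : IsScatteringSolution v ω) :
    ∀ᵐ x, ω x ≤ 1 := by
  have hloc := hω.locallyIntegrable
  have hWL : WeakLap (fun x => 1 - ω x) fun x => 1 / 2 * vone v ω x := by
    have h1 : WeakLap (fun _ => 1) fun _ => 0 := fun η hη => by simp [integral_lap hη]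
    have h2 := h1.sub (hω.weakLap hv) (locallyIntegrable_const 1) hloc (integrable_zero ..)
      ((hω.integrable_vone hv).const_mul _)
    refine fun η hη => (h2 η hη).trans (integral_congr_ae (.of_forall fun x => ?_))
    simp only; ring
  have := nonneg_of_weakLap (u := fun x => 1 - ω x) ((locallyIntegrable_const 1).sub hloc)
    ((hω.integrable_vone hv).const_mul (1 / 2)) hWL ?_ ?_
  · filter_upwards [this] with x hx using by linarith
  · refine .of_forall fun x hx => ?_
    have : vone v ω x ≤ 0 := mul_nonpos_of_nonneg_of_nonpos (hv.nonneg x) hx.le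
    linarith
  · intro δ hδ
    have h1 := hω.tendsto_zero.eventually (gt_mem_nhds (show (0 : ℝ) < 1 by norm_num))
    filter_upwards [h1] with x hx using by linarith

theorem IsScatteringSolution.vone_nonneg (hv : IsPotential v R) (hω : IsScatteringSolution v ω) :
    ∀ᵐ x, 0 ≤ vone v ω x := by
  filter_upwards [hω.le_one hv] with x hx using mul_nonneg (hv.nonneg x) (by linarith)

theorem IsScatteringSolution.nonneg (hv : IsPotential v R) (hω : IsScatteringSolution v ω) :
    ∀ᵐ x, 0 ≤ ω x := by
  refine nonneg_of_weakLap hω.locallyIntegrable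
    ((hω.integrable_vone hv).const_mul (-(1 / 2))) (hω.weakLap hv) ?_ ?_
  · filter_upwards [hω.vone_nonneg hv] with x hx _ using by linarith
  · intro δ hδ
    filter_upwards [hω.tendsto_zero.eventually (lt_mem_nhds (neg_lt_zero.2 hδ))] with x hx
      using hx.le

/-- The scattering solution is even, by uniqueness and the symmetry of `v`. -/
theorem IsScatteringSolution.even (hv : IsPotential v R) (hω : IsScatteringSolution v ω) :
    ∀ᵐ x, ω (-x) = ω x := by
  have hloc := hω.locallyIntegrable
  have hmp : MeasurePreserving (fun x : E3 => -x) volume volume :=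
    Measure.measurePreserving_neg volume
  have hloc' : LocallyIntegrable fun x => ω (-x) := by
    intro x
    obtain ⟨s, hs, hi⟩ := hloc (-x)
    refine ⟨Neg.neg ⁻¹' s, continuous_neg.continuousAt hs, ?_⟩
    exact (hmp.integrableOn_comp_preimage (MeasurableEquiv.neg E3).measurableEmbedding).2 hi
  have hv' : ∀ x, v (-x) = v x := fun x => hv.radial _ _ (norm_neg x)
  have hW := hω.weakLap hv
  have hlapneg : ∀ {η : E3 → ℝ}, IsTestFunction Set.univ η → ∀ x,
      lap (fun y => η (-y)) x = lap η (-x) := fun hη x => by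
    simpa using lap_comp_const_sub hη.smooth 0 x
  have hW' : WeakLap (fun x => ω (-x)) fun x => -(1 / 2) * vone v ω (-x) := by
    intro η hη
    have h1 := hW _ (isTestFunction_neg hη)
    rw [← integral_neg_eq_self, ← integral_neg_eq_self (f := fun x => -(1 / 2) * _ * _)] at h1
    simpa [hlapneg hη] using h1
  have hI := hω.integrable_vone hv
  have hI' : Integrable fun x => vone v ω (-x) := hI.comp_neg
  have hWd : WeakLap (fun x => ω (-x) - ω x)
      fun x => -(1 / 2) * vone v ω (-x) - -(1 / 2) * vone v ω x :=
    hW'.sub hW hloc' hloc (hI'.const_mul _) (hI.const_mul _)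
  have hnn : ∀ᵐ x, 0 ≤ ω (-x) - ω x := by
    refine nonneg_of_weakLap (hloc'.sub hloc)
      (g := fun x => -(1 / 2) * vone v ω (-x) - -(1 / 2) * vone v ω x)
      ((hI'.const_mul _).sub (hI.const_mul _)) hWd ?_ ?_
    · refine .of_forall fun x hx => ?_
      simp only [vone, hv']
      nlinarith [hv.nonneg x]
    · intro δ hδ
      have h1 : Tendsto (fun x : E3 => -x) (cocompact E3) (cocompact E3) :=
        (Homeomorph.neg E3).isClosedEmbedding.tendsto_cocompact
      have h2 := (hω.tendsto_zero.comp h1).sub hω.tendsto_zero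
      rw [sub_zero] at h2
      filter_upwards [h2.eventually (lt_mem_nhds (neg_lt_zero.2 hδ))] with x hx using hx.le
  have hnn' := hmp.quasiMeasurePreserving.ae hnn
  filter_upwards [hnn, hnn'] with x h1 h2
  rw [neg_neg] at h2
  linarith

end Scattering

/-! ### The Coulomb energy of the scattering solution -/

theorem fderiv_apply_eq_sum {f : E3 → ℝ} (x z : E3) :
    fderiv ℝ f x z = ∑ i, z i * pd i f x := by
  have h : fderiv ℝ f x z = ⟪∇ f x, z⟫_ℝ := by simp [gradient]
  rw [h, PiLp.inner_apply]
  simp [gradient_apply]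

theorem pd_gauss (i : Fin 3) (z : E3) : pd i gauss z = -(2 * π) * z i * gauss z := by
  have h := ((((hasStrictFDerivAt_norm_sq z).hasFDerivAt).const_mul (-π))).exp
  unfold pd gauss
  rw [h.fderiv]
  simp [EuclideanSpace.inner_single_right]
  ring

theorem contDiff_gauss : ContDiff ℝ (⊤ : ℕ∞) gauss := by
  unfold gauss
  exact (contDiff_const.mul (contDiff_norm_sq ℝ)).exp

theorem integrable_norm_mul_gauss : Integrable fun z : E3 => ‖z‖ * gauss z := by
  refine (integrable_gauss_smul (s := 1 / 2) (by norm_num)).mono'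
    (continuous_norm.mul continuous_gauss).aestronglyMeasurable (.of_forall fun z => ?_)
  rw [Real.norm_of_nonneg (mul_nonneg (norm_nonneg z) (gauss_pos z).le)]
  have hpi := Real.pi_gt_three
  have h1 : ‖z‖ ≤ Real.exp (‖z‖ ^ 2) := by
    nlinarith [Real.add_one_le_exp (‖z‖ ^ 2), sq_nonneg (‖z‖ - 1), norm_nonneg z]
  calc ‖z‖ * gauss z ≤ Real.exp (‖z‖ ^ 2) * gauss z :=
        mul_le_mul_of_nonneg_right h1 (gauss_pos z).le
    _ = Real.exp (‖z‖ ^ 2 + -π * ‖z‖ ^ 2) := by rw [gauss, Real.exp_add]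
    _ ≤ gauss ((1 / 2 : ℝ) • z) := by
        rw [gauss, norm_smul]
        refine Real.exp_le_exp.2 ?_
        rw [Real.norm_of_nonneg (by norm_num)]
        nlinarith [sq_nonneg ‖z‖]

theorem integrable_coord_mul_gauss (i : Fin 3) : Integrable fun z : E3 => z i * gauss z := by
  refine integrable_norm_mul_gauss.mono' (by
    exact ((EuclideanSpace.proj i : E3 →L[ℝ] ℝ).continuous.mul
      continuous_gauss).aestronglyMeasurable) (.of_forall fun z => ?_)
  rw [norm_mul, Real.norm_eq_abs (gauss z), abs_of_pos (gauss_pos z)]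
  exact mul_le_mul_of_nonneg_right (PiLp.norm_apply_le z i) (gauss_pos z).le

theorem pd_comp_add_smul {f : E3 → ℝ} (hf : Differentiable ℝ f) (i : Fin 3) (y : E3) (s : ℝ)
    (z : E3) : pd i (fun z => f (y + s • z)) z = s * pd i f (y + s • z) := by
  have h := (hf (y + s • z)).hasFDerivAt.comp z (((hasFDerivAt_id z).const_smul s).const_add y)
  unfold pd
  have h' : HasFDerivAt (fun z => f (y + s • z)) _ z := h
  rw [h'.fderiv]
  simp

/-- The Gaussian average of a smooth function solves the heat equation in the variable `s²`. -/
theorem hasDerivAt_gauss_average {f : E3 → ℝ} (hf : ContDiff ℝ (⊤ : ℕ∞) f) {C : ℝ}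
    (h0 : ∀ x, |f x| ≤ C) (h1 : ∀ i x, |pd i f x| ≤ C) (h2 : ∀ i x, |pd i (pd i f) x| ≤ C)
    (y : E3) (s : ℝ) :
    HasDerivAt (fun s : ℝ => ∫ z, gauss z * f (y + s • z))
      (s / (2 * π) * ∫ z, gauss z * lap f (y + s • z)) s := by
  have hC : 0 ≤ C := (abs_nonneg _).trans (h0 0)
  have hcont : ∀ {g : E3 → ℝ}, Continuous g → ∀ s : ℝ,
      AEStronglyMeasurable (fun z : E3 => g (y + s • z)) volume := fun hg s =>
    (hg.comp (by fun_prop)).aestronglyMeasurable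
  have hgI : ∀ {g : E3 → ℝ}, Continuous g → (∀ x, |g x| ≤ C) → ∀ s : ℝ,
      Integrable fun z => gauss z * g (y + s • z) := fun hg hb s =>
    integrable_gauss.mul_bdd (hcont hg s) (.of_forall fun z => hb _)
  have hd : Differentiable ℝ f := hf.differentiable (by simp)
  have key := hasDerivAt_integral_of_dominated_loc_of_deriv_le (μ := volume)
    (F := fun (s : ℝ) (z : E3) => gauss z * f (y + s • z))
    (F' := fun (s : ℝ) (z : E3) => gauss z * fderiv ℝ f (y + s • z) z)
    (x₀ := s) (s := Set.univ) (bound := fun z => 3 * C * (‖z‖ * gauss z)) univ_mem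
    (.of_forall fun s => (hgI hf.continuous h0 s).aestronglyMeasurable)
    (hgI hf.continuous h0 s) ?_ ?_ ?_ ?_
  · refine key.2.congr_deriv ?_
    have e1 : ∀ z, gauss z * fderiv ℝ f (y + s • z) z =
        ∑ i, (-(1 / (2 * π))) * (pd i f (y + s • z) * pd i gauss z) := by
      intro z
      rw [fderiv_apply_eq_sum, mul_sum]
      refine sum_congr rfl fun i _ => ?_
      rw [pd_gauss]
      have := Real.pi_ne_zero
      field_simp
    have i1 : ∀ i, Integrable fun z => pd i f (y + s • z) * pd i gauss z := fun i => by
      have h : Integrable (pd i gauss) := by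
        refine ((integrable_coord_mul_gauss i).const_mul (-(2 * π))).congr ?_
        exact .of_forall fun z => by rw [pd_gauss]; ring
      exact h.bdd_mul (hcont (contDiff_pd hf i).continuous s)
        (.of_forall fun z => h1 i _)
    have i2 : ∀ i, Integrable fun z => pd i (fun z => pd i f (y + s • z)) z * gauss z := fun i => by
      have h := ((hgI (contDiff_pd (contDiff_pd hf i) i).continuous (h2 i) s).const_mul s)
      refine h.congr (.of_forall fun z => ?_)
      simp only
      rw [pd_comp_add_smul ((contDiff_pd hf i).differentiable (by simp))]
      ring
    have e2 : ∀ i, ∫ z, pd i f (y + s • z) * pd i gauss z =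
        -∫ z, pd i (fun z => pd i f (y + s • z)) z * gauss z := fun i => by
      refine integral_mul_fderiv_eq_neg_fderiv_mul_of_integrable (i2 i) (i1 i) ?_ ?_ ?_
      · exact (hgI (contDiff_pd hf i).continuous (h1 i) s).congr
          (.of_forall fun z => mul_comm _ _)
      · exact fun x _ => ((contDiff_pd hf i).comp (g := pd i f) (f := fun z : E3 => y + s • z)
          (by fun_prop)).differentiable (by simp) x
      · exact fun x _ => contDiff_gauss.differentiable (by simp) x
    simp_rw [e1]
    rw [integral_finsetSum _ fun i _ => (i1 i).const_mul _]
    simp only [integral_const_mul, e2]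
    rw [← mul_sum, Finset.sum_neg_distrib, ← integral_finsetSum _ fun i _ => i2 i]
    have e3 : ∀ z, ∑ i, pd i (fun z => pd i f (y + s • z)) z * gauss z =
        s * (gauss z * lap f (y + s • z)) := by
      intro z
      simp only [lap, mul_sum]
      refine sum_congr rfl fun i _ => ?_
      rw [pd_comp_add_smul ((contDiff_pd hf i).differentiable (by simp))]
      ring
    simp only [e3]
    rw [integral_const_mul]
    ring
  · refine (continuous_gauss.mul ?_).aestronglyMeasurable
    exact ((hf.continuous_fderiv (by simp)).comp (by fun_prop)).clm_apply continuous_id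
  · refine .of_forall fun z s _ => ?_
    rw [norm_mul, Real.norm_of_nonneg (gauss_pos z).le, fderiv_apply_eq_sum]
    have : ‖∑ i, z i * pd i f (y + s • z)‖ ≤ ∑ _i : Fin 3, ‖z‖ * C := by
      refine (norm_sum_le _ _).trans (sum_le_sum fun i _ => ?_)
      rw [norm_mul]
      exact mul_le_mul (PiLp.norm_apply_le z i) (h1 i _) (norm_nonneg _) (norm_nonneg _)
    simp only [Finset.sum_const, Finset.card_univ, Fintype.card_fin, nsmul_eq_mul] at this
    push_cast at this
    nlinarith [gauss_pos z, mul_le_mul_of_nonneg_left this (gauss_pos z).le]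
  · exact integrable_norm_mul_gauss.const_mul _
  · refine .of_forall fun z s _ => ?_
    have h := (hd (y + s • z)).hasFDerivAt.comp_hasDerivAt s
      (((hasDerivAt_id s).smul_const z).const_add y)
    simpa using h.const_mul (gauss z)

/-- A bounded non-negative superharmonic function dominates its Newtonian potential, written as a
superposition of Gaussian averages. -/
theorem lintegral_gauss_average_le {f : E3 → ℝ} (hf : ContDiff ℝ (⊤ : ℕ∞) f) {C : ℝ}
    (h0 : ∀ x, |f x| ≤ C) (h1 : ∀ i x, |pd i f x| ≤ C) (h2 : ∀ i x, |pd i (pd i f) x| ≤ C)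
    (hpos : ∀ x, 0 ≤ f x) {g : E3 → ℝ} (hg : ∀ x, 0 ≤ g x) (hgf : ∀ x, lap f x = -(1 / 2) * g x)
    (y : E3) :
    ∫⁻ s in Set.Ioi (0 : ℝ), ofReal (s / (4 * π) * ∫ z, gauss z * g (y + s • z)) ≤
      ofReal (f y) := by
  set q : ℝ → ℝ := fun s => ∫ z, gauss z * f (y + s • z)
  set D : ℝ → ℝ := fun s => s / (4 * π) * ∫ z, gauss z * g (y + s • z)
  have hq : ∀ s, HasDerivAt q (-D s) s := by
    intro s
    refine (hasDerivAt_gauss_average hf h0 h1 h2 y s).congr_deriv ?_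
    simp only [hgf, D]
    have : ∀ z, gauss z * (-(1 / 2) * g (y + s • z)) = -(1 / 2) * (gauss z * g (y + s • z)) :=
      fun z => by ring
    simp only [this]
    rw [integral_const_mul]
    have := Real.pi_ne_zero
    field_simp
    ring
  have hq0 : q 0 = f y := by simp [q, integral_mul_const, integral_gauss]
  have hqpos : ∀ s, 0 ≤ q s := fun s =>
    integral_nonneg fun z => mul_nonneg (gauss_pos z).le (hpos _)
  have hDpos : ∀ s, 0 < s → 0 ≤ D s := fun s hs =>
    mul_nonneg (div_nonneg hs.le (by have := Real.pi_pos; positivity))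
      (integral_nonneg fun z => mul_nonneg (gauss_pos z).le (hg _))
  have hanti : AntitoneOn q (Set.Ici 0) := by
    refine antitoneOn_of_deriv_nonpos (convex_Ici 0)
      (fun s _ => (hq s).continuousAt.continuousWithinAt)
      (fun s _ => (hq s).differentiableAt.differentiableWithinAt) fun s hs => ?_
    rw [(hq s).deriv]
    rw [interior_Ici] at hs
    exact neg_nonpos.2 (hDpos s hs)
  have hfin : ∀ N : ℕ, ∫⁻ s in Set.Ioc (0 : ℝ) N, ofReal (D s) ≤ ofReal (f y) := by
    intro N
    have hint : IntervalIntegrable (fun s => -D s) volume 0 N := by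
      rw [intervalIntegrable_iff_integrableOn_Ioc_of_le (Nat.cast_nonneg N)]
      have := intervalIntegral.integrableOn_deriv_of_nonneg (a := 0) (b := (N : ℝ))
        (g := fun s => -q s) (g' := D)
        (fun s _ => (hq s).continuousAt.neg.continuousWithinAt)
        (fun s _ => by have h := (hq s).neg; rw [neg_neg] at h; exact h) (fun s hs => hDpos s hs.1)
      exact this.neg
    have e := intervalIntegral.integral_eq_sub_of_hasDerivAt (fun s _ => hq s) hint
    rw [intervalIntegral.integral_of_le (Nat.cast_nonneg N), integral_neg] at e
    have hI : IntegrableOn D (Set.Ioc 0 (N : ℝ)) := by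
      have := hint.1.neg
      simpa using! this
    rw [← ofReal_integral_eq_lintegral_ofReal hI ((ae_restrict_iff' measurableSet_Ioc).2
      (.of_forall fun s hs => hDpos s hs.1))]
    refine ENNReal.ofReal_le_ofReal ?_
    have := hqpos N
    rw [← hq0]
    linarith
  have hU : Set.Ioi (0 : ℝ) = ⋃ N : ℕ, Set.Ioc (0 : ℝ) N := by
    ext s
    simp only [Set.mem_Ioi, Set.mem_iUnion, Set.mem_Ioc]
    exact ⟨fun h => ⟨⌈s⌉₊, h, Nat.le_ceil s⟩, fun ⟨_, h, _⟩ => h⟩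
  rw [hU, setLIntegral_iUnion_of_directed]
  · exact iSup_le hfin
  · exact (monotone_nat_of_le_succ fun N =>
      Set.Ioc_subset_Ioc_right (by push_cast; linarith)).directed_le

/-- The Coulomb energy `∬ g(x) g(y) / (8π |x - y|)`, defined in Fourier space. -/
def coulomb (g : E3 → ℝ) : ℝ≥0∞ :=
  ∫⁻ k, ofReal (‖𝓕 (fun x => (g x : ℂ)) k‖ ^ 2 * (1 / (8 * π ^ 2 * ‖k‖ ^ 2)))

theorem lintegral_gauss_smul {k : E3} (hk : k ≠ 0) :
    ∫⁻ s in Set.Ioi (0 : ℝ), ofReal (s / (4 * π) * gauss (s • k)) =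
      ofReal (1 / (8 * π ^ 2 * ‖k‖ ^ 2)) := by
  have hk' : 0 < ‖k‖ := norm_pos_iff.2 hk
  have hpi := Real.pi_pos
  have hb : 0 < π * ‖k‖ ^ 2 := by positivity
  have e : ∀ s : ℝ, s / (4 * π) * gauss (s • k) =
      1 / (4 * π) * (s * Real.exp (-(π * ‖k‖ ^ 2) * s ^ 2)) := by
    intro s
    rw [gauss, norm_smul, mul_pow, Real.norm_eq_abs, sq_abs]
    ring_nf
  simp only [e]
  rw [← ofReal_integral_eq_lintegral_ofReal
    ((integrable_mul_exp_neg_mul_sq hb).const_mul _).integrableOn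
    ((ae_restrict_iff' measurableSet_Ioi).2 (.of_forall fun s hs => by
      have hs' : (0 : ℝ) < s := hs
      positivity))]
  congr 1
  rw [integral_const_mul]
  have h := integral_mul_cexp_neg_mul_sq (b := ((π * ‖k‖ ^ 2 : ℝ) : ℂ))
    (by rw [Complex.ofReal_re]; exact hb)
  have h2 : ∫ s in Set.Ioi (0 : ℝ), s * Real.exp (-(π * ‖k‖ ^ 2) * s ^ 2) =
      (2 * (π * ‖k‖ ^ 2))⁻¹ := by
    apply Complex.ofReal_injective
    rw [← integral_complex_ofReal]
    push_cast
    push_cast at h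
    exact h
  rw [h2]
  field_simp
  norm_num

theorem integrable_gauss_mul_comp {g : E3 → ℝ} (hg : Integrable g) {s : ℝ} (hs : 0 < s) (y : E3) :
    Integrable fun z => gauss z * g (y + s • z) := by
  have h1 : Integrable fun z : E3 => g (y + s • z) :=
    ((integrable_comp_smul_iff volume (fun u => g (y + u)) hs.ne').2 (hg.comp_add_left y))
  refine h1.bdd_mul (c := 1) continuous_gauss.aestronglyMeasurable (.of_forall fun z => ?_)
  rw [Real.norm_of_nonneg (gauss_pos z).le, gauss, Real.exp_le_one_iff]
  have := Real.pi_pos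
  nlinarith [sq_nonneg ‖z‖]

theorem integrable_fourier_sq_mul_gauss {g : E3 → ℝ} (hg : Integrable g) {s : ℝ} (hs : 0 < s) :
    Integrable fun k => ‖𝓕 (fun x => (g x : ℂ)) k‖ ^ 2 * gauss (s • k) := by
  refine (integrable_gauss_smul hs.ne').bdd_mul (c := (∫ x, ‖(g x : ℂ)‖) ^ 2)
    ((continuous_fourier hg.ofReal).norm.pow 2).aestronglyMeasurable
    (.of_forall fun k => ?_)
  rw [norm_pow, norm_norm]
  exact pow_le_pow_left₀ (norm_nonneg _) (norm_fourier_le _ k) 2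

theorem coulomb_eq {g : E3 → ℝ} (hg : Integrable g) :
    coulomb g = ∫⁻ s in Set.Ioi (0 : ℝ), ofReal (s / (4 * π)) *
      ofReal (∫ y, g y * ∫ z, gauss z * g (y + s • z)) := by
  have hpi := Real.pi_pos
  have hcont := continuous_fourier hg.ofReal
  have h1 : ∀ s ∈ Set.Ioi (0 : ℝ), ofReal (s / (4 * π)) *
      ofReal (∫ y, g y * ∫ z, gauss z * g (y + s • z)) =
      ∫⁻ k, ofReal (‖𝓕 (fun x => (g x : ℂ)) k‖ ^ 2) *
        ofReal (s / (4 * π) * gauss (s • k)) := by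
    intro s hs
    have hs' : (0 : ℝ) < s := hs
    rw [integral_mul_gauss_average hg hs,
      ofReal_integral_eq_lintegral_ofReal (integrable_fourier_sq_mul_gauss hg hs)
        (.of_forall fun k => mul_nonneg (sq_nonneg _) (gauss_pos _).le),
      ← lintegral_const_mul' _ _ ofReal_ne_top]
    refine lintegral_congr fun k => ?_
    rw [← ofReal_mul (by positivity), ← ofReal_mul (by positivity)]
    congr 1; ring
  rw [setLIntegral_congr_fun measurableSet_Ioi h1, lintegral_lintegral_swap]
  · unfold coulomb
    refine lintegral_congr_ae ?_
    have hne : ∀ᵐ k : E3, k ≠ 0 := by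
      simp [ae_iff]
    filter_upwards [hne] with k hk
    rw [lintegral_const_mul' _ _ ofReal_ne_top, lintegral_gauss_smul hk,
      ← ofReal_mul (by positivity)]
  · refine Measurable.aemeasurable ?_
    simp only [Function.uncurry_def]
    apply Measurable.fun_mul
    · exact ((hcont.comp continuous_snd).norm.pow 2).measurable.ennreal_ofReal
    · refine Measurable.ennreal_ofReal (Continuous.measurable ?_)
      exact (continuous_fst.div_const _).mul
        (continuous_gauss.comp (continuous_fst.smul continuous_snd))

theorem exists_continuous_gauss_average {g : E3 → ℝ} (hg : Integrable g) {s : ℝ} (hs : 0 < s) :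
    Continuous (fun y => ∫ z, gauss z * g (y + s • z)) ∧
      ∃ B, ∀ y, |∫ z, gauss z * g (y + s • z)| ≤ B := by
  have hI : Integrable fun k => ‖𝓕 (fun x => (g x : ℂ)) k‖ * gauss (s • k) := by
    refine (integrable_gauss_smul hs.ne').bdd_mul (c := ∫ x, ‖(g x : ℂ)‖)
      (continuous_fourier hg.ofReal).norm.aestronglyMeasurable (.of_forall fun k => ?_)
    rw [norm_norm]
    exact norm_fourier_le _ k
  have hrep : ∀ y, ∫ z, gauss z * g (y + s • z) =
      (∫ k, 𝓕 (fun x => (g x : ℂ)) k * ((gauss (s • k) : ℂ) *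
        Complex.exp (2 * π * Complex.I * ⟪y, k⟫_ℝ))).re := by
    intro y
    rw [← integral_gauss_mul_comp (W := fun x => (g x : ℂ)) hg.ofReal hs y,
      ← Complex.ofReal_re (∫ z, gauss z * g (y + s • z))]
    congr 1
    rw [← integral_complex_ofReal]
    push_cast
    rfl
  have hnorm : ∀ y k, ‖𝓕 (fun x => (g x : ℂ)) k * ((gauss (s • k) : ℂ) *
      Complex.exp (2 * π * Complex.I * ⟪y, k⟫_ℝ))‖ =
      ‖𝓕 (fun x => (g x : ℂ)) k‖ * gauss (s • k) := by
    intro y k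
    rw [show (2 * π * Complex.I * ⟪y, k⟫_ℝ : ℂ) =
      ((2 * π * ⟪y, k⟫_ℝ : ℝ) : ℂ) * Complex.I by push_cast; ring, norm_mul, norm_mul,
      Complex.norm_exp_ofReal_mul_I, mul_one, norm_real, Real.norm_eq_abs,
      abs_of_pos (gauss_pos _)]
  have hc := continuous_fourier hg.ofReal
  have hgc : Continuous fun k : E3 => (gauss (s • k) : ℂ) :=
    Complex.continuous_ofReal.comp (continuous_gauss.comp (continuous_const_smul s))
  constructor
  · simp_rw [hrep]
    refine Complex.continuous_re.comp (continuous_of_dominated (fun y => ?_)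
      (fun y => .of_forall fun k => (hnorm y k).le) hI (.of_forall fun k => ?_))
    · exact (hc.mul (hgc.mul (by fun_prop))).aestronglyMeasurable
    · fun_prop
  · refine ⟨∫ k, ‖𝓕 (fun x => (g x : ℂ)) k‖ * gauss (s • k), fun y => ?_⟩
    rw [hrep]
    refine (Complex.abs_re_le_norm _).trans ((norm_integral_le_integral_norm _).trans ?_)
    simp_rw [hnorm]
    exact le_rfl

/-- The Coulomb energy is monotone on non-negative charge densities. -/
theorem coulomb_mono {g h : E3 → ℝ} (hg : Integrable g) (hh : Integrable h) {c : ℝ} (hc : 0 ≤ c)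
    (hg0 : ∀ᵐ x, 0 ≤ g x) (hgh : ∀ᵐ x, g x ≤ c * h x) (hh0 : ∀ᵐ x, 0 ≤ h x) :
    coulomb g ≤ ofReal (c ^ 2) * coulomb h := by
  rw [coulomb_eq hg, coulomb_eq hh, ← lintegral_const_mul' _ _ ofReal_ne_top]
  refine setLIntegral_mono' measurableSet_Ioi fun s hs => ?_
  have hs' : (0 : ℝ) < s := hs
  rw [mul_left_comm, ← ofReal_mul (sq_nonneg c)]
  refine mul_le_mul_right (ENNReal.ofReal_le_ofReal ?_) _
  rw [← integral_const_mul]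
  have hshift : ∀ {p : E3 → Prop}, (∀ᵐ x, p x) → ∀ y : E3, ∀ᵐ z, p (y + s • z) := by
    intro p hp y
    have h1 : ∀ᵐ x, p (y + x) :=
      (measurePreserving_add_left volume y).quasiMeasurePreserving.ae hp
    have h2 : Measure.QuasiMeasurePreserving (fun z : E3 => s • z) volume volume :=
      ⟨measurable_const_smul s, by
        rw [Measure.map_addHaar_smul volume hs'.ne']
        exact Measure.smul_absolutelyContinuous⟩
    exact h2.ae h1
  obtain ⟨hcont, B, hB⟩ := exists_continuous_gauss_average hh hs
  refine integral_mono_of_nonneg ?_ ?_ ?_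
  · filter_upwards [hg0] with y hy
    refine mul_nonneg hy (integral_nonneg_of_ae ?_)
    filter_upwards [hshift hg0 y] with z hz using mul_nonneg (gauss_pos z).le hz
  · exact ((hh.mul_bdd hcont.aestronglyMeasurable (.of_forall hB))).const_mul _
  · filter_upwards [hg0, hgh, hh0] with y h1 h2 h3
    have h4 : ∫ z, gauss z * g (y + s • z) ≤ c * ∫ z, gauss z * h (y + s • z) := by
      rw [← integral_const_mul]
      refine integral_mono_ae (integrable_gauss_mul_comp hg hs y)
        ((integrable_gauss_mul_comp hh hs y).const_mul _) ?_
      filter_upwards [hshift hgh y] with z hz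
      have := mul_le_mul_of_nonneg_left hz (gauss_pos z).le
      linarith
    have h5 : 0 ≤ ∫ z, gauss z * g (y + s • z) := by
      refine integral_nonneg_of_ae ?_
      filter_upwards [hshift hg0 y] with z hz using mul_nonneg (gauss_pos z).le hz
    calc g y * ∫ z, gauss z * g (y + s • z)
        ≤ (c * h y) * (c * ∫ z, gauss z * h (y + s • z)) :=
          mul_le_mul h2 h4 h5 (mul_nonneg hc h3)
      _ = _ := by ring

theorem mol_const_mul (n : ℕ) (c : ℝ) (u : E3 → ℝ) :
    mol n (fun x => c * u x) = fun x => c * mol n u x := by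
  funext x
  rw [mol_apply, mol_apply, ← integral_const_mul]
  refine integral_congr_ae (.of_forall fun t => ?_)
  simp only; ring

theorem abs_convolution_le {J u : E3 → ℝ} (hJ : Integrable J) (hu : ∀ᵐ x, |u x| ≤ 1) (x : E3) :
    |(J ⋆[ContinuousLinearMap.lsmul ℝ ℝ, volume] u) x| ≤ ∫ t, |J t| := by
  rw [convolution_eq_swap, ← Real.norm_eq_abs]
  refine (norm_integral_le_integral_norm _).trans ?_
  rw [← integral_sub_left_eq_self (fun t => |J t|) volume x]
  refine integral_mono_of_nonneg (.of_forall fun t => norm_nonneg _)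
    (hJ.comp_sub_left x).abs ?_
  filter_upwards [hu] with t ht
  simp only [ContinuousLinearMap.lsmul_apply, smul_eq_mul]
  rw [norm_mul, Real.norm_eq_abs, Real.norm_eq_abs]
  exact mul_le_of_le_one_right (abs_nonneg _) ht

section Scattering

variable {v ω : E3 → ℝ} {R : ℝ}

/-- Mollified version of the bound: a solution `f` of `-Δ f = ½ g` with `f ≥ 0` dominates the
Newtonian potential of `½ g`, which is written as an integral of heat kernels. -/
theorem coulomb_mol_le (hv : IsPotential v R) (hω : IsScatteringSolution v ω) (n : ℕ) :
    coulomb (mol n (vone v ω)) ≤ ofReal (∫ y, mol n (vone v ω) y * mol n ω y) := by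
  have hpi := Real.pi_pos
  have hloc := hω.locallyIntegrable
  have hω1 : ∀ᵐ x, |ω x| ≤ 1 := by
    filter_upwards [hω.nonneg hv, hω.le_one hv] with x h1 h2
    rw [abs_of_nonneg h1]; exact h2
  set f := mol n ω with hf
  set g := mol n (vone v ω) with hg
  have hI := hω.integrable_vone hv
  have hgI : Integrable g := mol_integrable hI n
  have hfs : ContDiff ℝ (⊤ : ℕ∞) f := mol_smooth hloc n
  have hgs : ContDiff ℝ (⊤ : ℕ∞) g := mol_smooth hI.locallyIntegrable n
  have hg0 : ∀ x, 0 ≤ g x := mol_nonneg (hω.vone_nonneg hv) n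
  have hf0 : ∀ x, 0 ≤ f x := mol_nonneg (hω.nonneg hv) n
  have hlap : ∀ x, lap f x = -(1 / 2) * g x := fun x => by
    rw [hf, lap_mol_of_weakLap hloc (hω.weakLap hv), mol_const_mul]
  have hJ1 : ∀ i, Integrable (pd i (molK n)) := fun i =>
    (contDiff_pd (molK_smooth n) i).continuous.integrable_of_hasCompactSupport
      (hasCompactSupport_pd (molK_compact n) i)
  have hJ2 : ∀ i, Integrable (pd i (pd i (molK n))) := fun i =>
    (contDiff_pd (contDiff_pd (molK_smooth n) i) i).continuous.integrable_of_hasCompactSupport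
      (hasCompactSupport_pd (hasCompactSupport_pd (molK_compact n) i) i)
  set C := (∫ t, |molK n t|) + ∑ i, ((∫ t, |pd i (molK n) t|) + ∫ t, |pd i (pd i (molK n)) t|)
    with hC
  have hnn : ∀ F : E3 → ℝ, 0 ≤ ∫ t, |F t| := fun F => integral_nonneg fun t => abs_nonneg _
  have hsum : ∀ i, (∫ t, |pd i (molK n) t|) + ∫ t, |pd i (pd i (molK n)) t| ≤
      ∑ i, ((∫ t, |pd i (molK n) t|) + ∫ t, |pd i (pd i (molK n)) t|) := fun i =>
    Finset.single_le_sum (f := fun i => (∫ t, |pd i (molK n) t|) + ∫ t, |pd i (pd i (molK n)) t|)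
      (fun i _ => add_nonneg (hnn _) (hnn _)) (Finset.mem_univ i)
  have b0 : ∀ x, |f x| ≤ C := fun x =>
    (abs_convolution_le (molK_integrable n) hω1 x).trans
      (le_add_of_nonneg_right (sum_nonneg fun i _ => add_nonneg (hnn _) (hnn _)))
  have b1 : ∀ i x, |pd i f x| ≤ C := fun i x => by
    rw [hf, mol, pd_convolution (molK_smooth n) (molK_compact n) hloc]
    refine (abs_convolution_le (hJ1 i) hω1 x).trans ?_
    have := hsum i
    linarith [hnn (molK n), hnn (pd i (pd i (molK n)))]
  have b2 : ∀ i x, |pd i (pd i f) x| ≤ C := fun i x => by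
    rw [hf, mol, pd_convolution (molK_smooth n) (molK_compact n) hloc,
      pd_convolution (contDiff_pd (molK_smooth n) i) (hasCompactSupport_pd (molK_compact n) i) hloc]
    refine (abs_convolution_le (hJ2 i) hω1 x).trans ?_
    have := hsum i
    linarith [hnn (molK n), hnn (pd i (molK n))]
  have hgb : ∀ x, |g x| ≤ 6 * C := fun x => by
    have h1 : |lap f x| ≤ 3 * C := by
      unfold lap
      refine (Finset.abs_sum_le_sum_abs _ _).trans ?_
      refine (sum_le_sum fun i _ => b2 i x).trans ?_
      simp
    rw [hlap, abs_mul] at h1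
    norm_num at h1
    linarith
  have hjoint : Continuous fun p : ℝ × E3 => ∫ z, gauss z * g (p.2 + p.1 • z) := by
    refine continuous_of_dominated (bound := fun z => gauss z * (6 * C)) (fun p => ?_)
      (fun p => .of_forall fun z => ?_) (integrable_gauss.mul_const _)
      (.of_forall fun z => ?_)
    · exact (continuous_gauss.mul (hgs.continuous.comp (by fun_prop))).aestronglyMeasurable
    · rw [norm_mul, Real.norm_of_nonneg (gauss_pos z).le]
      exact mul_le_mul_of_nonneg_left (hgb _) (gauss_pos z).le
    · exact continuous_const.mul (hgs.continuous.comp (by fun_prop))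
  have hav0 : ∀ (s : ℝ) y, 0 ≤ ∫ z, gauss z * g (y + s • z) := fun s y =>
    integral_nonneg fun z => mul_nonneg (gauss_pos z).le (hg0 _)
  rw [coulomb_eq hgI]
  have h1 : ∀ s ∈ Set.Ioi (0 : ℝ), ofReal (s / (4 * π)) *
      ofReal (∫ y, g y * ∫ z, gauss z * g (y + s • z)) =
      ∫⁻ y, ofReal (g y) *
        ofReal (s / (4 * π) * ∫ z, gauss z * g (y + s • z)) := by
    intro s hs
    have hs' : (0 : ℝ) < s := hs
    obtain ⟨hcont, B, hB⟩ := exists_continuous_gauss_average hgI hs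
    rw [ofReal_integral_eq_lintegral_ofReal
      (hgI.mul_bdd hcont.aestronglyMeasurable (.of_forall hB))
        (.of_forall fun y => mul_nonneg (hg0 y) (hav0 s y)),
      ← lintegral_const_mul' _ _ ofReal_ne_top]
    refine lintegral_congr fun k => ?_
    rw [← ofReal_mul (by positivity), ← ofReal_mul (hg0 _)]
    congr 1; ring
  rw [setLIntegral_congr_fun measurableSet_Ioi h1, lintegral_lintegral_swap]
  · have hfin : Integrable fun y => g y * f y :=
      hgI.mul_bdd hfs.continuous.aestronglyMeasurable (.of_forall b0)
    rw [ofReal_integral_eq_lintegral_ofReal hfin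
      (.of_forall fun y => mul_nonneg (hg0 y) (hf0 y))]
    refine lintegral_mono fun y => ?_
    rw [lintegral_const_mul' _ _ ofReal_ne_top, ofReal_mul (hg0 y)]
    exact mul_le_mul_right (lintegral_gauss_average_le hfs b0 b1 b2 hf0 hg0 hlap y) _
  · refine Measurable.aemeasurable ?_
    simp only [Function.uncurry_def]
    apply Measurable.fun_mul
    · exact (hgs.continuous.comp continuous_snd).measurable.ennreal_ofReal
    · exact (((continuous_fst.div_const _).mul hjoint).measurable).ennreal_ofReal

/-- The Coulomb energy of `v (1 - ω)` is at most `∫ v (1 - ω) ω`, because the scattering solution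
dominates the Newtonian potential of `½ v (1 - ω)`. -/
theorem coulomb_vone_le (hv : IsPotential v R) (hω : IsScatteringSolution v ω) :
    coulomb (vone v ω) ≤ ofReal (∫ y, vone v ω y * ω y) := by
  set V := vone v ω
  have hI : Integrable V := hω.integrable_vone hv
  have hloc := hω.locallyIntegrable
  have hL1 := tendsto_integral_abs_mol_sub hI (hω.vone_nonneg hv)
  have hd : ∀ n, Integrable fun x => mol n V x - V x := fun n => (mol_integrable hI n).sub hI
  have hω1 : ∀ᵐ x, |ω x| ≤ 1 := by
    filter_upwards [hω.nonneg hv, hω.le_one hv] with x h1 h2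
    rw [abs_of_nonneg h1]; exact h2
  have hm1 : ∀ n x, |mol n ω x| ≤ 1 := fun n x => by
    refine (abs_convolution_le (molK_integrable n) hω1 x).trans ?_
    simp_rw [abs_of_nonneg (molK_nonneg n _)]
    exact (molK_integral n).le
  -- pointwise convergence of the Fourier transforms
  have hF : ∀ k, Tendsto (fun n => 𝓕 (fun x => (mol n V x : ℂ)) k) atTop
      (𝓝 (𝓕 (fun x => (V x : ℂ)) k)) := by
    intro k
    rw [tendsto_iff_norm_sub_tendsto_zero]
    refine squeeze_zero (fun n => norm_nonneg _) (fun n => ?_) hL1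
    have : 𝓕 (fun x => (mol n V x : ℂ)) k - 𝓕 (fun x => (V x : ℂ)) k =
        𝓕 (fun x => ((mol n V x - V x : ℝ) : ℂ)) k := by
      rw [Real.fourier_eq, Real.fourier_eq, Real.fourier_eq, ← integral_sub]
      · refine integral_congr_ae (.of_forall fun x => ?_)
        simp [smul_sub]
      · exact (Real.fourierIntegral_convergent_iff k).2 (mol_integrable hI n).ofReal
      · exact (Real.fourierIntegral_convergent_iff k).2 hI.ofReal
    rw [this]
    refine (norm_fourier_le _ k).trans (le_of_eq ?_)
    simp only [norm_real, Real.norm_eq_abs]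
  have hFatou : coulomb V ≤ liminf (fun n => coulomb (mol n V)) atTop := by
    unfold coulomb
    refine le_trans (lintegral_mono fun k => ?_) (lintegral_liminf_le fun n => ?_)
    · exact ((ENNReal.tendsto_ofReal (((hF k).norm.pow 2).mul_const _)).liminf_eq).ge
    · refine Measurable.ennreal_ofReal (Measurable.fun_mul ?_ ?_)
      · exact ((continuous_fourier (mol_integrable hI n).ofReal).norm.pow 2).measurable
      · fun_prop
  have hlim : Tendsto (fun n => ∫ y, mol n V y * mol n ω y) atTop (𝓝 (∫ y, V y * ω y)) := by
    have h1 : Tendsto (fun n => ∫ y, V y * mol n ω y) atTop (𝓝 (∫ y, V y * ω y)) := by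
      refine tendsto_integral_of_dominated_convergence (fun y => |V y|) (fun n => ?_) hI.abs ?_ ?_
      · exact (hI.mul_bdd (mol_smooth hloc n).continuous.aestronglyMeasurable
          (.of_forall (hm1 n))).aestronglyMeasurable
      · intro n
        refine .of_forall fun y => ?_
        rw [norm_mul]
        exact mul_le_of_le_one_right (abs_nonneg _) (hm1 n y)
      · filter_upwards [ae_tendsto_mol hloc] with y hy using hy.const_mul _
    have h2 : Tendsto (fun n => ∫ y, (mol n V y - V y) * mol n ω y) atTop (𝓝 0) := by
      refine squeeze_zero_norm (fun n => ?_) hL1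
      refine (norm_integral_le_integral_norm _).trans ?_
      refine integral_mono_of_nonneg (.of_forall fun _ => norm_nonneg _) (hd n).abs
        (.of_forall fun y => ?_)
      simp only [norm_mul]
      exact mul_le_of_le_one_right (abs_nonneg _) (hm1 n y)
    have h3 := h2.add h1
    rw [zero_add] at h3
    refine h3.congr fun n => ?_
    have hms := (mol_smooth hloc n).continuous.aestronglyMeasurable (μ := volume)
    rw [← integral_add ((hd n).mul_bdd hms (.of_forall (hm1 n)))
      (hI.mul_bdd hms (.of_forall (hm1 n)))]
    refine integral_congr_ae (.of_forall fun y => ?_)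
    simp only; ring
  calc coulomb V ≤ liminf (fun n => coulomb (mol n V)) atTop := hFatou
    _ ≤ liminf (fun n => ofReal (∫ y, mol n V y * mol n ω y)) atTop :=
        liminf_le_liminf (.of_forall fun n => coulomb_mol_le hv hω n)
    _ = _ := (ENNReal.tendsto_ofReal hlim).liminf_eq

end Scattering

/-! ### Duality between the Coulomb energy and the Dirichlet integral -/

section Duality

open SchwartzMap LineDeriv

theorem integrable_norm_gradient_sq {g : E3 → ℝ} (hg : IsTestFunction Set.univ g) :
    Integrable fun x => ‖∇ g x‖ ^ 2 := by
  simp only [norm_gradient_sq]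
  refine integrable_finsetSum _ fun i _ => ?_
  have h := isTestFunction_pd hg i
  exact (h.smooth.continuous.pow 2).integrable_of_hasCompactSupport
    (by simpa only [sq] using! h.compact.mul_left (f := pd i g))

/-- The function `g` as a complex Schwartz function. -/
def IsTestFunction.toSchwartz {g : E3 → ℝ} (hg : IsTestFunction Set.univ g) : 𝓢(E3, ℂ) :=
  (hg.compact.comp_left (g := fun t : ℝ => (t : ℂ)) Complex.ofReal_zero).toSchwartzMap
    (Complex.ofRealCLM.contDiff.comp hg.smooth)

theorem IsTestFunction.toSchwartz_apply {g : E3 → ℝ} (hg : IsTestFunction Set.univ g) (x : E3) :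
    hg.toSchwartz x = (g x : ℂ) := rfl

theorem IsTestFunction.lineDeriv_toSchwartz {g : E3 → ℝ} (hg : IsTestFunction Set.univ g)
    (i : Fin 3) (x : E3) :
    (∂_{(EuclideanSpace.single i (1 : ℝ) : E3)} hg.toSchwartz) x = (pd i g x : ℂ) := by
  rw [lineDerivOp_apply_eq_fderiv]
  have h := (Complex.ofRealCLM.hasFDerivAt (x := g x)).comp x
    (hg.smooth.differentiable (by simp) x).hasFDerivAt
  have h' : HasFDerivAt hg.toSchwartz _ x := h
  rw [h'.fderiv]
  simp [pd]

theorem IsTestFunction.lintegral_fourierInv {g : E3 → ℝ} (hg : IsTestFunction Set.univ g) :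
    ∫⁻ k, ofReal (8 * π ^ 2 * ‖k‖ ^ 2 * ‖(𝓕⁻ hg.toSchwartz) k‖ ^ 2) =
      ofReal (2 * ∫ x, ‖∇ g x‖ ^ 2) := by
  set F := hg.toSchwartz with hF
  have h1 : ∀ i : Fin 3, ∫⁻ k, ofReal (4 * π ^ 2 * k i ^ 2 * ‖(𝓕⁻ F) k‖ ^ 2) =
      ∫⁻ x, ofReal (pd i g x ^ 2) := by
    intro i
    set G := ∂_{(EuclideanSpace.single i (1 : ℝ) : E3)} F with hG
    have hP := lintegral_enorm_sq_fourier (𝓕⁻ G).integrable ((𝓕⁻ G).memLp 2)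
    rw [← fourier_coe, FourierTransform.fourier_fourierInv_eq] at hP
    have e1 : ∀ x, ‖G x‖ₑ ^ 2 = ofReal (pd i g x ^ 2) := fun x => by
      rw [hG, hF, hg.lineDeriv_toSchwartz, ← ofReal_norm, ← ENNReal.ofReal_pow (norm_nonneg _),
        norm_real, Real.norm_eq_abs, sq_abs]
    have e2 : ∀ k, ‖(𝓕⁻ G) k‖ₑ ^ 2 =
        ofReal (4 * π ^ 2 * k i ^ 2 * ‖(𝓕⁻ F) k‖ ^ 2) := fun k => by
      have ht : (fun x : E3 => inner ℝ x (EuclideanSpace.single i (1 : ℝ) : E3)).HasTemperateGrowth :=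
        by fun_prop
      rw [hG, fourierInv_lineDerivOp_eq, ← ofReal_norm, ← ENNReal.ofReal_pow (norm_nonneg _)]
      congr 1
      rw [smul_apply, smulLeftCLM_apply_apply ht, EuclideanSpace.inner_single_right]
      simp [mul_pow, abs_of_pos Real.pi_pos]
      ring
    simp only [e1, e2] at hP
    exact hP.symm
  have h2 : ∀ k : E3, ofReal (8 * π ^ 2 * ‖k‖ ^ 2 * ‖(𝓕⁻ F) k‖ ^ 2) =
      2 * ∑ i, ofReal (4 * π ^ 2 * k i ^ 2 * ‖(𝓕⁻ F) k‖ ^ 2) := fun k => by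
    have e2 : ∀ t : ℝ, 2 * ofReal t = ofReal (2 * t) := fun t => by
      rw [ofReal_mul (by norm_num), ENNReal.ofReal_ofNat]
    rw [← ENNReal.ofReal_sum_of_nonneg fun i _ => by positivity, e2, EuclideanSpace.norm_sq_eq k]
    congr 1
    simp only [Real.norm_eq_abs, sq_abs, mul_sum, sum_mul]
    exact sum_congr rfl fun i _ => by ring
  simp only [h2]
  have hm : ∀ i : Fin 3, Measurable fun k : E3 =>
      ofReal (4 * π ^ 2 * k i ^ 2 * ‖(𝓕⁻ F) k‖ ^ 2) := fun i => by
    refine Continuous.measurable ?_ |>.ennreal_ofReal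
    have := (𝓕⁻ F).continuous
    fun_prop
  rw [lintegral_const_mul _ (Finset.measurable_fun_sum _ fun i _ => hm i),
    lintegral_finsetSum _ fun i _ => hm i]
  simp only [h1]
  rw [ofReal_mul (by norm_num), ofReal_integral_eq_lintegral_ofReal
    (integrable_norm_gradient_sq hg) (.of_forall fun x => sq_nonneg _)]
  simp only [norm_gradient_sq]
  have hm' : ∀ i, Measurable fun x => ofReal (pd i g x ^ 2) := fun i =>
    ((contDiff_pd hg.smooth i).continuous.pow 2).measurable.ennreal_ofReal
  rw [← lintegral_finsetSum _ fun i _ => hm' i]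
  simp only [ENNReal.ofReal_sum_of_nonneg fun i (_ : i ∈ univ) => sq_nonneg (pd i g _)]
  simp

/-- Coulomb energy and Dirichlet integral are dual: Cauchy–Schwarz in Fourier space. -/
theorem abs_integral_mul_le_coulomb {V g : E3 → ℝ} (hV : Integrable V)
    (hg : IsTestFunction Set.univ g) {E : ℝ} (hE : 0 ≤ E) (hVE : coulomb V ≤ ofReal E) :
    |∫ x, V x * g x| ≤ E / 2 + ∫ x, ‖∇ g x‖ ^ 2 := by
  set h := 𝓕⁻ hg.toSchwartz with hh
  have hD : 0 ≤ ∫ x, ‖∇ g x‖ ^ 2 := integral_nonneg fun x => sq_nonneg _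
  have e1 : ((∫ x, V x * g x : ℝ) : ℂ) = ∫ k, 𝓕 (fun x => (V x : ℂ)) k * h k := by
    rw [integral_fourier_mul (f := fun x => (V x : ℂ)) hV.ofReal h.integrable,
      ← integral_complex_ofReal]
    refine integral_congr_ae (.of_forall fun x => ?_)
    simp only
    rw [← fourier_coe, hh, FourierTransform.fourier_fourierInv_eq, hg.toSchwartz_apply]
    push_cast; rfl
  have hI : Integrable fun k => 𝓕 (fun x => (V x : ℂ)) k * h k :=
    h.integrable.bdd_mul (c := ∫ x, ‖(V x : ℂ)‖)
      (continuous_fourier (f := fun x => (V x : ℂ)) hV.ofReal).aestronglyMeasurable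
      (.of_forall (norm_fourier_le _))
  rw [← Real.norm_eq_abs, ← norm_real, e1, ← ENNReal.ofReal_le_ofReal_iff (by positivity)]
  calc ofReal ‖∫ k, 𝓕 (fun x => (V x : ℂ)) k * h k‖
      ≤ ∫⁻ k, ‖𝓕 (fun x => (V x : ℂ)) k * h k‖ₑ := by
        rw [ofReal_norm]; exact enorm_integral_le_lintegral_enorm _
    _ ≤ ∫⁻ k, (ofReal (1 / 2) * ofReal (‖𝓕 (fun x => (V x : ℂ)) k‖ ^ 2 *
          (1 / (8 * π ^ 2 * ‖k‖ ^ 2))) +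
          ofReal (1 / 2) * ofReal (8 * π ^ 2 * ‖k‖ ^ 2 * ‖h k‖ ^ 2)) := by
        refine lintegral_mono_ae ?_
        have hne : ∀ᵐ k : E3, k ≠ 0 := by simp [ae_iff]
        filter_upwards [hne] with k hk
        have hk' : 0 < ‖k‖ := norm_pos_iff.2 hk
        have hpi := Real.pi_pos
        rw [← ofReal_mul (by norm_num), ← ofReal_mul (by norm_num),
          ← ENNReal.ofReal_add (by positivity) (by positivity), ← ofReal_norm, norm_mul]
        refine ENNReal.ofReal_le_ofReal ?_
        set c := 8 * π ^ 2 * ‖k‖ ^ 2 with hc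
        have hc0 : 0 < c := by positivity
        set p := ‖𝓕 (fun x => (V x : ℂ)) k‖
        set q := ‖h k‖
        have : 0 ≤ (p - c * q) ^ 2 / c := by positivity
        have e : (p - c * q) ^ 2 / c = p ^ 2 * (1 / c) - 2 * p * q + c * q ^ 2 := by
          field_simp; ring
        linarith
    _ ≤ ofReal (E / 2 + ∫ x, ‖∇ g x‖ ^ 2) := by
        rw [lintegral_add_right, lintegral_const_mul' _ _ ofReal_ne_top,
          lintegral_const_mul' _ _ ofReal_ne_top, hg.lintegral_fourierInv,
          ENNReal.ofReal_add (by positivity) hD]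
        · refine add_le_add ?_ (le_of_eq ?_)
          · calc _ ≤ ofReal (1 / 2) * ofReal E := mul_le_mul_right hVE _
              _ = _ := by rw [← ofReal_mul (by norm_num)]; congr 1; ring
          · rw [← ofReal_mul (by norm_num)]; congr 1; ring
        · have := h.continuous
          exact (Continuous.measurable (by fun_prop)).ennreal_ofReal.const_mul _

end Duality

section Scattering

variable {v ω : E3 → ℝ} {R : ℝ}

/-- Testing the scattering energy from below: by duality with the Coulomb energy, `½ ∫ v (1 - ω)`
is a lower bound for the scattering functional on `1 + C_c^∞`. -/
theorem half_integral_vone_le (hv : IsPotential v R) (hω : IsScatteringSolution v ω) {g : E3 → ℝ}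
    (hg : IsTestFunction Set.univ g) :
    1 / 2 * ∫ x, vone v ω x ≤ (∫ x, ‖∇ g x‖ ^ 2) + 1 / 2 * ∫ x, v x * (1 + g x) ^ 2 := by
  have hI := hω.integrable_vone hv
  have hωm := hω.locallyIntegrable.aestronglyMeasurable
  have hω1 : ∀ᵐ x, ‖ω x‖ ≤ 1 := by
    filter_upwards [hω.nonneg hv, hω.le_one hv] with x h1 h2
    rw [Real.norm_of_nonneg h1]; exact h2
  have hVω : Integrable fun x => vone v ω x * ω x := hI.mul_bdd hωm hω1
  have hE : 0 ≤ ∫ x, vone v ω x * ω x := by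
    refine integral_nonneg_of_ae ?_
    filter_upwards [hω.nonneg hv, hω.vone_nonneg hv] with x h1 h2 using mul_nonneg h2 h1
  have h1 := abs_integral_mul_le_coulomb hI hg hE (coulomb_vone_le hv hω)
  obtain ⟨c, hc⟩ := hg.compact.exists_bound_of_continuous hg.smooth.continuous
  have hgm := hg.smooth.continuous.aestronglyMeasurable (μ := volume)
  have hVg : Integrable fun x => vone v ω x * g x := hI.mul_bdd hgm (.of_forall hc)
  have hvg : Integrable fun x => v x * (1 + g x) ^ 2 := by
    refine hv.integrable.mul_bdd (c := (1 + c) ^ 2)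
      ((continuous_const.add hg.smooth.continuous).pow 2).aestronglyMeasurable
      (.of_forall fun x => ?_)
    rw [norm_pow]
    refine pow_le_pow_left₀ (norm_nonneg _) ((norm_add_le _ _).trans ?_) 2
    simpa using hc x
  have hs : Integrable fun x => vone v ω x + vone v ω x * ω x := hI.add hVω
  have h2 : ∫ x, (vone v ω x + vone v ω x * ω x + 2 * (vone v ω x * g x)) ≤
      ∫ x, v x * (1 + g x) ^ 2 := by
    refine integral_mono (hs.add (hVg.const_mul 2)) hvg fun x => ?_
    have : 0 ≤ v x * (1 + g x - (1 - ω x)) ^ 2 := mul_nonneg (hv.nonneg x) (sq_nonneg _)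
    simp only [vone]
    nlinarith
  rw [integral_add hs (hVg.const_mul 2), integral_add hI hVω, integral_const_mul] at h2
  have := (abs_le.1 h1).1
  linarith

end Scattering

/-! ### The scattering length bounds the integral of `v (1 - ω)` -/

/-- The radial function with derivative `-m(|x|)` that equals `1` near the origin. -/
def radialTail (m : ℝ → ℝ) (x : E3) : ℝ := 1 - ∫ t in (0 : ℝ)..‖x‖, m t

section RadialTail

variable {m : ℝ → ℝ} {r s : ℝ}

theorem hasDerivAt_primitive (hm : ContDiff ℝ (⊤ : ℕ∞) m) (t : ℝ) :
    HasDerivAt (fun t => ∫ u in (0 : ℝ)..t, m u) (m t) t :=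
  intervalIntegral.integral_hasDerivAt_right (hm.continuous.intervalIntegrable _ _)
    (hm.continuous.stronglyMeasurableAtFilter _ _) hm.continuous.continuousAt

theorem contDiff_primitive (hm : ContDiff ℝ (⊤ : ℕ∞) m) :
    ContDiff ℝ (⊤ : ℕ∞) fun t => ∫ u in (0 : ℝ)..t, m u := by
  rw [contDiff_infty_iff_deriv]
  refine ⟨fun t => (hasDerivAt_primitive hm t).differentiableAt, ?_⟩
  rwa [show deriv (fun t => ∫ u in (0 : ℝ)..t, m u) = m from
    funext fun t => (hasDerivAt_primitive hm t).deriv]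

theorem radialTail_eq_one (hs : ∀ t, t ∉ Set.Icc r s → m t = 0) {x : E3} (hx : ‖x‖ ≤ r) :
    radialTail m x = 1 := by
  unfold radialTail
  rw [intervalIntegral.integral_of_le (norm_nonneg x), setIntegral_congr_fun
    (g := fun t => if t = r then m r else 0) measurableSet_Ioc, sub_eq_self]
  · refine integral_eq_zero_of_ae (ae_restrict_of_ae ?_)
    have : ∀ᵐ t : ℝ, t ≠ r := by simp [ae_iff]
    filter_upwards [this] with t ht
    simp [ht]
  · intro t ht
    by_cases h : t = r
    · simp [h]
    · simp only [h, if_false]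
      exact hs t fun h' => h (le_antisymm (ht.2.trans hx) h'.1)

theorem contDiff_radialTail (hm : ContDiff ℝ (⊤ : ℕ∞) m) (hr : 0 < r)
    (hs : ∀ t, t ∉ Set.Icc r s → m t = 0) : ContDiff ℝ (⊤ : ℕ∞) (radialTail m) := by
  rw [contDiff_iff_contDiffAt]
  intro x
  by_cases hx : x = 0
  · have : radialTail m =ᶠ[𝓝 x] fun _ => 1 := by
      filter_upwards [Metric.ball_mem_nhds x hr] with y hy
      rw [hx, mem_ball_zero_iff] at hy
      exact radialTail_eq_one hs hy.le
    exact contDiffAt_const.congr_of_eventuallyEq this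
  · exact contDiffAt_const.sub ((contDiff_primitive hm).contDiffAt.comp x (contDiffAt_norm ℝ hx))

theorem radialTail_eq_zero (h1 : ∫ t in (0 : ℝ)..s, m t = 1)
    (hm : ContDiff ℝ (⊤ : ℕ∞) m) (hs : ∀ t, t ∉ Set.Icc r s → m t = 0) {x : E3} (hx : s ≤ ‖x‖) :
    radialTail m x = 0 := by
  have h2 : ∫ t in s..‖x‖, m t = 0 := by
    rw [intervalIntegral.integral_of_le hx]
    refine integral_eq_zero_of_ae ((ae_restrict_iff' measurableSet_Ioc).2
      (.of_forall fun t ht => ?_))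
    exact hs t fun h => absurd h.2 (not_le.2 ht.1)
  unfold radialTail
  rw [← intervalIntegral.integral_add_adjacent_intervals (hm.continuous.intervalIntegrable 0 s)
    (hm.continuous.intervalIntegrable _ _), h1, h2]
  norm_num

theorem norm_gradient_radialTail (hm : ContDiff ℝ (⊤ : ℕ∞) m) (hr : 0 < r)
    (hs : ∀ t, t ∉ Set.Icc r s → m t = 0) (x : E3) :
    ‖∇ (radialTail m) x‖ ^ 2 = m ‖x‖ ^ 2 := by
  by_cases hx : x = 0
  · have : radialTail m =ᶠ[𝓝 x] fun _ => 1 := by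
      filter_upwards [Metric.ball_mem_nhds x hr] with y hy
      rw [hx, mem_ball_zero_iff] at hy
      exact radialTail_eq_one hs hy.le
    have h0 : m ‖x‖ = 0 := hs _ fun h => by rw [hx, norm_zero] at h; linarith [h.1]
    rw [h0, gradient, this.fderiv_eq]
    simp
  · have hn : ‖x‖ ≠ 0 := norm_ne_zero_iff.2 hx
    have hnorm : HasFDerivAt (fun y : E3 => ‖y‖) ((‖x‖⁻¹) • innerSL ℝ x) x := by
      have h2 := ((hasStrictFDerivAt_norm_sq x).hasFDerivAt).sqrt (by positivity)
      have e : (fun y : E3 => √(‖y‖ ^ 2)) = fun y => ‖y‖ := by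
        funext y; exact Real.sqrt_sq (norm_nonneg y)
      rw [e, Real.sqrt_sq (norm_nonneg x)] at h2
      refine h2.congr_fderiv ?_
      rw [← Nat.cast_smul_eq_nsmul ℝ, smul_smul]
      congr 1
      push_cast
      field_simp
    have h := ((hasDerivAt_primitive hm ‖x‖).comp_hasFDerivAt x hnorm).const_sub 1
    have h' : HasFDerivAt (radialTail m) _ x := h
    have hg : ∇ (radialTail m) x = (-(m ‖x‖) * ‖x‖⁻¹) • x := by
      rw [gradient, h'.fderiv]
      refine (InnerProductSpace.toDual ℝ E3).injective ?_
      rw [LinearIsometryEquiv.apply_symm_apply]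
      ext z
      simp
      ring
    rw [hg, norm_smul, mul_pow, Real.norm_eq_abs, sq_abs]
    field_simp
    try ring

end RadialTail

/-- Nearly optimal test functions for the Newtonian capacity `4πr` of a ball of radius `r`. -/
theorem exists_capacity_testFunction {r : ℝ} (hr : 0 < r) {ε : ℝ} (hε : 0 < ε) :
    ∃ u, IsTestFunction Set.univ u ∧ (∀ x, ‖x‖ ≤ r → u x = 1) ∧
      ∫ x, ‖∇ u x‖ ^ 2 ≤ 4 * π * r * (1 + ε) := by
  -- the profile `q` approximates `r` times the indicator function of `[0, 1/r]`
  obtain ⟨c, hcpos, hc⟩ : ∃ c : ℝ, 0 < c ∧ c = 1 / (2 * r) := ⟨_, by positivity, rfl⟩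
  let f : ContDiffBump c := ⟨c / (1 + ε), c * ((1 + ε / 2) / (1 + ε)), by positivity, by
    rw [mul_div_assoc', div_lt_div_iff_of_pos_right (by positivity)]
    nlinarith⟩
  have hrIn : f.rIn = c / (1 + ε) := rfl
  have hrOut : f.rOut < c := by
    change c * ((1 + ε / 2) / (1 + ε)) < c
    have : (1 + ε / 2) / (1 + ε) < 1 := by rw [div_lt_one (by positivity)]; linarith
    nlinarith
  set q : ℝ → ℝ := f.normed volume with hq
  have hq0 : ∀ t, 0 ≤ q t := f.nonneg_normed
  have hqs : ∀ t, t ∉ Set.Ioo (c - f.rOut) (c + f.rOut) → q t = 0 := by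
    intro t ht
    by_contra h
    have : t ∈ Function.support q := h
    rw [hq, ContDiffBump.support_normed_eq, Real.ball_eq_Ioo] at this
    exact ht this
  have hqle : ∀ t, q t ≤ (1 + ε) * r := by
    intro t
    have h1 := f.normed_le_div_measure_closedBall_rIn (μ := volume) t
    rw [hrIn, Measure.real, Real.volume_closedBall, ENNReal.toReal_ofReal (by positivity)] at h1
    refine h1.trans (le_of_eq ?_)
    rw [hc]; field_simp
  have hcr : c + c = 1 / r := by rw [hc]; field_simp; norm_num
  set b := 1 / (c - f.rOut) with hb
  have hcf : 0 < c - f.rOut := by linarith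
  have hbpos : 0 < b := by positivity
  set m : ℝ → ℝ := fun y => (y ^ 2)⁻¹ * q y⁻¹ with hm
  have hm0 : ∀ y, 0 ≤ m y := fun y => mul_nonneg (by positivity) (hq0 _)
  have hms : ∀ y, y ∉ Set.Icc r b → m y = 0 := by
    intro y hy
    by_contra h
    have h1 : q y⁻¹ ≠ 0 := right_ne_zero_of_mul h
    have h2 : y⁻¹ ∈ Set.Ioo (c - f.rOut) (c + f.rOut) := by
      by_contra h3
      exact h1 (hqs _ h3)
    have hy0 : 0 < y := inv_pos.1 (hcf.trans h2.1)
    refine hy ⟨?_, ?_⟩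
    · have h3 : y⁻¹ < 1 / r := by linarith [h2.2]
      rw [one_div] at h3
      exact ((inv_lt_inv₀ hy0 hr).1 h3).le
    · rw [hb, le_div_iff₀ hcf]
      have := h2.1
      rw [lt_inv_comm₀ hcf hy0, ← one_div, lt_div_iff₀ hcf] at this
      exact this.le
  have hmsm : ContDiff ℝ (⊤ : ℕ∞) m := by
    rw [contDiff_iff_contDiffAt]
    intro y
    by_cases hy : y < r
    · have : m =ᶠ[𝓝 y] fun _ => 0 := by
        filter_upwards [Iio_mem_nhds hy] with z hz using hms z fun h => absurd h.1 (not_le.2 hz)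
      exact contDiffAt_const.congr_of_eventuallyEq this
    · have hy0 : y ≠ 0 := by linarith [not_lt.1 hy]
      exact ((contDiffAt_id.pow 2).inv (pow_ne_zero 2 hy0)).mul
        ((f.contDiff_normed (n := ⊤)).contDiffAt.comp y (contDiffAt_inv ℝ hy0))
  have hsub : ∀ g : ℝ → ℝ,
      ∫ y in Set.Ioi (0 : ℝ), (y ^ 2)⁻¹ * g y⁻¹ = ∫ t in Set.Ioi (0 : ℝ), g t := by
    intro g
    rw [← integral_comp_rpow_Ioi g (p := -1) (by norm_num)]
    refine setIntegral_congr_fun measurableSet_Ioi fun y hy => ?_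
    have hy' : (0 : ℝ) < y := hy
    simp only [smul_eq_mul]
    rw [Real.rpow_neg_one, show (-1 - 1 : ℝ) = -(2 : ℕ) by norm_num, Real.rpow_neg hy'.le,
      Real.rpow_natCast]
    norm_num
  have hqint : ∫ t in Set.Ioi (0 : ℝ), q t = 1 := by
    rw [← f.integral_normed (μ := volume), setIntegral_eq_integral_of_forall_compl_eq_zero]
    intro t ht
    exact hqs t fun h => ht (hcf.trans h.1)
  have hmint : ∫ t in (0 : ℝ)..b, m t = 1 := by
    rw [← hqint, ← hsub q, intervalIntegral.integral_of_le hbpos.le]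
    refine (setIntegral_eq_of_subset_of_forall_sdiff_eq_zero measurableSet_Ioi
      Set.Ioc_subset_Ioi_self fun y hy => ?_).symm
    exact hms y fun h => hy.2 ⟨hy.1, h.2⟩
  refine ⟨radialTail m, ⟨contDiff_radialTail hmsm hr hms, ?_, Set.subset_univ _⟩,
    fun x hx => radialTail_eq_one hms hx, ?_⟩
  · refine HasCompactSupport.intro (isCompact_closedBall (0 : E3) b) fun x hx => ?_
    rw [mem_closedBall_zero_iff, not_le] at hx
    exact radialTail_eq_zero hmint hmsm hms hx.le
  · simp only [norm_gradient_radialTail hmsm hr hms]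
    rw [integral_fun_norm_addHaar volume fun t => m t ^ 2]
    have hvol : volume.real (Metric.ball (0 : E3) 1) = 4 / 3 * π := by
      have := Real.pi_pos
      rw [Measure.real, EuclideanSpace.volume_ball_fin_three, ENNReal.ofReal_one, one_pow, one_mul,
        ENNReal.toReal_ofReal (by positivity)]
      ring
    have hle : ∫ y in Set.Ioi (0 : ℝ), y ^ 2 * m y ^ 2 ≤ (1 + ε) * r := by
      calc ∫ y in Set.Ioi (0 : ℝ), y ^ 2 * m y ^ 2
          ≤ ∫ y in Set.Ioi (0 : ℝ), (1 + ε) * r * ((y ^ 2)⁻¹ * q y⁻¹) := by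
            refine integral_mono_of_nonneg (.of_forall fun y => by positivity) ?_
              ((ae_restrict_iff' measurableSet_Ioi).2 (.of_forall fun y hy => ?_))
            · refine Integrable.const_mul ?_ _
              have : HasCompactSupport m := HasCompactSupport.intro isCompact_Icc hms
              exact (hmsm.continuous.integrable_of_hasCompactSupport this).integrableOn
            · have hy' : (0 : ℝ) < y := hy
              have e : y ^ 2 * m y ^ 2 = q y⁻¹ * ((y ^ 2)⁻¹ * q y⁻¹) := by
                simp only [hm]; field_simp
              simp only [e]
              exact mul_le_mul_of_nonneg_right (hqle _) (hm0 y)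
        _ = (1 + ε) * r := by rw [integral_const_mul, hsub q, hqint, mul_one]
    rw [hvol]
    simp only [finrank_euclideanSpace, Fintype.card_fin, nsmul_eq_mul, smul_eq_mul]
    have := mul_le_mul_of_nonneg_left hle (show 0 ≤ 4 * π by have := Real.pi_pos; positivity)
    norm_num
    linarith

section Scattering

variable {v ω : E3 → ℝ} {R : ℝ}

theorem mul_sin_div (M y : ℝ) (hM : M ≠ 0) : M * Real.sin (y / M) = y * Real.sinc (y / M) := by
  rcases eq_or_ne y 0 with rfl | hy
  · simp
  · rw [Real.sinc_of_ne_zero (div_ne_zero hy hM)]; field_simp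

theorem abs_mul_sin_div_le {M : ℝ} (hM : 0 < M) (y : ℝ) : |M * Real.sin (y / M)| ≤ |y| := by
  rw [mul_sin_div M y hM.ne', abs_mul]
  exact mul_le_of_le_one_right (abs_nonneg y) (Real.abs_sinc_le_one _)

theorem gradient_eq_zero_of_notMem_tsupport {η : E3 → ℝ} {x : E3} (h : x ∉ tsupport η) :
    ∇ η x = 0 := by
  rw [gradient, image_eq_zero_of_notMem_tsupport fun h' => h (tsupport_fderiv_subset ℝ h'),
    map_zero]

theorem IsTestFunction.mono {Ω Ω' : Set E3} {η : E3 → ℝ} (h : IsTestFunction Ω η) (hΩ : Ω ⊆ Ω') :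
    IsTestFunction Ω' η := ⟨h.smooth, h.compact, h.support.trans hΩ⟩

/-- Duality for the competitor `t M sin(η/M) - (1 - t) u`, with `u` a capacity test function of the
ball; the sine keeps it bounded. -/
theorem half_integral_vone_le_cut (hv : IsPotential v R) (hω : IsScatteringSolution v ω) {r : ℝ}
    (hr : R < r) {η : E3 → ℝ} (hη : IsTestFunction (Metric.ball 0 r) η) {M : ℝ} (hM : 0 < M)
    (t : ℝ) :
    1 / 2 * ∫ x, vone v ω x ≤ t ^ 2 * ((∫ x, ‖∇ η x‖ ^ 2) +
      1 / 2 * ∫ x, v x * (1 + M * Real.sin (η x / M)) ^ 2) + (1 - t) ^ 2 * (4 * π * r) := by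
  have hr0 : 0 < r := hv.range_pos.trans hr
  have hη' := hη.mono (Set.subset_univ _)
  have key : ∀ ε : ℝ, 0 < ε → 1 / 2 * ∫ x, vone v ω x ≤ t ^ 2 * ((∫ x, ‖∇ η x‖ ^ 2) +
      1 / 2 * ∫ x, v x * (1 + M * Real.sin (η x / M)) ^ 2) +
        (1 - t) ^ 2 * (4 * π * r * (1 + ε)) := by
    intro ε hε
    obtain ⟨u, hu, hu1, hu2⟩ := exists_capacity_testFunction hr0 hε
    set F : ℝ → ℝ := fun y => t * (M * Real.sin (y / M)) with hF
    have hFs : ContDiff ℝ (⊤ : ℕ∞) F := by unfold F; fun_prop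
    set g : E3 → ℝ := fun x => F (η x) - (1 - t) * u x with hg
    have hgs : ContDiff ℝ (⊤ : ℕ∞) g := (hFs.comp hη.smooth).sub (contDiff_const.mul hu.smooth)
    have hgt : IsTestFunction Set.univ g := by
      refine ⟨hgs, ?_, Set.subset_univ _⟩
      exact (hη.compact.comp_left (g := F) (by simp [hF])).sub
        (hu.compact.mul_left (f := fun _ => 1 - t))
    have hdF : ∀ y, deriv F y = t * Real.cos (y / M) := fun y => by
      have h := (((Real.hasDerivAt_sin (y / M)).comp y ((hasDerivAt_id y).div_const M)).const_mul
        M).const_mul t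
      have h' : HasDerivAt F _ y := h
      rw [h'.deriv]; field_simp
    have hpd : ∀ i x, pd i g x = t * Real.cos (η x / M) * pd i η x - (1 - t) * pd i u x := by
      intro i x
      have h1 := pd_comp (hFs.differentiable (by simp)) (hη.smooth.differentiable (by simp)) i x
      have hd1 : DifferentiableAt ℝ (fun y => F (η y)) x :=
        (hFs.comp hη.smooth).differentiable (by simp) x
      have hd2 : DifferentiableAt ℝ u x := hu.smooth.differentiable (by simp) x
      rw [← hdF, ← h1]
      unfold pd
      rw [hg, fderiv_fun_sub hd1 (hd2.const_mul _), fderiv_const_mul hd2]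
      simp
    have hgrad : ∀ x, ‖∇ g x‖ ^ 2 ≤ t ^ 2 * ‖∇ η x‖ ^ 2 + (1 - t) ^ 2 * ‖∇ u x‖ ^ 2 := by
      intro x
      simp only [norm_gradient_sq]
      rw [mul_sum, mul_sum, ← sum_add_distrib]
      refine sum_le_sum fun i _ => ?_
      rw [hpd]
      have hc : (t * Real.cos (η x / M)) ^ 2 ≤ t ^ 2 := by
        rw [mul_pow]
        exact mul_le_of_le_one_right (sq_nonneg t) (Real.cos_sq_le_one _)
      have hc' := mul_le_mul_of_nonneg_right hc (sq_nonneg (pd i η x))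
      by_cases hx : ‖x‖ < r
      · have : u =ᶠ[𝓝 x] fun _ => 1 := by
          filter_upwards [Metric.isOpen_ball.mem_nhds (mem_ball_zero_iff.2 hx)] with y hy
          exact hu1 y (mem_ball_zero_iff.1 hy).le
        have h0 : pd i u x = 0 := by rw [(pd_congr this i).eq_of_nhds]; simp [pd]
        rw [h0]; nlinarith
      · have h0 : pd i η x = 0 := by
          rw [← gradient_apply, gradient_eq_zero_of_notMem_tsupport fun h =>
            hx (mem_ball_zero_iff.1 (hη.support h))]
          rfl
        rw [h0]; nlinarith
    have hpot : ∀ x, v x * (1 + g x) ^ 2 = t ^ 2 * (v x * (1 + M * Real.sin (η x / M)) ^ 2) := by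
      intro x
      by_cases hx : ‖x‖ ≤ R
      · rw [hg, hF]
        simp only
        rw [hu1 x (hx.trans hr.le)]; ring
      · rw [hv.finite_range x (not_le.1 hx)]; ring
    have h1 := half_integral_vone_le hv hω hgt
    simp only [hpot] at h1
    rw [integral_const_mul] at h1
    have h2 : ∫ x, ‖∇ g x‖ ^ 2 ≤ t ^ 2 * (∫ x, ‖∇ η x‖ ^ 2) + (1 - t) ^ 2 * ∫ x, ‖∇ u x‖ ^ 2 := by
      rw [← integral_const_mul, ← integral_const_mul, ← integral_add
        ((integrable_norm_gradient_sq hη').const_mul _)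
          ((integrable_norm_gradient_sq hu).const_mul _)]
      exact integral_mono (integrable_norm_gradient_sq hgt)
        (((integrable_norm_gradient_sq hη').const_mul _).add
          ((integrable_norm_gradient_sq hu).const_mul _)) hgrad
    have h3 := mul_le_mul_of_nonneg_left hu2 (sq_nonneg (1 - t))
    linarith
  have hlim : Tendsto (fun ε : ℝ => t ^ 2 * ((∫ x, ‖∇ η x‖ ^ 2) +
      1 / 2 * ∫ x, v x * (1 + M * Real.sin (η x / M)) ^ 2) +
        (1 - t) ^ 2 * (4 * π * r * (1 + ε))) (𝓝[>] 0) (𝓝 (t ^ 2 * ((∫ x, ‖∇ η x‖ ^ 2) +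
      1 / 2 * ∫ x, v x * (1 + M * Real.sin (η x / M)) ^ 2) +
        (1 - t) ^ 2 * (4 * π * r * (1 + 0)))) := by
    refine tendsto_nhdsWithin_of_tendsto_nhds (Continuous.tendsto ?_ 0)
    fun_prop
  rw [add_zero, mul_one] at hlim
  exact ge_of_tendsto hlim (by filter_upwards [self_mem_nhdsWithin] with ε hε using key ε hε)

/-- The bound for a competitor `φ` in `H¹`: approximate `φ - 1` by test functions and let
`M → ∞`. -/
theorem half_integral_vone_le_of_isH10 (hv : IsPotential v R) (hω : IsScatteringSolution v ω)
    {r : ℝ}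
    (hr : R < r) {φ : E3 → ℝ} {G : E3 → E3}
    (h : IsH10 (Metric.ball 0 r) (fun x => φ x - 1) G)
    (hE : ∫⁻ x in Metric.ball 0 r, ofReal (‖G x‖ ^ 2 + 1 / 2 * v x * φ x ^ 2) ≠ ⊤) (t : ℝ) :
    1 / 2 * ∫ x, vone v ω x ≤ t ^ 2 * (∫⁻ x in Metric.ball 0 r,
      ofReal (‖G x‖ ^ 2 + 1 / 2 * v x * φ x ^ 2)).toReal +
        (1 - t) ^ 2 * (4 * π * r) := by
  obtain ⟨hf2, hG2, η, hη, hηf, hηG⟩ := h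
  set f : E3 → ℝ := fun x => φ x - 1 with hf
  set ν := volume.restrict (Metric.ball (0 : E3) r) with hν
  have hball : MeasurableSet (Metric.ball (0 : E3) r) := measurableSet_ball
  have hfm : AEStronglyMeasurable f ν := hf2.aestronglyMeasurable
  have hφm : AEStronglyMeasurable φ ν := by
    have := hfm.add (aestronglyMeasurable_const (b := (1 : ℝ)))
    refine this.congr (.of_forall fun x => ?_)
    simp [hf]
  have hvm : AEStronglyMeasurable v ν := hv.integrable.aestronglyMeasurable.restrict
  have hvball : ∀ x, x ∉ Metric.ball (0 : E3) r → v x = 0 := fun x hx =>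
    hv.finite_range x (hr.trans_le (not_lt.1 fun h => hx (mem_ball_zero_iff.2 h)))
  -- the two parts of the energy
  have hGI : Integrable (fun x => ‖G x‖ ^ 2) ν := hG2.integrable_norm_pow (by norm_num)
  have hsum : Integrable (fun x => ‖G x‖ ^ 2 + 1 / 2 * v x * φ x ^ 2) ν := by
    refine ⟨hGI.aestronglyMeasurable.add ((hvm.const_mul _).mul (hφm.pow 2)), ?_⟩
    rw [hasFiniteIntegral_iff_ofReal (.of_forall fun x => by
      have := hv.nonneg x; positivity)]
    exact lt_top_iff_ne_top.2 hE
  have hvφ : Integrable (fun x => v x * φ x ^ 2) ν := by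
    have := (hsum.sub hGI).const_mul 2
    refine this.congr (.of_forall fun x => ?_)
    simp only [Pi.sub_apply]; ring
  have hEn : (∫⁻ x, ofReal (‖G x‖ ^ 2 + 1 / 2 * v x * φ x ^ 2) ∂ν).toReal =
      (eLpNorm G 2 ν).toReal ^ 2 + 1 / 2 * ∫ x, v x * φ x ^ 2 ∂ν := by
    rw [← ofReal_integral_eq_lintegral_ofReal hsum (.of_forall fun x => by
      have := hv.nonneg x; positivity), ENNReal.toReal_ofReal (integral_nonneg fun x => by
      have := hv.nonneg x; positivity)]
    have e2 : ∀ x, ‖G x‖ ^ 2 + 1 / 2 * v x * φ x ^ 2 = ‖G x‖ ^ 2 + 1 / 2 * (v x * φ x ^ 2) :=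
      fun x => by ring
    simp only [e2]
    rw [integral_add hGI (hvφ.const_mul _), integral_const_mul,
      integral_norm_sq_eq_eLpNorm hG2.1]
  rw [hEn]
  -- almost everywhere convergence along a subsequence
  obtain ⟨σ, hσ, hσae⟩ := (tendstoInMeasure_of_tendsto_eLpNorm (by norm_num)
    (fun n => (hη n).smooth.continuous.aestronglyMeasurable) hfm hηf).exists_seq_tendsto_ae
  have hgradfin : ∀ n, eLpNorm (∇ (η n)) 2 ν ≤
      eLpNorm (fun x => ∇ (η n) x - G x) 2 ν + eLpNorm G 2 ν := by
    intro n
    have := eLpNorm_add_le (f := fun x => ∇ (η n) x - G x) (g := G) (p := 2)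
      ((hη n).continuous_gradient.aestronglyMeasurable.sub hG2.aestronglyMeasurable)
      hG2.aestronglyMeasurable (by norm_num)
    refine le_trans (le_of_eq ?_) this
    congr 1; funext x; simp
  have hdfin : ∀ᶠ n in atTop, eLpNorm (fun x => ∇ (η n) x - G x) 2 ν < 1 :=
    hηG.eventually_lt_const (by norm_num)
  have hgradint : ∀ n, ∫ x, ‖∇ (η n) x‖ ^ 2 = (eLpNorm (∇ (η n)) 2 ν).toReal ^ 2 := by
    intro n
    rw [← integral_norm_sq_eq_eLpNorm (hη n).continuous_gradient.aestronglyMeasurable, hν,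
      setIntegral_eq_integral_of_forall_compl_eq_zero]
    intro x hx
    rw [gradient_eq_zero_of_notMem_tsupport fun h => hx ((hη n).support h)]
    simp
  have hstep : ∀ M : ℝ, 0 < M → 1 / 2 * ∫ x, vone v ω x ≤ t ^ 2 * ((eLpNorm G 2 ν).toReal ^ 2 +
      1 / 2 * ∫ x, v x * (1 + M * Real.sin (f x / M)) ^ 2 ∂ν) + (1 - t) ^ 2 * (4 * π * r) := by
    intro M hM
    have hint : ∀ p : E3 → ℝ, ∫ x, v x * p x = ∫ x, v x * p x ∂ν := fun p => by
      rw [hν, setIntegral_eq_integral_of_forall_compl_eq_zero]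
      intro x hx
      rw [hvball x hx, zero_mul]
    have hlim1 : Tendsto (fun n => ((eLpNorm (fun x => ∇ (η (σ n)) x - G x) 2 ν +
        eLpNorm G 2 ν).toReal) ^ 2) atTop (𝓝 ((eLpNorm G 2 ν).toReal ^ 2)) := by
      have h1 := (hηG.comp hσ.tendsto_atTop).add_const (eLpNorm G 2 ν)
      rw [zero_add] at h1
      exact ((ENNReal.tendsto_toReal hG2.eLpNorm_ne_top).comp h1).pow 2
    have hlim2 : Tendsto (fun n => ∫ x, v x * (1 + M * Real.sin (η (σ n) x / M)) ^ 2 ∂ν) atTop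
        (𝓝 (∫ x, v x * (1 + M * Real.sin (f x / M)) ^ 2 ∂ν)) := by
      refine tendsto_integral_of_dominated_convergence (fun x => v x * (1 + M) ^ 2) (fun n => ?_)
        (hv.integrable.restrict.mul_const _) (fun n => .of_forall fun x => ?_) ?_
      · have := (hη (σ n)).smooth.continuous
        exact hvm.mul (Continuous.aestronglyMeasurable (by fun_prop))
      · rw [norm_mul, Real.norm_of_nonneg (hv.nonneg x), norm_pow]
        refine mul_le_mul_of_nonneg_left (pow_le_pow_left₀ (norm_nonneg _)
          ((norm_add_le _ _).trans ?_) 2) (hv.nonneg x)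
        rw [norm_one, norm_mul, Real.norm_of_nonneg hM.le]
        have := Real.abs_sin_le_one (η (σ n) x / M)
        rw [Real.norm_eq_abs]
        nlinarith
      · filter_upwards [hσae] with x hx
        have hc : Continuous fun y : ℝ => v x * (1 + M * Real.sin (y / M)) ^ 2 := by fun_prop
        exact (hc.tendsto _).comp hx
    refine ge_of_tendsto (((hlim1.add (hlim2.const_mul (1 / 2))).const_mul (t ^ 2)).add_const
      ((1 - t) ^ 2 * (4 * π * r))) ?_
    filter_upwards [hσ.tendsto_atTop.eventually hdfin] with n hn
    refine (half_integral_vone_le_cut hv hω hr (hη (σ n)) hM t).trans ?_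
    rw [hgradint, hint]
    have h1 : (eLpNorm (∇ (η (σ n))) 2 ν).toReal ≤ (eLpNorm (fun x => ∇ (η (σ n)) x - G x) 2 ν +
        eLpNorm G 2 ν).toReal := by
      refine ENNReal.toReal_mono ?_ (hgradfin _)
      exact ENNReal.add_ne_top.2 ⟨(hn.trans ENNReal.one_lt_top).ne, hG2.eLpNorm_ne_top⟩
    have h2 := pow_le_pow_left₀ ENNReal.toReal_nonneg h1 2
    have h3 := mul_le_mul_of_nonneg_left h2 (sq_nonneg t)
    linarith
  have hlimM : Tendsto (fun n : ℕ => ∫ x, v x * (1 + (n + 1 : ℝ) * Real.sin (f x / (n + 1))) ^ 2 ∂ν)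
      atTop (𝓝 (∫ x, v x * φ x ^ 2 ∂ν)) := by
    refine tendsto_integral_of_dominated_convergence (fun x => 2 * (v x * φ x ^ 2) + 8 * v x)
      (fun n => ?_) ((hvφ.const_mul 2).add (hv.integrable.restrict.const_mul 8))
      (fun n => .of_forall fun x => ?_) (.of_forall fun x => ?_)
    · exact hvm.mul ((aestronglyMeasurable_const.add ((Real.continuous_sin.comp_aestronglyMeasurable
        (hfm.div₀ aestronglyMeasurable_const)).const_mul _)).pow 2)
    · have hn : (0 : ℝ) < n + 1 := by positivity
      rw [norm_mul, Real.norm_of_nonneg (hv.nonneg x), norm_pow, Real.norm_eq_abs, sq_abs]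
      have h1 := abs_mul_sin_div_le hn (f x)
      have h2 : |f x| ≤ |φ x| + 1 := by
        rw [hf]
        refine (abs_sub _ _).trans ?_
        simp
      have h3 : |1 + (n + 1 : ℝ) * Real.sin (f x / (n + 1))| ≤ 2 + |φ x| := by
        refine (abs_add_le _ _).trans ?_
        rw [abs_one]; linarith
      have h4 := pow_le_pow_left₀ (abs_nonneg _) h3 2
      rw [sq_abs] at h4
      have h5 : (2 + |φ x|) ^ 2 ≤ 2 * φ x ^ 2 + 8 := by
        nlinarith [sq_abs (φ x), sq_nonneg (|φ x| - 2)]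
      have := mul_le_mul_of_nonneg_left (h4.trans h5) (hv.nonneg x)
      linarith
    · have h1 : Tendsto (fun n : ℕ => f x / ((n : ℝ) + 1)) atTop (𝓝 0) :=
        tendsto_const_nhds.div_atTop (tendsto_atTop_add_const_right _ _ tendsto_natCast_atTop_atTop)
      have h2 : Tendsto (fun n : ℕ => (n + 1 : ℝ) * Real.sin (f x / (n + 1))) atTop (𝓝 (f x)) := by
        have h3 : ∀ n : ℕ,
            (n + 1 : ℝ) * Real.sin (f x / (n + 1)) = f x * Real.sinc (f x / (n + 1)) :=
          fun n => mul_sin_div _ _ (by positivity)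
        simp only [h3]
        have := ((Real.continuous_sinc.tendsto 0).comp h1).const_mul (f x)
        simpa using this
      have h4 : φ x = 1 + f x := by simp [hf]
      rw [h4]
      exact ((h2.const_add 1).pow 2).const_mul _
  exact ge_of_tendsto' (((hlimM.const_mul (1 / 2)).const_add _ |>.const_mul (t ^ 2)).add_const _)
    fun n => hstep (n + 1) (by positivity)

/-- The quantity `(1/8π) ∫ v (1 - ω)` is at most the scattering length. -/
theorem half_integral_vone_le_scatteringLength (hv : IsPotential v R)
    (hω : IsScatteringSolution v ω) {r : ℝ} (hr : R < r) (ha : 0 < scatteringLength v r) :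
    1 / 2 * ∫ x, vone v ω x ≤ 4 * π * scatteringLength v r := by
  have hr0 : 0 < r := hv.range_pos.trans hr
  have hpi := Real.pi_pos
  set I := (scatteringEnergy v r).toReal with hI
  have hI0 : 0 ≤ I := ENNReal.toReal_nonneg
  have hIpos : 0 < I := by
    refine lt_of_le_of_ne hI0 fun h => ?_
    rw [scatteringLength, ← hI, ← h] at ha
    simp at ha
  have htop : scatteringEnergy v r ≠ ⊤ := fun h => by rw [hI, h] at hIpos; simp at hIpos
  set t := 4 * π * r / (I + 4 * π * r) with ht
  have ht0 : 0 < t := by positivity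
  have hle : ofReal ((1 / 2 * (∫ x, vone v ω x) - (1 - t) ^ 2 * (4 * π * r)) / t ^ 2) ≤
      scatteringEnergy v r := by
    refine le_iInf fun φ => le_iInf fun G => le_iInf fun h => ?_
    by_cases hE : ∫⁻ x in Metric.ball 0 r, ofReal (‖G x‖ ^ 2 + 1 / 2 * v x * φ x ^ 2) = ⊤
    · rw [hE]; exact le_top
    · rw [ENNReal.ofReal_le_iff_le_toReal hE, div_le_iff₀ (by positivity)]
      have := half_integral_vone_le_of_isH10 hv hω hr h hE t
      linarith
  rw [ENNReal.ofReal_le_iff_le_toReal htop, ← hI, div_le_iff₀ (by positivity)] at hle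
  have e : I * t ^ 2 + (1 - t) ^ 2 * (4 * π * r) = 4 * π * scatteringLength v r := by
    rw [scatteringLength, ← hI, ht]
    field_simp
    ring
  linarith

/-- The scattering length is at most a constant multiple of the range. -/
theorem exists_scatteringLength_le : ∃ C : ℝ, 0 < C ∧ ∀ (v : E3 → ℝ) (R r : ℝ), IsPotential v R →
    R < r → scatteringLength v r ≤ C * R := by
  let f : ContDiffBump (0 : E3) := ⟨1, 2, by norm_num, by norm_num⟩
  have hft : IsTestFunction Set.univ (f : E3 → ℝ) :=
    ⟨f.contDiff, f.hasCompactSupport, Set.subset_univ _⟩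
  set c := ∫ x, ‖∇ (f : E3 → ℝ) x‖ ^ 2 with hc
  have hc0 : 0 ≤ c := integral_nonneg fun x => sq_nonneg _
  have hpi := Real.pi_pos
  refine ⟨2 + c, by positivity, fun v R r hv hr => ?_⟩
  have hR := hv.range_pos
  have hr0 := hR.trans hr
  rcases le_or_gt r (2 * R) with h2 | h2
  · have := (scatteringLength_spec v hr0).1
    nlinarith
  set g : E3 → ℝ := fun x => f (R⁻¹ • x) with hg
  have hgs : ContDiff ℝ (⊤ : ℕ∞) g := f.contDiff.comp (contDiff_const_smul _)
  have hsupp : tsupport g ⊆ Metric.closedBall 0 (2 * R) := by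
    refine closure_minimal (fun x hx => ?_) Metric.isClosed_closedBall
    have h3 : R⁻¹ • x ∈ Metric.ball (0 : E3) 2 := by
      have : R⁻¹ • x ∈ Function.support f := hx
      rwa [f.support_eq] at this
    rw [mem_ball_zero_iff, norm_smul, norm_inv, Real.norm_of_nonneg hR.le,
      inv_mul_lt_iff₀ hR] at h3
    rw [mem_closedBall_zero_iff]; linarith
  have hgc : HasCompactSupport g :=
    HasCompactSupport.of_support_subset_isCompact (isCompact_closedBall 0 (2 * R))
      (subset_closure.trans hsupp)
  have hgt : IsTestFunction (Metric.ball 0 r) g :=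
    ⟨hgs, hgc, hsupp.trans (Metric.closedBall_subset_ball h2)⟩
  set η : E3 → ℝ := fun x => -g x with hη
  have hηt : IsTestFunction (Metric.ball 0 r) η := by
    refine ⟨hgs.neg, hgc.neg, ?_⟩
    refine (closure_mono fun x hx => ?_).trans hgt.support
    simpa [hη] using hx
  have hgrad : ∀ x, ‖∇ η x‖ ^ 2 = (R⁻¹) ^ 2 * ‖∇ (f : E3 → ℝ) (R⁻¹ • x)‖ ^ 2 := by
    intro x
    have h3 : HasFDerivAt η _ x := ((f.contDiff (n := ⊤)).differentiable (by simp) (R⁻¹ • x)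
      |>.hasFDerivAt.comp x ((hasFDerivAt_id x).const_smul R⁻¹)).neg
    simp only [norm_gradient_sq, mul_sum]
    refine sum_congr rfl fun i _ => ?_
    unfold pd
    rw [h3.fderiv]
    simp
    ring
  have hηI : ∫ x, ‖∇ η x‖ ^ 2 = R * c := by
    simp only [hgrad]
    rw [integral_const_mul, Measure.integral_comp_smul volume (fun x => ‖∇ (f : E3 → ℝ) x‖ ^ 2) R⁻¹,
      ← hc]
    simp [abs_of_pos hR]
    field_simp
  have hle : scatteringEnergy v r ≤ ofReal (R * c) := by
    have hH : IsH10 (Metric.ball 0 r) (fun x => (1 + η x) - 1) (∇ η) := by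
      refine ⟨?_, ?_, fun _ => η, fun _ => hηt, ?_, ?_⟩
      · simp only [add_sub_cancel_left]
        exact (hηt.smooth.continuous.memLp_of_hasCompactSupport hηt.compact).restrict _
      · exact (hηt.continuous_gradient.memLp_of_hasCompactSupport
          hηt.hasCompactSupport_gradient).restrict _
      · simp
      · simp
    have hE : scatteringEnergy v r ≤ ∫⁻ x in Metric.ball 0 r,
        ofReal (‖∇ η x‖ ^ 2 + 1 / 2 * v x * (1 + η x) ^ 2) :=
      iInf_le_of_le (fun x => 1 + η x) (iInf₂_le (∇ η) hH)
    refine hE.trans ?_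
    · rw [← hηI, ofReal_integral_eq_lintegral_ofReal (integrable_norm_gradient_sq
        (hηt.mono (Set.subset_univ _))) (.of_forall fun x => sq_nonneg _)]
      refine (setLIntegral_le_lintegral _ _).trans (lintegral_mono fun x => ENNReal.ofReal_le_ofReal ?_)
      have h6 : v x * (1 + η x) ^ 2 = 0 := by
        by_cases hx : ‖x‖ ≤ R
        · have : f (R⁻¹ • x) = 1 := f.one_of_mem_closedBall (by
            rw [mem_closedBall_zero_iff, norm_smul, norm_inv, Real.norm_of_nonneg hR.le]
            change R⁻¹ * ‖x‖ ≤ 1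
            rw [inv_mul_le_iff₀ hR]; linarith)
          simp [hη, hg, this]
        · rw [hv.finite_range x (not_le.1 hx), zero_mul]
      linarith
  have hI : (scatteringEnergy v r).toReal ≤ R * c :=
    ENNReal.toReal_le_of_le_ofReal (by positivity) hle
  have hI0 : 0 ≤ (scatteringEnergy v r).toReal := ENNReal.toReal_nonneg
  unfold scatteringLength
  generalize (scatteringEnergy v r).toReal = I at hI hI0
  rw [div_le_iff₀ (by positivity)]
  have h7 : 0 ≤ I / r := by positivity
  have h8 : 1 ≤ 4 * π + I / r := by linarith [Real.pi_gt_three]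
  nlinarith [mul_nonneg hc0 hR.le]

end Scattering

/-! ### Averaging and multiplication operators on `L²` -/

section Operators

variable {ι α : Type*} [DecidableEq ι] [MeasurableSpace α]

/-- Bounded measurable functions. -/
def BddMeas {X : Type*} [MeasurableSpace X] (F : X → ℂ) : Prop :=
  Measurable F ∧ ∃ C : ℝ, ∀ x, ‖F x‖ ≤ C

section BddMeas

variable {X : Type*} [MeasurableSpace X] {F G : X → ℂ}

theorem BddMeas.mul (hF : BddMeas F) (hG : BddMeas G) : BddMeas fun x => F x * G x := by
  obtain ⟨a, ha⟩ := hF.2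
  obtain ⟨b, hb⟩ := hG.2
  refine ⟨hF.1.mul hG.1, a * b, fun x => ?_⟩
  rw [norm_mul]
  exact mul_le_mul (ha x) (hb x) (norm_nonneg _) ((norm_nonneg _).trans (ha x))

theorem BddMeas.conj (hF : BddMeas F) : BddMeas fun x => conj (F x) := by
  obtain ⟨a, ha⟩ := hF.2
  exact ⟨Complex.continuous_conj.measurable.comp hF.1, a, fun x => by
    rw [RCLike.norm_conj]; exact ha x⟩

theorem bddMeas_const (c : ℂ) : BddMeas fun _ : X => c := ⟨measurable_const, ‖c‖, fun _ => le_rfl⟩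

theorem BddMeas.comp {Y : Type*} [MeasurableSpace Y] (hF : BddMeas F) {g : Y → X}
    (hg : Measurable g) : BddMeas fun y => F (g y) := by
  obtain ⟨a, ha⟩ := hF.2
  exact ⟨hF.1.comp hg, a, fun y => ha _⟩

theorem BddMeas.memLp (hF : BddMeas F) (ν : Measure X) [IsFiniteMeasure ν] (p : ℝ≥0∞) :
    MemLp F p ν := by
  obtain ⟨a, ha⟩ := hF.2
  exact MemLp.of_bound hF.1.aestronglyMeasurable a (.of_forall ha)

theorem BddMeas.integrable (hF : BddMeas F) (ν : Measure X) [IsFiniteMeasure ν] :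
    Integrable F ν := memLp_one_iff_integrable.1 (hF.memLp ν 1)

theorem BddMeas.memLp_mul (hF : BddMeas F) {ν : Measure X} {f : X → ℂ} (hf : MemLp f 2 ν) :
    MemLp (fun x => F x * f x) 2 ν := by
  obtain ⟨a, ha⟩ := hF.2
  exact hf.of_le_mul (c := a) (hF.1.aestronglyMeasurable.mul hf.aestronglyMeasurable)
    (.of_forall fun x => by
      rw [norm_mul]; exact mul_le_mul_of_nonneg_right (ha x) (norm_nonneg _))

open Classical in
/-- Multiplication by `F` on `L²(ν)`, for bounded measurable `F` (and `0` for other `F`). -/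
def mulOp (ν : Measure X) (F : X → ℂ) : Lp ℂ 2 ν →L[ℂ] Lp ℂ 2 ν :=
  if hF : BddMeas F then
    LinearMap.mkContinuous
      { toFun := fun f => (hF.memLp_mul (Lp.memLp f)).toLp _
        map_add' := fun f g => by
          refine Lp.ext ?_
          filter_upwards [(hF.memLp_mul (Lp.memLp (f + g))).coeFn_toLp,
            (hF.memLp_mul (Lp.memLp f)).coeFn_toLp, (hF.memLp_mul (Lp.memLp g)).coeFn_toLp,
            Lp.coeFn_add f g, Lp.coeFn_add ((hF.memLp_mul (Lp.memLp f)).toLp _)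
              ((hF.memLp_mul (Lp.memLp g)).toLp _)] with x h1 h2 h3 h4 h5
          rw [h1, h5, Pi.add_apply, h2, h3, h4, Pi.add_apply, mul_add]
        map_smul' := fun c f => by
          refine Lp.ext ?_
          filter_upwards [(hF.memLp_mul (Lp.memLp (c • f))).coeFn_toLp,
            (hF.memLp_mul (Lp.memLp f)).coeFn_toLp, Lp.coeFn_smul c f,
            Lp.coeFn_smul c ((hF.memLp_mul (Lp.memLp f)).toLp _)] with x h1 h2 h3 h4
          rw [h1, RingHom.id_apply, h4, Pi.smul_apply, h2, h3, Pi.smul_apply, smul_eq_mul,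
            smul_eq_mul]
          ring }
      hF.2.choose (fun f => by
        refine Lp.norm_le_mul_norm_of_ae_le_mul ?_
        filter_upwards [(hF.memLp_mul (Lp.memLp f)).coeFn_toLp] with x h1
        rw [LinearMap.coe_mk, AddHom.coe_mk, h1, norm_mul]
        exact mul_le_mul_of_nonneg_right (hF.2.choose_spec x) (norm_nonneg _))
  else 0

variable {ν : Measure X}

theorem coeFn_mulOp (hF : BddMeas F) (f : Lp ℂ 2 ν) :
    mulOp ν F f =ᵐ[ν] fun x => F x * f x := by
  rw [mulOp, dif_pos hF]
  exact (hF.memLp_mul (Lp.memLp f)).coeFn_toLp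

theorem mulOp_toLp (hF : BddMeas F) {f : X → ℂ} (hf : MemLp f 2 ν) :
    mulOp ν F (hf.toLp f) = (hF.memLp_mul hf).toLp _ := by
  refine Lp.ext ?_
  filter_upwards [coeFn_mulOp hF (hf.toLp f), hf.coeFn_toLp,
    (hF.memLp_mul hf).coeFn_toLp] with x h1 h2 h3
  rw [h1, h2, h3]

theorem mulOp_mul (hF : BddMeas F) (hG : BddMeas G) :
    mulOp ν F * mulOp ν G = mulOp ν fun x => F x * G x := by
  ext1 f
  refine Lp.ext ?_
  filter_upwards [coeFn_mulOp hF (mulOp ν G f), coeFn_mulOp hG f,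
    coeFn_mulOp (hF.mul hG) f] with x h1 h2 h3
  rw [mul_apply_eq_comp, h1, h2, h3, mul_assoc]

theorem commute_mulOp (hF : BddMeas F) (hG : BddMeas G) : Commute (mulOp ν F) (mulOp ν G) := by
  rw [Commute, SemiconjBy, mulOp_mul hF hG, mulOp_mul hG hF]
  simp only [mul_comm]

theorem inner_mulOp (hF : BddMeas F) (f g : Lp ℂ 2 ν) :
    ⟪f, mulOp ν F g⟫_ℂ = ∫ x, conj (f x) * (F x * g x) ∂ν := by
  rw [L2.inner_def]
  refine integral_congr_ae ?_
  filter_upwards [coeFn_mulOp hF g] with x h1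
  rw [h1, RCLike.inner_apply']

theorem star_mulOp (hF : BddMeas F) : star (mulOp ν F) = mulOp ν fun x => conj (F x) := by
  rw [ContinuousLinearMap.star_eq_adjoint]
  symm
  rw [ContinuousLinearMap.eq_adjoint_iff]
  intro f g
  rw [inner_mulOp hF, L2.inner_def]
  refine integral_congr_ae ?_
  filter_upwards [coeFn_mulOp hF.conj f] with x h1
  rw [h1, RCLike.inner_apply']
  simp only [map_mul, Complex.conj_conj]
  ring

theorem mulOp_const (c : ℂ) : mulOp ν (fun _ => c) = c • (1 : Lp ℂ 2 ν →L[ℂ] Lp ℂ 2 ν) := by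
  ext1 f
  refine Lp.ext ?_
  filter_upwards [coeFn_mulOp (bddMeas_const c) f, Lp.coeFn_smul c f] with x h1 h2
  rw [h1, smul_apply, one_apply_eq_self, h2]
  rfl

/-- Bounded operators on `L²` of a finite measure agree if they agree on bounded functions. -/
theorem clm_ext_bddMeas [IsFiniteMeasure ν] {G : Type*} [NormedAddCommGroup G]
    [NormedSpace ℂ G] {A B : Lp ℂ 2 ν →L[ℂ] G}
    (h : ∀ (f : X → ℂ) (hf : BddMeas f), A ((hf.memLp ν 2).toLp f) = B ((hf.memLp ν 2).toLp f)) :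
    A = B := by
  ext1 f
  refine Lp.induction (by norm_num) (fun f => A f = B f) ?_ ?_ ?_ f
  · intro c s hs hμs
    have hb : BddMeas (s.indicator fun _ => c) := by
      refine ⟨measurable_const.indicator hs, ‖c‖, fun x => ?_⟩
      exact norm_indicator_le_norm_self (f := fun _ => c) (s := s) x
    have e : ((Lp.simpleFunc.indicatorConst 2 hs hμs.ne c : Lp.simpleFunc ℂ 2 ν) : Lp ℂ 2 ν) =
        (hb.memLp ν 2).toLp _ := by
      rw [Lp.simpleFunc.coe_indicatorConst]; rfl
    rw [e]
    exact h _ hb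
  · intro f g hf hg _ h1 h2
    rw [map_add, map_add, h1, h2]
  · exact isClosed_eq A.continuous B.continuous

end BddMeas

variable (μ : Measure α)

/-- The average of `f` over the coordinate `i`. -/
def avg (i : ι) (f : (ι → α) → ℂ) (x : ι → α) : ℂ := ∫ y, f (update x i y) ∂μ

variable {μ}

theorem avg_mul_left (i : ι) {F f : (ι → α) → ℂ} (hF : ∀ x y, F (update x i y) = F x) :
    avg μ i (fun x => F x * f x) = fun x => F x * avg μ i f x := by
  funext x
  simp [avg, hF, integral_const_mul]

theorem avg_update (i : ι) (f : (ι → α) → ℂ) (x : ι → α) (y : α) :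
    avg μ i f (update x i y) = avg μ i f x := by
  simp [avg]

theorem avg_conj (i : ι) (f : (ι → α) → ℂ) (x : ι → α) :
    avg μ i (fun x => conj (f x)) x = conj (avg μ i f x) := by
  unfold avg; exact integral_conj

variable [IsProbabilityMeasure μ]

theorem measurable_update_prod (i : ι) :
    Measurable fun p : (ι → α) × α => update p.1 i p.2 := measurable_update'

theorem BddMeas.slice {f : (ι → α) → ℂ} (hf : BddMeas f) (i : ι) (x : ι → α) :
    BddMeas fun y => f (update x i y) := hf.comp (measurable_update x)

theorem BddMeas.avg {f : (ι → α) → ℂ} (hf : BddMeas f) (i : ι) : BddMeas (avg μ i f) := by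
  obtain ⟨a, ha⟩ := hf.2
  refine ⟨?_, a, fun x => ?_⟩
  · exact ((hf.1.comp (measurable_update_prod i)).stronglyMeasurable.integral_prod_right').measurable
  · refine (norm_integral_le_integral_norm _).trans ?_
    calc ∫ y, ‖f (update x i y)‖ ∂μ ≤ ∫ _y, a ∂μ :=
          integral_mono ((hf.slice i x).integrable μ).norm (integrable_const a) fun y => ha _
      _ = a := by simp

theorem avg_avg (i : ι) (f : (ι → α) → ℂ) : avg μ i (avg μ i f) = avg μ i f := by
  funext x
  simp [avg]

theorem avg_comm {f : (ι → α) → ℂ} (hf : BddMeas f) (i j : ι) :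
    avg μ i (avg μ j f) = avg μ j (avg μ i f) := by
  rcases eq_or_ne i j with rfl | hij
  · rfl
  funext x
  unfold avg
  rw [integral_integral_swap]
  · simp only [Function.update_comm hij]
  · refine BddMeas.integrable (F := Function.uncurry fun y z =>
      f (update (update x i y) j z)) ?_ _
    exact hf.comp ((measurable_update_prod j).comp
      (((measurable_update x).comp measurable_fst).prodMk measurable_snd))

variable (μ) in
/-- The measure `ν` is invariant under averaging over the coordinate `i`: resampling that coordinate
from `μ` preserves `ν`. -/
def Resampling (ν : Measure (ι → α)) (i : ι) : Prop :=
  MeasurePreserving (fun p : (ι → α) × α => update p.1 i p.2) (ν.prod μ) ν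

variable {ν : Measure (ι → α)} [IsFiniteMeasure ν]

theorem Resampling.integral_avg {i : ι} (h : Resampling μ ν i) {f : (ι → α) → ℂ} (hf : BddMeas f) :
    ∫ x, avg μ i f x ∂ν = ∫ x, f x ∂ν := by
  unfold avg
  rw [integral_integral (f := fun x y => f (update x i y))
    ((hf.comp (measurable_update_prod i)).integrable _)]
  conv_rhs => rw [← h.map_eq]
  rw [integral_map h.measurable.aemeasurable hf.1.aestronglyMeasurable]

open Classical in
variable (μ ν) in
/-- Averaging over the coordinate `i` as an operator on `L²(ν)`, for `ν` invariant under
resampling (and `0` for other `ν`). -/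
def avgOp (i : ι) : Lp ℂ 2 ν →L[ℂ] Lp ℂ 2 ν :=
  if h : Resampling μ ν i then
    ContinuousLinearMap.adjoint (Lp.compMeasurePreservingₗᵢ ℂ (E := ℂ) (p := 2) Prod.fst
        (measurePreserving_fst (μ := ν) (ν := μ))).toContinuousLinearMap ∘L
      (Lp.compMeasurePreservingₗᵢ ℂ (E := ℂ) (p := 2) _ h).toContinuousLinearMap
  else 0

theorem inner_avgOp {i : ι} (h : Resampling μ ν i) (f g : Lp ℂ 2 ν) :
    ⟪g, avgOp μ ν i f⟫_ℂ = ∫ x, avg μ i f x * conj (g x) ∂ν := by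
  have hint : Integrable (fun p : (ι → α) × α => f (update p.1 i p.2) * conj (g p.1))
      (ν.prod μ) := by
    have h1 := (Lp.memLp f).comp_measurePreserving h
    have h2 := ((Lp.memLp g).comp_measurePreserving (measurePreserving_fst (μ := ν) (ν := μ))).star
    exact h1.integrable_mul h2
  rw [avgOp, dif_pos h, ContinuousLinearMap.comp_apply, ContinuousLinearMap.adjoint_inner_right,
    L2.inner_def]
  calc _ = ∫ p : (ι → α) × α, f (update p.1 i p.2) * conj (g p.1) ∂(ν.prod μ) := by
        refine integral_congr_ae ?_
        filter_upwards [Lp.coeFn_compMeasurePreserving f h,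
          Lp.coeFn_compMeasurePreserving g (measurePreserving_fst (μ := ν) (ν := μ))] with p h1 h2
        change ⟪(Lp.compMeasurePreserving _ _ g : _ → ℂ) p,
          (Lp.compMeasurePreserving _ _ f : _ → ℂ) p⟫_ℂ = _
        rw [h1, h2]
        rfl
    _ = _ := by
        rw [integral_prod _ hint]
        simp only [integral_mul_const, avg]

theorem avgOp_toLp {i : ι} (h : Resampling μ ν i) {f : (ι → α) → ℂ} (hf : BddMeas f) :
    avgOp μ ν i ((hf.memLp ν 2).toLp f) = ((hf.avg i).memLp ν 2).toLp (avg μ i f) := by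
  refine ext_inner_left ℂ fun g => ?_
  rw [inner_avgOp h, L2.inner_def]
  refine integral_congr_ae ?_
  have h0 : ∀ᵐ p ∂(ν.prod μ), ((hf.memLp ν 2).toLp f) (update p.1 i p.2) =
      f (update p.1 i p.2) := h.quasiMeasurePreserving.ae (hf.memLp ν 2).coeFn_toLp
  filter_upwards [Measure.ae_ae_of_ae_prod h0,
    ((hf.avg (μ := μ) i).memLp ν 2).coeFn_toLp] with x h1 h2
  rw [h2]
  have : avg μ i ((hf.memLp ν 2).toLp f) x = avg μ i f x := integral_congr_ae h1
  rw [this]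
  rfl

theorem coeFn_avgOp {i : ι} (h : Resampling μ ν i) (f : Lp ℂ 2 ν) :
    avgOp μ ν i f =ᵐ[ν] avg μ i f := by
  have hf : Integrable (fun p : (ι → α) × α => f (update p.1 i p.2)) (ν.prod μ) :=
    h.integrable_comp_of_integrable ((Lp.memLp f).integrable (by norm_num))
  have hI : Integrable (avg μ i f) ν := hf.integral_prod_left
  refine Integrable.ae_eq_of_forall_setIntegral_eq _ _ ((Lp.memLp _).integrable (by norm_num)) hI
    fun s hs _ => ?_
  have hb : MemLp (s.indicator fun _ => (1 : ℂ)) 2 ν :=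
    memLp_indicator_const 2 hs 1 (Or.inr (measure_ne_top _ _))
  have h1 := inner_avgOp h f (hb.toLp _)
  rw [L2.inner_def] at h1
  rw [← integral_indicator hs, ← integral_indicator hs]
  calc _ = ∫ x, ⟪(hb.toLp _ : _ → ℂ) x, avgOp μ ν i f x⟫_ℂ ∂ν := by
        refine integral_congr_ae ?_
        filter_upwards [hb.coeFn_toLp] with x hx
        rw [hx, RCLike.inner_apply']
        by_cases hxs : x ∈ s <;> simp [hxs]
    _ = _ := by
        rw [h1]
        refine integral_congr_ae ?_
        filter_upwards [hb.coeFn_toLp] with x hx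
        rw [hx]
        by_cases hxs : x ∈ s <;> simp [hxs]

theorem avgOp_mul_self {i : ι} (h : Resampling μ ν i) :
    avgOp μ ν i * avgOp μ ν i = avgOp μ ν i := by
  refine clm_ext_bddMeas fun f hf => ?_
  rw [mul_apply_eq_comp, avgOp_toLp h hf, avgOp_toLp h (hf.avg i)]
  simp only [avg_avg]

theorem commute_avgOp {i j : ι} (hi : Resampling μ ν i) (hj : Resampling μ ν j) :
    Commute (avgOp μ ν i) (avgOp μ ν j) := by
  refine clm_ext_bddMeas fun f hf => ?_
  rw [mul_apply_eq_comp, mul_apply_eq_comp, avgOp_toLp hi hf,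
    avgOp_toLp hj hf, avgOp_toLp hi (hf.avg j), avgOp_toLp hj (hf.avg i)]
  simp only [avg_comm hf i j]

theorem isSelfAdjoint_avgOp {i : ι} (h : Resampling μ ν i) : IsSelfAdjoint (avgOp μ ν i) := by
  rw [isSelfAdjoint_iff, ContinuousLinearMap.star_eq_adjoint]
  refine clm_ext_bddMeas fun f hf => ?_
  refine ext_inner_right ℂ fun g => ?_
  rw [ContinuousLinearMap.adjoint_inner_left]
  have H : innerSL ℂ ((hf.memLp ν 2).toLp f) ∘L avgOp μ ν i =
      innerSL ℂ (avgOp μ ν i ((hf.memLp ν 2).toLp f)) := by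
    refine clm_ext_bddMeas fun g hg => ?_
    have e : ∀ {p q : (ι → α) → ℂ} (hp : BddMeas p) (hq : BddMeas q),
        ⟪(hp.memLp ν 2).toLp p, (hq.memLp ν 2).toLp q⟫_ℂ = ∫ x, conj (p x) * q x ∂ν := by
      intro p q hp hq
      rw [L2.inner_def]
      refine integral_congr_ae ?_
      filter_upwards [(hp.memLp ν 2).coeFn_toLp, (hq.memLp ν 2).coeFn_toLp] with x h1 h2
      rw [h1, h2, RCLike.inner_apply']
    rw [ContinuousLinearMap.comp_apply, innerSL_apply_apply, innerSL_apply_apply,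
      avgOp_toLp h hf, avgOp_toLp h hg, e hf (hg.avg i), e (hf.avg i) hg,
      ← h.integral_avg (hf.conj.mul (hg.avg i)), ← h.integral_avg ((hf.avg i).conj.mul hg)]
    have a1 : avg μ i (fun x => conj (f x) * avg μ i g x) =
        fun x => conj (avg μ i f x) * avg μ i g x := by
      have := avg_mul_left (μ := μ) i (F := avg μ i g) (f := fun x => conj (f x)) (avg_update i g)
      simp only [mul_comm (avg μ i g _)] at this
      rw [this]
      funext x
      rw [avg_conj]
    have a2 : avg μ i (fun x => conj (avg μ i f x) * g x) =
        fun x => conj (avg μ i f x) * avg μ i g x :=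
      avg_mul_left i fun x y => by rw [avg_update]
    rw [a1, a2]
  have := congrArg (fun A => A g) H
  simpa using this

theorem avgOp_mulOp_avgOp {i : ι} (h : Resampling μ ν i) {F : (ι → α) → ℂ} (hF : BddMeas F) :
    avgOp μ ν i * mulOp ν F * avgOp μ ν i = mulOp ν (avg μ i F) * avgOp μ ν i := by
  refine clm_ext_bddMeas fun f hf => ?_
  simp only [mul_apply_eq_comp]
  rw [avgOp_toLp h hf, mulOp_toLp hF, mulOp_toLp (hF.avg i), avgOp_toLp h (hF.mul (hf.avg i))]
  congr 1
  have := avg_mul_left (μ := μ) i (F := avg μ i f) (f := F) (avg_update i f)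
  simp only [mul_comm (F _)]
  rw [this]
  simp only [mul_comm]

theorem commute_avgOp_mulOp {i : ι} (h : Resampling μ ν i) {F : (ι → α) → ℂ} (hF : BddMeas F)
    (hi : ∀ x y, F (update x i y) = F x) : Commute (avgOp μ ν i) (mulOp ν F) := by
  refine clm_ext_bddMeas fun f hf => ?_
  rw [mul_apply_eq_comp, mul_apply_eq_comp, avgOp_toLp h hf,
    mulOp_toLp hF, mulOp_toLp hF, avgOp_toLp h (hF.mul hf)]
  simp only [avg_mul_left i hi]

end Operators

/-! ### Condensate projections and the Bogoliubov inequality -/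

section Abstract

theorem norm_sum_sq_le {H κ : Type*} [SeminormedAddCommGroup H] [Fintype κ] (f : κ → H) :
    ‖∑ i, f i‖ ^ 2 ≤ Fintype.card κ * ∑ i, ‖f i‖ ^ 2 := by
  calc ‖∑ i, f i‖ ^ 2 ≤ (∑ i, ‖f i‖) ^ 2 := pow_le_pow_left₀ (norm_nonneg _) (norm_sum_le _ _) 2
    _ ≤ _ := by
      have := sq_sum_le_card_mul_sum_sq (s := univ) (f := fun i => ‖f i‖)
      simpa using this

variable {H : Type*} [NormedAddCommGroup H] [InnerProductSpace ℂ H]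

theorem re_inner_self (x : H) : (⟪x, x⟫_ℂ).re = ‖x‖ ^ 2 := by
  have := inner_self_eq_norm_sq (𝕜 := ℂ) x
  simpa using this

variable [CompleteSpace H] {κ : Type*}

/-- Commuting orthogonal projections. -/
structure CommProj (P : κ → H →L[ℂ] H) : Prop where
  idem : ∀ i, P i * P i = P i
  selfAdjoint : ∀ i, star (P i) = P i
  comm : ∀ i j, Commute (P i) (P j)

theorem inner_apply_left (A : H →L[ℂ] H) (x y : H) : ⟪A x, y⟫_ℂ = ⟪x, star A y⟫_ℂ := by
  rw [ContinuousLinearMap.star_eq_adjoint, ContinuousLinearMap.adjoint_inner_right]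

variable {P : κ → H →L[ℂ] H}

namespace CommProj

theorem apply_apply (hP : CommProj P) (i : κ) (x : H) : P i (P i x) = P i x := by
  rw [← mul_apply_eq_comp, hP.idem]

theorem apply_comm (hP : CommProj P) (i j : κ) (x : H) : P i (P j x) = P j (P i x) := by
  rw [← mul_apply_eq_comp, ← mul_apply_eq_comp, (hP.comm i j).eq]

theorem inner_left (hP : CommProj P) (i : κ) (x y : H) : ⟪P i x, y⟫_ℂ = ⟪x, P i y⟫_ℂ := by
  rw [inner_apply_left, hP.selfAdjoint]

theorem norm_sq_apply (hP : CommProj P) (i : κ) (x : H) : ‖P i x‖ ^ 2 = (⟪x, P i x⟫_ℂ).re := by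
  rw [← re_inner_self, hP.inner_left, hP.apply_apply]

theorem norm_sq_add (hP : CommProj P) (i : κ) (x : H) :
    ‖P i x‖ ^ 2 + ‖x - P i x‖ ^ 2 = ‖x‖ ^ 2 := by
  have h : ⟪P i x, x - P i x⟫_ℂ = 0 := by
    rw [hP.inner_left, map_sub, hP.apply_apply, sub_self, inner_zero_right]
  have := norm_add_sq_eq_norm_sq_add_norm_sq_of_inner_eq_zero (𝕜 := ℂ) _ _ h
  rw [add_sub_cancel] at this
  linarith

theorem norm_apply_le (hP : CommProj P) (i : κ) (x : H) : ‖P i x‖ ^ 2 ≤ ‖x‖ ^ 2 := by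
  linarith [hP.norm_sq_add i x, sq_nonneg ‖x - P i x‖]

theorem norm_sub_le (hP : CommProj P) (i : κ) (x : H) : ‖x - P i x‖ ^ 2 ≤ ‖x‖ ^ 2 := by
  linarith [hP.norm_sq_add i x, sq_nonneg ‖P i x‖]

theorem norm_sq_apply_apply (hP : CommProj P) (i j : κ) (x : H) :
    ‖P i (P j x)‖ ^ 2 = (⟪P i x, P j x⟫_ℂ).re := by
  rw [← re_inner_self, hP.inner_left, hP.apply_apply, hP.inner_left, hP.apply_comm i j,
    hP.apply_apply, hP.inner_left i, hP.apply_comm i j]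

variable [Fintype κ]

variable [DecidableEq κ]

theorem sum_erase_apply (hP : CommProj P) (j : κ) (x : H) :
    ∑ i ∈ univ.erase j, P i (P j x) = P j ((∑ i, P i) x) - P j x := by
  have h := Finset.sum_erase_add (s := univ) (f := fun i => P i (P j x)) (a := j)
    (Finset.mem_univ j)
  rw [hP.apply_apply] at h
  rw [eq_sub_iff_add_eq, h, sum_apply, map_sum]
  exact sum_congr rfl fun i _ => hP.apply_comm i j x

/-- The pairs of particles in the condensate are counted by `n₀ (n₀ - 1)`, where `n₀ = ∑ P i`. -/
theorem sum_pairs_norm_sq (hP : CommProj P) (x : H) :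
    ∑ j, ∑ i ∈ univ.erase j, ‖P i (P j x)‖ ^ 2 =
      ‖(∑ i, P i) x‖ ^ 2 - ∑ i, ‖P i x‖ ^ 2 := by
  have h1 : ‖(∑ i, P i) x‖ ^ 2 = ∑ j, ∑ i, ‖P i (P j x)‖ ^ 2 := by
    simp only [hP.norm_sq_apply_apply]
    rw [← re_inner_self, sum_apply, sum_inner, Complex.re_sum, Finset.sum_comm]
    refine sum_congr rfl fun i _ => ?_
    rw [inner_sum, Complex.re_sum]
  rw [h1, ← Finset.sum_sub_distrib]
  refine sum_congr rfl fun j _ => ?_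
  rw [← Finset.sum_erase_add (s := univ) (f := fun i => ‖P i (P j x)‖ ^ 2) (a := j)
    (Finset.mem_univ j), hP.apply_apply]
  ring

end CommProj

variable [Fintype κ] [DecidableEq κ]

/-- The Bogoliubov pairing of excitations of momenta `k` and `-k`: here `e i` stands for
multiplication by the plane wave `χ_B(x_i) exp(2πi⟨k, x_i⟩)` in the variable of the `i`-th particle,
and `c` for the Fourier coefficient of the interaction. The bound comes from completing a square,
and from the commutator of `∑ P_i e_i Q_i` with its adjoint being at most the number of particles in
the condensate. -/
theorem bogoliubov_pairing (hP : CommProj P) {e : κ → H →L[ℂ] H}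
    (heP : ∀ i j, i ≠ j → Commute (e i) (P j))
    (hes : ∀ i j, i ≠ j → Commute (e i) (star (e j)))
    (hn : ∀ i x, ‖star (e i) (P i x)‖ ≤ ‖P i x‖) (x : H) (c : ℂ) {τ : ℝ} (hτ : 0 < τ) :
    -(‖c‖ ^ 2 / (4 * τ) * (Fintype.card κ * ∑ i, ‖P i (e i (x - P i x))‖ ^ 2 + ∑ i, ‖P i x‖ ^ 2) +
      τ * (Fintype.card κ * ∑ i, ‖P i (star (e i) (x - P i x))‖ ^ 2)) ≤
    (c * ∑ j, ∑ i ∈ univ.erase j, ⟪P i (P j x),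
      e i (star (e j) ((x - P j x) - P i (x - P j x)))⟫_ℂ).re := by
  set C : κ → H →L[ℂ] H := fun i => P i * e i * (1 - P i) with hC
  set D : κ → H →L[ℂ] H := fun i => P i * star (e i) * (1 - P i) with hD
  have hPs : ∀ i j, i ≠ j → Commute (P i) (star (e j)) := fun i j hij => by
    have := (heP j i hij.symm).star_star
    rw [hP.selfAdjoint] at this
    exact this.symm
  have hPQ : ∀ i, (1 - P i) * P i = 0 := fun i => by rw [sub_mul, one_mul, hP.idem, sub_self]
  have hCD : (∑ i, C i) * (∑ j, D j) = ∑ j, ∑ i ∈ univ.erase j,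
      P i * P j * (e i * star (e j) * ((1 - P i) * (1 - P j))) := by
    rw [mul_sum]
    refine sum_congr rfl fun j _ => ?_
    rw [sum_mul, ← Finset.sum_erase_add _ _ (Finset.mem_univ j)]
    have h0 : C j * D j = 0 := by
      have : C j * D j = P j * e j * ((1 - P j) * P j) * star (e j) * (1 - P j) := by
        simp only [hC, hD, mul_assoc]
      rw [this, hPQ]; simp
    rw [h0, add_zero]
    refine sum_congr rfl fun i hi => ?_
    have hij : i ≠ j := (Finset.mem_erase.1 hi).1
    have c1 : Commute (e i * (1 - P i)) (P j) :=
      (heP i j hij).mul_left (((Commute.one_left _).sub_left (hP.comm i j)))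
    have c2 : Commute (1 - P i) (star (e j)) := (Commute.one_left _).sub_left (hPs i j hij)
    calc C i * D j = P i * ((e i * (1 - P i)) * P j) * star (e j) * (1 - P j) := by
          simp only [hC, hD, mul_assoc]
      _ = P i * P j * e i * ((1 - P i) * star (e j)) * (1 - P j) := by
          rw [c1.eq]; simp only [mul_assoc]
      _ = _ := by rw [c2.eq]; simp only [mul_assoc]
  have hsum : ∑ j, ∑ i ∈ univ.erase j, ⟪P i (P j x),
      e i (star (e j) ((x - P j x) - P i (x - P j x)))⟫_ℂ =
        ⟪star (∑ i, C i) x, (∑ j, D j) x⟫_ℂ := by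
    rw [inner_apply_left, star_star, ← mul_apply_eq_comp, hCD, sum_apply, inner_sum]
    refine sum_congr rfl fun j _ => ?_
    rw [sum_apply, inner_sum]
    refine sum_congr rfl fun i _ => ?_
    rw [hP.inner_left, hP.inner_left, hP.apply_comm j i]
    simp [mul_apply_eq_comp, hP.apply_comm i j, inner_sub_right]
  have hstarC : ∀ i, star (C i) = (1 - P i) * star (e i) * P i := fun i => by
    simp only [hC, star_mul, star_sub, star_one, hP.selfAdjoint, mul_assoc]
  -- the commutator bound
  have hcomm : ‖star (∑ i, C i) x‖ ^ 2 ≤ ‖(∑ i, C i) x‖ ^ 2 + ∑ i, ‖P i x‖ ^ 2 := by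
    have e1 : ‖star (∑ i, C i) x‖ ^ 2 = (⟪x, ((∑ i, C i) * star (∑ i, C i)) x⟫_ℂ).re := by
      rw [← re_inner_self, inner_apply_left, star_star, mul_apply_eq_comp]
    have e2 : ‖(∑ i, C i) x‖ ^ 2 = (⟪x, (star (∑ i, C i) * ∑ i, C i) x⟫_ℂ).re := by
      rw [← re_inner_self, inner_apply_left, mul_apply_eq_comp]
    have e3 : (∑ i, C i) * star (∑ i, C i) - star (∑ i, C i) * ∑ i, C i =
        ∑ i, (C i * star (C i) - star (C i) * C i) := by
      rw [star_sum, Finset.sum_mul_sum, Finset.sum_mul_sum]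
      rw [Finset.sum_comm (f := fun i j => star (C i) * C j), ← Finset.sum_sub_distrib]
      refine sum_congr rfl fun i _ => ?_
      rw [← Finset.sum_sub_distrib]
      rw [Finset.sum_eq_single i]
      · intro j _ hji
        have hij : i ≠ j := hji.symm
        have c1 : Commute (P i) (star (C j)) := by
          rw [hstarC]
          exact (((Commute.one_right _).sub_right (hP.comm i j)).mul_right (hPs i j hij)).mul_right
            (hP.comm i j)
        have c2 : Commute (e i) (star (C j)) := by
          rw [hstarC]
          exact (((Commute.one_right _).sub_right (heP i j hij)).mul_right (hes i j hij)).mul_right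
            (heP i j hij)
        have c3 : Commute (C i) (star (C j)) :=
          (c1.mul_left c2).mul_left ((Commute.one_left _).sub_left c1)
        rw [c3.eq, sub_self]
      · intro h; exact absurd (Finset.mem_univ i) h
    have e4 : (⟪x, ((∑ i, C i) * star (∑ i, C i) - star (∑ i, C i) * ∑ i, C i) x⟫_ℂ).re ≤
        ∑ i, ‖P i x‖ ^ 2 := by
      rw [e3, sum_apply, inner_sum, Complex.re_sum]
      refine sum_le_sum fun i _ => ?_
      have e5 : (⟪x, (C i * star (C i) - star (C i) * C i) x⟫_ℂ).re =
          ‖star (C i) x‖ ^ 2 - ‖C i x‖ ^ 2 := by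
        rw [sub_apply, inner_sub_right, Complex.sub_re, ← re_inner_self, ← re_inner_self,
          inner_apply_left, inner_apply_left, star_star, ← mul_apply_eq_comp,
          ← mul_apply_eq_comp]
      rw [e5]
      have e6 : ‖star (C i) x‖ ^ 2 ≤ ‖P i x‖ ^ 2 := by
        rw [hstarC, mul_apply_eq_comp, mul_apply_eq_comp, sub_apply, one_apply_eq_self]
        exact (hP.norm_sub_le i _).trans (pow_le_pow_left₀ (norm_nonneg _) (hn i x) 2)
      linarith [sq_nonneg ‖C i x‖]
    rw [sub_apply, inner_sub_right, Complex.sub_re, ← e1, ← e2] at e4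
    linarith
  have hCx : ‖(∑ i, C i) x‖ ^ 2 ≤ Fintype.card κ * ∑ i, ‖P i (e i (x - P i x))‖ ^ 2 := by
    rw [sum_apply]
    refine (norm_sum_sq_le _).trans (le_of_eq ?_)
    simp [hC, mul_apply_eq_comp]
  have hDx : ‖(∑ i, D i) x‖ ^ 2 ≤ Fintype.card κ * ∑ i, ‖P i (star (e i) (x - P i x))‖ ^ 2 := by
    rw [sum_apply]
    refine (norm_sum_sq_le _).trans (le_of_eq ?_)
    simp [hD, mul_apply_eq_comp]
  rw [hsum]
  set a := ‖star (∑ i, C i) x‖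
  set d := ‖(∑ i, D i) x‖
  have hre : -(‖c‖ * (a * d)) ≤ (c * ⟪star (∑ i, C i) x, (∑ i, D i) x⟫_ℂ).re := by
    have h1 := Complex.abs_re_le_norm (c * ⟪star (∑ i, C i) x, (∑ i, D i) x⟫_ℂ)
    rw [norm_mul] at h1
    have h2 := mul_le_mul_of_nonneg_left (norm_inner_le_norm (𝕜 := ℂ) (star (∑ i, C i) x)
      ((∑ i, D i) x)) (norm_nonneg c)
    linarith [neg_abs_le (c * ⟪star (∑ i, C i) x, (∑ i, D i) x⟫_ℂ).re]
  have hsq : ‖c‖ * (a * d) ≤ ‖c‖ ^ 2 / (4 * τ) * a ^ 2 + τ * d ^ 2 := by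
    have h : 0 ≤ (‖c‖ * a - 2 * τ * d) ^ 2 / (4 * τ) := by positivity
    have h' : (‖c‖ * a - 2 * τ * d) ^ 2 / (4 * τ) =
        ‖c‖ ^ 2 / (4 * τ) * a ^ 2 + τ * d ^ 2 - ‖c‖ * (a * d) := by field_simp; ring
    linarith
  have h3 := mul_le_mul_of_nonneg_left (hcomm.trans (add_le_add_left hCx _))
    (show 0 ≤ ‖c‖ ^ 2 / (4 * τ) by positivity)
  have h4 := mul_le_mul_of_nonneg_left hDx hτ.le
  linarith

end Abstract

section ManyBody

variable {H : Type*} [NormedAddCommGroup H] [InnerProductSpace ℂ H] [CompleteSpace H]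
variable {κ : Type*} [Fintype κ] [DecidableEq κ] {P : κ → H →L[ℂ] H}

theorem sum_erase_comm (f : κ → κ → ℝ) :
    ∑ j, ∑ i ∈ univ.erase j, f i j = ∑ j, ∑ i ∈ univ.erase j, f j i :=
  Finset.sum_comm' fun i j => by simp [ne_comm]

theorem re_inner_add_self {U : H →L[ℂ] H} (hU : star U = U) (a b : H) :
    (⟪a + b, U (a + b)⟫_ℂ).re = (⟪a, U a⟫_ℂ).re + 2 * (⟪a, U b⟫_ℂ).re + (⟪b, U b⟫_ℂ).re := by
  have h : (⟪b, U a⟫_ℂ).re = (⟪a, U b⟫_ℂ).re := by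
    rw [← inner_conj_symm, Complex.conj_re, inner_apply_left, hU]
  simp only [map_add, inner_add_left, inner_add_right, Complex.add_re, h]
  ring

/-- Cauchy–Schwarz for a positive operator. -/
theorem neg_le_re_inner {U : H →L[ℂ] H} (hU : star U = U) (hpos : ∀ y, 0 ≤ (⟪y, U y⟫_ℂ).re)
    (a b : H) {δ : ℝ} (hδ : 0 < δ) :
    -(δ * (⟪a, U a⟫_ℂ).re + δ⁻¹ * (⟪b, U b⟫_ℂ).re) ≤ 2 * (⟪a, U b⟫_ℂ).re := by
  have h := hpos ((δ : ℂ) • a + b)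
  rw [re_inner_add_self hU] at h
  simp only [map_smul, inner_smul_left, inner_smul_right, conj_ofReal, ← mul_assoc,
    ← Complex.ofReal_mul, re_ofReal_mul] at h
  have h2 := mul_nonneg (inv_pos.2 hδ).le h
  have e : δ⁻¹ * (δ * δ * (⟪a, U a⟫_ℂ).re + 2 * (δ * (⟪a, U b⟫_ℂ).re) + (⟪b, U b⟫_ℂ).re) =
      δ * (⟪a, U a⟫_ℂ).re + δ⁻¹ * (⟪b, U b⟫_ℂ).re + 2 * (⟪a, U b⟫_ℂ).re := by
    field_simp
    ring
  linarith

/-- The `c`-number substitution: splitting each one-particle space into the condensate (the range of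
`P i`) and the excitations, the interaction energy is bounded below by a quadratic polynomial in the
number `∑ P i` of condensate particles, up to the energy of excited pairs and an error proportional
to the number of excitations. `T i j` is the interaction of the pair `(i, j)`, `U j` the mean field
it generates, `K i j` and `L i j` the interaction weighted by `1 - ω` and by `(1 - ω) ω`. -/
theorem condensate_lower_bound (hP : CommProj P) {U : κ → H →L[ℂ] H} {K L : κ → κ → H →L[ℂ] H}
    {T : κ → κ → ℝ} {x : H} {c I J u ρ δ B : ℝ} (hδ : 0 < δ) (hρ : 0 ≤ ρ) (hI : 0 ≤ I)
    (hUs : ∀ j, star (U j) = U j) (hUpos : ∀ j y, 0 ≤ (⟪y, U j y⟫_ℂ).re)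
    (hUle : ∀ j y, (⟪y, U j y⟫_ℂ).re ≤ u * ‖y‖ ^ 2)
    (hPUP : ∀ j, P j * U j * P j = (I : ℂ) • P j)
    (hPU : ∀ i j, i ≠ j → Commute (P i) (U j))
    (hPKP : ∀ i j, i ≠ j → P i * K i j * P i = (c : ℂ) • (U j * P i))
    (hK : ∀ i j, K i j = K j i)
    (hL : ∀ i j, i ≠ j → (⟪P i (P j x), L i j (P i (P j x))⟫_ℂ).re = c * J * ‖P i (P j x)‖ ^ 2)
    (hT : ∀ i j, i ≠ j → 2 * (⟪P i (P j x), K i j x⟫_ℂ).re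
      - (⟪P i (P j x), K i j (P i (P j x))⟫_ℂ).re
      + (⟪P i (P j x), L i j (P i (P j x))⟫_ℂ).re ≤ T i j)
    (hB : -B ≤ (∑ j, ∑ i ∈ univ.erase j,
      ⟪P i (P j x), K i j ((x - P j x) - P i (x - P j x))⟫_ℂ).re) :
    1 / 2 * c * (I + J) * (‖(∑ i, P i) x‖ ^ 2 - ∑ i, ‖P i x‖ ^ 2) - ρ * I * ∑ i, ‖P i x‖ ^ 2
      - δ * I * Fintype.card κ * ‖(c : ℂ) • ((∑ i, P i) x - x) - (ρ : ℂ) • x‖ ^ 2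
      - (δ⁻¹ + ρ) * u * ∑ i, ‖x - P i x‖ ^ 2 - B ≤
    -ρ * ∑ j, (⟪x, U j x⟫_ℂ).re + 1 / 2 * ∑ j, ∑ i ∈ univ.erase j, T i j := by
  set N := ∑ i, P i
  set y := (c : ℂ) • (N x - x) - (ρ : ℂ) • x with hy
  -- matrix elements of `K`
  have hKP : ∀ i j, i ≠ j → ∀ z, ⟪P i (P j x), K i j (P i z)⟫_ℂ = c * ⟪P i (P j x), U j z⟫_ℂ := by
    intro i j hij z
    have h1 : P i (K i j (P i z)) = (c : ℂ) • U j (P i z) := by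
      have := congrArg (fun A : H →L[ℂ] H => A z) (hPKP i j hij)
      simpa [mul_apply_eq_comp] using this
    have h2 : U j (P i z) = P i (U j z) := by
      have := congrArg (fun A : H →L[ℂ] H => A z) (hPU i j hij).eq
      simpa [mul_apply_eq_comp] using this.symm
    rw [hP.inner_left, h1, h2, inner_smul_right, ← hP.inner_left]
  have hUP : ∀ j z w, ⟪P j z, U j (P j w)⟫_ℂ = I * ⟪P j z, w⟫_ℂ := by
    intro j z w
    have h1 : P j (U j (P j w)) = (I : ℂ) • P j w := by
      have := congrArg (fun A : H →L[ℂ] H => A w) (hPUP j)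
      simpa [mul_apply_eq_comp] using this
    rw [hP.inner_left, h1, inner_smul_right, ← hP.inner_left]
  have hKpp : ∀ i j, i ≠ j →
      (⟪P i (P j x), K i j (P i (P j x))⟫_ℂ).re = c * I * ‖P i (P j x)‖ ^ 2 := by
    intro i j hij
    rw [hKP i j hij, hP.apply_comm i j, hUP]
    have h3 : ⟪P j (P i x), x⟫_ℂ = ⟪P i (P j x), P i (P j x)⟫_ℂ := by
      rw [hP.inner_left, hP.inner_left, hP.inner_left i, hP.apply_apply, hP.inner_left j,
        hP.apply_comm i j, hP.apply_apply, hP.apply_comm j i]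
    rw [h3, ← re_inner_self, hP.apply_comm j i, re_ofReal_mul, re_ofReal_mul]
    ring
  set a : κ → κ → ℝ := fun i j => (⟪P i (P j x), K i j (P i (x - P j x))⟫_ℂ).re with ha
  have hsplit : ∀ i j, i ≠ j → c * (I + J) * ‖P i (P j x)‖ ^ 2 + 2 * (a i j + a j i) +
      2 * (⟪P i (P j x), K i j ((x - P j x) - P i (x - P j x))⟫_ℂ).re ≤ T i j := by
    intro i j hij
    refine le_trans (le_of_eq ?_) (hT i j hij)
    have hx : x = P i (P j x) + P i (x - P j x) + P j (x - P i x) +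
        ((x - P j x) - P i (x - P j x)) := by
      rw [map_sub, map_sub, hP.apply_comm j i]; abel
    have h4 : (⟪P i (P j x), K i j x⟫_ℂ).re = (⟪P i (P j x), K i j (P i (P j x))⟫_ℂ).re + a i j +
        a j i + (⟪P i (P j x), K i j ((x - P j x) - P i (x - P j x))⟫_ℂ).re := by
      have h5 := congrArg (fun z => (⟪P i (P j x), K i j z⟫_ℂ).re) hx
      rw [map_add, map_add, map_add, inner_add_right, inner_add_right, inner_add_right,
        Complex.add_re, Complex.add_re, Complex.add_re] at h5
      rw [h5]
      simp only [ha]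
      rw [hK j i, hP.apply_comm j i]
    rw [h4, hKpp i j hij, hL i j hij]
    ring
  have hsumT : c * (I + J) * (‖N x‖ ^ 2 - ∑ i, ‖P i x‖ ^ 2) +
      4 * ∑ j, ∑ i ∈ univ.erase j, a i j - 2 * B ≤
      ∑ j, ∑ i ∈ univ.erase j, T i j := by
    have h1 : ∑ j, ∑ i ∈ univ.erase j, (c * (I + J) * ‖P i (P j x)‖ ^ 2 +
        2 * (a i j + a j i) +
        2 * (⟪P i (P j x), K i j ((x - P j x) - P i (x - P j x))⟫_ℂ).re) ≤
        ∑ j, ∑ i ∈ univ.erase j, T i j :=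
      sum_le_sum fun j _ => sum_le_sum fun i hi =>
        hsplit i j (Finset.mem_erase.1 hi).1
    simp only [sum_add_distrib, ← mul_sum, ← Complex.re_sum] at h1
    rw [hP.sum_pairs_norm_sq, sum_erase_comm fun i j => a j i] at h1
    linarith
  have hsuma : ∀ j, ∑ i ∈ univ.erase j, a i j =
      c * (⟪P j (N x) - P j x, U j (x - P j x)⟫_ℂ).re := by
    intro j
    rw [← hP.sum_erase_apply, sum_inner, Complex.re_sum, mul_sum]
    refine sum_congr rfl fun i hi => ?_
    simp only [ha]
    rw [hKP i j (Finset.mem_erase.1 hi).1, re_ofReal_mul]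
  have hone : ∀ j, (⟪x, U j x⟫_ℂ).re = I * ‖P j x‖ ^ 2 +
      2 * (⟪P j x, U j (x - P j x)⟫_ℂ).re + (⟪x - P j x, U j (x - P j x)⟫_ℂ).re := by
    intro j
    have h1 := re_inner_add_self (hUs j) (P j x) (x - P j x)
    rw [add_sub_cancel, hUP, re_ofReal_mul, hP.inner_left, ← hP.norm_sq_apply] at h1
    exact h1
  have hj : ∀ j, -(δ * I * ‖y‖ ^ 2) - (δ⁻¹ + ρ) * u * ‖x - P j x‖ ^ 2 - ρ * I * ‖P j x‖ ^ 2 ≤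
      -ρ * (⟪x, U j x⟫_ℂ).re + 2 * ∑ i ∈ univ.erase j, a i j := by
    intro j
    rw [hsuma, hone]
    have hPy : P j y = (c : ℂ) • (P j (N x) - P j x) - (ρ : ℂ) • P j x := by
      rw [hy, map_sub, map_smul, map_smul, map_sub]
    have h1 := neg_le_re_inner (hUs j) (hUpos j) (P j y) (x - P j x) hδ
    have h2 : (⟪P j y, U j (x - P j x)⟫_ℂ).re =
        c * (⟪P j (N x) - P j x, U j (x - P j x)⟫_ℂ).re -
          ρ * (⟪P j x, U j (x - P j x)⟫_ℂ).re := by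
      rw [hPy, inner_sub_left, inner_smul_left, inner_smul_left, conj_ofReal,
        conj_ofReal, Complex.sub_re, re_ofReal_mul, re_ofReal_mul]
    have h3 : (⟪P j y, U j (P j y)⟫_ℂ).re ≤ I * ‖y‖ ^ 2 := by
      rw [hUP, re_ofReal_mul, hP.inner_left, ← hP.norm_sq_apply]
      exact mul_le_mul_of_nonneg_left (hP.norm_apply_le j y) hI
    have h4 := hUle j (x - P j x)
    have h5 := mul_le_mul_of_nonneg_left h3 hδ.le
    have h6 := mul_le_mul_of_nonneg_left h4 (add_pos_of_pos_of_nonneg (inv_pos.2 hδ) hρ).le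
    rw [h2] at h1
    linarith
  have hsumj := sum_le_sum fun j (_ : j ∈ univ) => hj j
  simp only [sum_add_distrib, Finset.sum_sub_distrib, ← mul_sum,
    Finset.sum_const, Finset.card_univ, nsmul_eq_mul] at hsumj
  linarith

end ManyBody

/-! ### The localization function -/

section Localization

theorem cube_eq_preimage (ℓ : ℝ) :
    cube ℓ = (WithLp.ofLp : E3 → (Fin 3 → ℝ)) ⁻¹' Set.Icc (fun _ => -(ℓ / 2)) fun _ => ℓ / 2 := by
  ext x
  simp only [cube, Set.mem_ofPred_eq, Set.mem_preimage, Set.mem_Icc, Pi.le_def, abs_le]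
  exact forall_and

theorem isClosed_cube (ℓ : ℝ) : IsClosed (cube ℓ) := by
  rw [cube_eq_preimage]
  exact isClosed_Icc.preimage (PiLp.continuous_ofLp 2 _)

theorem measurableSet_cube (ℓ : ℝ) : MeasurableSet (cube ℓ) := (isClosed_cube ℓ).measurableSet

theorem isCompact_cube (ℓ : ℝ) : IsCompact (cube ℓ) := by
  have h := (isCompact_Icc (a := fun _ : Fin 3 => -(ℓ / 2)) (b := fun _ => ℓ / 2)).image
    (PiLp.continuous_toLp 2 fun _ : Fin 3 => ℝ)
  refine h.of_isClosed_subset (isClosed_cube ℓ) fun x hx => ?_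
  rw [cube_eq_preimage] at hx
  exact ⟨_, hx, rfl⟩

theorem volume_cube {ℓ : ℝ} (hℓ : 0 < ℓ) : volume (cube ℓ) = ofReal (ℓ ^ 3) := by
  rw [cube_eq_preimage, (PiLp.volume_preserving_ofLp (Fin 3)).measure_preimage
    measurableSet_Icc.nullMeasurableSet, Real.volume_Icc_pi]
  simp only [Finset.prod_const, Finset.card_univ, Fintype.card_fin]
  rw [← ENNReal.ofReal_pow (by linarith)]
  congr 2
  ring

variable {χ : E3 → ℝ}

namespace IsLocalization

theorem compact (hχ : IsLocalization χ) : HasCompactSupport χ :=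
  (isCompact_cube 1).of_isClosed_subset (isClosed_tsupport χ) hχ.support

theorem eq_zero (hχ : IsLocalization χ) {x : E3} (hx : x ∉ cube 1) : χ x = 0 :=
  image_eq_zero_of_notMem_tsupport fun h => hx (hχ.support h)

theorem exists_le (hχ : IsLocalization χ) : ∃ X : ℝ, 0 < X ∧ ∀ x, χ x ≤ X := by
  obtain ⟨X, hX⟩ := hχ.compact.exists_bound_of_continuous hχ.smooth.continuous
  exact ⟨max X 1, by positivity, fun x =>
    ((le_abs_self _).trans (hX x)).trans (le_max_left _ _)⟩

theorem integrable_sq (hχ : IsLocalization χ) : Integrable fun x => χ x ^ 2 :=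
  Continuous.integrable_of_hasCompactSupport (hχ.smooth.continuous.pow 2)
    (hχ.compact.comp_left (g := fun t : ℝ => t ^ 2) (zero_pow two_ne_zero))

theorem selfConv_eq (hχ : IsLocalization χ) (z : E3) : selfConv χ z = ∫ x, χ x * χ (x - z) := by
  unfold selfConv convolution
  refine integral_congr_ae (.of_forall fun x => ?_)
  simp only [ContinuousLinearMap.mul_apply']
  rw [← hχ.even (z - x), neg_sub]

theorem one_sub_selfConv (hχ : IsLocalization χ) (z : E3) :
    1 - selfConv χ z = 1 / 2 * ∫ x, (χ x - χ (x - z)) ^ 2 := by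
  have h2 : Integrable fun x => χ (x - z) ^ 2 := hχ.integrable_sq.comp_sub_right z
  have h3 : Integrable fun x => χ x * χ (x - z) :=
    (hχ.smooth.continuous.mul (hχ.smooth.continuous.comp
      (continuous_id.sub continuous_const))).integrable_of_hasCompactSupport hχ.compact.mul_right
  have e : ∀ x, (χ x - χ (x - z)) ^ 2 = χ x ^ 2 - 2 * (χ x * χ (x - z)) + χ (x - z) ^ 2 :=
    fun x => by ring
  have h4 : Integrable fun x => χ x ^ 2 - 2 * (χ x * χ (x - z)) :=
    hχ.integrable_sq.sub (h3.const_mul 2)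
  simp only [e]
  rw [integral_add h4 h2,
    integral_sub hχ.integrable_sq (h3.const_mul 2), integral_const_mul, ← hχ.selfConv_eq,
    integral_sub_right_eq_self (fun x => χ x ^ 2), hχ.integral_sq]
  ring

theorem exists_one_sub_selfConv_le (hχ : IsLocalization χ) :
    ∃ C : ℝ, 0 < C ∧ ∀ z, 1 - selfConv χ z ≤ C * ‖z‖ ^ 2 := by
  obtain ⟨L, hL⟩ := hχ.smooth.lipschitzWith_of_hasCompactSupport hχ.compact (by simp)
  refine ⟨L ^ 2 + 1, by positivity, fun z => ?_⟩
  have hI : Integrable ((cube 1).indicator fun _ => (1 : ℝ)) := by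
    rw [integrable_indicator_iff (measurableSet_cube 1)]
    exact integrableOn_const (by rw [volume_cube one_pos]; simp)
  have hint : ∫ x, (cube 1).indicator (fun _ => (1 : ℝ)) x = 1 := by
    rw [integral_indicator (measurableSet_cube 1)]
    simp [Measure.real, volume_cube one_pos]
  have hle : ∫ x, (χ x - χ (x - z)) ^ 2 ≤ ∫ x, (L ^ 2 * ‖z‖ ^ 2) *
      ((cube 1).indicator (fun _ => (1 : ℝ)) x +
        (cube 1).indicator (fun _ => (1 : ℝ)) (x - z)) := by
    refine integral_mono_of_nonneg (.of_forall fun x => sq_nonneg _)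
      ((hI.add (hI.comp_sub_right z)).const_mul _) (.of_forall fun x => ?_)
    simp only
    by_cases h : x ∈ cube 1 ∨ x - z ∈ cube 1
    · have h1 : (1 : ℝ) ≤ (cube 1).indicator (fun _ => (1 : ℝ)) x +
          (cube 1).indicator (fun _ => (1 : ℝ)) (x - z) := by
        have h0 : ∀ y : E3, 0 ≤ (cube 1).indicator (fun _ => (1 : ℝ)) y :=
          fun y => Set.indicator_nonneg (fun _ _ => zero_le_one) y
        rcases h with h | h
        · rw [Set.indicator_of_mem h]; linarith [h0 (x - z)]
        · rw [Set.indicator_of_mem h]; linarith [h0 x]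
      have h2 : |χ x - χ (x - z)| ≤ L * ‖z‖ := by
        have := hL.dist_le_mul x (x - z)
        rwa [Real.dist_eq, dist_eq_norm, sub_sub_cancel] at this
      have h3 := pow_le_pow_left₀ (abs_nonneg _) h2 2
      rw [sq_abs, mul_pow] at h3
      calc _ ≤ (L ^ 2 * ‖z‖ ^ 2 : ℝ) * 1 := by rw [mul_one]; exact h3
        _ ≤ _ := mul_le_mul_of_nonneg_left h1 (by positivity)
    · push Not at h
      rw [hχ.eq_zero h.1, hχ.eq_zero h.2, Set.indicator_of_notMem h.1, Set.indicator_of_notMem h.2]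
      simp
  rw [integral_const_mul, integral_add hI (hI.comp_sub_right z),
    integral_sub_right_eq_self ((cube 1).indicator fun _ => (1 : ℝ)), hint] at hle
  rw [hχ.one_sub_selfConv]
  nlinarith [sq_nonneg ‖z‖]

theorem chiB_nonneg (hχ : IsLocalization χ) (ℓ : ℝ) (x : E3) : 0 ≤ chiB χ ℓ x := hχ.nonneg _

theorem continuous_chiB (hχ : IsLocalization χ) (ℓ : ℝ) : Continuous (chiB χ ℓ) :=
  hχ.smooth.continuous.comp (continuous_const_smul _)

theorem chiB_eq_zero (hχ : IsLocalization χ) {ℓ : ℝ} (hℓ : 0 < ℓ) {x : E3} (hx : x ∉ cube ℓ) :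
    chiB χ ℓ x = 0 := by
  refine hχ.eq_zero fun h => hx fun i => ?_
  have := h i
  simp only [PiLp.smul_apply, smul_eq_mul, abs_mul, abs_inv, abs_of_pos hℓ] at this
  rw [inv_mul_le_iff₀ hℓ] at this
  linarith

theorem integral_chiB_sq (hχ : IsLocalization χ) {ℓ : ℝ} (hℓ : 0 < ℓ) :
    ∫ x, chiB χ ℓ x ^ 2 = ℓ ^ 3 := by
  unfold chiB
  rw [Measure.integral_comp_smul volume (fun x => χ x ^ 2) ℓ⁻¹, hχ.integral_sq]
  simp [abs_of_pos hℓ]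

theorem integral_chiB_mul (hχ : IsLocalization χ) {ℓ : ℝ} (hℓ : 0 < ℓ) (z : E3) :
    ∫ x, chiB χ ℓ x * chiB χ ℓ (x - z) = ℓ ^ 3 * selfConv χ (ℓ⁻¹ • z) := by
  unfold chiB
  simp only [smul_sub]
  rw [Measure.integral_comp_smul volume (fun x => χ x * χ (x - ℓ⁻¹ • z)) ℓ⁻¹, hχ.selfConv_eq]
  simp [abs_of_pos hℓ]

end IsLocalization

end Localization

/-! ### Pair interactions in the box -/

section Kernel

variable {X : Type*} [MeasurableSpace X] {ν : Measure X}

theorem bddMeas_ofReal {r : X → ℝ} (hr : Measurable r) {C : ℝ} (hC : ∀ x, |r x| ≤ C) :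
    BddMeas fun x => (r x : ℂ) :=
  ⟨Complex.measurable_ofReal.comp hr, C, fun x => by
    rw [norm_real, Real.norm_eq_abs]; exact hC x⟩

theorem star_mulOp_ofReal {r : X → ℝ} (h : BddMeas fun x => (r x : ℂ)) :
    star (mulOp ν fun x => (r x : ℂ)) = mulOp ν fun x => (r x : ℂ) := by
  rw [star_mulOp h]; simp only [conj_ofReal]

theorem re_inner_mulOp_ofReal {r : X → ℝ} (h : BddMeas fun x => (r x : ℂ)) (f g : Lp ℂ 2 ν) :
    (⟪f, mulOp ν (fun x => (r x : ℂ)) g⟫_ℂ).re = ∫ x, r x * (conj (f x) * g x).re ∂ν := by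
  rw [inner_mulOp h]
  have hI : Integrable (fun x => conj (f x) * ((r x : ℂ) * g x)) ν :=
    ((Lp.memLp f).star).integrable_mul (h.memLp_mul (Lp.memLp g))
  have := integral_re hI
  rw [← RCLike.re_eq_complex_re, ← this]
  refine integral_congr_ae (.of_forall fun x => ?_)
  simp only [RCLike.re_eq_complex_re]
  rw [mul_left_comm, re_ofReal_mul]

theorem integrable_mul_re_inner {r : X → ℝ} (h : BddMeas fun x => (r x : ℂ)) (f g : Lp ℂ 2 ν) :
    Integrable (fun x => r x * (conj (f x) * g x).re) ν := by
  have hI : Integrable (fun x => conj (f x) * ((r x : ℂ) * g x)) ν :=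
    ((Lp.memLp f).star).integrable_mul (h.memLp_mul (Lp.memLp g))
  refine hI.re.congr (.of_forall fun x => ?_)
  simp only [RCLike.re_eq_complex_re]
  rw [mul_left_comm, re_ofReal_mul]

theorem conj_mul_self_re (z : ℂ) : (conj z * z).re = ‖z‖ ^ 2 := by
  rw [← Complex.normSq_eq_conj_mul_self, Complex.ofReal_re, Complex.normSq_eq_norm_sq]

theorem norm_sq_eq_integral (f : Lp ℂ 2 ν) : ‖f‖ ^ 2 = ∫ x, ‖f x‖ ^ 2 ∂ν := by
  rw [← re_inner_self, L2.inner_def]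
  have := integral_re (L2.integrable_inner (𝕜 := ℂ) f f)
  rw [← RCLike.re_eq_complex_re, ← this]
  refine integral_congr_ae (.of_forall fun x => ?_)
  simp only [RCLike.re_eq_complex_re]
  rw [RCLike.inner_apply', conj_mul_self_re]

theorem re_inner_mulOp_self_nonneg {r : X → ℝ} (h : BddMeas fun x => (r x : ℂ))
    (h0 : ∀ x, 0 ≤ r x) (f : Lp ℂ 2 ν) : 0 ≤ (⟪f, mulOp ν (fun x => (r x : ℂ)) f⟫_ℂ).re := by
  rw [re_inner_mulOp_ofReal h]
  refine integral_nonneg fun x => ?_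
  rw [conj_mul_self_re]
  exact mul_nonneg (h0 x) (sq_nonneg _)

theorem re_inner_mulOp_self_le {r : X → ℝ} (h : BddMeas fun x => (r x : ℂ)) {u : ℝ}
    (hu : ∀ x, r x ≤ u) (f : Lp ℂ 2 ν) :
    (⟪f, mulOp ν (fun x => (r x : ℂ)) f⟫_ℂ).re ≤ u * ‖f‖ ^ 2 := by
  rw [re_inner_mulOp_ofReal h, norm_sq_eq_integral, ← integral_const_mul]
  refine integral_mono (integrable_mul_re_inner h f f)
    (((Lp.memLp f).integrable_norm_pow (by norm_num)).const_mul u) fun x => ?_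
  simp only
  rw [conj_mul_self_re]
  exact mul_le_mul_of_nonneg_right (hu x) (sq_nonneg _)

/-- The pair potential `χ(x) k(x - y) χ(y)`. -/
def pairKer (χ k : E3 → ℝ) (x y : E3) : ℝ := χ x * k (x - y) * χ y

/-- The mean field `∫ χ(x) k(x - y) χ(y) dy` of the pair potential. -/
def meanField (χ k : E3 → ℝ) (x : E3) : ℝ := ∫ y, pairKer χ k x y

/-- Bounded, even, integrable and non-negative interaction kernels. -/
structure IsKernel (k : E3 → ℝ) : Prop where
  meas : Measurable k
  nonneg : ∀ x, 0 ≤ k x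
  even : ∀ x, k (-x) = k x
  bdd : ∃ M, ∀ x, k x ≤ M
  int : Integrable k

/-- Bounded measurable non-negative weights that vanish outside the box. -/
structure IsWeight (ℓ X : ℝ) (χ : E3 → ℝ) : Prop where
  meas : Measurable χ
  nonneg : ∀ x, 0 ≤ χ x
  le : ∀ x, χ x ≤ X
  supp : ∀ x, x ∉ cube ℓ → χ x = 0

variable {χ k : E3 → ℝ} {ℓ X : ℝ}

theorem IsWeight.bound_nonneg (hχ : IsWeight ℓ X χ) : 0 ≤ X := (hχ.nonneg 0).trans (hχ.le 0)

theorem pairKer_nonneg (hχ : IsWeight ℓ X χ) (hk : IsKernel k) (x y : E3) :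
    0 ≤ pairKer χ k x y := mul_nonneg (mul_nonneg (hχ.nonneg _) (hk.nonneg _)) (hχ.nonneg _)

theorem pairKer_symm (hk : IsKernel k) (x y : E3) : pairKer χ k x y = pairKer χ k y x := by
  unfold pairKer
  rw [← hk.even (y - x), neg_sub]; ring

theorem pairKer_le (hχ : IsWeight ℓ X χ) (hk : IsKernel k) (x y : E3) :
    pairKer χ k x y ≤ X ^ 2 * k (x - y) := by
  have h1 := mul_le_mul (hχ.le x) (hχ.le y) (hχ.nonneg y) hχ.bound_nonneg
  have h2 := mul_le_mul_of_nonneg_right h1 (hk.nonneg (x - y))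
  unfold pairKer
  linarith

theorem measurable_pairKer (hχ : IsWeight ℓ X χ) (hk : IsKernel k) :
    Measurable fun p : E3 × E3 => pairKer χ k p.1 p.2 :=
  ((hχ.meas.comp measurable_fst).mul (hk.meas.comp (measurable_fst.sub measurable_snd))).mul
    (hχ.meas.comp measurable_snd)

theorem integrable_pairKer (hχ : IsWeight ℓ X χ) (hk : IsKernel k) (x : E3) :
    Integrable (pairKer χ k x) := by
  refine ((hk.int.comp_sub_left x).const_mul (X ^ 2)).mono'
    ((measurable_pairKer hχ hk).comp (measurable_const.prodMk measurable_id)).aestronglyMeasurable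
    (.of_forall fun y => ?_)
  rw [Real.norm_of_nonneg (pairKer_nonneg hχ hk x y)]
  exact pairKer_le hχ hk x y

theorem measurable_meanField (hχ : IsWeight ℓ X χ) (hk : IsKernel k) :
    Measurable (meanField χ k) :=
  ((measurable_pairKer hχ hk).stronglyMeasurable.integral_prod_right').measurable

theorem meanField_nonneg (hχ : IsWeight ℓ X χ) (hk : IsKernel k) (x : E3) :
    0 ≤ meanField χ k x := integral_nonneg fun y => pairKer_nonneg hχ hk x y

theorem meanField_le (hχ : IsWeight ℓ X χ) (hk : IsKernel k) (x : E3) :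
    meanField χ k x ≤ X ^ 2 * ∫ z, k z := by
  unfold meanField
  rw [← integral_sub_left_eq_self k volume x, ← integral_const_mul]
  exact integral_mono (integrable_pairKer hχ hk x) ((hk.int.comp_sub_left x).const_mul _)
    fun y => pairKer_le hχ hk x y

theorem bddMeas_meanField (hχ : IsWeight ℓ X χ) (hk : IsKernel k) :
    BddMeas fun x => (meanField χ k x : ℂ) :=
  bddMeas_ofReal (measurable_meanField hχ hk) fun x => by
    rw [abs_of_nonneg (meanField_nonneg hχ hk x)]; exact meanField_le hχ hk x

/-- The normalized Lebesgue measure on the box. -/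
def boxMeasure (ℓ : ℝ) : Measure E3 := ofReal (ℓ ^ 3)⁻¹ • volume.restrict (cube ℓ)

theorem isProbabilityMeasure_boxMeasure (hℓ : 0 < ℓ) : IsProbabilityMeasure (boxMeasure ℓ) := by
  constructor
  have h3 : 0 < ℓ ^ 3 := by positivity
  rw [boxMeasure, Measure.smul_apply, Measure.restrict_apply_univ, volume_cube hℓ, smul_eq_mul,
    ← ofReal_mul (by positivity), inv_mul_cancel₀ h3.ne', ENNReal.ofReal_one]

theorem boxMeasure_absolutelyContinuous (ℓ : ℝ) : boxMeasure ℓ ≪ volume :=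
  (Measure.absolutelyContinuous_of_le Measure.restrict_le_self).smul_left _

theorem integral_boxMeasure {F : Type*} [NormedAddCommGroup F] [NormedSpace ℝ F] (hℓ : 0 < ℓ)
    (g : E3 → F) : ∫ x, g x ∂(boxMeasure ℓ) = (ℓ ^ 3)⁻¹ • ∫ x in cube ℓ, g x := by
  rw [boxMeasure, integral_smul_measure, ENNReal.toReal_ofReal (by positivity)]

theorem integral_boxMeasure_of_eq_zero {F : Type*} [NormedAddCommGroup F] [NormedSpace ℝ F]
    (hℓ : 0 < ℓ) {g : E3 → F} (hg : ∀ x, x ∉ cube ℓ → g x = 0) :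
    ∫ x, g x ∂(boxMeasure ℓ) = (ℓ ^ 3)⁻¹ • ∫ x, g x := by
  rw [integral_boxMeasure hℓ, setIntegral_eq_integral_of_forall_compl_eq_zero hg]

theorem integral_pairKer_left (hℓ : 0 < ℓ) (hχ : IsWeight ℓ X χ) (hk : IsKernel k) (y : E3) :
    ∫ x, pairKer χ k x y ∂(boxMeasure ℓ) = (ℓ ^ 3)⁻¹ * meanField χ k y := by
  rw [integral_boxMeasure_of_eq_zero hℓ fun x hx => by rw [pairKer, hχ.supp x hx]; ring]
  simp only [pairKer_symm hk _ y]
  rfl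

/-- The space average of the mean field is `∫ k(z) ℓ⁻³ (χ * χ)(z) dz`. -/
theorem integral_meanField (hℓ : 0 < ℓ) (hχ : IsWeight ℓ X χ) (hk : IsKernel k)
    (hχ2 : Integrable χ) {S : E3 → ℝ}
    (hS : ∀ z, ∫ x, χ x * χ (x - z) = ℓ ^ 3 * S z) :
    ∫ x, meanField χ k x ∂(boxMeasure ℓ) = ∫ z, k z * S z := by
  have h3 : 0 < ℓ ^ 3 := by positivity
  rw [integral_boxMeasure_of_eq_zero hℓ fun x hx => by simp [meanField, pairKer, hχ.supp x hx]]
  have e1 : ∀ x, meanField χ k x = ∫ z, χ x * k z * χ (x - z) := by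
    intro x
    unfold meanField
    rw [← integral_sub_left_eq_self (pairKer χ k x) volume x]
    simp only [pairKer, sub_sub_cancel]
  simp only [e1]
  rw [integral_integral_swap]
  · have e2 : ∀ z, ∫ x, χ x * k z * χ (x - z) = ℓ ^ 3 * (k z * S z) := by
      intro z
      rw [mul_left_comm, ← hS, ← integral_const_mul]
      refine integral_congr_ae (.of_forall fun x => ?_)
      simp only; ring
    simp only [e2]
    rw [integral_const_mul, smul_eq_mul, inv_mul_cancel_left₀ h3.ne']
  · refine (((hχ2.mul_prod hk.int).mul_const X)).mono' ?_ (.of_forall fun p => ?_)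
    · exact (((hχ.meas.comp measurable_fst).mul (hk.meas.comp measurable_snd)).mul
        (hχ.meas.comp (measurable_fst.sub measurable_snd))).aestronglyMeasurable
    · have h1 := mul_nonneg (hχ.nonneg p.1) (hk.nonneg p.2)
      simp only [Function.uncurry_def]
      rw [Real.norm_of_nonneg (mul_nonneg h1 (hχ.nonneg _))]
      exact mul_le_mul_of_nonneg_left (hχ.le _) h1

end Kernel

section KernelOperators

variable {ι : Type*} {χ k : E3 → ℝ} {ℓ X : ℝ}

/-- Multiplication by the pair potential of the particles `i` and `j`. -/
def pairOp (ν : Measure (ι → E3)) (χ k : E3 → ℝ) (i j : ι) : Lp ℂ 2 ν →L[ℂ] Lp ℂ 2 ν :=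
  mulOp ν fun x => (pairKer χ k (x i) (x j) : ℂ)

/-- Multiplication by the mean field at the position of particle `j`. -/
def fieldOp (ν : Measure (ι → E3)) (χ k : E3 → ℝ) (j : ι) : Lp ℂ 2 ν →L[ℂ] Lp ℂ 2 ν :=
  mulOp ν fun x => (meanField χ k (x j) : ℂ)

variable {ν : Measure (ι → E3)}

theorem bddMeas_pair (hχ : IsWeight ℓ X χ) (hk : IsKernel k) (i j : ι) :
    BddMeas fun x : ι → E3 => (pairKer χ k (x i) (x j) : ℂ) := by
  obtain ⟨M, hM⟩ := hk.bdd
  have hm : Measurable fun x : ι → E3 => pairKer χ k (x i) (x j) :=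
    (measurable_pairKer hχ hk).comp (f := fun x : ι → E3 => (x i, x j))
      ((measurable_pi_apply i).prodMk (measurable_pi_apply j))
  refine bddMeas_ofReal (C := X ^ 2 * M) hm fun x => ?_
  rw [abs_of_nonneg (pairKer_nonneg hχ hk _ _)]
  exact (pairKer_le hχ hk _ _).trans (mul_le_mul_of_nonneg_left (hM _) (sq_nonneg X))

theorem bddMeas_field (hχ : IsWeight ℓ X χ) (hk : IsKernel k) (j : ι) :
    BddMeas fun x : ι → E3 => (meanField χ k (x j) : ℂ) :=
  (bddMeas_meanField hχ hk).comp (measurable_pi_apply j)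

theorem pairOp_symm (hk : IsKernel k) (i j : ι) : pairOp ν χ k i j = pairOp ν χ k j i := by
  unfold pairOp
  congr 1; funext x; rw [pairKer_symm hk]

variable [DecidableEq ι] [IsFiniteMeasure ν] [IsProbabilityMeasure (boxMeasure ℓ)]

theorem avgOp_pairOp_avgOp (hℓ : 0 < ℓ) (hχ : IsWeight ℓ X χ) (hk : IsKernel k) {i j : ι}
    (hij : i ≠ j) (hi : Resampling (boxMeasure ℓ) ν i) :
    avgOp (boxMeasure ℓ) ν i * pairOp ν χ k i j * avgOp (boxMeasure ℓ) ν i =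
      (((ℓ ^ 3)⁻¹ : ℝ) : ℂ) • (fieldOp ν χ k j * avgOp (boxMeasure ℓ) ν i) := by
  unfold pairOp fieldOp
  rw [avgOp_mulOp_avgOp hi (bddMeas_pair hχ hk i j)]
  have e : avg (boxMeasure ℓ) i (fun x : ι → E3 => (pairKer χ k (x i) (x j) : ℂ)) =
      fun x => (((ℓ ^ 3)⁻¹ : ℝ) : ℂ) * (meanField χ k (x j) : ℂ) := by
    funext x
    unfold avg
    simp only [Function.update_self, Function.update_of_ne hij.symm]
    rw [integral_complex_ofReal, integral_pairKer_left hℓ hχ hk]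
    push_cast; rfl
  rw [e, ← mulOp_mul (bddMeas_const _) (bddMeas_field hχ hk j), mulOp_const, smul_mul_assoc,
    one_mul, smul_mul_assoc]

theorem avgOp_fieldOp_avgOp (hℓ : 0 < ℓ) (hχ : IsWeight ℓ X χ) (hk : IsKernel k)
    (hχ2 : Integrable χ) {S : E3 → ℝ} (hS : ∀ z, ∫ x, χ x * χ (x - z) = ℓ ^ 3 * S z) {j : ι}
    (hj : Resampling (boxMeasure ℓ) ν j) :
    avgOp (boxMeasure ℓ) ν j * fieldOp ν χ k j * avgOp (boxMeasure ℓ) ν j =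
      ((∫ z, k z * S z : ℝ) : ℂ) • avgOp (boxMeasure ℓ) ν j := by
  unfold fieldOp
  rw [avgOp_mulOp_avgOp hj (bddMeas_field hχ hk j)]
  have e : avg (boxMeasure ℓ) j (fun x : ι → E3 => (meanField χ k (x j) : ℂ)) =
      fun _ => ((∫ z, k z * S z : ℝ) : ℂ) := by
    funext x
    unfold avg
    simp only [Function.update_self]
    rw [integral_complex_ofReal, integral_meanField hℓ hχ hk hχ2 hS]
  rw [e, mulOp_const, smul_mul_assoc, one_mul]

theorem commute_avgOp_fieldOp (hχ : IsWeight ℓ X χ) (hk : IsKernel k) {i j : ι}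
    (hij : i ≠ j) (hi : Resampling (boxMeasure ℓ) ν i) :
    Commute (avgOp (boxMeasure ℓ) ν i) (fieldOp ν χ k j) :=
  commute_avgOp_mulOp hi (bddMeas_field hχ hk j) fun x y => by
    rw [Function.update_of_ne hij.symm]

theorem commProj_avgOp {κ : Type*} {σ : κ → ι}
    (h : ∀ i, Resampling (boxMeasure ℓ) ν (σ i)) :
    CommProj fun i => avgOp (boxMeasure ℓ) ν (σ i) where
  idem i := avgOp_mul_self (h i)
  selfAdjoint i := isSelfAdjoint_avgOp (h i)
  comm i j := commute_avgOp (h i) (h j)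

theorem re_inner_pairOp_avgOp (hℓ : 0 < ℓ) (hχ : IsWeight ℓ X χ) (hk : IsKernel k)
    (hχ2 : Integrable χ) {S : E3 → ℝ} (hS : ∀ z, ∫ x, χ x * χ (x - z) = ℓ ^ 3 * S z) {i j : ι}
    (hij : i ≠ j) (hi : Resampling (boxMeasure ℓ) ν i) (hj : Resampling (boxMeasure ℓ) ν j)
    (f : Lp ℂ 2 ν) :
    (⟪avgOp (boxMeasure ℓ) ν i (avgOp (boxMeasure ℓ) ν j f),
      pairOp ν χ k i j (avgOp (boxMeasure ℓ) ν i (avgOp (boxMeasure ℓ) ν j f))⟫_ℂ).re =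
      (ℓ ^ 3)⁻¹ * (∫ z, k z * S z) *
        ‖avgOp (boxMeasure ℓ) ν i (avgOp (boxMeasure ℓ) ν j f)‖ ^ 2 := by
  have hP := commProj_avgOp (ν := ν) (ℓ := ℓ) (κ := ({i, j} : Set ι)) (σ := Subtype.val) (by
    rintro ⟨a, ha⟩
    rcases ha with rfl | ha
    · exact hi
    · rw [Set.mem_singleton_iff] at ha; subst ha; exact hj)
  set Pi := avgOp (boxMeasure ℓ) ν i
  set Pj := avgOp (boxMeasure ℓ) ν j
  set g := Pi (Pj f) with hg
  have hPi : Pi g = g := hP.apply_apply ⟨i, by simp⟩ _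
  have hPj : Pj g = g := by
    rw [hg, ← hP.apply_comm ⟨i, by simp⟩ ⟨j, by simp⟩, hP.apply_apply ⟨j, by simp⟩]
  have h1 : Pi (pairOp ν χ k i j (Pi g)) = (((ℓ ^ 3)⁻¹ : ℝ) : ℂ) • fieldOp ν χ k j (Pi g) := by
    have := congrArg (fun A => A g) (avgOp_pairOp_avgOp hℓ hχ hk hij hi (ν := ν))
    simpa [mul_apply_eq_comp] using this
  have h2 : Pj (fieldOp ν χ k j (Pj g)) = ((∫ z, k z * S z : ℝ) : ℂ) • Pj g := by
    have := congrArg (fun A => A g) (avgOp_fieldOp_avgOp hℓ hχ hk hχ2 hS hj (ν := ν))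
    simp only [mul_apply_eq_comp, smul_apply] at this
    exact this
  rw [hPi] at h1
  rw [hPj] at h2
  have h3 : ⟪g, pairOp ν χ k i j g⟫_ℂ = ⟪g, Pi (pairOp ν χ k i j g)⟫_ℂ := by
    conv_lhs => rw [← hPi]
    rw [hP.inner_left ⟨i, by simp⟩, hPi]
  have h4 : ⟪g, fieldOp ν χ k j g⟫_ℂ = ⟪g, Pj (fieldOp ν χ k j g)⟫_ℂ := by
    conv_lhs => rw [← hPj]
    rw [hP.inner_left ⟨j, by simp⟩, hPj]
  rw [h3, h1, inner_smul_right, h4, h2, inner_smul_right, re_ofReal_mul,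
    re_ofReal_mul, re_inner_self]
  ring

end KernelOperators

/-! ### Plane waves and the pairing energy of excitations -/

/-- The localized plane wave `χ(y) exp(2πi⟨y, k⟩)`. -/
def wave (χ : E3 → ℝ) (k y : E3) : ℂ := (χ y : ℂ) * (Real.fourierChar ⟪y, k⟫_ℝ : ℂ)

section Wave

variable {χ : E3 → ℝ} {ℓ X : ℝ}

theorem norm_wave (hχ : IsWeight ℓ X χ) (k y : E3) : ‖wave χ k y‖ = χ y := by
  rw [wave, norm_mul, Circle.norm_coe, mul_one, norm_real, Real.norm_of_nonneg (hχ.nonneg y)]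

theorem conj_fourierChar (t : ℝ) :
    conj (Real.fourierChar t : ℂ) = (Real.fourierChar (-t) : ℂ) := by
  rw [← Circle.coe_inv_eq_conj, AddChar.map_neg_eq_inv]

theorem conj_wave (χ : E3 → ℝ) (k y : E3) : conj (wave χ k y) = wave χ (-k) y := by
  rw [wave, wave, map_mul, conj_ofReal, conj_fourierChar, inner_neg_right]

theorem measurable_wave (hχ : IsWeight ℓ X χ) :
    Measurable fun p : E3 × E3 => wave χ p.1 p.2 := by
  have h : Continuous fun p : E3 × E3 => (Real.fourierChar ⟪p.2, p.1⟫_ℝ : ℂ) :=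
    continuous_subtype_val.comp (Real.continuous_fourierChar.comp
      (continuous_snd.inner continuous_fst))
  exact (Complex.measurable_ofReal.comp (hχ.meas.comp measurable_snd)).mul h.measurable

theorem bddMeas_wave (hχ : IsWeight ℓ X χ) (k : E3) : BddMeas (wave χ k) :=
  ⟨(measurable_wave hχ).comp (measurable_const.prodMk measurable_id), X, fun y => by
    rw [norm_wave hχ]; exact hχ.le y⟩

theorem conj_wave_mul_wave (χ : E3 → ℝ) (k y : E3) :
    conj (wave χ k y) * wave χ k y = ((χ y ^ 2 : ℝ) : ℂ) := by
  rw [← Complex.normSq_eq_conj_mul_self, wave, map_mul, Complex.normSq_ofReal, Circle.normSq_coe]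
  push_cast; ring

theorem wave_mul_conj_wave (χ : E3 → ℝ) (k x y : E3) :
    wave χ k x * conj (wave χ k y) =
      (χ x : ℂ) * (χ y : ℂ) * (Real.fourierChar ⟪x - y, k⟫_ℝ : ℂ) := by
  rw [conj_wave, wave, wave, inner_neg_right, inner_sub_left, sub_eq_add_neg,
    AddChar.map_add_eq_mul, Circle.coe_mul]
  ring

/-- Multiplication by the plane wave in the variable of the particle `i`. -/
def waveOp {ι : Type*} (ν : Measure (ι → E3)) (χ : E3 → ℝ) (k : E3) (i : ι) :
    Lp ℂ 2 ν →L[ℂ] Lp ℂ 2 ν :=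
  mulOp ν fun x => wave χ k (x i)

theorem bddMeas_wave_apply {ι : Type*} (hχ : IsWeight ℓ X χ) (k : E3) (i : ι) :
    BddMeas fun x : ι → E3 => wave χ k (x i) := (bddMeas_wave hχ k).comp (measurable_pi_apply i)

theorem star_waveOp {ι : Type*} {ν : Measure (ι → E3)} (hχ : IsWeight ℓ X χ) (k : E3) (i : ι) :
    star (waveOp ν χ k i) = waveOp ν χ (-k) i := by
  unfold waveOp
  rw [star_mulOp (bddMeas_wave_apply hχ k i)]
  simp only [conj_wave]

theorem commute_waveOp {ι : Type*} {ν : Measure (ι → E3)} (hχ : IsWeight ℓ X χ) (k k' : E3)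
    (i j : ι) :
    Commute (waveOp ν χ k i) (waveOp ν χ k' j) :=
  commute_mulOp (bddMeas_wave_apply hχ k i) (bddMeas_wave_apply hχ k' j)

/-- The Fourier transform of `χ f` in the variable `i`; the value at `x` has the frequency
`x i`. -/
def sliceFourier {ι : Type*} [DecidableEq ι] (χ : E3 → ℝ) (i : ι) (f : (ι → E3) → ℂ)
    (x : ι → E3) : ℂ :=
  𝓕 (fun y : E3 => (χ y : ℂ) * f (update x i y)) (x i)

variable {ι : Type*} [DecidableEq ι]

theorem sliceFourier_update (i : ι) (f : (ι → E3) → ℂ) (x : ι → E3) (k : E3) :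
    sliceFourier χ i f (update x i k) =
      ∫ y, conj (wave χ k y) * f (update x i y) := by
  unfold sliceFourier
  simp only [Function.update_self, Function.update_idem, Real.fourier_eq]
  refine integral_congr_ae (.of_forall fun y => ?_)
  simp only [conj_wave χ k]
  simp only [wave, inner_neg_right, Circle.smul_def, smul_eq_mul]
  ring

theorem measurable_sliceFourier (hχ : IsWeight ℓ X χ) (i : ι) {f : (ι → E3) → ℂ}
    (hf : Measurable f) :
    Measurable fun p : (ι → E3) × E3 => sliceFourier χ i f (update p.1 i p.2) := by
  simp only [sliceFourier_update]
  have h1 : Measurable fun q : ((ι → E3) × E3) × E3 =>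
      conj (wave χ q.1.2 q.2) * f (update q.1.1 i q.2) :=
    (Complex.continuous_conj.measurable.comp ((measurable_wave hχ).comp
      (f := fun q : ((ι → E3) × E3) × E3 => (q.1.2, q.2))
      ((measurable_snd.comp measurable_fst).prodMk measurable_snd))).mul
    (hf.comp ((measurable_update_prod i).comp
      (f := fun q : ((ι → E3) × E3) × E3 => (q.1.1, q.2))
      ((measurable_fst.comp measurable_fst).prodMk measurable_snd)))
  exact (h1.stronglyMeasurable.integral_prod_right').measurable

/-- Plancherel's theorem in one variable. -/
theorem lintegral_sliceFourier (hχ : IsWeight ℓ X χ) {g : E3 → ℂ}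
    (hg : MemLp g 2 (volume.restrict (cube ℓ))) :
    ∫⁻ k, ‖∫ y, conj (wave χ k y) * g y‖ₑ ^ 2 = ∫⁻ y, ‖(χ y : ℂ) * g y‖ₑ ^ 2 := by
  have h2 : MemLp (fun y => (χ y : ℂ) * g y) 2 := by
    have h3 : MemLp (fun y => (χ y : ℂ) * g y) 2 (volume.restrict (cube ℓ)) :=
      (bddMeas_ofReal hχ.meas fun x => by
        rw [abs_of_nonneg (hχ.nonneg x)]; exact hχ.le x).memLp_mul hg
    have h4 := (memLp_indicator_iff_restrict (measurableSet_cube ℓ)).2 h3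
    rwa [Set.indicator_eq_self.2 fun y hy => by
      by_contra hn
      exact hy (by simp [hχ.supp y hn])] at h4
  have h1 : Integrable fun y => (χ y : ℂ) * g y := by
    have : IsFiniteMeasure (volume.restrict (cube ℓ)) :=
      ⟨by rw [Measure.restrict_apply_univ]; exact (isCompact_cube ℓ).measure_lt_top⟩
    have h3 : IntegrableOn (fun y => (χ y : ℂ) * g y) (cube ℓ) :=
      (h2.restrict (cube ℓ)).integrable (by norm_num)
    refine (integrableOn_iff_integrable_of_support_subset fun y hy => ?_).1 h3
    by_contra hn
    exact hy (by simp [hχ.supp y hn])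
  rw [← lintegral_enorm_sq_fourier h1 h2]
  refine lintegral_congr fun k => ?_
  congr 2
  rw [Real.fourier_eq]
  refine integral_congr_ae (.of_forall fun y => ?_)
  simp only [conj_wave χ k]
  simp only [wave, inner_neg_right, Circle.smul_def, smul_eq_mul]
  ring

theorem lintegral_boxMeasure_le (hℓ : 0 < ℓ) (g : E3 → ℝ≥0∞) :
    ∫⁻ x in cube ℓ, g x = ofReal (ℓ ^ 3) * ∫⁻ x, g x ∂(boxMeasure ℓ) := by
  rw [boxMeasure, lintegral_smul_measure, smul_eq_mul, ← mul_assoc,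
    ← ofReal_mul (by positivity), mul_inv_cancel₀ (by positivity), ENNReal.ofReal_one,
    one_mul]

variable {ν : Measure (ι → E3)} [IsProbabilityMeasure (boxMeasure ℓ)]

theorem Resampling.ae_ae {i : ι} (h : Resampling (boxMeasure ℓ) ν i) {p : (ι → E3) → Prop}
    (hp : ∀ᵐ x ∂ν, p x) : ∀ᵐ x ∂ν, ∀ᵐ y ∂(boxMeasure ℓ), p (update x i y) :=
  Measure.ae_ae_of_ae_prod (h.quasiMeasurePreserving.ae hp)

theorem Resampling.lintegral {i : ι} (h : Resampling (boxMeasure ℓ) ν i)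
    {F : (ι → E3) → ℝ≥0∞} (hF : Measurable F) :
    ∫⁻ x, ∫⁻ y, F (update x i y) ∂(boxMeasure ℓ) ∂ν = ∫⁻ x, F x ∂ν := by
  rw [← h.lintegral_comp hF]
  exact (lintegral_prod _ (hF.comp (measurable_update_prod i)).aemeasurable).symm

theorem Resampling.ae_memLp {i : ι} (h : Resampling (boxMeasure ℓ) ν i) (hℓ : 0 < ℓ)
    {f : (ι → E3) → ℂ} (hf : Measurable f) (hf2 : MemLp f 2 ν) :
    ∀ᵐ x ∂ν, MemLp (fun y => f (update x i y)) 2 (volume.restrict (cube ℓ)) := by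
  have h1 : ∫⁻ x, ‖f x‖ₑ ^ 2 ∂ν < ∞ := by
    rw [lintegral_enorm_sq_eq_eLpNorm]
    exact ENNReal.pow_lt_top hf2.2
  have hm : Measurable fun x => ‖f x‖ₑ ^ 2 := hf.enorm.pow_const 2
  rw [← h.lintegral hm] at h1
  have h2 := ae_lt_top (Measurable.lintegral_prod_right'
    (f := fun p : (ι → E3) × E3 => ‖f (update p.1 i p.2)‖ₑ ^ 2)
    (hm.comp (measurable_update_prod i))) h1.ne
  filter_upwards [h2] with x hx
  refine memLp_two_of_lintegral_lt_top (hf.comp (measurable_update x)).aestronglyMeasurable ?_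
  rw [lintegral_boxMeasure_le hℓ]
  exact ENNReal.mul_lt_top ENNReal.ofReal_lt_top hx

variable [IsFiniteMeasure ν]

/-- The energy distribution of the excitations of one particle over the frequencies. -/
theorem lintegral_lintegral_sliceFourier {i : ι} (h : Resampling (boxMeasure ℓ) ν i)
    (hℓ : 0 < ℓ) (hχ : IsWeight ℓ X χ) {f : (ι → E3) → ℂ} (hf : Measurable f)
    (hf2 : MemLp f 2 ν) :
    ∫⁻ k, ∫⁻ x, ‖sliceFourier χ i f (update x i k)‖ₑ ^ 2 ∂ν ≤
      ofReal (ℓ ^ 3 * X ^ 2) * ∫⁻ x, ‖f x‖ₑ ^ 2 ∂ν := by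
  have hX := hχ.bound_nonneg
  have hm : Measurable fun x => ‖f x‖ₑ ^ 2 := hf.enorm.pow_const 2
  have hs : Measurable fun p : (ι → E3) × E3 =>
      ‖sliceFourier χ i f (update p.1 i p.2)‖ₑ ^ 2 :=
    (measurable_sliceFourier hχ i hf).enorm.pow_const 2
  rw [lintegral_lintegral_swap (f := fun k x => ‖sliceFourier χ i f (update x i k)‖ₑ ^ 2)
    (hs.comp measurable_swap).aemeasurable, ← h.lintegral hm,
    ← lintegral_const_mul' _ _ ofReal_ne_top]
  refine lintegral_mono_ae ?_
  filter_upwards [h.ae_memLp hℓ hf hf2] with x hx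
  simp only [sliceFourier_update]
  rw [lintegral_sliceFourier hχ hx]
  calc ∫⁻ y, ‖(χ y : ℂ) * f (update x i y)‖ₑ ^ 2
      ≤ ∫⁻ y in cube ℓ, ofReal (X ^ 2) * ‖f (update x i y)‖ₑ ^ 2 := by
        rw [← lintegral_indicator (measurableSet_cube ℓ)]
        refine lintegral_mono fun y => ?_
        by_cases hy : y ∈ cube ℓ
        · rw [Set.indicator_of_mem hy, enorm_mul, mul_pow, ← ofReal_norm (E := ℂ) (χ y : ℂ),
            ← ENNReal.ofReal_pow (norm_nonneg _), norm_real, Real.norm_eq_abs, sq_abs]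
          gcongr
          · exact hχ.nonneg y
          · exact hχ.le y
        · rw [Set.indicator_of_notMem hy, hχ.supp y hy]; simp
    _ = _ := by
        rw [lintegral_const_mul' _ _ ofReal_ne_top, lintegral_boxMeasure_le hℓ, ← mul_assoc,
          ← ofReal_mul (by positivity), mul_comm (X ^ 2)]

theorem commute_avgOp_waveOp (hχ : IsWeight ℓ X χ) (k : E3) {i j : ι} (hij : i ≠ j)
    (hi : Resampling (boxMeasure ℓ) ν i) :
    Commute (avgOp (boxMeasure ℓ) ν i) (waveOp ν χ k j) :=
  commute_avgOp_mulOp hi (bddMeas_wave_apply hχ k j) fun x y => by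
    rw [Function.update_of_ne hij.symm]

/-- The normalization `∫ χ² = ℓ³` makes the plane waves act as contractions on the condensate. -/
theorem norm_star_waveOp_avgOp (hℓ : 0 < ℓ) (hχ : IsWeight ℓ X χ) (h2 : ∫ x, χ x ^ 2 = ℓ ^ 3)
    (k : E3) {i : ι} (hi : Resampling (boxMeasure ℓ) ν i) (f : Lp ℂ 2 ν) :
    ‖star (waveOp ν χ k i) (avgOp (boxMeasure ℓ) ν i f)‖ ≤ ‖avgOp (boxMeasure ℓ) ν i f‖ := by
  have hb := bddMeas_wave_apply (ι := ι) hχ k i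
  set P := avgOp (boxMeasure ℓ) ν i with hP
  have hidem : P * P = P := avgOp_mul_self hi
  have hself : star P = P := isSelfAdjoint_avgOp hi
  have h3 : ℓ ^ 3 ≠ 0 := by positivity
  have hPf : P (P f) = P f := by rw [← mul_apply_eq_comp, hidem]
  have e1 : P * (waveOp ν χ k i * star (waveOp ν χ k i)) * P = P := by
    rw [waveOp, star_mulOp hb, mulOp_mul hb hb.conj, hP, avgOp_mulOp_avgOp hi (hb.mul hb.conj)]
    have e : avg (boxMeasure ℓ) i (fun x : ι → E3 => wave χ k (x i) * conj (wave χ k (x i))) =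
        fun _ => 1 := by
      funext x
      unfold avg
      simp only [Function.update_self, mul_comm (wave χ k _), conj_wave_mul_wave]
      rw [integral_complex_ofReal, integral_boxMeasure_of_eq_zero hℓ fun y hy => by
        rw [hχ.supp y hy]; simp, h2, smul_eq_mul, inv_mul_cancel₀ h3, Complex.ofReal_one]
    rw [e, mulOp_const, one_smul, one_mul]
  have e2 : ‖star (waveOp ν χ k i) (P f)‖ ^ 2 = ‖P f‖ ^ 2 := by
    have e3 : ∀ z, ⟪P f, P z⟫_ℂ = ⟪P f, z⟫_ℂ := fun z => by
      have h := inner_apply_left P (P f) z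
      rw [hself, hPf] at h
      exact h.symm
    have e4 := congrArg (fun A => A f) e1
    simp only [mul_apply_eq_comp] at e4
    rw [← re_inner_self, ← re_inner_self, inner_apply_left, star_star, ← e3, e4, e3]
  exact (pow_le_pow_iff_left₀ (norm_nonneg _) (norm_nonneg _) two_ne_zero).1 e2.le

/-- The amplitude `⟨θ, e_k f⟩` of the frequency `k`, as a Fourier transform. -/
theorem norm_avgOp_waveOp (hℓ : 0 < ℓ) (hχ : IsWeight ℓ X χ) (k : E3) {i : ι}
    (hi : Resampling (boxMeasure ℓ) ν i) {f : (ι → E3) → ℂ} {g : Lp ℂ 2 ν}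
    (hfg : g =ᵐ[ν] f) :
    ofReal (‖avgOp (boxMeasure ℓ) ν i (star (waveOp ν χ k i) g)‖ ^ 2) =
      ofReal ((ℓ ^ 6)⁻¹) * ∫⁻ x, ‖sliceFourier χ i f (update x i k)‖ₑ ^ 2 ∂ν := by
  have hb := bddMeas_wave_apply (ι := ι) hχ k i
  have e1 : avgOp (boxMeasure ℓ) ν i (star (waveOp ν χ k i) g) =ᵐ[ν]
      fun x => (((ℓ ^ 3)⁻¹ : ℝ) : ℂ) * sliceFourier χ i f (update x i k) := by
    refine (coeFn_avgOp hi _).trans ?_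
    have h1 : star (waveOp ν χ k i) g =ᵐ[ν] fun x => conj (wave χ k (x i)) * f x := by
      rw [waveOp, star_mulOp hb]
      filter_upwards [coeFn_mulOp hb.conj g, hfg] with x h1 h2
      rw [h1, h2]
    filter_upwards [hi.ae_ae h1] with x hx
    unfold avg
    rw [integral_congr_ae hx, sliceFourier_update, integral_boxMeasure_of_eq_zero hℓ]
    · simp only [Function.update_self, Complex.real_smul]
    · intro y hy
      simp [wave, hχ.supp y hy]
  rw [ENNReal.ofReal_pow (norm_nonneg _), Lp.norm_def, ENNReal.ofReal_toReal (Lp.eLpNorm_ne_top _),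
    eLpNorm_congr_ae e1, ← lintegral_enorm_sq_eq_eLpNorm,
    ← lintegral_const_mul' _ _ ofReal_ne_top]
  refine lintegral_congr fun x => ?_
  rw [enorm_mul, mul_pow, ← ofReal_norm (E := ℂ) (((ℓ ^ 3)⁻¹ : ℝ) : ℂ),
    ← ENNReal.ofReal_pow (norm_nonneg _), norm_real, Real.norm_eq_abs, sq_abs]
  congr 2
  rw [inv_pow, ← pow_mul]

end Wave

section Pairing

/-- Mollification multiplies the Fourier transform by a factor that is integrable and at most
one. -/
theorem fourier_mol {W : E3 → ℝ} (hW : Integrable W) (m : ℕ) :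
    Integrable (𝓕 fun x => (mol m W x : ℂ)) ∧
      ∀ k, ‖𝓕 (fun x => (mol m W x : ℂ)) k‖ ≤ ‖𝓕 (fun x => (W x : ℂ)) k‖ := by
  have hJ : IsTestFunction Set.univ (molK m) := ⟨molK_smooth m, molK_compact m, Set.subset_univ _⟩
  have hJI : Integrable fun x => (molK m x : ℂ) := (molK_integrable m).ofReal
  have hWI : Integrable fun x => (W x : ℂ) := hW.ofReal
  have e : 𝓕 (fun x => (mol m W x : ℂ)) =
      fun k => 𝓕 (fun x => (molK m x : ℂ)) k * 𝓕 (fun x => (W x : ℂ)) k := by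
    funext k
    rw [← Real.fourier_mul_convolution_eq hJI hWI]
    refine congrArg (fun f : E3 → ℂ => 𝓕 f k) (funext fun x => ?_)
    rw [mol_apply, ← integral_complex_ofReal]
    simp only [convolution, ContinuousLinearMap.mul_apply', Complex.ofReal_mul]
  have hS : Integrable (𝓕 fun x => (molK m x : ℂ)) := by
    have h := (𝓕 hJ.toSchwartz).integrable (μ := volume)
    rwa [SchwartzMap.fourier_coe] at h
  have h1 : ∀ k, ‖𝓕 (fun x => (molK m x : ℂ)) k‖ ≤ 1 := fun k => by
    refine (norm_fourier_le _ k).trans (le_of_eq ?_)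
    simp only [norm_real, Real.norm_of_nonneg (molK_nonneg m _)]
    exact molK_integral m
  rw [e]
  refine ⟨hS.mul_bdd (c := ∫ x, ‖(W x : ℂ)‖) (continuous_fourier hWI).aestronglyMeasurable
    (.of_forall fun k => norm_fourier_le _ k), fun k => ?_⟩
  rw [norm_mul]
  exact mul_le_of_le_one_left (norm_nonneg _) (h1 k)

theorem mol_eq_fourier_integral {W : E3 → ℝ} (hW : Integrable W) (m : ℕ) (z : E3) :
    (mol m W z : ℂ) =
      ∫ k, 𝓕 (fun x => (mol m W x : ℂ)) k * (Real.fourierChar ⟪z, k⟫_ℝ : ℂ) := by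
  have hc : Continuous fun x => (mol m W x : ℂ) :=
    Complex.continuous_ofReal.comp (mol_smooth hW.locallyIntegrable m).continuous
  have h := Continuous.fourierInv_fourier_eq hc (mol_integrable hW m).ofReal (fourier_mol hW m).1
  have h' := congrFun h z
  rw [Real.fourierInv_eq] at h'
  rw [← h']
  refine integral_congr_ae (.of_forall fun k => ?_)
  simp only [Circle.smul_def, smul_eq_mul, real_inner_comm z k]
  ring

variable {ι : Type*} {χ w : E3 → ℝ} {ℓ X : ℝ} {ν : Measure (ι → E3)}

theorem bddMeas_pair_of_bound (hχ : IsWeight ℓ X χ) (hw : Measurable w) {M : ℝ}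
    (hM : ∀ z, |w z| ≤ M) (i j : ι) :
    BddMeas fun x : ι → E3 => (pairKer χ w (x i) (x j) : ℂ) := by
  refine bddMeas_ofReal (C := X * M * X) (((hχ.meas.comp (measurable_pi_apply i)).mul
    (hw.comp ((measurable_pi_apply i).sub (measurable_pi_apply j)))).mul
    (hχ.meas.comp (measurable_pi_apply j))) fun x => ?_
  have hX := hχ.bound_nonneg
  rw [pairKer, abs_mul, abs_mul, abs_of_nonneg (hχ.nonneg _), abs_of_nonneg (hχ.nonneg (x j))]
  have hM0 : 0 ≤ M := (abs_nonneg _).trans (hM 0)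
  exact mul_le_mul (mul_le_mul (hχ.le _) (hM _) (abs_nonneg _) hX) (hχ.le _) (hχ.nonneg _)
    (by positivity)

section

variable [DecidableEq ι] [IsProbabilityMeasure (boxMeasure ℓ)]

/-- A property of almost all vectors holds for almost all differences of two positions. -/
theorem Resampling.ae_sub {i j : ι} (hij : i ≠ j) (h : Resampling (boxMeasure ℓ) ν i)
    {p : E3 → Prop} (hp : ∀ᵐ z, p z) : ∀ᵐ x ∂ν, p (x i - x j) := by
  set Z := toMeasurable volume {z | ¬ p z} with hZ
  have hZ0 : volume Z = 0 := by rw [hZ, measure_toMeasurable]; exact hp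
  have hZm : MeasurableSet Z := measurableSet_toMeasurable _ _
  have hm : Measurable fun x : ι → E3 => x i - x j :=
    (measurable_pi_apply i).sub (measurable_pi_apply j)
  have h0 : ν ((fun x : ι → E3 => x i - x j) ⁻¹' Z) = 0 := by
    rw [← lintegral_indicator_one (hm hZm), ← h.lintegral
      (measurable_one.indicator (hm hZm))]
    refine lintegral_eq_zero_of_ae_eq_zero (.of_forall fun x => ?_)
    simp only [Pi.zero_apply]
    refine lintegral_eq_zero_of_ae_eq_zero ?_
    refine (boxMeasure_absolutelyContinuous ℓ).ae_le ?_
    have h1 : ∀ᵐ y, y - x j ∉ Z :=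
      (measurePreserving_sub_right volume (x j)).quasiMeasurePreserving.ae
        (measure_eq_zero_iff_ae_notMem.1 hZ0)
    filter_upwards [h1] with y hy
    have : update x i y ∉ (fun x : ι → E3 => x i - x j) ⁻¹' Z := by
      simpa [Function.update_of_ne hij.symm] using hy
    rw [Set.indicator_of_notMem this]; rfl
  refine measure_mono_null (fun x hx => ?_) h0
  exact subset_toMeasurable _ _ hx

theorem tendsto_inner_pairOp (hχ : IsWeight ℓ X χ) {u : ℕ → E3 → ℝ} (hu : ∀ m, Measurable (u m))
    (hw : Measurable w) {M : ℝ} (huM : ∀ m z, |u m z| ≤ M) (hwM : ∀ z, |w z| ≤ M)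
    (hlim : ∀ᵐ z, Tendsto (fun m => u m z) atTop (𝓝 (w z))) {i j : ι} (hij : i ≠ j)
    (hi : Resampling (boxMeasure ℓ) ν i) (a b : Lp ℂ 2 ν) :
    Tendsto (fun m => ⟪a, pairOp ν χ (u m) i j b⟫_ℂ) atTop (𝓝 ⟪a, pairOp ν χ w i j b⟫_ℂ) := by
  have hb := fun m => bddMeas_pair_of_bound hχ (hu m) (huM m) i j
  simp only [pairOp]
  rw [inner_mulOp (bddMeas_pair_of_bound hχ hw hwM i j)]
  simp only [inner_mulOp (hb _)]
  have hab : Integrable (fun x => conj (a x) * b x) ν :=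
    (Lp.memLp a).star.integrable_mul (Lp.memLp b)
  have hM0 : 0 ≤ M := (abs_nonneg _).trans (hwM 0)
  refine tendsto_integral_of_dominated_convergence
    (fun x => X * M * X * ‖conj (a x) * b x‖) (fun m => ?_) (hab.norm.const_mul _)
    (fun m => .of_forall fun x => ?_) ?_
  · exact ((Lp.memLp a).star.integrable_mul ((hb m).memLp_mul (Lp.memLp b))).aestronglyMeasurable
  · rw [norm_mul, norm_mul, norm_mul, pairKer, norm_real, Real.norm_eq_abs, abs_mul, abs_mul,
      abs_of_nonneg (hχ.nonneg _), abs_of_nonneg (hχ.nonneg (x j))]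
    have h1 : χ (x i) * |u m (x i - x j)| * χ (x j) ≤ X * M * X :=
      mul_le_mul (mul_le_mul (hχ.le _) (huM m _) (abs_nonneg _) hχ.bound_nonneg) (hχ.le _)
        (hχ.nonneg _) (mul_nonneg hχ.bound_nonneg hM0)
    have h2 := mul_le_mul_of_nonneg_right h1 (mul_nonneg (norm_nonneg (conj (a x)))
      (norm_nonneg (b x)))
    linarith
  · filter_upwards [hi.ae_sub hij hlim] with x hx
    simp only [pairKer]
    exact (((Complex.continuous_ofReal.tendsto _).comp
      ((hx.const_mul _).mul_const _)).mul_const _).const_mul _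

end

/-- The weight of the frequency `k` in the excitations of the particle `i`. -/
def excitation [DecidableEq ι] (ν : Measure (ι → E3)) (χ : E3 → ℝ) (ℓ : ℝ)
    [IsProbabilityMeasure (boxMeasure ℓ)] (i : ι) (f : Lp ℂ 2 ν) (k : E3) : ℝ :=
  ‖avgOp (boxMeasure ℓ) ν i (star (waveOp ν χ k i) (f - avgOp (boxMeasure ℓ) ν i f))‖ ^ 2

theorem excitation_nonneg [DecidableEq ι] [IsProbabilityMeasure (boxMeasure ℓ)] (i : ι)
    (f : Lp ℂ 2 ν) (k : E3) : 0 ≤ excitation ν χ ℓ i f k := sq_nonneg _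

variable [IsFiniteMeasure ν]

/-- A pair potential as a superposition of products of plane waves. -/
theorem inner_pairOp_eq_integral (hχ : IsWeight ℓ X χ) (hw : Measurable w) {M : ℝ}
    (hM : ∀ z, |w z| ≤ M) {g : E3 → ℂ} (hg : Integrable g)
    (hwg : ∀ z, (w z : ℂ) = ∫ k, g k * (Real.fourierChar ⟪z, k⟫_ℝ : ℂ)) (i j : ι)
    (a b : Lp ℂ 2 ν) :
    Integrable (fun k => g k * ⟪a, waveOp ν χ k i (star (waveOp ν χ k j) b)⟫_ℂ) ∧
      ⟪a, pairOp ν χ w i j b⟫_ℂ =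
        ∫ k, g k * ⟪a, waveOp ν χ k i (star (waveOp ν χ k j) b)⟫_ℂ := by
  have hb : ∀ (i : ι) (k : E3), BddMeas fun x : ι → E3 => wave χ k (x i) :=
    fun i k => bddMeas_wave_apply hχ k i
  have e1 : ∀ k, g k * ⟪a, waveOp ν χ k i (star (waveOp ν χ k j) b)⟫_ℂ =
      ∫ x, g k * (conj (a x) * (wave χ k (x i) * conj (wave χ k (x j)) * b x)) ∂ν := by
    intro k
    rw [waveOp, waveOp, star_mulOp (hb j k), ← mul_apply_eq_comp, mulOp_mul (hb i k) (hb j k).conj,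
      inner_mulOp ((hb i k).mul (hb j k).conj), integral_const_mul]
  have hab : Integrable (fun x => conj (a x) * b x) ν :=
    (Lp.memLp a).star.integrable_mul (Lp.memLp b)
  have hF : Integrable (fun p : E3 × (ι → E3) => g p.1 * (conj (a p.2) *
      (wave χ p.1 (p.2 i) * conj (wave χ p.1 (p.2 j)) * b p.2))) (volume.prod ν) := by
    have h1 := hg.mul_prod hab
    have hm : ∀ i : ι, Measurable fun p : E3 × (ι → E3) => wave χ p.1 (p.2 i) := fun i =>
      (measurable_wave hχ).comp (f := fun p : E3 × (ι → E3) => (p.1, p.2 i))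
        (measurable_fst.prodMk ((measurable_pi_apply i).comp measurable_snd))
    have h2 := h1.bdd_mul (c := X * X)
      (f := fun p : E3 × (ι → E3) => wave χ p.1 (p.2 i) * conj (wave χ p.1 (p.2 j)))
      ((hm i).mul (Complex.continuous_conj.measurable.comp (hm j))).aestronglyMeasurable
      (.of_forall fun p => by
        rw [norm_mul, RCLike.norm_conj, norm_wave hχ, norm_wave hχ]
        exact mul_le_mul (hχ.le _) (hχ.le _) (hχ.nonneg _) hχ.bound_nonneg)
    refine h2.congr (.of_forall fun p => ?_)
    simp only
    ring
  simp only [e1]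
  refine ⟨hF.integral_prod_left, ?_⟩
  rw [integral_integral_swap hF, pairOp, inner_mulOp (bddMeas_pair_of_bound hχ hw hM i j)]
  refine integral_congr_ae (.of_forall fun x => ?_)
  simp only [wave_mul_conj_wave]
  have e2 : ∀ k, g k * (conj (a x) * ((χ (x i) : ℂ) * (χ (x j) : ℂ) *
      (Real.fourierChar ⟪x i - x j, k⟫_ℝ : ℂ) * b x)) =
      (conj (a x) * (χ (x i) : ℂ) * (χ (x j) : ℂ) * b x) *
        (g k * (Real.fourierChar ⟪x i - x j, k⟫_ℝ : ℂ)) := fun k => by ring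
  simp only [e2]
  rw [integral_const_mul, ← hwg, pairKer]
  push_cast
  ring

variable [DecidableEq ι] [IsProbabilityMeasure (boxMeasure ℓ)]

theorem measurable_excitation (hℓ : 0 < ℓ) (hχ : IsWeight ℓ X χ) {i : ι}
    (hi : Resampling (boxMeasure ℓ) ν i) (f : Lp ℂ 2 ν) : Measurable (excitation ν χ ℓ i f) := by
  have hg := (Lp.stronglyMeasurable (f - avgOp (boxMeasure ℓ) ν i f)).measurable
  have h1 : Measurable fun k => ofReal (excitation ν χ ℓ i f k) := by
    unfold excitation
    simp only [norm_avgOp_waveOp hℓ hχ _ hi (EventuallyEq.refl _ _)]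
    exact (Measurable.lintegral_prod_left'
      (f := fun p : (ι → E3) × E3 => ‖sliceFourier χ i (f - avgOp (boxMeasure ℓ) ν i f : Lp ℂ 2 ν)
        (update p.1 i p.2)‖ₑ ^ 2)
      ((measurable_sliceFourier hχ i hg).enorm.pow_const 2)).const_mul _
  have h2 := h1.ennreal_toReal
  simp only [ENNReal.toReal_ofReal (excitation_nonneg i f _)] at h2
  exact h2

theorem lintegral_excitation_le (hℓ : 0 < ℓ) (hχ : IsWeight ℓ X χ) {i : ι}
    (hi : Resampling (boxMeasure ℓ) ν i) (f : Lp ℂ 2 ν) :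
    ∫⁻ k, ofReal (excitation ν χ ℓ i f k) ≤
      ofReal ((ℓ ^ 3)⁻¹ * X ^ 2 * ‖f - avgOp (boxMeasure ℓ) ν i f‖ ^ 2) := by
  set g := f - avgOp (boxMeasure ℓ) ν i f with hgdef
  have hg := (Lp.stronglyMeasurable g).measurable
  unfold excitation
  simp only [← hgdef, norm_avgOp_waveOp hℓ hχ _ hi (EventuallyEq.refl _ g)]
  rw [lintegral_const_mul' _ _ ofReal_ne_top]
  refine (mul_le_mul_right (lintegral_lintegral_sliceFourier hi hℓ hχ hg (Lp.memLp g)) _).trans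
    (le_of_eq ?_)
  have e : ∫⁻ x, ‖g x‖ₑ ^ 2 ∂ν = ofReal (‖g‖ ^ 2) := by
    rw [lintegral_enorm_sq_eq_eLpNorm, ENNReal.ofReal_pow (norm_nonneg _), Lp.norm_def,
      ENNReal.ofReal_toReal (Lp.eLpNorm_ne_top _)]
  rw [e, ← ofReal_mul (by positivity), ← ofReal_mul (by positivity)]
  congr 1
  field_simp

theorem integrable_excitation (hℓ : 0 < ℓ) (hχ : IsWeight ℓ X χ) {i : ι}
    (hi : Resampling (boxMeasure ℓ) ν i) (f : Lp ℂ 2 ν) : Integrable (excitation ν χ ℓ i f) := by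
  refine ⟨(measurable_excitation hℓ hχ hi f).aestronglyMeasurable, ?_⟩
  rw [hasFiniteIntegral_iff_ofReal (.of_forall (excitation_nonneg i f))]
  exact (lintegral_excitation_le hℓ hχ hi f).trans_lt ENNReal.ofReal_lt_top

theorem integral_excitation_le (hℓ : 0 < ℓ) (hχ : IsWeight ℓ X χ) {i : ι}
    (hi : Resampling (boxMeasure ℓ) ν i) (f : Lp ℂ 2 ν) :
    ∫ k, excitation ν χ ℓ i f k ≤
      (ℓ ^ 3)⁻¹ * X ^ 2 * ‖f - avgOp (boxMeasure ℓ) ν i f‖ ^ 2 := by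
  rw [integral_eq_lintegral_of_nonneg_ae (.of_forall (excitation_nonneg i f))
    (measurable_excitation hℓ hχ hi f).aestronglyMeasurable]
  exact ENNReal.toReal_le_of_le_ofReal (by positivity) (lintegral_excitation_le hℓ hχ hi f)

/-- Lower bound on the energy of the creation of pairs of excitations out of the condensate, for an
arbitrary dispersion relation `d`. -/
theorem pairing_lower_bound {κ : Type*} [Fintype κ] [DecidableEq κ] {σ : κ → ι}
    (hσ : Function.Injective σ) (hR : ∀ i, Resampling (boxMeasure ℓ) ν (σ i)) (hℓ : 0 < ℓ)
    (hχ : IsWeight ℓ X χ) (h2 : ∫ x, χ x ^ 2 = ℓ ^ 3) {W : E3 → ℝ} (hW : IsKernel W)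
    {d : E3 → ℝ} (hd0 : ∀ k, 0 < d k) {E A : ℝ} (hE : ∀ k, (d k)⁻¹ ≤ E)
    (hA : ∀ k, ‖𝓕 (fun x => (W x : ℂ)) k‖ ^ 2 ≤ A)
    (hdI : Integrable fun k => ‖𝓕 (fun x => (W x : ℂ)) k‖ ^ 2 / d k) (f : Lp ℂ 2 ν)
    (hdG : ∀ i, Integrable fun k => d k * excitation ν χ ℓ (σ i) f k) :
    -((Fintype.card κ : ℝ) ^ 2 / (4 * ℓ ^ 3) * (A * E) * ∑ i, (∫ k, excitation ν χ ℓ (σ i) f k) +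
      (Fintype.card κ : ℝ) / (4 * ℓ ^ 3) * (∫ k, ‖𝓕 (fun x => (W x : ℂ)) k‖ ^ 2 / d k) *
        ∑ i, ‖avgOp (boxMeasure ℓ) ν (σ i) f‖ ^ 2 +
      ℓ ^ 3 * ∑ i, ∫ k, d k * excitation ν χ ℓ (σ i) f k) ≤
    (∑ j, ∑ i ∈ univ.erase j, ⟪avgOp (boxMeasure ℓ) ν (σ i) (avgOp (boxMeasure ℓ) ν (σ j) f),
      pairOp ν χ W (σ i) (σ j) ((f - avgOp (boxMeasure ℓ) ν (σ j) f) -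
        avgOp (boxMeasure ℓ) ν (σ i) (f - avgOp (boxMeasure ℓ) ν (σ j) f))⟫_ℂ).re := by
  rcases isEmpty_or_nonempty κ with hκ | hκ
  · simp
  set P : κ → Lp ℂ 2 ν →L[ℂ] Lp ℂ 2 ν := fun i => avgOp (boxMeasure ℓ) ν (σ i) with hPdef
  set G : κ → E3 → ℝ := fun i => excitation ν χ ℓ (σ i) f with hG
  set n : ℝ := (Fintype.card κ : ℝ) with hn
  have hn0 : 0 < n := by rw [hn]; exact_mod_cast Fintype.card_pos
  have h3 : 0 < ℓ ^ 3 := by positivity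
  have hP : CommProj P := commProj_avgOp hR
  obtain ⟨M, hM⟩ := hW.bdd
  have hWM : ∀ z, |W z| ≤ M := fun z => by rw [abs_of_nonneg (hW.nonneg z)]; exact hM z
  have hML : ∀ m z, |mol m W z| ≤ M := fun m z => by
    rw [abs_of_nonneg (mol_nonneg (.of_forall hW.nonneg) m z)]
    have h1 := mol_mono hW.int.locallyIntegrable (locallyIntegrable_const M)
      (.of_forall hM) m z
    refine h1.trans (le_of_eq ?_)
    rw [mol_apply, integral_mul_const, molK_integral, one_mul]
  have hmm : ∀ m, Measurable (mol m W) := fun m =>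
    (mol_smooth hW.int.locallyIntegrable m).continuous.measurable
  have hGI : ∀ i, Integrable (G i) := fun i => integrable_excitation hℓ hχ (hR i) f
  have hG0 : ∀ i k, 0 ≤ G i k := fun i k => excitation_nonneg _ _ _
  set β : E3 → ℝ := fun k => n ^ 2 / (4 * ℓ ^ 3) * (A * E) * ∑ i, G i (-k) +
    n / (4 * ℓ ^ 3) * (‖𝓕 (fun x => (W x : ℂ)) k‖ ^ 2 / d k) * ∑ i, ‖P i f‖ ^ 2 +
    ℓ ^ 3 * ∑ i, d k * G i k with hβ
  have i1 : Integrable fun k => n ^ 2 / (4 * ℓ ^ 3) * (A * E) * ∑ i, G i (-k) :=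
    (integrable_finsetSum _ fun i _ => (hGI i).comp_neg).const_mul _
  have i2 : Integrable fun k => n / (4 * ℓ ^ 3) * (‖𝓕 (fun x => (W x : ℂ)) k‖ ^ 2 / d k) *
      ∑ i, ‖P i f‖ ^ 2 := (hdI.const_mul _).mul_const _
  have i3 : Integrable fun k => ℓ ^ 3 * ∑ i, d k * G i k :=
    (integrable_finsetSum _ fun i _ => hdG i).const_mul _
  have hβI : Integrable β := (i1.add i2).add i3
  have hβint : ∫ k, β k = n ^ 2 / (4 * ℓ ^ 3) * (A * E) * ∑ i, (∫ k, G i k) +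
      n / (4 * ℓ ^ 3) * (∫ k, ‖𝓕 (fun x => (W x : ℂ)) k‖ ^ 2 / d k) * ∑ i, ‖P i f‖ ^ 2 +
      ℓ ^ 3 * ∑ i, ∫ k, d k * G i k := by
    have i12 : Integrable fun k => n ^ 2 / (4 * ℓ ^ 3) * (A * E) * ∑ i, G i (-k) +
      n / (4 * ℓ ^ 3) * (‖𝓕 (fun x => (W x : ℂ)) k‖ ^ 2 / d k) * ∑ i, ‖P i f‖ ^ 2 := i1.add i2
    rw [hβ, integral_add i12 i3, integral_add i1 i2, integral_const_mul, integral_mul_const,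
      integral_const_mul, integral_const_mul, integral_finsetSum _ fun i _ => (hGI i).comp_neg,
      integral_finsetSum _ fun i _ => hdG i]
    simp only [integral_neg_eq_self (G _) volume]
    rfl
  rw [← hβint]
  -- the bound for the mollified interaction
  have key : ∀ m, -∫ k, β k ≤ (∑ j, ∑ i ∈ univ.erase j, ⟪P i (P j f),
      pairOp ν χ (mol m W) (σ i) (σ j) ((f - P j f) - P i (f - P j f))⟫_ℂ).re := by
    intro m
    set g := 𝓕 (fun x => (mol m W x : ℂ)) with hg
    have hrep := fun i j a b => inner_pairOp_eq_integral (ν := ν) hχ (hmm m) (hML m)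
      (fourier_mol hW.int m).1 (mol_eq_fourier_integral hW.int m) (σ i) (σ j) a b
    have hsumI : Integrable fun k => g k * ∑ j, ∑ i ∈ univ.erase j, ⟪P i (P j f),
        waveOp ν χ k (σ i) (star (waveOp ν χ k (σ j)) ((f - P j f) - P i (f - P j f)))⟫_ℂ := by
      simp only [mul_sum]
      exact integrable_finsetSum _ fun j _ => integrable_finsetSum _ fun i _ => (hrep i j _ _).1
    have hsum : ∑ j, ∑ i ∈ univ.erase j, ⟪P i (P j f),
        pairOp ν χ (mol m W) (σ i) (σ j) ((f - P j f) - P i (f - P j f))⟫_ℂ =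
        ∫ k, g k * ∑ j, ∑ i ∈ univ.erase j, ⟪P i (P j f),
        waveOp ν χ k (σ i) (star (waveOp ν χ k (σ j)) ((f - P j f) - P i (f - P j f)))⟫_ℂ := by
      simp only [mul_sum]
      rw [integral_finsetSum _ fun j _ => integrable_finsetSum _ fun i _ => (hrep i j _ _).1]
      refine sum_congr rfl fun j _ => ?_
      rw [integral_finsetSum _ fun i _ => (hrep i j _ _).1]
      exact sum_congr rfl fun i _ => (hrep i j _ _).2
    have hre := integral_re hsumI
    simp only [RCLike.re_eq_complex_re] at hre
    rw [hsum, ← hre, ← integral_neg]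
    refine integral_mono hβI.neg hsumI.re fun k => ?_
    have hb := bogoliubov_pairing hP (e := fun i => waveOp ν χ k (σ i))
      (fun i j hij => (commute_avgOp_waveOp hχ k (hσ.ne hij.symm) (hR j)).symm)
      (fun i j hij => by rw [star_waveOp hχ]; exact commute_waveOp hχ _ _ _ _)
      (fun i x => norm_star_waveOp_avgOp hℓ hχ h2 k (hR i) x) f (g k)
      (τ := ℓ ^ 3 * d k / n) (by have := hd0 k; positivity)
    refine le_trans (neg_le_neg ?_) hb
    have hgW : ‖g k‖ ^ 2 ≤ ‖𝓕 (fun x => (W x : ℂ)) k‖ ^ 2 :=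
      pow_le_pow_left₀ (norm_nonneg _) ((fourier_mol hW.int m).2 k) 2
    have eG : ∀ i, ‖P i (waveOp ν χ k (σ i) (f - P i f))‖ ^ 2 = G i (-k) := fun i => by
      rw [hG]; simp only [excitation]; rw [star_waveOp hχ, neg_neg]
    have eG' : ∀ i, ‖P i (star (waveOp ν χ k (σ i)) (f - P i f))‖ ^ 2 = G i k := fun i => rfl
    simp only [eG, eG']
    have hd' := hd0 k
    set S1 := ∑ i, G i (-k)
    set S2 := ∑ i, G i k
    set S3 := ∑ i, ‖P i f‖ ^ 2
    have hS1 : 0 ≤ S1 := sum_nonneg fun i _ => hG0 i _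
    have hS3 : 0 ≤ S3 := sum_nonneg fun i _ => sq_nonneg _
    have e4 : ‖g k‖ ^ 2 / (4 * (ℓ ^ 3 * d k / n)) * (n * S1 + S3) +
        ℓ ^ 3 * d k / n * (n * S2) = n ^ 2 / (4 * ℓ ^ 3) * (‖g k‖ ^ 2 * (d k)⁻¹) * S1 +
        n / (4 * ℓ ^ 3) * (‖g k‖ ^ 2 / d k) * S3 + ℓ ^ 3 * (d k * S2) := by
      field_simp
    rw [e4, hβ]
    simp only [← mul_sum]
    have hA0 : 0 ≤ A := (sq_nonneg _).trans (hA k)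
    have h5 : ‖g k‖ ^ 2 * (d k)⁻¹ ≤ A * E :=
      mul_le_mul (hgW.trans (hA k)) (hE k) (inv_pos.2 hd').le hA0
    have h6 : ‖g k‖ ^ 2 / d k ≤ ‖𝓕 (fun x => (W x : ℂ)) k‖ ^ 2 / d k :=
      div_le_div_of_nonneg_right hgW hd'.le
    have h7 := mul_le_mul_of_nonneg_right (mul_le_mul_of_nonneg_left h5
      (show 0 ≤ n ^ 2 / (4 * ℓ ^ 3) by positivity)) hS1
    have h8 := mul_le_mul_of_nonneg_right (mul_le_mul_of_nonneg_left h6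
      (show 0 ≤ n / (4 * ℓ ^ 3) by positivity)) hS3
    linarith
  have hlim : Tendsto (fun m => (∑ j, ∑ i ∈ univ.erase j, ⟪P i (P j f),
      pairOp ν χ (mol m W) (σ i) (σ j) ((f - P j f) - P i (f - P j f))⟫_ℂ).re) atTop
      (𝓝 (∑ j, ∑ i ∈ univ.erase j, ⟪P i (P j f),
      pairOp ν χ W (σ i) (σ j) ((f - P j f) - P i (f - P j f))⟫_ℂ).re) := by
    refine (Complex.continuous_re.tendsto _).comp (tendsto_finsetSum _ fun j _ =>
      tendsto_finsetSum _ fun i hi => ?_)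
    exact tendsto_inner_pairOp hχ hmm hW.meas hML hWM (ae_tendsto_mol hW.int.locallyIntegrable)
      (hσ.ne (Finset.mem_erase.1 hi).1) (hR i) _ _
  exact ge_of_tendsto' hlim key

end Pairing

/-! ### The dispersion relation of the excitations -/

section Dispersion

theorem inv_max_sub_le {C β t : ℝ} (hC : 0 < C) (hβ : 0 < β) (ht : 0 < t) :
    (max (t - C) 0 + β)⁻¹ ≤ 1 / t +
      ((1 + 2 * C) ^ 2 / β + (1 + 2 * C) ^ 2 / (2 * C)) * ((1 + t) ^ 2)⁻¹ := by
  have h1 : 0 < (1 + t) ^ 2 := by positivity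
  rcases lt_or_ge t (2 * C) with h | h
  · have h2 : (max (t - C) 0 + β)⁻¹ ≤ β⁻¹ :=
      inv_anti₀ hβ (le_add_of_nonneg_left (le_max_right _ _))
    have h3 : β⁻¹ ≤ (1 + 2 * C) ^ 2 / β * ((1 + t) ^ 2)⁻¹ := by
      rw [← div_eq_mul_inv, le_div_iff₀ h1, inv_mul_eq_div]
      gcongr
    have h4 : 0 ≤ (1 + 2 * C) ^ 2 / (2 * C) * ((1 + t) ^ 2)⁻¹ := by positivity
    have h5 : 0 < 1 / t := by positivity
    linarith
  · have htC : 0 < t - C := by linarith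
    have h2 : (max (t - C) 0 + β)⁻¹ ≤ (t - C)⁻¹ :=
      inv_anti₀ htC ((le_max_left _ _).trans (le_add_of_nonneg_right hβ.le))
    have h3 : (t - C)⁻¹ ≤ 1 / t + 2 * C / t ^ 2 := by
      have e : 1 / t + 2 * C / t ^ 2 = (t + 2 * C) / t ^ 2 := by field_simp
      rw [e, inv_eq_one_div, div_le_div_iff₀ htC (by positivity)]
      nlinarith
    have h4 : 2 * C / t ^ 2 ≤ (1 + 2 * C) ^ 2 / (2 * C) * ((1 + t) ^ 2)⁻¹ := by
      rw [← div_eq_mul_inv, div_div, div_le_div_iff₀ (by positivity) (by positivity)]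
      have h5 : 2 * C * (1 + t) ≤ (1 + 2 * C) * t := by linarith
      have h6 := pow_le_pow_left₀ (by positivity) h5 2
      nlinarith
    have h7 : 0 ≤ (1 + 2 * C) ^ 2 / β * ((1 + t) ^ 2)⁻¹ := by positivity
    linarith

/-- The dispersion relation of the excitations differs from that of free particles by a perturbation
at the frequency scale of the box. -/
theorem exists_inv_dispersion_le {Ckin β : ℝ} (hC : 0 < Ckin) (hβ : 0 < β) :
    ∃ C : ℝ, 0 < C ∧ ∀ (ℓ : ℝ), 0 < ℓ → ∀ k : E3, k ≠ 0 →
      (kinSymbol Ckin ℓ k + β * (ℓ ^ 2)⁻¹)⁻¹ ≤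
        2 * (1 / (8 * π ^ 2 * ‖k‖ ^ 2)) + C * ℓ ^ 2 * ((1 + ‖ℓ • k‖ ^ 2) ^ 2)⁻¹ := by
  refine ⟨(1 + 2 * Ckin) ^ 2 / β + (1 + 2 * Ckin) ^ 2 / (2 * Ckin), by positivity,
    fun ℓ hℓ k hk => ?_⟩
  have hk' : 0 < ‖k‖ := norm_pos_iff.2 hk
  have hpi := Real.pi_gt_three
  set t := (2 * π * ‖k‖ * ℓ) ^ 2 with ht
  have ht0 : 0 < t := by positivity
  have h1 := inv_max_sub_le hC hβ ht0
  have e1 : kinSymbol Ckin ℓ k + β * (ℓ ^ 2)⁻¹ = (max (t - Ckin) 0 + β) * (ℓ ^ 2)⁻¹ := by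
    rw [kinSymbol, add_mul, max_mul_of_nonneg _ _ (by positivity), zero_mul, ht]
    congr 2
    field_simp
  have e2 : 2 * (1 / (8 * π ^ 2 * ‖k‖ ^ 2)) = 1 / t * ℓ ^ 2 := by
    rw [ht]; field_simp; norm_num
  rw [e1, e2, mul_inv, inv_inv]
  have h2 := mul_le_mul_of_nonneg_right h1 (sq_nonneg ℓ)
  refine h2.trans ?_
  rw [add_mul]
  have h3 : ‖ℓ • k‖ ^ 2 ≤ t := by
    rw [norm_smul, Real.norm_of_nonneg hℓ.le, ht]
    refine pow_le_pow_left₀ (by positivity) ?_ 2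
    have : ℓ * ‖k‖ * 1 ≤ ℓ * ‖k‖ * (2 * π) :=
      mul_le_mul_of_nonneg_left (by linarith) (by positivity)
    linarith
  have h4 : ((1 + t) ^ 2)⁻¹ ≤ ((1 + ‖ℓ • k‖ ^ 2) ^ 2)⁻¹ := by gcongr
  have h5 := mul_le_mul_of_nonneg_left h4
    (show 0 ≤ ((1 + 2 * Ckin) ^ 2 / β + (1 + 2 * Ckin) ^ 2 / (2 * Ckin)) * ℓ ^ 2 by positivity)
  linarith

theorem integrable_inv_one_add_norm_sq : Integrable fun k : E3 => ((1 + ‖k‖ ^ 2) ^ 2)⁻¹ := by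
  have h := integrable_rpow_neg_one_add_norm_sq (E := E3) (μ := volume) (r := 4) (by simp; norm_num)
  refine h.congr (.of_forall fun k => ?_)
  simp only
  rw [show (-4 / 2 : ℝ) = -((2 : ℕ) : ℝ) by norm_num, Real.rpow_neg (by positivity),
    Real.rpow_natCast]

theorem continuous_kinSymbol (Ckin ℓ : ℝ) : Continuous (kinSymbol Ckin ℓ) := by
  unfold kinSymbol; fun_prop

theorem kinSymbol_nonneg (Ckin ℓ : ℝ) (k : E3) : 0 ≤ kinSymbol Ckin ℓ k := le_max_right _ _

/-- The energy gained from creating pairs with the amplitude `Ŵ`, over excitations of energy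
`kinSymbol + β ℓ⁻²`, is the Coulomb energy of `W` up to an error `C (∫ W)² / ℓ`. -/
def DispersionBound (Ckin β ℓ C : ℝ) : Prop :=
  ∀ W : E3 → ℝ, Integrable W → (∀ x, 0 ≤ W x) → coulomb W < ∞ →
    Integrable (fun k => ‖𝓕 (fun x => (W x : ℂ)) k‖ ^ 2 /
      (kinSymbol Ckin ℓ k + β * (ℓ ^ 2)⁻¹)) ∧
    ∫ k, ‖𝓕 (fun x => (W x : ℂ)) k‖ ^ 2 / (kinSymbol Ckin ℓ k + β * (ℓ ^ 2)⁻¹) ≤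
      2 * (coulomb W).toReal + C * (∫ x, W x) ^ 2 / ℓ

/-- The energy gained from pair creation: the Coulomb energy of the interaction, up to a correction
from the low frequencies. -/
theorem exists_dispersionBound {Ckin β : ℝ} (hC : 0 < Ckin) (hβ : 0 < β) :
    ∃ C : ℝ, 0 < C ∧ ∀ ℓ, 0 < ℓ → DispersionBound Ckin β ℓ C := by
  obtain ⟨C, hC0, hCle⟩ := exists_inv_dispersion_le hC hβ
  set m : E3 → ℝ := fun k => ((1 + ‖k‖ ^ 2) ^ 2)⁻¹ with hm
  have hmI : Integrable m := integrable_inv_one_add_norm_sq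
  have hm0 : 0 ≤ ∫ k, m k := integral_nonneg fun k => by positivity
  refine ⟨C * ((∫ k, m k) + 1), by positivity, fun ℓ hℓ W hW hW0 hcoul => ?_⟩
  set F := 𝓕 (fun x => (W x : ℂ)) with hF
  have hFc : Continuous F := continuous_fourier hW.ofReal
  set A := ∫ x, W x with hA
  have hA0 : 0 ≤ A := integral_nonneg hW0
  have hFA : ∀ k, ‖F k‖ ^ 2 ≤ A ^ 2 := fun k => by
    refine pow_le_pow_left₀ (norm_nonneg _) ((norm_fourier_le _ k).trans (le_of_eq ?_)) 2
    simp only [norm_real, Real.norm_of_nonneg (hW0 _), hA]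
  have hd0 : ∀ k, 0 < kinSymbol Ckin ℓ k + β * (ℓ ^ 2)⁻¹ := fun k =>
    add_pos_of_nonneg_of_pos (kinSymbol_nonneg _ _ _) (by positivity)
  set g : E3 → ℝ := fun k => ‖F k‖ ^ 2 * (1 / (8 * π ^ 2 * ‖k‖ ^ 2)) with hg
  have hg0 : ∀ k, 0 ≤ g k := fun k => by positivity
  have hgm : AEStronglyMeasurable g volume :=
    (Measurable.mul (hFc.norm.pow 2).measurable (by fun_prop)).aestronglyMeasurable
  have hgI : Integrable g := by
    refine ⟨hgm, ?_⟩
    rw [hasFiniteIntegral_iff_ofReal (.of_forall hg0)]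
    exact hcoul
  have hgint : ∫ k, g k = (coulomb W).toReal := by
    rw [integral_eq_lintegral_of_nonneg_ae (.of_forall hg0) hgm]; rfl
  have hmI' : Integrable fun k : E3 => m (ℓ • k) := hmI.comp_smul hℓ.ne'
  have hmint : ∫ k : E3, m (ℓ • k) = (ℓ ^ 3)⁻¹ * ∫ k, m k := by
    rw [Measure.integral_comp_smul, abs_of_pos (by positivity), smul_eq_mul]
    simp
  have hle : ∀ᵐ k, ‖F k‖ ^ 2 / (kinSymbol Ckin ℓ k + β * (ℓ ^ 2)⁻¹) ≤
      2 * g k + A ^ 2 * (C * ℓ ^ 2) * m (ℓ • k) := by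
    have h0 : ∀ᵐ k : E3, k ≠ 0 := by simp [ae_iff]
    filter_upwards [h0] with k hk
    rw [div_eq_mul_inv]
    have h1 := mul_le_mul_of_nonneg_left (hCle ℓ hℓ k hk) (sq_nonneg ‖F k‖)
    have h2 := mul_le_mul_of_nonneg_right (hFA k)
      (show 0 ≤ C * ℓ ^ 2 * ((1 + ‖ℓ • k‖ ^ 2) ^ 2)⁻¹ by positivity)
    simp only [hg, hm]
    linarith
  have hRI : Integrable fun k => 2 * g k + A ^ 2 * (C * ℓ ^ 2) * m (ℓ • k) :=
    (hgI.const_mul 2).add (hmI'.const_mul _)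
  have hI : Integrable (fun k => ‖F k‖ ^ 2 / (kinSymbol Ckin ℓ k + β * (ℓ ^ 2)⁻¹)) := by
    refine hRI.mono' ((hFc.norm.pow 2).div ((continuous_kinSymbol Ckin ℓ).add continuous_const)
      fun k => (hd0 k).ne').aestronglyMeasurable ?_
    filter_upwards [hle] with k hk
    rwa [Real.norm_of_nonneg (div_nonneg (sq_nonneg _) (hd0 k).le)]
  refine ⟨hI, (integral_mono_ae hI hRI hle).trans ?_⟩
  rw [integral_add (hgI.const_mul 2) (hmI'.const_mul _), integral_const_mul, integral_const_mul,
    hgint, hmint]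
  have e : A ^ 2 * (C * ℓ ^ 2) * ((ℓ ^ 3)⁻¹ * ∫ k, m k) = C * (∫ k, m k) * A ^ 2 / ℓ := by
    field_simp
  rw [e]
  have h1 : C * (∫ k, m k) * A ^ 2 / ℓ ≤ C * ((∫ k, m k) + 1) * A ^ 2 / ℓ := by
    gcongr; linarith
  linarith

end Dispersion

/-! ### The energy of a group of particles in the box -/

section Group

theorem IsKernel.mul {f p : E3 → ℝ} (hf : IsKernel f) (hp : Measurable p)
    (hpe : ∀ z, p (-z) = p z) (hp0 : ∀ z, 0 ≤ p z) (hp1 : ∀ z, p z ≤ 1) :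
    IsKernel fun z => f z * p z where
  meas := hf.meas.mul hp
  nonneg z := mul_nonneg (hf.nonneg z) (hp0 z)
  even z := by rw [hf.even, hpe]
  bdd := by
    obtain ⟨M, hM⟩ := hf.bdd
    exact ⟨M, fun z => (mul_le_of_le_one_right (hf.nonneg z) (hp1 z)).trans (hM z)⟩
  int := hf.int.mul_bdd (c := 1) hp.aestronglyMeasurable (.of_forall fun z => by
    rw [Real.norm_of_nonneg (hp0 z)]; exact hp1 z)

/-- Completing the square: `f |Ψ - p Φ|² ≥ 0`. -/
theorem re_inner_pairOp_ge {ι : Type*} {χ : E3 → ℝ} {ℓ X : ℝ} {ν : Measure (ι → E3)}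
    (hχ : IsWeight ℓ X χ) {f p : E3 → ℝ} (hf : IsKernel f)
    (hW : IsKernel fun z => f z * p z) (hL : IsKernel fun z => f z * p z * (1 - p z))
    (i j : ι) (a x : Lp ℂ 2 ν) :
    2 * (⟪a, pairOp ν χ (fun z => f z * p z) i j x⟫_ℂ).re -
      (⟪a, pairOp ν χ (fun z => f z * p z) i j a⟫_ℂ).re +
      (⟪a, pairOp ν χ (fun z => f z * p z * (1 - p z)) i j a⟫_ℂ).re ≤
    (⟪x, pairOp ν χ f i j x⟫_ℂ).re := by
  simp only [pairOp]
  have hf' := bddMeas_pair (ι := ι) hχ hf i j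
  have hW' := bddMeas_pair (ι := ι) hχ hW i j
  have hL' := bddMeas_pair (ι := ι) hχ hL i j
  rw [re_inner_mulOp_ofReal hf', re_inner_mulOp_ofReal hW', re_inner_mulOp_ofReal hW',
    re_inner_mulOp_ofReal hL']
  have i1 := integrable_mul_re_inner hW' a x
  have i2 := integrable_mul_re_inner hW' a a
  have i3 := integrable_mul_re_inner hL' a a
  have i4 := integrable_mul_re_inner hf' x x
  have i5 := i1.const_mul 2
  rw [← integral_const_mul]
  refine le_of_eq_of_le ?_ (integral_mono ((i5.sub i2).add i3) i4 fun y => ?_)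
  · rw [integral_add' (i5.sub i2) i3, integral_sub' i5 i2]
  simp only [Pi.add_apply, Pi.sub_apply, conj_mul_self_re, pairKer]
  set z := y i - y j
  have h0 : 0 ≤ χ (y i) * f z * χ (y j) :=
    mul_nonneg (mul_nonneg (hχ.nonneg _) (hf.nonneg _)) (hχ.nonneg _)
  have h1 : 0 ≤ ‖x y - (p z : ℂ) * a y‖ ^ 2 := sq_nonneg _
  have h2 : ‖x y - (p z : ℂ) * a y‖ ^ 2 =
      ‖x y‖ ^ 2 - 2 * (p z * (conj (a y) * x y).re) + p z ^ 2 * ‖a y‖ ^ 2 := by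
    simp only [← Complex.normSq_eq_norm_sq, Complex.normSq_apply, Complex.sub_re, Complex.sub_im,
      Complex.mul_re, Complex.mul_im, Complex.conj_re, Complex.conj_im, Complex.ofReal_re,
      Complex.ofReal_im]
    ring
  rw [h2] at h1
  have h3 := mul_nonneg h0 h1
  linarith

variable {ι : Type*} [DecidableEq ι] {χ : E3 → ℝ} {ℓ X : ℝ} {ν : Measure (ι → E3)}
  [IsFiniteMeasure ν] [IsProbabilityMeasure (boxMeasure ℓ)]

/-- Lower bound on the energy of `n` particles in the box in terms of the number of particles in
the condensate. -/
theorem group_lower_bound {κ : Type*} [Fintype κ] [DecidableEq κ] {σ : κ → ι}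
    (hσ : Function.Injective σ) (hR : ∀ i, Resampling (boxMeasure ℓ) ν (σ i)) (hℓ : 0 < ℓ)
    (hχ : IsWeight ℓ X χ) (h2 : ∫ x, χ x ^ 2 = ℓ ^ 3) (hχI : Integrable χ) {S : E3 → ℝ}
    (hS : ∀ z, ∫ x, χ x * χ (x - z) = ℓ ^ 3 * S z) {f p : E3 → ℝ} (hf : IsKernel f)
    (hp : Measurable p) (hpe : ∀ z, p (-z) = p z) (hp0 : ∀ z, 0 ≤ p z) (hp1 : ∀ z, p z ≤ 1)
    {Ckin β' : ℝ} (hβ : 0 < β') {ρ δ : ℝ} (hρ : 0 ≤ ρ) (hδ : 0 < δ)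
    (hdI : Integrable fun k => ‖𝓕 (fun x => ((f x * p x : ℝ) : ℂ)) k‖ ^ 2 /
      (kinSymbol Ckin ℓ k + β'))
    (hI : 0 ≤ ∫ z, f z * p z * S z) (x : Lp ℂ 2 ν)
    (hk : ∀ i, Integrable fun k => kinSymbol Ckin ℓ k * excitation ν χ ℓ (σ i) x k) :
    1 / 2 * (ℓ ^ 3)⁻¹ * ((∫ z, f z * p z * S z) + ∫ z, f z * p z * (1 - p z) * S z) *
        (‖(∑ i, avgOp (boxMeasure ℓ) ν (σ i)) x‖ ^ 2 - ∑ i, ‖avgOp (boxMeasure ℓ) ν (σ i) x‖ ^ 2)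
      - ρ * (∫ z, f z * p z * S z) * ∑ i, ‖avgOp (boxMeasure ℓ) ν (σ i) x‖ ^ 2
      - δ * (∫ z, f z * p z * S z) * Fintype.card κ *
        ‖(((ℓ ^ 3)⁻¹ : ℝ) : ℂ) • ((∑ i, avgOp (boxMeasure ℓ) ν (σ i)) x - x) - (ρ : ℂ) • x‖ ^ 2
      - (δ⁻¹ + ρ) * (X ^ 2 * ∫ z, f z * p z) * ∑ i, ‖x - avgOp (boxMeasure ℓ) ν (σ i) x‖ ^ 2
      - ((Fintype.card κ : ℝ) ^ 2 / (4 * ℓ ^ 3) * ((∫ z, f z * p z) ^ 2 * β'⁻¹) *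
          ((ℓ ^ 3)⁻¹ * X ^ 2 * ∑ i, ‖x - avgOp (boxMeasure ℓ) ν (σ i) x‖ ^ 2) +
        (Fintype.card κ : ℝ) / (4 * ℓ ^ 3) * (∫ k, ‖𝓕 (fun x => ((f x * p x : ℝ) : ℂ)) k‖ ^ 2 /
          (kinSymbol Ckin ℓ k + β')) * ∑ i, ‖avgOp (boxMeasure ℓ) ν (σ i) x‖ ^ 2 +
        β' * X ^ 2 * ∑ i, ‖x - avgOp (boxMeasure ℓ) ν (σ i) x‖ ^ 2) ≤
    ℓ ^ 3 * ∑ i, (∫ k, kinSymbol Ckin ℓ k * excitation ν χ ℓ (σ i) x k)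
      - ρ * ∑ i, (⟪x, fieldOp ν χ (fun z => f z * p z) (σ i) x⟫_ℂ).re
      + 1 / 2 * ∑ j, ∑ i ∈ univ.erase j, (⟪x, pairOp ν χ f (σ i) (σ j) x⟫_ℂ).re := by
  set W : E3 → ℝ := fun z => f z * p z with hWdef
  have hW : IsKernel W := hf.mul hp hpe hp0 hp1
  have hL : IsKernel fun z => f z * p z * (1 - p z) :=
    hW.mul (measurable_const.sub hp) (fun z => by rw [hpe]) (fun z => sub_nonneg.2 (hp1 z))
      fun z => by linarith [hp0 z]
  have h3 : 0 < ℓ ^ 3 := by positivity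
  have hd0 : ∀ k, 0 < kinSymbol Ckin ℓ k + β' := fun k =>
    add_pos_of_nonneg_of_pos (kinSymbol_nonneg _ _ _) hβ
  have hGI : ∀ i, Integrable (excitation ν χ ℓ (σ i) x) := fun i =>
    integrable_excitation hℓ hχ (hR i) x
  have hsplit : ∀ i, (fun k => (kinSymbol Ckin ℓ k + β') * excitation ν χ ℓ (σ i) x k) =
      fun k => kinSymbol Ckin ℓ k * excitation ν χ ℓ (σ i) x k +
        β' * excitation ν χ ℓ (σ i) x k := fun i => by funext k; ring
  have hQQ := pairing_lower_bound hσ hR hℓ hχ h2 hW (d := fun k => kinSymbol Ckin ℓ k + β') hd0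
    (E := β'⁻¹) (A := (∫ z, W z) ^ 2)
    (fun k => inv_anti₀ hβ (le_add_of_nonneg_left (kinSymbol_nonneg _ _ _)))
    (fun k => by
      refine pow_le_pow_left₀ (norm_nonneg _) ((norm_fourier_le _ k).trans (le_of_eq ?_)) 2
      simp only [norm_real, Real.norm_of_nonneg (hW.nonneg _)])
    hdI x (fun i => by rw [hsplit]; exact (hk i).add ((hGI i).const_mul _))
  have hT := condensate_lower_bound (commProj_avgOp hR) (x := x)
    (U := fun j => fieldOp ν χ W (σ j)) (K := fun i j => pairOp ν χ W (σ i) (σ j))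
    (L := fun i j => pairOp ν χ (fun z => f z * p z * (1 - p z)) (σ i) (σ j))
    (T := fun i j => (⟪x, pairOp ν χ f (σ i) (σ j) x⟫_ℂ).re) (c := (ℓ ^ 3)⁻¹)
    (I := ∫ z, f z * p z * S z) (J := ∫ z, f z * p z * (1 - p z) * S z)
    (u := X ^ 2 * ∫ z, W z) hδ hρ hI
    (fun j => star_mulOp_ofReal (bddMeas_field hχ hW _))
    (fun j y => re_inner_mulOp_self_nonneg (bddMeas_field hχ hW _)
      (fun y => meanField_nonneg hχ hW _) y)
    (fun j y => re_inner_mulOp_self_le (bddMeas_field hχ hW _) (fun y => meanField_le hχ hW _) y)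
    (fun j => avgOp_fieldOp_avgOp hℓ hχ hW hχI hS (hR j))
    (fun i j hij => commute_avgOp_fieldOp hχ hW (hσ.ne hij) (hR i))
    (fun i j hij => avgOp_pairOp_avgOp hℓ hχ hW (hσ.ne hij) (hR i))
    (fun i j => pairOp_symm hW _ _)
    (fun i j hij => re_inner_pairOp_avgOp hℓ hχ hL hχI hS (hσ.ne hij) (hR i) (hR j) x)
    (fun i j hij => re_inner_pairOp_ge hχ hf hW hL _ _ _ x) hQQ
  have e1 : ∀ i, ∫ k, (kinSymbol Ckin ℓ k + β') * excitation ν χ ℓ (σ i) x k =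
      (∫ k, kinSymbol Ckin ℓ k * excitation ν χ ℓ (σ i) x k) +
        β' * ∫ k, excitation ν χ ℓ (σ i) x k := fun i => by
    rw [hsplit, integral_add (hk i) ((hGI i).const_mul _), integral_const_mul]
  have hGle : ∑ i, (∫ k, excitation ν χ ℓ (σ i) x k) ≤
      (ℓ ^ 3)⁻¹ * X ^ 2 * ∑ i, ‖x - avgOp (boxMeasure ℓ) ν (σ i) x‖ ^ 2 := by
    rw [mul_sum]
    exact sum_le_sum fun i _ => integral_excitation_le hℓ hχ (hR i) x
  simp only [e1, sum_add_distrib, ← mul_sum] at hT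
  have h5 := mul_le_mul_of_nonneg_left hGle (show 0 ≤ (Fintype.card κ : ℝ) ^ 2 / (4 * ℓ ^ 3) *
    ((∫ z, W z) ^ 2 * β'⁻¹) by positivity)
  have h6 := mul_le_mul_of_nonneg_left hGle (show 0 ≤ ℓ ^ 3 * β' by positivity)
  have e7 : ℓ ^ 3 * β' * ((ℓ ^ 3)⁻¹ * X ^ 2 * ∑ i, ‖x - avgOp (boxMeasure ℓ) ν (σ i) x‖ ^ 2) =
      β' * X ^ 2 * ∑ i, ‖x - avgOp (boxMeasure ℓ) ν (σ i) x‖ ^ 2 := by field_simp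
  rw [e7] at h6
  linarith

end Group

section GroupEnergy

/-- The bookkeeping of the error terms in `group_lower_bound`: `q` is the squared norm of the state,
`n₀` and `n₁` the (unnormalized) expected numbers of particles in the condensate and of excitations,
`s₀` that of the square of the number of particles in the condensate, and `g` the gap, which absorbs
all terms proportional to `n₁`. -/
theorem group_energy_arithmetic {n n₀ n₁ q s₀ y L ρ I J Jd Iw X g σ ε C ℓ G : ℝ} (hL : 0 < L)
    (hρ : 0 < ρ) (hρL : 1 ≤ ρ * L) (hn : 0 ≤ n) (hnL : n ≤ 20 * (ρ * L)) (hn₀ : 0 ≤ n₀)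
    (hn₁ : 0 ≤ n₁) (hq : 0 ≤ q) (hnq : n₀ + n₁ = n * q) (hs : n * n₀ - n * n₁ ≤ s₀)
    (hy : y ≤ 2 * (L⁻¹ ^ 2 * s₀ - 2 * L⁻¹ * ρ * n₀ + ρ ^ 2 * q) + 2 * L⁻¹ ^ 2 * q)
    (hz₀ : 0 ≤ L⁻¹ ^ 2 * s₀ - 2 * L⁻¹ * ρ * n₀ + ρ ^ 2 * q)
    (hJ : 0 ≤ J) (hJI : J ≤ I) (hIw : 0 ≤ Iw) (hIwI : Iw ≤ 2 * I) (hσ : 0 ≤ σ) (hσ1 : σ ≤ 1 / 2)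
    (hε : 0 ≤ ε) (hC : 0 ≤ C)
    (hJd : Jd ≤ 2 * (1 + 6 * σ) * (J + ε) + C * I ^ 2 * ℓ ^ 2 * L⁻¹)
    (hG : ρ * I * ℓ ^ 2 ≤ G) (hX : 0 < X) (hg : 0 < g)
    (hgap : ρ * I * (338 * X ^ 2 + 11) ≤ g / 4) :
    1 / 4 * L * I * (L⁻¹ ^ 2 * s₀ - 2 * L⁻¹ * ρ * n₀ + ρ ^ 2 * q) - 1 / 2 * ρ ^ 2 * L * I * q
      - (21 + 100 * C * G) * (ρ * I) * q - 1200 * σ * (ρ ^ 2 * L * I) * q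
      - 800 * (ρ ^ 2 * L) * ε * q + ρ * I * n₁ ≤
    (1 / 2 * L⁻¹ * (I + J) * (s₀ - n₀) - ρ * I * n₀ - L / (8 * (n + 1)) * I * n * y
      - ((L / (8 * (n + 1)))⁻¹ + ρ) * (X ^ 2 * Iw) * n₁
      - (n ^ 2 / (4 * L) * (Iw ^ 2 * (g / (4 * X ^ 2))⁻¹) * (L⁻¹ * X ^ 2 * n₁) +
        n / (4 * L) * Jd * n₀ + g / (4 * X ^ 2) * X ^ 2 * n₁)) + g * n₁ := by
  have hI : 0 ≤ I := hJ.trans hJI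
  set c := L⁻¹ with hc
  have hc0 : 0 < c := inv_pos.2 hL
  have hcL : c * L = 1 := inv_mul_cancel₀ hL.ne'
  have hcρ : c ≤ ρ := by
    have := mul_le_mul_of_nonneg_left hρL hc0.le
    have e : c * (ρ * L) = ρ := by rw [mul_left_comm, hcL, mul_one]
    linarith
  set z := c ^ 2 * s₀ - 2 * c * ρ * n₀ + ρ ^ 2 * q with hz
  have hn₀q : n₀ ≤ n * q := by linarith
  have hcn : c * n ≤ 20 * ρ := by
    have := mul_le_mul_of_nonneg_left hnL hc0.le
    have e : c * (20 * (ρ * L)) = 20 * ρ * (c * L) := by ring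
    rw [e, hcL, mul_one] at this
    exact this
  have hcn₀ : c * n₀ ≤ 20 * ρ * q := by
    have h1 := mul_le_mul_of_nonneg_left hn₀q hc0.le
    have h2 := mul_le_mul_of_nonneg_right hcn hq
    linarith
  have hρI : 0 ≤ ρ * I := by positivity
  have hLIz : L * I * z = c * I * s₀ - 2 * ρ * I * n₀ + ρ ^ 2 * L * I * q := by
    have e : L * I * z = (c * L) * c * I * s₀ - 2 * (c * L) * ρ * I * n₀ + ρ ^ 2 * L * I * q := by
      rw [hz]; ring
    rw [e, hcL]; ring
  -- the term quadratic in the deviation of the condensate density from `ρ`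
  have t3 : L / (8 * (n + 1)) * I * n * y ≤ 1 / 4 * L * I * z + 1 / 4 * (ρ * I) * q := by
    have h1 : L / (8 * (n + 1)) * I * n ≤ 1 / 8 * (L * I) := by
      rw [div_mul_eq_mul_div, div_mul_eq_mul_div, div_le_iff₀ (by positivity)]
      have : 0 ≤ L * I := by positivity
      linarith
    have h0 : 0 ≤ L / (8 * (n + 1)) * I * n := by positivity
    have hz0 : 0 ≤ 2 * z + 2 * c ^ 2 * q := by positivity
    have h2 := mul_le_mul_of_nonneg_left hy h0
    have h3 := mul_le_mul_of_nonneg_right h1 hz0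
    have e : 1 / 8 * (L * I) * (2 * z + 2 * c ^ 2 * q) =
        1 / 4 * L * I * z + 1 / 4 * (c * L) * (c * I) * q := by ring
    rw [e, hcL] at h3
    have h4 : c * I * q ≤ ρ * I * q := by gcongr
    linarith
  have t4 : ((L / (8 * (n + 1)))⁻¹ + ρ) * (X ^ 2 * Iw) * n₁ ≤ ρ * I * (338 * X ^ 2) * n₁ := by
    have h1 : (L / (8 * (n + 1)))⁻¹ + ρ ≤ 169 * ρ := by
      rw [inv_div, div_eq_mul_inv, ← hc]
      linarith
    have h2 : X ^ 2 * Iw ≤ X ^ 2 * (2 * I) := by gcongr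
    have h3 := mul_le_mul_of_nonneg_right (mul_le_mul h1 h2 (by positivity) (by positivity)) hn₁
    linarith
  have hX2 : 0 < X ^ 2 := by positivity
  have t5 : n ^ 2 / (4 * L) * (Iw ^ 2 * (g / (4 * X ^ 2))⁻¹) * (c * X ^ 2 * n₁) ≤ g / 4 * n₁ := by
    have e : n ^ 2 / (4 * L) * (Iw ^ 2 * (g / (4 * X ^ 2))⁻¹) * (c * X ^ 2 * n₁) =
        (c * n) ^ 2 * Iw ^ 2 * X ^ 4 / g * n₁ := by
      rw [inv_div, hc]; field_simp
    rw [e]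
    refine mul_le_mul_of_nonneg_right ?_ hn₁
    have h1 : c * n * Iw * X ^ 2 ≤ g / 2 := by
      have h2 : c * n * Iw ≤ 20 * ρ * (2 * I) := mul_le_mul hcn hIwI hIw (by positivity)
      have h3 := mul_le_mul_of_nonneg_right h2 hX2.le
      have h4 : 0 ≤ ρ * I * X ^ 2 := by positivity
      linarith
    rw [div_le_iff₀ hg]
    have h5 := pow_le_pow_left₀ (by positivity) h1 2
    calc (c * n) ^ 2 * Iw ^ 2 * X ^ 4 = (c * n * Iw * X ^ 2) ^ 2 := by ring
      _ ≤ (g / 2) ^ 2 := h5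
      _ = g / 4 * g := by ring
  have t7 : g / (4 * X ^ 2) * X ^ 2 * n₁ = g / 4 * n₁ := by field_simp
  have hnn₀ : 0 ≤ n * n₀ := by positivity
  have hcnn₀ : c ^ 2 * (n * n₀) ≤ 400 * ρ ^ 2 * q := by
    have h1 := mul_le_mul hcn hcn₀ (by positivity) (by positivity)
    linarith
  have hcnn₀' : c * (n * n₀) ≤ 400 * ρ ^ 2 * L * q := by
    have h1 := mul_le_mul_of_nonneg_left hcnn₀ hL.le
    have e : L * (c ^ 2 * (n * n₀)) = (c * L) * (c * (n * n₀)) := by ring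
    rw [e, hcL] at h1
    linarith
  have t6 : n / (4 * L) * Jd * n₀ ≤ 1 / 2 * c * J * (n * n₀) + 1200 * σ * (ρ ^ 2 * L * I) * q +
      800 * (ρ ^ 2 * L) * ε * q + 100 * C * G * (ρ * I) * q := by
    have e0 : n / (4 * L) * Jd * n₀ = 1 / 4 * c * (n * n₀) * Jd := by
      rw [hc]; field_simp
    have h1 := mul_le_mul_of_nonneg_left hJd (show 0 ≤ 1 / 4 * c * (n * n₀) by positivity)
    rw [e0]
    refine h1.trans ?_
    have h2 : 6 * σ * J + (1 + 6 * σ) * ε ≤ 6 * σ * I + 4 * ε := by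
      have h3 : σ * J ≤ σ * I := by gcongr
      have h4 : σ * ε ≤ 1 / 2 * ε := by gcongr
      linarith
    have h5 := mul_le_mul_of_nonneg_left h2 (show 0 ≤ 1 / 2 * (c * (n * n₀)) by positivity)
    have h6 := mul_le_mul_of_nonneg_right hcnn₀'
      (show 0 ≤ 1 / 2 * (6 * σ * I + 4 * ε) by positivity)
    have h7 := mul_le_mul_of_nonneg_right hcnn₀ (show 0 ≤ 1 / 4 * (C * I ^ 2 * ℓ ^ 2) by positivity)
    have h8 := mul_le_mul_of_nonneg_left hG (show 0 ≤ 100 * C * (ρ * I) * q by positivity)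
    linarith
  have t1 : 1 / 2 * c * I * n₀ ≤ 10 * (ρ * I) * q := by
    have := mul_le_mul_of_nonneg_right hcn₀ hI
    linarith
  have t2 : 1 / 2 * c * J * (n * n₀) - 10 * (ρ * I) * n₁ - 10 * (ρ * I) * q ≤
      1 / 2 * c * J * (s₀ - n₀) := by
    have h1 := mul_le_mul_of_nonneg_left hs (show 0 ≤ 1 / 2 * c * J by positivity)
    have h2 : c * n * (J * n₁) ≤ 20 * ρ * (I * n₁) :=
      mul_le_mul hcn (by gcongr) (by positivity) (by positivity)
    have h3 : c * n₀ * J ≤ 20 * ρ * q * I := mul_le_mul hcn₀ hJI hJ (by positivity)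
    linarith
  have hgap' := mul_le_mul_of_nonneg_right hgap hn₁
  have hρIq : 0 ≤ ρ * I * q := by positivity
  have hgn₁ : 0 ≤ g * n₁ := by positivity
  linarith

end GroupEnergy

/-! ### The truncated interaction -/

/-- The data of the box: the localization function `χ ≤ X`, the interaction and its scattering
solution, the side length `ℓ`, and a bound `σ` on `1 - (χ * χ)(x/ℓ)` on the range of the
interaction. -/
structure IsBoxSetup (χ v ω : E3 → ℝ) (R ℓ X σ : ℝ) : Prop where
  loc : IsLocalization χ
  bound_pos : 0 < X
  le_bound : ∀ x, χ x ≤ X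
  pot : IsPotential v R
  sol : IsScatteringSolution v ω
  side_pos : 0 < ℓ
  σ_nonneg : 0 ≤ σ
  σ_le : σ ≤ 1 / 2
  le_selfConv : ∀ z, ‖z‖ ≤ R → 1 - σ ≤ selfConv χ (ℓ⁻¹ • z)

section Truncation

/-- A scattering solution is determined almost everywhere only; this picks a measurable, even
representative with values in `[0, 1]`. -/
theorem exists_even_representative {u : E3 → ℝ} (hm : AEStronglyMeasurable u)
    (he : ∀ᵐ x, u (-x) = u x) {lo hi : ℝ} (hlh : lo ≤ hi) (hl : ∀ᵐ x, lo ≤ u x)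
    (hh : ∀ᵐ x, u x ≤ hi) :
    ∃ p : E3 → ℝ, Measurable p ∧ (∀ x, p (-x) = p x) ∧ (∀ x, lo ≤ p x) ∧ (∀ x, p x ≤ hi) ∧
      p =ᵐ[volume] u := by
  have hmm : Measurable (hm.mk u) := hm.stronglyMeasurable_mk.measurable
  refine ⟨fun x => max lo (min hi ((hm.mk u x + hm.mk u (-x)) / 2)), ?_, fun x => ?_,
    fun x => le_max_left _ _, fun x => max_le hlh (min_le_left _ _), ?_⟩
  · exact measurable_const.max (measurable_const.min
      ((hmm.add (hmm.comp measurable_neg)).div_const 2))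
  · simp only [neg_neg, add_comm]
  · have h1 := hm.ae_eq_mk
    have h2 := (Measure.measurePreserving_neg (volume : Measure E3)).quasiMeasurePreserving.ae h1
    filter_upwards [h1, h2, he, hl, hh] with x h1 h2 h3 h4 h5
    rw [← h1, ← h2, h3, add_self_div_two, min_eq_right h5, max_eq_right h4]

theorem IsLocalization.selfConv_neg {χ : E3 → ℝ} (hχ : IsLocalization χ) (z : E3) :
    selfConv χ (-z) = selfConv χ z := by
  rw [hχ.selfConv_eq, hχ.selfConv_eq]
  rw [← integral_add_right_eq_self (fun x => χ x * χ (x - -z)) (-z)]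
  refine integral_congr_ae (.of_forall fun x => ?_)
  simp only [sub_neg_eq_add, neg_add_cancel_right]
  rw [← sub_eq_add_neg, mul_comm]

theorem IsLocalization.continuous_selfConv {χ : E3 → ℝ} (hχ : IsLocalization χ) :
    Continuous (selfConv χ) :=
  hχ.compact.continuous_convolution_right _ hχ.smooth.continuous.locallyIntegrable
    hχ.smooth.continuous

variable {χ v ω : E3 → ℝ} {R ℓ X σ : ℝ}

/-- The interaction weighted by `1 - ω`, cut off at height `M`. -/
def voneCut (v ω : E3 → ℝ) (M : ℕ) (z : E3) : ℝ := min (v z) M * (1 - ω z)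

namespace IsBoxSetup

theorem isWeight (h : IsBoxSetup χ v ω R ℓ X σ) : IsWeight ℓ X (chiB χ ℓ) where
  meas := (h.loc.continuous_chiB ℓ).measurable
  nonneg := h.loc.chiB_nonneg ℓ
  le _ := h.le_bound _
  supp _ hx := h.loc.chiB_eq_zero h.side_pos hx

theorem integrable_chiB (h : IsBoxSetup χ v ω R ℓ X σ) : Integrable (chiB χ ℓ) :=
  (h.loc.smooth.continuous.integrable_of_hasCompactSupport h.loc.compact).comp_smul
    (inv_pos.2 h.side_pos).ne'

theorem half_le_selfConv (h : IsBoxSetup χ v ω R ℓ X σ) {z : E3} (hz : ‖z‖ ≤ R) :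
    1 / 2 ≤ selfConv χ (ℓ⁻¹ • z) := by
  linarith [h.le_selfConv z hz, h.σ_le]

/-- A regular representative of `1 - ω`. -/
theorem exists_one_sub_representative (h : IsBoxSetup χ v ω R ℓ X σ) :
    ∃ p : E3 → ℝ, Measurable p ∧ (∀ x, p (-x) = p x) ∧ (∀ x, 0 ≤ p x) ∧ (∀ x, p x ≤ 1) ∧
      p =ᵐ[volume] fun x => 1 - ω x := by
  refine exists_even_representative (u := fun x => 1 - ω x)
    (aestronglyMeasurable_const.sub h.sol.locallyIntegrable.aestronglyMeasurable) ?_ zero_le_one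
    ?_ ?_
  · filter_upwards [h.sol.even h.pot] with x hx using by rw [hx]
  · filter_upwards [h.sol.le_one h.pot] with x hx using by linarith
  · filter_upwards [h.sol.nonneg h.pot] with x hx using by linarith

/-- A regular representative of `W`, with the interaction cut off at height `M`. -/
theorem exists_truncated_kernel (h : IsBoxSetup χ v ω R ℓ X σ) (M : ℕ) :
    ∃ f : E3 → ℝ, IsKernel f ∧
      f =ᵐ[volume] fun z => min (v z) M / selfConv χ (ℓ⁻¹ • z) := by
  have hM : (0 : ℝ) ≤ M := Nat.cast_nonneg M
  have hmin : Integrable fun z => min (v z) M :=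
    h.pot.integrable.mono' (h.pot.integrable.aestronglyMeasurable.inf aestronglyMeasurable_const)
      (.of_forall fun z => by
        rw [Real.norm_of_nonneg (le_min (h.pot.nonneg z) hM)]
        exact min_le_left _ _)
  obtain ⟨g, hgm, hge, hg0, hg1, hgv⟩ := exists_even_representative hmin.aestronglyMeasurable
    (lo := 0) (hi := M) (.of_forall fun x => by
      rw [h.pot.radial (-x) x (norm_neg x)]) hM
    (.of_forall fun x => le_min (h.pot.nonneg x) hM)
    (.of_forall fun x => min_le_right _ _)
  have hSm : Measurable fun z : E3 => selfConv χ (ℓ⁻¹ • z) :=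
    (h.loc.continuous_selfConv.comp (continuous_const_smul _)).measurable
  set f : E3 → ℝ := (Metric.closedBall 0 R).indicator fun z => g z / selfConv χ (ℓ⁻¹ • z) with hf
  have hfm : Measurable f := (hgm.div hSm).indicator measurableSet_closedBall
  have hfle : ∀ z, f z ≤ 2 * g z := by
    intro z
    by_cases hz : z ∈ Metric.closedBall (0 : E3) R
    · have hS := h.half_le_selfConv (mem_closedBall_zero_iff.1 hz)
      rw [hf, Set.indicator_of_mem hz, div_le_iff₀ (by linarith)]
      have := mul_le_mul_of_nonneg_left hS (mul_nonneg zero_le_two (hg0 z))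
      linarith
    · rw [hf, Set.indicator_of_notMem hz]
      exact mul_nonneg zero_le_two (hg0 z)
  have hf0 : ∀ z, 0 ≤ f z := by
    intro z
    refine Set.indicator_nonneg (fun z hz => div_nonneg (hg0 z) ?_) z
    linarith [h.half_le_selfConv (mem_closedBall_zero_iff.1 hz)]
  refine ⟨f, ⟨hfm, hf0, fun z => ?_, ⟨2 * M, fun z => (hfle z).trans
    (mul_le_mul_of_nonneg_left (hg1 z) zero_le_two)⟩, ?_⟩, ?_⟩
  · by_cases hz : z ∈ Metric.closedBall (0 : E3) R
    · have hz' : -z ∈ Metric.closedBall (0 : E3) R := by simpa using hz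
      rw [hf, Set.indicator_of_mem hz, Set.indicator_of_mem hz', hge, smul_neg,
        h.loc.selfConv_neg]
    · have hz' : -z ∉ Metric.closedBall (0 : E3) R := by simpa using hz
      rw [hf, Set.indicator_of_notMem hz, Set.indicator_of_notMem hz']
  · refine ((hmin.congr hgv.symm).const_mul 2).mono' hfm.aestronglyMeasurable
      (.of_forall fun z => ?_)
    rw [Real.norm_of_nonneg (hf0 z)]
    exact hfle z
  · filter_upwards [hgv] with z hz
    by_cases hzR : z ∈ Metric.closedBall (0 : E3) R
    · rw [hf, Set.indicator_of_mem hzR, hz]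
    · rw [hf, Set.indicator_of_notMem hzR,
        h.pot.finite_range z (by simpa using hzR), min_eq_left hM, zero_div]

theorem voneCut_nonneg (h : IsBoxSetup χ v ω R ℓ X σ) (M : ℕ) : ∀ᵐ z, 0 ≤ voneCut v ω M z := by
  filter_upwards [h.sol.le_one h.pot] with z hz
  exact mul_nonneg (le_min (h.pot.nonneg z) (Nat.cast_nonneg M)) (by linarith)

theorem voneCut_le (h : IsBoxSetup χ v ω R ℓ X σ) (M : ℕ) :
    ∀ᵐ z, voneCut v ω M z ≤ vone v ω z := by
  filter_upwards [h.sol.le_one h.pot] with z hz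
  exact mul_le_mul_of_nonneg_right (min_le_left _ _) (by linarith)

theorem integrable_voneCut (h : IsBoxSetup χ v ω R ℓ X σ) (M : ℕ) :
    Integrable (voneCut v ω M) := by
  refine (h.sol.integrable_vone h.pot).mono' ((h.pot.integrable.aestronglyMeasurable.inf
    aestronglyMeasurable_const).mul
    (aestronglyMeasurable_const.sub h.sol.locallyIntegrable.aestronglyMeasurable)) ?_
  filter_upwards [h.voneCut_nonneg M, h.voneCut_le M] with z h1 h2
  rw [Real.norm_eq_abs]
  rwa [abs_of_nonneg h1]

/-- The part of `∫ v (1 - ω)` that is lost by the truncation tends to zero. -/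
theorem tendsto_integral_voneCut (h : IsBoxSetup χ v ω R ℓ X σ) :
    Tendsto (fun M => (∫ z, vone v ω z) - ∫ z, voneCut v ω M z) atTop (𝓝 0) := by
  have h1 : Tendsto (fun M => ∫ z, voneCut v ω M z) atTop (𝓝 (∫ z, vone v ω z)) := by
    refine tendsto_integral_of_dominated_convergence (vone v ω)
      (fun M => (h.integrable_voneCut M).aestronglyMeasurable) (h.sol.integrable_vone h.pot)
      (fun M => ?_) (.of_forall fun z => ?_)
    · filter_upwards [h.voneCut_nonneg M, h.voneCut_le M] with z h1 h2
      rwa [Real.norm_of_nonneg h1]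
    · refine tendsto_const_nhds.congr' ?_
      obtain ⟨M₀, hM₀⟩ := exists_nat_ge (v z)
      filter_upwards [eventually_ge_atTop M₀] with M hM
      rw [voneCut, vone, min_eq_left (hM₀.trans (by exact_mod_cast hM))]
  simpa using (tendsto_const_nhds (x := ∫ z, vone v ω z)).sub h1

/-- The mean field `∫ w₁(x, y) dy` exceeds that of the truncated interaction by little. -/
theorem abs_integral_pairW1_sub_le (h : IsBoxSetup χ v ω R ℓ X σ) {M : ℕ} {f p : E3 → ℝ}
    (hf : IsKernel f) (hfv : f =ᵐ[volume] fun z => min (v z) M / selfConv χ (ℓ⁻¹ • z))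
    (hp : Measurable p) (hpe : ∀ z, p (-z) = p z) (hp0 : ∀ z, 0 ≤ p z) (hp1 : ∀ z, p z ≤ 1)
    (hpω : p =ᵐ[volume] fun x => 1 - ω x) (x : E3) :
    |(∫ y, pairW1 χ ℓ v ω x y) - meanField (chiB χ ℓ) (fun z => f z * p z) x| ≤
      2 * X ^ 2 * ((∫ z, vone v ω z) - ∫ z, voneCut v ω M z) := by
  have hk := hf.mul hp hpe hp0 hp1
  have hχ := h.isWeight
  have hv1 := h.sol.integrable_vone h.pot
  have hd : Integrable fun z => vone v ω z - voneCut v ω M z := hv1.sub (h.integrable_voneCut M)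
  -- the difference of the kernels
  have hle : ∀ᵐ z, |bigW χ ℓ v z * (1 - ω z) - f z * p z| ≤
      2 * (vone v ω z - voneCut v ω M z) := by
    filter_upwards [hfv, hpω, h.voneCut_le M] with z h1 h2 h3
    rw [h1, h2, bigW]
    by_cases hz : ‖z‖ ≤ R
    · have hS := h.half_le_selfConv hz
      have e : v z / selfConv χ (ℓ⁻¹ • z) * (1 - ω z) -
          min (v z) M / selfConv χ (ℓ⁻¹ • z) * (1 - ω z) =
          (vone v ω z - voneCut v ω M z) / selfConv χ (ℓ⁻¹ • z) := by
        rw [vone, voneCut]; ring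
      rw [e, abs_of_nonneg (div_nonneg (sub_nonneg.2 h3) (by linarith)),
        div_le_iff₀ (by linarith)]
      have := mul_le_mul_of_nonneg_left hS (mul_nonneg zero_le_two (sub_nonneg.2 h3))
      linarith
    · rw [h.pot.finite_range z (not_le.1 hz), min_eq_left (Nat.cast_nonneg M)]
      simp only [zero_div, zero_mul, sub_zero, abs_zero]
      linarith
  have hle' : ∀ᵐ y, |pairW1 χ ℓ v ω x y - pairKer (chiB χ ℓ) (fun z => f z * p z) x y| ≤
      X ^ 2 * (2 * (vone v ω (x - y) - voneCut v ω M (x - y))) := by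
    have := (Measure.measurePreserving_sub_left volume x).quasiMeasurePreserving.ae hle
    filter_upwards [this] with y hy
    have e : pairW1 χ ℓ v ω x y - pairKer (chiB χ ℓ) (fun z => f z * p z) x y =
        chiB χ ℓ x * chiB χ ℓ y *
          (bigW χ ℓ v (x - y) * (1 - ω (x - y)) - f (x - y) * p (x - y)) := by
      rw [pairW1, pairW, pairKer]; ring
    rw [e, abs_mul, abs_of_nonneg (mul_nonneg (hχ.nonneg x) (hχ.nonneg y))]
    have h1 := mul_le_mul (hχ.le x) (hχ.le y) (hχ.nonneg y) h.bound_pos.le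
    rw [← sq] at h1
    exact mul_le_mul h1 hy (abs_nonneg _) (sq_nonneg X)
  have hdI : Integrable fun y => X ^ 2 * (2 * (vone v ω (x - y) - voneCut v ω M (x - y))) :=
    ((hd.comp_sub_left x).const_mul 2).const_mul _
  have hkI := integrable_pairKer hχ hk x
  have hm : AEStronglyMeasurable (fun y => pairW1 χ ℓ v ω x y) volume := by
    have hWm : AEStronglyMeasurable (fun z => bigW χ ℓ v z * (1 - ω z)) volume :=
      (h.pot.integrable.aestronglyMeasurable.aemeasurable.div
        (h.loc.continuous_selfConv.comp (continuous_const_smul _)).measurable.aemeasurable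
        ).aestronglyMeasurable.mul (aestronglyMeasurable_const.sub
        h.sol.locallyIntegrable.aestronglyMeasurable)
    have h1 := (hWm.comp_quasiMeasurePreserving
      (Measure.measurePreserving_sub_left volume x).quasiMeasurePreserving)
    have h2 := ((h1.const_mul (chiB χ ℓ x)).mul
      (h.loc.continuous_chiB ℓ).aestronglyMeasurable)
    refine h2.congr (.of_forall fun y => ?_)
    simp only [pairW1, pairW, Pi.mul_apply, Function.comp_apply]
    ring
  have hdiff : Integrable fun y =>
      pairW1 χ ℓ v ω x y - pairKer (chiB χ ℓ) (fun z => f z * p z) x y :=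
    hdI.mono' (hm.sub hkI.aestronglyMeasurable) hle'
  have hw : Integrable fun y => pairW1 χ ℓ v ω x y :=
    (hdiff.add hkI).congr (.of_forall fun y => by simp)
  rw [meanField, ← integral_sub hw hkI]
  rw [← Real.norm_eq_abs]
  refine (norm_integral_le_integral_norm _).trans ?_
  refine (integral_mono_ae hdiff.norm hdI hle').trans (le_of_eq ?_)
  rw [integral_const_mul, integral_const_mul,
    integral_sub_left_eq_self (fun z => vone v ω z - voneCut v ω M z) volume x,
    integral_sub hv1 (h.integrable_voneCut M)]
  ring

end IsBoxSetup

end Truncation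

section GroupEnergyFull

theorem norm_sq_smul_sub_smul {H : Type*} [NormedAddCommGroup H] [InnerProductSpace ℂ H] (x y : H)
    (α β : ℝ) : ‖(α : ℂ) • y - (β : ℂ) • x‖ ^ 2 =
      α ^ 2 * ‖y‖ ^ 2 - 2 * α * β * (⟪x, y⟫_ℂ).re + β ^ 2 * ‖x‖ ^ 2 := by
  have h := norm_sub_sq (𝕜 := ℂ) ((α : ℂ) • y) ((β : ℂ) • x)
  rw [h, norm_smul, norm_smul, norm_real, norm_real, mul_pow, mul_pow,
    Real.norm_eq_abs, Real.norm_eq_abs, sq_abs, sq_abs, inner_smul_left, inner_smul_right,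
    conj_ofReal, RCLike.re_eq_complex_re, re_ofReal_mul, re_ofReal_mul,
    ← inner_conj_symm, Complex.conj_re]
  ring

theorem sum_sum_erase_le {κ : Type*} [Fintype κ] [DecidableEq κ] {f g : κ → κ → ℝ}
    (h : ∀ i j, i ≠ j → f i j ≤ g i j) :
    ∑ j, ∑ i ∈ univ.erase j, f i j ≤ ∑ j, ∑ i ∈ univ.erase j, g i j :=
  sum_le_sum fun j _ => sum_le_sum fun i hi => h i j (Finset.ne_of_mem_erase hi)

variable {χ v ω : E3 → ℝ} {R ℓ X σ : ℝ}

/-- The integrals of the truncated interaction that enter the energy of a group. -/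
theorem IsBoxSetup.truncated_integrals (h : IsBoxSetup χ v ω R ℓ X σ) {M : ℕ} {f p : E3 → ℝ}
    (hf : IsKernel f) (hfv : f =ᵐ[volume] fun z => min (v z) M / selfConv χ (ℓ⁻¹ • z))
    (hp : Measurable p) (hpe : ∀ z, p (-z) = p z) (hp0 : ∀ z, 0 ≤ p z) (hp1 : ∀ z, p z ≤ 1)
    (hpω : p =ᵐ[volume] fun x => 1 - ω x) :
    (∫ z, f z * p z * selfConv χ (ℓ⁻¹ • z)) = ∫ z, voneCut v ω M z ∧
    0 ≤ ∫ z, f z * p z * (1 - p z) * selfConv χ (ℓ⁻¹ • z) ∧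
    (∫ z, f z * p z * (1 - p z) * selfConv χ (ℓ⁻¹ • z)) ≤ ∫ z, voneCut v ω M z ∧
    (∫ z, f z * p z) ≤ 2 * ∫ z, voneCut v ω M z ∧
    coulomb (fun z => f z * p z) ≤ ofReal ((1 + 6 * σ) *
      ((∫ z, f z * p z * (1 - p z) * selfConv χ (ℓ⁻¹ • z)) +
        ((∫ z, vone v ω z) - ∫ z, voneCut v ω M z))) := by
  have hk := hf.mul hp hpe hp0 hp1
  have hv1 := h.sol.integrable_vone h.pot
  have hvc := h.integrable_voneCut M
  have hS : ∀ z, min (v z) M / selfConv χ (ℓ⁻¹ • z) * selfConv χ (ℓ⁻¹ • z) = min (v z) M := by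
    intro z
    by_cases hz : ‖z‖ ≤ R
    · exact div_mul_cancel₀ _ (by linarith [h.half_le_selfConv hz])
    · rw [h.pot.finite_range z (not_le.1 hz), min_eq_left (Nat.cast_nonneg M)]; simp
  have e1 : (fun z => f z * p z * selfConv χ (ℓ⁻¹ • z)) =ᵐ[volume] voneCut v ω M := by
    filter_upwards [hfv, hpω] with z h1 h2
    rw [h1, h2, mul_right_comm, hS, voneCut]
  have e2 : (fun z => f z * p z * (1 - p z) * selfConv χ (ℓ⁻¹ • z)) =ᵐ[volume]
      fun z => voneCut v ω M z * ω z := by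
    filter_upwards [e1, hpω] with z h1 h2
    rw [← h1, h2]; ring
  have hω1 : ∀ᵐ z, ‖ω z‖ ≤ 1 := by
    filter_upwards [h.sol.nonneg h.pot, h.sol.le_one h.pot] with z h1 h2
    rwa [Real.norm_of_nonneg h1]
  have hωm := h.sol.locallyIntegrable.aestronglyMeasurable
  have hcω : Integrable fun z => voneCut v ω M z * ω z := hvc.mul_bdd hωm hω1
  have hvω : Integrable fun z => vone v ω z * ω z := hv1.mul_bdd hωm hω1
  have hle2 : ∀ᵐ z, f z * p z ≤ (1 + 2 * σ) * vone v ω z := by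
    filter_upwards [hfv, hpω, h.voneCut_le M, h.voneCut_nonneg M] with z h1 h2 h3 h4
    have hσ := h.σ_nonneg
    rw [h1, h2]
    by_cases hz : ‖z‖ ≤ R
    · have hS1 := h.le_selfConv z hz
      have hS2 := h.half_le_selfConv hz
      have e : min (v z) M / selfConv χ (ℓ⁻¹ • z) * (1 - ω z) =
        voneCut v ω M z / selfConv χ (ℓ⁻¹ • z) := by rw [voneCut]; ring
      rw [e, div_le_iff₀ (by linarith)]
      have h5 : 1 ≤ (1 + 2 * σ) * selfConv χ (ℓ⁻¹ • z) := by
        nlinarith [h.σ_le]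
      have h6 := mul_le_mul_of_nonneg_left h5 (h4.trans h3)
      linarith
    · rw [h.pot.finite_range z (not_le.1 hz), min_eq_left (Nat.cast_nonneg M)]
      have := h4.trans h3
      simp only [zero_div, zero_mul]
      positivity
  refine ⟨integral_congr_ae e1, ?_, ?_, ?_, ?_⟩
  · rw [integral_congr_ae e2]
    refine integral_nonneg_of_ae ?_
    filter_upwards [h.voneCut_nonneg M, h.sol.nonneg h.pot] with z h1 h2 using mul_nonneg h1 h2
  · rw [integral_congr_ae e2]
    refine integral_mono_ae hcω hvc ?_
    filter_upwards [h.voneCut_nonneg M, h.sol.le_one h.pot] with z h1 h2 using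
      mul_le_of_le_one_right h1 h2
  · rw [← integral_const_mul]
    refine integral_mono_ae hk.int (hvc.const_mul 2) ?_
    filter_upwards [e1, h.voneCut_nonneg M, hfv] with z h1 h2 h3
    rw [← h1]
    by_cases hz : ‖z‖ ≤ R
    · have hS2 := h.half_le_selfConv hz
      have := mul_le_mul_of_nonneg_left hS2 (mul_nonneg zero_le_two (hk.nonneg z))
      linarith
    · rw [h3, h.pot.finite_range z (not_le.1 hz), min_eq_left (Nat.cast_nonneg M)]; simp
  · refine (coulomb_mono hk.int hv1 (c := 1 + 2 * σ) (by linarith [h.σ_nonneg])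
      (.of_forall hk.nonneg) hle2 (h.sol.vone_nonneg h.pot)).trans ?_
    refine (mul_le_mul_right (coulomb_vone_le h.pot h.sol) _).trans ?_
    rw [← ofReal_mul (sq_nonneg _)]
    refine ENNReal.ofReal_le_ofReal ?_
    have h1 : ∫ y, vone v ω y * ω y ≤
        (∫ z, f z * p z * (1 - p z) * selfConv χ (ℓ⁻¹ • z)) +
        ((∫ z, vone v ω z) - ∫ z, voneCut v ω M z) := by
      rw [integral_congr_ae e2, ← integral_sub hv1 hvc, ← sub_le_iff_le_add',
        ← integral_sub hvω hcω]
      refine integral_mono_ae (hvω.sub hcω) (hv1.sub hvc) ?_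
      filter_upwards [h.voneCut_le M, h.sol.le_one h.pot] with z h1 h2
      have := mul_le_of_le_one_right (sub_nonneg.2 h1) h2
      linarith
    have h2 : 0 ≤ ∫ y, vone v ω y * ω y := by
      refine integral_nonneg_of_ae ?_
      filter_upwards [h.sol.vone_nonneg h.pot, h.sol.nonneg h.pot] with z h1 h2 using
        mul_nonneg h1 h2
    have h3 : (1 + 2 * σ) ^ 2 ≤ 1 + 6 * σ := by nlinarith [h.σ_le, h.σ_nonneg]
    exact mul_le_mul h3 h1 h2 (by linarith [h.σ_nonneg])

variable {ι : Type*} [DecidableEq ι] {ν : Measure (ι → E3)} [IsFiniteMeasure ν]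
  [IsProbabilityMeasure (boxMeasure ℓ)]

/-- The energy of a group of at most `20 ρ ℓ³` particles, and its positivity if there are at least
`6 ρ ℓ³` of them. -/
theorem group_energy_ge (h : IsBoxSetup χ v ω R ℓ X σ) {b Ckin ρ C G : ℝ} (hb : 0 < b)
    (hρ : 0 < ρ) (hC : 0 ≤ C)
    (hdisp : DispersionBound Ckin (b / (4 * X ^ 2)) ℓ C)
    (hgap : ρ * (∫ z, vone v ω z) * (338 * X ^ 2 + 11) ≤ b * (ℓ ^ 2)⁻¹ / 4)
    (hG : ρ * (∫ z, vone v ω z) * ℓ ^ 2 ≤ G) (hρL : 21 + 400 * C * G ≤ ρ * ℓ ^ 3)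
    {κ : Type*} [Fintype κ] [DecidableEq κ] {e : κ → ι} (he : Function.Injective e)
    (hR : ∀ i, Resampling (boxMeasure ℓ) ν (e i)) (hn : Fintype.card κ ≤ 20 * (ρ * ℓ ^ 3))
    (x : Lp ℂ 2 ν)
    (hk : ∀ i, Integrable fun k => kinSymbol Ckin ℓ k * excitation ν (chiB χ ℓ) ℓ (e i) x k)
    (hw : ∀ i j, i ≠ j →
      Integrable (fun y => pairW χ ℓ v (y (e i)) (y (e j)) * ‖x y‖ ^ 2) ν) {E : ℝ}
    (hE : E = ∑ i, (ℓ ^ 3 * (∫ k, kinSymbol Ckin ℓ k * excitation ν (chiB χ ℓ) ℓ (e i) x k) +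
        b * (ℓ ^ 2)⁻¹ * ‖x - avgOp (boxMeasure ℓ) ν (e i) x‖ ^ 2 -
        ρ * ∫ y, (∫ y', pairW1 χ ℓ v ω (y (e i)) y') * ‖x y‖ ^ 2 ∂ν) +
      1 / 2 * ∑ j, ∑ i ∈ univ.erase j,
        ∫ y, pairW χ ℓ v (y (e i)) (y (e j)) * ‖x y‖ ^ 2 ∂ν) :
    -((1 / 2 * ρ ^ 2 * ℓ ^ 3 + (21 + 400 * C * G) * ρ + 1200 * σ * ρ ^ 2 * ℓ ^ 3) *
      (∫ z, vone v ω z)) * ‖x‖ ^ 2 ≤ E ∧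
    (6 * (ρ * ℓ ^ 3) ≤ Fintype.card κ → σ ≤ 1 / 600 → 0 ≤ E) := by
  have hℓ := h.side_pos
  have hX := h.bound_pos
  have hχ := h.isWeight
  have h3 : 0 < ℓ ^ 3 := by positivity
  obtain ⟨p, hp, hpe, hp0, hp1, hpω⟩ := h.exists_one_sub_representative
  set I := ∫ z, vone v ω z with hI
  set n : ℝ := (Fintype.card κ : ℝ) with hndef
  set q := ‖x‖ ^ 2 with hq
  set P : κ → Lp ℂ 2 ν →L[ℂ] Lp ℂ 2 ν := fun i => avgOp (boxMeasure ℓ) ν (e i) with hPdef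
  have hP : CommProj P := commProj_avgOp hR
  set N := ∑ i, P i with hN
  set n₀ := ∑ i, ‖P i x‖ ^ 2 with hn₀
  set n₁ := ∑ i, ‖x - P i x‖ ^ 2 with hn₁
  set ε : ℕ → ℝ := fun M => I - ∫ z, voneCut v ω M z with hε
  have hε0 : ∀ M, 0 ≤ ε M := fun M => sub_nonneg.2
    (integral_mono_ae (h.integrable_voneCut M) (h.sol.integrable_vone h.pot) (h.voneCut_le M))
  have hεlim : Tendsto ε atTop (𝓝 0) := h.tendsto_integral_voneCut
  have hn0 : 0 ≤ n := Nat.cast_nonneg _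
  have hn₀0 : 0 ≤ n₀ := sum_nonneg fun i _ => sq_nonneg _
  have hn₁0 : 0 ≤ n₁ := sum_nonneg fun i _ => sq_nonneg _
  have hq0 : 0 ≤ q := sq_nonneg _
  have hnq : n₀ + n₁ = n * q := by
    rw [hn₀, hn₁, ← sum_add_distrib, sum_congr rfl fun i _ => hP.norm_sq_add i x]
    simp [hndef, hq]
  have hNx : (⟪x, N x⟫_ℂ).re = n₀ := by
    rw [hN, sum_apply, inner_sum, Complex.re_sum, hn₀]
    exact sum_congr rfl fun i _ => (hP.norm_sq_apply i x).symm
  set s₀ := ‖N x‖ ^ 2 with hs₀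
  have hexp : ∀ α β : ℝ, 0 ≤ α ^ 2 * s₀ - 2 * α * β * n₀ + β ^ 2 * q := fun α β => by
    rw [← hNx, ← norm_sq_smul_sub_smul x (N x) α β]; exact sq_nonneg _
  have hs : n * n₀ - n * n₁ ≤ s₀ := by
    have h1 := hexp 1 n
    have h2 : n * (n * q) = n * n₀ + n * n₁ := by rw [← hnq]; ring
    linarith
  set c := (ℓ ^ 3)⁻¹ with hc
  have hc0 : 0 < c := inv_pos.2 h3
  set y := ‖(c : ℂ) • (N x - x) - (ρ : ℂ) • x‖ ^ 2 with hy
  have hyle : y ≤ 2 * (c ^ 2 * s₀ - 2 * c * ρ * n₀ + ρ ^ 2 * q) + 2 * c ^ 2 * q := by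
    have e1 : (c : ℂ) • (N x - x) - (ρ : ℂ) • x =
        ((c : ℂ) • N x - (ρ : ℂ) • x) - (c : ℂ) • x := by rw [smul_sub]; abel
    have e2 := norm_sq_smul_sub_smul x (N x) c ρ
    rw [hNx] at e2
    have e3 : ‖(c : ℂ) • x‖ ^ 2 = c ^ 2 * q := by
      rw [norm_smul, norm_real, mul_pow, Real.norm_eq_abs, sq_abs]
    have e4 := norm_sub_le ((c : ℂ) • N x - (ρ : ℂ) • x) ((c : ℂ) • x)
    have e5 := pow_le_pow_left₀ (norm_nonneg _) e4 2
    have e6 := add_sq_le (a := ‖(c : ℂ) • N x - (ρ : ℂ) • x‖) (b := ‖(c : ℂ) • x‖)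
    rw [hy, e1]
    rw [e2, e3] at e6
    linarith
  have hI0 : 0 ≤ I := integral_nonneg_of_ae (h.sol.vone_nonneg h.pot)
  have hG0 : 0 ≤ G := le_trans (by positivity) hG
  have hCG : 0 ≤ C * G := mul_nonneg hC hG0
  have hρL1 : 1 ≤ ρ * ℓ ^ 3 := by linarith
  set g := b * (ℓ ^ 2)⁻¹ with hg
  have hg0 : 0 < g := by positivity
  have hβ : b / (4 * X ^ 2) * (ℓ ^ 2)⁻¹ = g / (4 * X ^ 2) := by rw [hg]; ring
  rw [DispersionBound, hβ] at hdisp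
  have hxx : Integrable (fun y => ‖x y‖ ^ 2) ν := (Lp.memLp x).integrable_norm_pow (by norm_num)
  set D : ℝ := 800 * (ρ ^ 2 * ℓ ^ 3) * q + ρ * (n * (2 * X ^ 2 * q)) with hD
  -- the bound for the truncated interaction
  have key : ∀ M, ∃ IM : ℝ, 0 ≤ IM ∧ IM ≤ I ∧
      1 / 4 * ℓ ^ 3 * IM * (c ^ 2 * s₀ - 2 * c * ρ * n₀ + ρ ^ 2 * q)
        - 1 / 2 * ρ ^ 2 * ℓ ^ 3 * IM * q - (21 + 100 * (4 * C) * G) * (ρ * IM) * q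
        - 1200 * σ * (ρ ^ 2 * ℓ ^ 3 * IM) * q + ρ * IM * n₁ - D * ε M ≤ E := by
    intro M
    obtain ⟨f, hf, hfv⟩ := h.exists_truncated_kernel M
    obtain ⟨a1, a2, a3, a4, a5⟩ := h.truncated_integrals hf hfv hp hpe hp0 hp1 hpω
    have hk' := hf.mul hp hpe hp0 hp1
    have hdispf := hdisp (fun z => f z * p z) hk'.int hk'.nonneg (a5.trans_lt ENNReal.ofReal_lt_top)
    set IM := ∫ z, voneCut v ω M z with hIM
    set J := ∫ z, f z * p z * (1 - p z) * selfConv χ (ℓ⁻¹ • z) with hJ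
    set Iw := ∫ z, f z * p z with hIw
    have hIM0 : 0 ≤ IM := integral_nonneg_of_ae (h.voneCut_nonneg M)
    have hIMI : IM ≤ I := by have := hε0 M; simp only [hε] at this; linarith
    have hIw0 : 0 ≤ Iw := integral_nonneg hk'.nonneg
    have hL := group_lower_bound he hR hℓ hχ (h.loc.integral_chiB_sq hℓ) h.integrable_chiB
      (S := fun z => selfConv χ (ℓ⁻¹ • z)) (h.loc.integral_chiB_mul hℓ) hf hp hpe hp0 hp1
      (Ckin := Ckin) (β' := g / (4 * X ^ 2)) (by positivity) (ρ := ρ)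
      (δ := ℓ ^ 3 / (8 * (n + 1))) hρ.le (by positivity) hdispf.1 (by rw [a1]; exact hIM0) x hk
    rw [a1] at hL
    have hcoul : (coulomb fun z => f z * p z).toReal ≤ (1 + 6 * σ) * (J + ε M) :=
      ENNReal.toReal_le_of_le_ofReal
        (mul_nonneg (by linarith [h.σ_nonneg]) (add_nonneg a2 (hε0 M))) a5
    have hJd : ∫ k, ‖𝓕 (fun x => ((f x * p x : ℝ) : ℂ)) k‖ ^ 2 /
        (kinSymbol Ckin ℓ k + g / (4 * X ^ 2)) ≤
        2 * (1 + 6 * σ) * (J + ε M) + 4 * C * IM ^ 2 * ℓ ^ 2 * c := by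
      refine hdispf.2.trans ?_
      have h5 : C * Iw ^ 2 / ℓ ≤ 4 * C * IM ^ 2 * ℓ ^ 2 * c := by
        have e1 : 4 * C * IM ^ 2 * ℓ ^ 2 * c = C * (2 * IM) ^ 2 / ℓ := by
          rw [hc]; field_simp; ring
        rw [e1]
        gcongr
      linarith
    have harith := group_energy_arithmetic (L := ℓ ^ 3) (J := J) (I := IM) (Iw := Iw) (ε := ε M)
      (C := 4 * C) (ℓ := ℓ) (G := G) h3 hρ hρL1 hn0 hn hn₀0 hn₁0 hq0 hnq hs hyle (hexp c ρ) a2 a3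
      hIw0 a4 h.σ_nonneg h.σ_le (hε0 M) (by positivity) hJd
      (le_trans (by gcongr) hG) hX hg0 (le_trans (by gcongr) hgap)
    -- comparison with the full interaction
    have hU : ∀ i, ∫ y, (∫ y', pairW1 χ ℓ v ω (y (e i)) y') * ‖x y‖ ^ 2 ∂ν ≤
        (⟪x, fieldOp ν (chiB χ ℓ) (fun z => f z * p z) (e i) x⟫_ℂ).re + 2 * X ^ 2 * q * ε M := by
      intro i
      have hfield := bddMeas_field (ι := ι) hχ hk' (e i)
      rw [fieldOp, re_inner_mulOp_ofReal hfield, hq, norm_sq_eq_integral]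
      have i1 := integrable_mul_re_inner hfield x x
      have i2 := hxx.const_mul (2 * X ^ 2 * ε M)
      have e1 : 2 * X ^ 2 * (∫ y, ‖x y‖ ^ 2 ∂ν) * ε M = ∫ y, 2 * X ^ 2 * ε M * ‖x y‖ ^ 2 ∂ν := by
        rw [integral_const_mul]; ring
      rw [e1, ← integral_add i1 i2]
      refine integral_mono_of_nonneg ?_ (i1.add i2) (.of_forall fun y => ?_)
      · refine .of_forall fun y => mul_nonneg ?_ (sq_nonneg _)
        refine le_of_tendsto' (f := fun M => -(2 * X ^ 2 * ε M)) (x := atTop) ?_ fun M' => ?_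
        · simpa using (hεlim.const_mul (2 * X ^ 2)).neg
        · obtain ⟨f', hf', hfv'⟩ := h.exists_truncated_kernel M'
          have h6 := abs_le.1 (h.abs_integral_pairW1_sub_le hf' hfv' hp hpe hp0 hp1 hpω (y (e i)))
          have h7 := meanField_nonneg hχ (hf'.mul hp hpe hp0 hp1) (y (e i))
          simp only [hε, hI]
          linarith [h6.1]
      · have h6 := abs_le.1 (h.abs_integral_pairW1_sub_le hf hfv hp hpe hp0 hp1 hpω (y (e i)))
        simp only [conj_mul_self_re]
        have h7 : (∫ y', pairW1 χ ℓ v ω (y (e i)) y') ≤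
            meanField (chiB χ ℓ) (fun z => f z * p z) (y (e i)) + 2 * X ^ 2 * ε M := by
          simp only [hε, hI]
          linarith [h6.2]
        have h8 := mul_le_mul_of_nonneg_right h7 (sq_nonneg ‖x y‖)
        linarith
    have hT : ∀ i j, i ≠ j → (⟪x, pairOp ν (chiB χ ℓ) f (e i) (e j) x⟫_ℂ).re ≤
        ∫ y, pairW χ ℓ v (y (e i)) (y (e j)) * ‖x y‖ ^ 2 ∂ν := by
      intro i j hij
      have hpair := bddMeas_pair (ι := ι) hχ hf (e i) (e j)
      rw [pairOp, re_inner_mulOp_ofReal hpair]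
      refine integral_mono_ae (integrable_mul_re_inner hpair x x) (hw i j hij) ?_
      have hle : ∀ᵐ z, f z ≤ bigW χ ℓ v z := by
        filter_upwards [hfv] with z hz
        rw [hz, bigW]
        by_cases hzR : ‖z‖ ≤ R
        · have := h.half_le_selfConv hzR
          exact div_le_div_of_nonneg_right (min_le_left _ _) (by linarith)
        · rw [h.pot.finite_range z (not_le.1 hzR), min_eq_left (Nat.cast_nonneg M)]
      filter_upwards [(hR i).ae_sub (he.ne hij) hle] with y hy
      rw [conj_mul_self_re, pairKer, pairW]
      have h6 := mul_le_mul_of_nonneg_left hy (hχ.nonneg (y (e i)))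
      have h7 := mul_le_mul_of_nonneg_right h6 (hχ.nonneg (y (e j)))
      exact mul_le_mul_of_nonneg_right h7 (sq_nonneg _)
    have hUs := sum_le_sum fun i (_ : i ∈ univ) => hU i
    rw [sum_add_distrib, Finset.sum_const, Finset.card_univ, nsmul_eq_mul] at hUs
    have hTs := sum_sum_erase_le hT
    have hUs' := mul_le_mul_of_nonneg_left hUs hρ.le
    refine ⟨IM, hIM0, hIMI, ?_⟩
    rw [hE, Finset.sum_sub_distrib, sum_add_distrib, ← mul_sum, ← mul_sum,
      ← mul_sum, hD]
    have hfin := add_le_add_left hL (g * n₁)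
    linarith
  have hDlim : ∀ A : ℝ, Tendsto (fun M => A - D * ε M) atTop (𝓝 A) := fun A => by
    simpa using (tendsto_const_nhds (x := A)).sub (hεlim.const_mul D)
  have hσ := h.σ_nonneg
  refine ⟨?_, fun h6 hσ6 => ?_⟩
  · refine le_of_tendsto' (hDlim _) fun M => ?_
    obtain ⟨IM, hIM0, hIMI, hE'⟩ := key M
    refine le_trans ?_ hE'
    have h7 := hexp c ρ
    have h8 : 0 ≤ 1 / 4 * ℓ ^ 3 * IM * (c ^ 2 * s₀ - 2 * c * ρ * n₀ + ρ ^ 2 * q) :=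
      mul_nonneg (mul_nonneg (by positivity) hIM0) h7
    have h9 : 0 ≤ ρ * IM * n₁ := mul_nonneg (mul_nonneg hρ.le hIM0) hn₁0
    have h10 := mul_le_mul_of_nonneg_left hIMI (show 0 ≤ (1 / 2 * ρ ^ 2 * ℓ ^ 3 +
      (21 + 400 * C * G) * ρ + 1200 * σ * ρ ^ 2 * ℓ ^ 3) * q by
        have : 0 ≤ 21 + 400 * C * G := by linarith
        positivity)
    linarith
  · refine le_of_tendsto' (hDlim 0) fun M => ?_
    obtain ⟨IM, hIM0, hIMI, hE'⟩ := key M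
    refine le_trans ?_ hE'
    have hcL : c * ℓ ^ 3 = 1 := inv_mul_cancel₀ h3.ne'
    have h7 := mul_le_mul_of_nonneg_left (hexp c (3 * ρ))
      (show 0 ≤ 1 / 4 * ℓ ^ 3 * IM by positivity)
    -- with at least `6 ρ ℓ³` particles the density of the condensate or that of the excitations
    -- is far from `ρ`
    have h8 : ρ * IM * (6 * (ρ * ℓ ^ 3) * q - n₁) ≤ ρ * IM * n₀ := by
      refine mul_le_mul_of_nonneg_left ?_ (by positivity)
      have := mul_le_mul_of_nonneg_right h6 hq0
      linarith
    have h9 : (21 + 400 * C * G) * (ρ * IM * q) ≤ ρ * ℓ ^ 3 * (ρ * IM * q) := by gcongr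
    have h10 : σ * (ρ ^ 2 * ℓ ^ 3 * IM * q) ≤ 1 / 600 * (ρ ^ 2 * ℓ ^ 3 * IM * q) := by gcongr
    have h11 : 0 ≤ ρ ^ 2 * ℓ ^ 3 * IM * q := by positivity
    have e1 : 1 / 4 * ℓ ^ 3 * IM * (c ^ 2 * s₀ - 2 * c * (3 * ρ) * n₀ + (3 * ρ) ^ 2 * q) =
        1 / 4 * ℓ ^ 3 * IM * (c ^ 2 * s₀ - 2 * c * ρ * n₀ + ρ ^ 2 * q)
          - (c * ℓ ^ 3) * (ρ * IM * n₀) + 2 * (ρ ^ 2 * ℓ ^ 3 * IM * q) := by ring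
    rw [e1, hcL] at h7
    linarith only [h7, h8, h9, h10, h11]

end GroupEnergyFull

/-! ### Cells of the configuration space -/

section Cells

variable {N : ℕ} {ℓ : ℝ}

/-- The integral over a configuration and an additional point is invariant under the exchange of
this point with the particle `i`. -/
theorem lintegral_lintegral_update {G : Conf N → E3 → ℝ≥0∞}
    (hG : Measurable fun p : Conf N × E3 => G p.1 p.2)
    (i : Fin N) :
    ∫⁻ x : Conf N, ∫⁻ y, G (update x i y) (x i) = ∫⁻ x : Conf N, ∫⁻ y, G x y := by
  have m1 : Measurable fun x : Conf N => ∫⁻ y, G (update x i y) (x i) := by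
    refine Measurable.lintegral_prod_right'
      (f := fun p : Conf N × E3 => G (update p.1 i p.2) (p.1 i)) ?_
    exact hG.comp ((measurable_update_prod i).prodMk
      ((measurable_pi_apply i).comp measurable_fst))
  have m2 : Measurable fun x : Conf N => ∫⁻ y, G x y := hG.lintegral_prod_right'
  rw [volume_pi, lintegral_eq_lmarginal_univ (fun _ => 0), lintegral_eq_lmarginal_univ (fun _ => 0),
    lmarginal_erase' _ m1 (Finset.mem_univ i), lmarginal_erase' _ m2 (Finset.mem_univ i)]
  congr 1
  funext x
  simp only [Function.update_idem, Function.update_self]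
  exact lintegral_lintegral_swap (hG.comp
    ((measurable_update x).comp measurable_snd |>.prodMk measurable_fst)).aemeasurable

/-- The configurations with the particles of the set `p.1` in the box and the other ones outside, at
distances to the origin that add up to a number with integer part `p.2`. -/
def cell (ℓ : ℝ) (p : Finset (Fin N) × ℕ) : Set (Conf N) :=
  {x | (∀ i, x i ∈ cube ℓ ↔ i ∈ p.1) ∧ ⌊∑ j ∈ p.1ᶜ, ‖x j‖⌋₊ = p.2}

theorem measurableSet_cell (ℓ : ℝ) (p : Finset (Fin N) × ℕ) : MeasurableSet (cell ℓ p) := by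
  have e : cell ℓ p = (⋂ i, {x : Conf N | x i ∈ cube ℓ ↔ i ∈ p.1}) ∩
      {x | ⌊∑ j ∈ p.1ᶜ, ‖x j‖⌋₊ = p.2} := by
    ext x; simp [cell]
  rw [e]
  refine MeasurableSet.inter (MeasurableSet.iInter fun i => ?_) ?_
  · have h : MeasurableSet {x : Conf N | x i ∈ cube ℓ} :=
      (measurable_pi_apply i) (measurableSet_cube ℓ)
    by_cases hi : i ∈ p.1
    · simpa [hi] using h
    · have e : {x : Conf N | x i ∈ cube ℓ ↔ i ∈ p.1} = {x : Conf N | x i ∈ cube ℓ}ᶜ := by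
        ext x; simp [hi]
      rw [e]
      exact h.compl
  · have h : Measurable fun x : Conf N => ⌊∑ j ∈ p.1ᶜ, ‖x j‖⌋₊ :=
      Nat.measurable_floor.comp (Finset.measurable_sum _ fun j _ => (measurable_pi_apply j).norm)
    exact h (measurableSet_singleton p.2)

open Classical in
/-- Every configuration is in exactly one cell. -/
theorem exists_mem_cell_iff (ℓ : ℝ) (x : Conf N) : ∃ p, ∀ p', x ∈ cell ℓ p' ↔ p' = p := by
  set A : Finset (Fin N) := univ.filter fun i => x i ∈ cube ℓ with hA
  refine ⟨(A, ⌊∑ j ∈ Aᶜ, ‖x j‖⌋₊), fun p' => ⟨fun h => ?_, fun h => ?_⟩⟩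
  · obtain ⟨B, m⟩ := p'
    have hB : B = A := by
      ext i
      rw [← h.1 i, hA]; simp
    subst hB
    exact Prod.ext rfl h.2.symm
  · subst h
    exact ⟨fun i => by simp [hA], rfl⟩

theorem zero_mem_cube (hℓ : 0 < ℓ) : (0 : E3) ∈ cube ℓ := fun j => by
  simpa using (half_pos hℓ).le

theorem update_mem_cell (hℓ : 0 < ℓ) {p : Finset (Fin N) × ℕ} {i : Fin N} (hi : i ∈ p.1)
    (x : Conf N) (y : E3) :
    update x i y ∈ cell ℓ p ↔ y ∈ cube ℓ ∧ update x i 0 ∈ cell ℓ p := by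
  have h0 := zero_mem_cube hℓ
  have e : ∀ y, ∑ j ∈ p.1ᶜ, ‖update x i y j‖ = ∑ j ∈ p.1ᶜ, ‖x j‖ := fun y =>
    sum_congr rfl fun j hj => by
      rw [Function.update_of_ne]
      rintro rfl
      exact (Finset.mem_compl.1 hj) hi
  have key : ∀ y, update x i y ∈ cell ℓ p ↔
      y ∈ cube ℓ ∧ (∀ j, j ≠ i → (x j ∈ cube ℓ ↔ j ∈ p.1)) ∧ ⌊∑ j ∈ p.1ᶜ, ‖x j‖⌋₊ = p.2 := by
    intro y
    simp only [cell, Set.mem_ofPred_eq, e]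
    rw [← and_assoc]
    refine and_congr_left fun _ => ⟨fun h => ⟨?_, fun j hj => ?_⟩, fun h j => ?_⟩
    · have := (h i).2 hi
      rwa [Function.update_self] at this
    · have := h j
      rwa [Function.update_of_ne hj] at this
    · by_cases hj : j = i
      · subst hj
        rw [Function.update_self]
        exact iff_of_true h.1 hi
      · rw [Function.update_of_ne hj]
        exact h.2 j hj
  rw [key, key]
  tauto

/-- The configurations that belong to the cell `p` once the particle `i` is moved into the box. -/
def cellExcept (ℓ : ℝ) (p : Finset (Fin N) × ℕ) (i : Fin N) : Set (Conf N) :=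
  {x | update x i 0 ∈ cell ℓ p}

theorem measurableSet_cellExcept (ℓ : ℝ) (p : Finset (Fin N) × ℕ) (i : Fin N) :
    MeasurableSet (cellExcept ℓ p i) :=
  ((measurable_update_prod i).comp (measurable_id.prodMk measurable_const))
    (measurableSet_cell ℓ p)

theorem cellExcept_eq_empty (hℓ : 0 < ℓ) {p : Finset (Fin N) × ℕ} {i : Fin N} (hi : i ∉ p.1) :
    cellExcept ℓ p i = ∅ := by
  refine Set.eq_empty_of_forall_notMem fun x hx => hi ((hx.1 i).1 ?_)
  rw [Function.update_self]
  exact zero_mem_cube hℓ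

theorem volume_cell_lt_top (ℓ : ℝ) (p : Finset (Fin N) × ℕ) : volume (cell ℓ p) < ∞ := by
  have hb := (isCompact_cube ℓ).isBounded
  obtain ⟨r, hr⟩ := hb.subset_closedBall 0
  refine (measure_mono (t := Metric.closedBall (0 : Conf N) (max r (p.2 + 1)))
    fun x hx => ?_).trans_lt
    (isCompact_closedBall _ _).measure_lt_top
  have h0 : (0 : ℝ) ≤ max r (p.2 + 1) := le_max_of_le_right (by positivity)
  rw [mem_closedBall_zero_iff, pi_norm_le_iff_of_nonneg h0]
  intro i
  by_cases hi : i ∈ p.1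
  · have := hr ((hx.1 i).2 hi)
    rw [mem_closedBall_zero_iff] at this
    exact this.trans (le_max_left _ _)
  · have h1 := Finset.single_le_sum (f := fun j => ‖x j‖) (fun j _ => norm_nonneg _)
      (Finset.mem_compl.2 hi)
    have h2 := Nat.lt_floor_add_one (∑ j ∈ p.1ᶜ, ‖x j‖)
    rw [hx.2] at h2
    exact (h1.trans h2.le).trans (le_max_right _ _)

instance isFiniteMeasure_cell (ℓ : ℝ) (p : Finset (Fin N) × ℕ) :
    IsFiniteMeasure ((volume : Measure (Conf N)).restrict (cell ℓ p)) :=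
  isFiniteMeasure_restrict.2 (volume_cell_lt_top ℓ p).ne

/-- Moving the particle `i` of a cell through space. -/
theorem lintegral_cell_update (hℓ : 0 < ℓ) {p : Finset (Fin N) × ℕ} {i : Fin N} (hi : i ∈ p.1)
    {G : Conf N → ℝ≥0∞} (hG : Measurable G) :
    ∫⁻ x in cell ℓ p, ∫⁻ y, G (update x i y) =
      ofReal (ℓ ^ 3) * ∫⁻ x in cellExcept ℓ p i, G x := by
  classical
  have hc := measurableSet_cube ℓ
  have he := measurableSet_cellExcept ℓ p i
  have h := lintegral_lintegral_update (N := N)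
    (G := fun x y => (cellExcept ℓ p i).indicator G x * (cube ℓ).indicator 1 y)
    (((hG.indicator he).comp measurable_fst).mul
      ((measurable_one.indicator hc).comp measurable_snd)) i
  have e : ∀ x : Conf N, ∀ y : E3, (cellExcept ℓ p i).indicator G (update x i y) *
      (cube ℓ).indicator 1 (x i) = (cell ℓ p).indicator 1 x * G (update x i y) := by
    intro x y
    have h1 := update_mem_cell hℓ hi x (x i)
    rw [Function.update_eq_self] at h1
    have h2 : update x i y ∈ cellExcept ℓ p i ↔ update x i 0 ∈ cell ℓ p := by
      rw [cellExcept, Set.mem_ofPred_eq, Function.update_idem]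
    simp only [Set.indicator_apply, h1, h2]
    split_ifs <;> simp_all
  simp only [e] at h
  rw [← lintegral_indicator (measurableSet_cell ℓ p), ← lintegral_indicator he,
    ← lintegral_const_mul _ (hG.indicator he)]
  calc _ = ∫⁻ x : Conf N, ∫⁻ y, (cell ℓ p).indicator 1 x * G (update x i y) := by
        refine lintegral_congr fun x => ?_
        by_cases hx : x ∈ cell ℓ p <;> simp [hx]
    _ = _ := by
        rw [h]
        refine lintegral_congr fun x => ?_
        rw [lintegral_const_mul _ (measurable_one.indicator hc), lintegral_indicator_one hc,
          volume_cube hℓ, mul_comm]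

/-- The distribution of the particles of a cell that are in the box is uniform. -/
theorem resampling_cell (hℓ : 0 < ℓ) {p : Finset (Fin N) × ℕ} {i : Fin N} (hi : i ∈ p.1) :
    Resampling (boxMeasure ℓ) ((volume : Measure (Conf N)).restrict (cell ℓ p)) i := by
  have := isProbabilityMeasure_boxMeasure hℓ
  refine ⟨measurable_update_prod i, Measure.ext fun s hs => ?_⟩
  classical
  have hc := measurableSet_cube ℓ
  have hci : MeasurableSet {x : Conf N | x i ∈ cube ℓ} := (measurable_pi_apply i) hc
  rw [Measure.map_apply (measurable_update_prod i) hs,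
    Measure.prod_apply ((measurable_update_prod i) hs)]
  have h := lintegral_cell_update hℓ hi (G := ({x | x i ∈ cube ℓ} ∩ s).indicator 1)
    (measurable_one.indicator (hci.inter hs))
  have e1 : ∀ x : Conf N, boxMeasure ℓ (Prod.mk x ⁻¹' ((fun q : Conf N × E3 =>
      update q.1 i q.2) ⁻¹' s)) = (ofReal (ℓ ^ 3))⁻¹ *
      ∫⁻ y, ({x | x i ∈ cube ℓ} ∩ s).indicator 1 (update x i y) := by
    intro x
    have hm : MeasurableSet (update x i ⁻¹' s) := (measurable_update x) hs
    have e2 : (fun y => ({x : Conf N | x i ∈ cube ℓ} ∩ s).indicator (1 : Conf N → ℝ≥0∞)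
        (update x i y)) = (update x i ⁻¹' s ∩ cube ℓ).indicator 1 := by
      funext y
      simp only [Set.indicator_apply, Set.mem_inter_iff, Set.mem_ofPred_eq, Function.update_self,
        Set.mem_preimage, and_comm, Pi.one_apply]
    rw [e2, lintegral_indicator_one (hm.inter hc), boxMeasure, Measure.smul_apply, smul_eq_mul,
      ENNReal.ofReal_inv_of_pos (by positivity)]
    congr 1
    exact Measure.restrict_apply hm
  simp only [e1]
  rw [lintegral_const_mul' _ _ (by simp [hℓ]), h, ← mul_assoc, ENNReal.inv_mul_cancel (by simp [hℓ])
    ofReal_ne_top, one_mul, lintegral_indicator_one (hci.inter hs),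
    Measure.restrict_apply (hci.inter hs), Measure.restrict_apply hs]
  congr 1
  ext x
  have h1 := update_mem_cell hℓ hi x (x i)
  rw [Function.update_eq_self] at h1
  simp only [Set.mem_inter_iff, Set.mem_ofPred_eq, h1, cellExcept]
  tauto

/-- An integral over the configuration space is the sum of the integrals over the cells. -/
theorem hasSum_integral_cell {f : Conf N → ℝ} (hf : Integrable f) (ℓ : ℝ) :
    HasSum (fun p => ∫ x in cell ℓ p, f x) (∫ x, f x) := by
  have hu : ⋃ p, cell ℓ p = (Set.univ : Set (Conf N)) := Set.eq_univ_of_forall fun x => by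
    obtain ⟨p, hp⟩ := exists_mem_cell_iff ℓ x
    exact Set.mem_iUnion.2 ⟨p, (hp p).2 rfl⟩
  have h := hasSum_integral_iUnion (μ := volume) (f := f) (fun p => measurableSet_cell (N := N) ℓ p)
    (fun p p' hpp => Set.disjoint_left.2 fun x h1 h2 => hpp (by
      obtain ⟨q, hq⟩ := exists_mem_cell_iff ℓ x
      rw [(hq p).1 h1, (hq p').1 h2])) hf.integrableOn
  rwa [hu, setIntegral_univ] at h

theorem hasSum_integral_cellExcept {f : Conf N → ℝ} (hf : Integrable f) (ℓ : ℝ) (i : Fin N) :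
    HasSum (fun p => ∫ x in cellExcept ℓ p i, f x) (∫ x, f x) := by
  have hu : ⋃ p, cellExcept ℓ p i = (Set.univ : Set (Conf N)) := Set.eq_univ_of_forall fun x => by
    obtain ⟨p, hp⟩ := exists_mem_cell_iff ℓ (update x i 0)
    exact Set.mem_iUnion.2 ⟨p, (hp p).2 rfl⟩
  have h := hasSum_integral_iUnion (μ := volume) (f := f)
    (fun p => measurableSet_cellExcept (N := N) ℓ p i)
    (fun p p' hpp => Set.disjoint_left.2 fun x h1 h2 => hpp (by
      obtain ⟨q, hq⟩ := exists_mem_cell_iff ℓ (update x i 0)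
      rw [(hq p).1 h1, (hq p').1 h2])) hf.integrableOn
  rwa [hu, setIntegral_univ] at h

end Cells

/-! ### One-particle operators on the configuration space -/

section OneParticle

variable {N : ℕ} {χ : E3 → ℝ} {ℓ X : ℝ}

/-- A property of almost every configuration survives almost every displacement of a particle. -/
theorem ae_ae_update {p : Conf N → Prop} (hp : ∀ᵐ x, p x) (i : Fin N) :
    ∀ᵐ x : Conf N, ∀ᵐ y, p (update x i y) := by
  obtain ⟨t, hpt, ht, h0⟩ := exists_measurable_superset_of_null (ae_iff.1 hp)
  have h := lintegral_lintegral_update (N := N) (G := fun x _ => t.indicator 1 x)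
    ((measurable_one.indicator ht).comp measurable_fst) i
  have h1 : ∫⁻ x : Conf N, ∫⁻ _ : E3, t.indicator (1 : Conf N → ℝ≥0∞) x = 0 := by
    simp only [lintegral_const]
    rw [lintegral_mul_const _ (measurable_one.indicator ht), lintegral_indicator_one ht, h0,
      zero_mul]
  rw [h1, lintegral_eq_zero_iff (Measurable.lintegral_prod_right'
    (f := fun q : Conf N × E3 => t.indicator 1 (update q.1 i q.2))
    ((measurable_one.indicator ht).comp (measurable_update_prod i)))] at h
  filter_upwards [h] with x hx
  have h2 := (lintegral_eq_zero_iff ((measurable_one.indicator ht).comp (measurable_update x))).1 hx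
  filter_upwards [h2] with y hy
  by_contra hn
  have : update x i y ∈ t := hpt hn
  simp [this] at hy

/-- Almost all slices of a square integrable function are square integrable. -/
theorem ae_memLp_update {Ψ : Conf N → ℂ} (hΨ : MemLp Ψ 2) (i : Fin N) :
    ∀ᵐ x : Conf N, MemLp (fun y => Ψ (update x i y)) 2 := by
  obtain ⟨Φ, hΦm, hΦ⟩ := hΨ.1
  have hΦ2 : MemLp Φ 2 := hΨ.ae_eq hΦ
  have hm : Measurable fun x => ‖Φ x‖ₑ ^ 2 := hΦm.measurable.enorm.pow_const 2
  obtain ⟨g, hg0, hgm, hg1⟩ :=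
    exists_pos_lintegral_lt_of_sigmaFinite (volume : Measure E3) one_ne_zero
  have hgm' : Measurable fun y => (g y : ℝ≥0∞) := hgm.coe_nnreal_ennreal
  have h := lintegral_lintegral_update (N := N) (G := fun x y => ‖Φ x‖ₑ ^ 2 * g y)
    ((hm.comp measurable_fst).mul (hgm'.comp measurable_snd)) i
  have h1 : ∫⁻ x : Conf N, ∫⁻ y, ‖Φ x‖ₑ ^ 2 * g y < ∞ := by
    have e : ∀ x : Conf N, ∫⁻ y, ‖Φ x‖ₑ ^ 2 * g y = ‖Φ x‖ₑ ^ 2 * ∫⁻ y, g y :=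
      fun x => lintegral_const_mul _ hgm'
    simp only [e]
    rw [lintegral_mul_const _ hm, lintegral_enorm_sq_eq_eLpNorm]
    exact ENNReal.mul_lt_top (ENNReal.pow_lt_top hΦ2.2) (hg1.trans ENNReal.one_lt_top)
  rw [← h] at h1
  have h2 := ae_lt_top (Measurable.lintegral_prod_right'
    (f := fun q : Conf N × E3 => ‖Φ (update q.1 i q.2)‖ₑ ^ 2 * g (q.1 i))
    ((hm.comp (measurable_update_prod i)).mul
      (hgm'.comp ((measurable_pi_apply i).comp measurable_fst)))) h1.ne
  filter_upwards [h2, ae_ae_update hΦ i] with x hx hxe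
  refine MemLp.ae_eq (EventuallyEq.symm hxe) (memLp_two_of_lintegral_lt_top
    (hΦm.measurable.comp (measurable_update x)).aestronglyMeasurable ?_)
  have hmx : Measurable fun y => ‖Φ (update x i y)‖ₑ ^ 2 := hm.comp (measurable_update x)
  rw [lintegral_mul_const _ hmx] at hx
  by_contra hn
  rw [not_lt, top_le_iff] at hn
  rw [hn, ENNReal.top_mul (by exact_mod_cast (hg0 _).ne')] at hx
  exact lt_irrefl _ hx

theorem projQ_eq_zero (i : Fin N) (Ψ : Conf N → ℂ) {x : Conf N} (hx : x i ∉ cube ℓ) :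
    projQ ℓ i Ψ x = 0 := Set.indicator_of_notMem hx _

theorem projQ_congr {Ψ Φ : Conf N → ℂ} (h : Ψ =ᵐ[volume] Φ) (i : Fin N) :
    projQ ℓ i Ψ =ᵐ[volume] projQ ℓ i Φ := by
  filter_upwards [h, ae_ae_update h i] with x h1 h2
  unfold projQ
  rw [h1, integral_congr_ae (ae_restrict_of_ae h2)]

theorem sliceFourier_congr {f g : Conf N → ℂ} (h : f =ᵐ[volume] g) (i : Fin N) :
    sliceFourier χ i f =ᵐ[volume] sliceFourier χ i g := by
  filter_upwards [ae_ae_update h i] with x h2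
  unfold sliceFourier
  simp only [Real.fourier_eq]
  refine integral_congr_ae ?_
  filter_upwards [h2] with y hy
  rw [hy]

theorem measurable_projQ {Ψ : Conf N → ℂ} (hΨ : Measurable Ψ) (i : Fin N) :
    Measurable (projQ ℓ i Ψ) := by
  have h1 : Measurable fun x : Conf N => Ψ x - ((ℓ ^ 3)⁻¹ : ℝ) *
      ∫ y in cube ℓ, Ψ (update x i y) :=
    hΨ.sub (((hΨ.comp (measurable_update_prod i)).stronglyMeasurable.integral_prod_right'
      (ν := volume.restrict (cube ℓ))).measurable.const_mul _)
  have h2 : MeasurableSet {x : Conf N | x i ∈ cube ℓ} :=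
    (measurable_pi_apply i) (measurableSet_cube ℓ)
  have e : projQ ℓ i Ψ = {x : Conf N | x i ∈ cube ℓ}.indicator fun x => Ψ x - ((ℓ ^ 3)⁻¹ : ℝ) *
      ∫ y in cube ℓ, Ψ (update x i y) := by
    funext x
    unfold projQ
    by_cases hx : x i ∈ cube ℓ <;> simp [hx]
  rw [e]
  exact h1.indicator h2

theorem measurable_sliceFourier_conf (hχ : IsWeight ℓ X χ) (i : Fin N) {f : Conf N → ℂ}
    (hf : Measurable f) : Measurable (sliceFourier χ i f) := by
  have h := (measurable_sliceFourier hχ i hf).comp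
    (measurable_id.prodMk (measurable_pi_apply i))
  have e : (fun p : Conf N × E3 => sliceFourier χ i f (update p.1 i p.2)) ∘
      (fun x => (id x, x i)) = sliceFourier χ i f := by
    funext x; simp
  rwa [e] at h

theorem enorm_integral_boxMeasure_sq_le (hℓ : 0 < ℓ) {g : E3 → ℂ} (hg : Measurable g) :
    ‖∫ y, g y ∂(boxMeasure ℓ)‖ₑ ^ 2 ≤ ∫⁻ y, ‖g y‖ₑ ^ 2 ∂(boxMeasure ℓ) := by
  have := isProbabilityMeasure_boxMeasure hℓ
  rw [lintegral_enorm_sq_eq_eLpNorm]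
  gcongr
  refine (enorm_integral_le_lintegral_enorm _).trans ?_
  rw [← eLpNorm_one_eq_lintegral_enorm]
  exact eLpNorm_le_eLpNorm_of_exponent_le (by norm_num) hg.aestronglyMeasurable

theorem lintegral_enorm_sq_projQ_le (hℓ : 0 < ℓ) {Ψ : Conf N → ℂ} (hΨ : Measurable Ψ) (i : Fin N) :
    ∫⁻ x, ‖projQ ℓ i Ψ x‖ₑ ^ 2 ≤ 4 * ∫⁻ x, ‖Ψ x‖ₑ ^ 2 := by
  have hc := measurableSet_cube ℓ
  have hm : Measurable fun x => ‖Ψ x‖ₑ ^ 2 := hΨ.enorm.pow_const 2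
  have := isProbabilityMeasure_boxMeasure hℓ
  have hpt : ∀ x : Conf N, ‖projQ ℓ i Ψ x‖ₑ ^ 2 ≤ 2 * ‖Ψ x‖ₑ ^ 2 + 2 *
      ∫⁻ y, ‖Ψ (update x i y)‖ₑ ^ 2 * (cube ℓ).indicator 1 (x i) ∂(boxMeasure ℓ) := by
    intro x
    by_cases hx : x i ∈ cube ℓ
    · have e1 : projQ ℓ i Ψ x = Ψ x - ∫ y, Ψ (update x i y) ∂(boxMeasure ℓ) := by
        rw [projQ, Set.indicator_of_mem hx, integral_boxMeasure hℓ, Complex.real_smul]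
      have e2 := enorm_integral_boxMeasure_sq_le hℓ (hΨ.comp (measurable_update x (a := i)))
      simp only [Set.indicator_of_mem hx, Pi.one_apply, mul_one]
      rw [e1]
      calc _ ≤ (‖Ψ x‖ₑ + ‖∫ y, Ψ (update x i y) ∂(boxMeasure ℓ)‖ₑ) ^ 2 := by
            gcongr; exact enorm_sub_le
        _ ≤ 2 * ‖Ψ x‖ₑ ^ 2 + 2 * ‖∫ y, Ψ (update x i y) ∂(boxMeasure ℓ)‖ₑ ^ 2 := by
            have := ENNReal.rpow_add_le_mul_rpow_add_rpow ‖Ψ x‖ₑ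
              ‖∫ y, Ψ (update x i y) ∂(boxMeasure ℓ)‖ₑ (p := 2) (by norm_num)
            norm_num [mul_add] at this
            exact this
        _ ≤ _ := by gcongr; exact e2
    · rw [projQ_eq_zero i Ψ hx]; simp
  refine (lintegral_mono hpt).trans ?_
  rw [lintegral_add_left (hm.const_mul 2), lintegral_const_mul _ hm]
  have h3 : ∫⁻ x : Conf N, 2 * ∫⁻ y, ‖Ψ (update x i y)‖ₑ ^ 2 *
      (cube ℓ).indicator 1 (x i) ∂(boxMeasure ℓ) ≤ 2 * ∫⁻ x, ‖Ψ x‖ₑ ^ 2 := by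
    rw [lintegral_const_mul' _ _ (by norm_num)]
    refine mul_le_mul_right ?_ 2
    have h4 := lintegral_lintegral_update (N := N)
      (G := fun x y => (ofReal (ℓ ^ 3))⁻¹ * ((cube ℓ).indicator 1 (x i) *
        (‖Ψ x‖ₑ ^ 2 * (cube ℓ).indicator 1 y)))
      ((((measurable_one.indicator hc).comp ((measurable_pi_apply i).comp measurable_fst)).mul
        ((hm.comp measurable_fst).mul
        ((measurable_one.indicator hc).comp measurable_snd))).const_mul _) i
    have e1 : ∀ x : Conf N, ∫⁻ y, ‖Ψ (update x i y)‖ₑ ^ 2 *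
        (cube ℓ).indicator 1 (x i) ∂(boxMeasure ℓ) =
        ∫⁻ y, (ofReal (ℓ ^ 3))⁻¹ * ((cube ℓ).indicator 1 (update x i y i) *
        (‖Ψ (update x i y)‖ₑ ^ 2 * (cube ℓ).indicator 1 (x i))) := by
      intro x
      rw [boxMeasure, lintegral_smul_measure, smul_eq_mul, ← lintegral_indicator hc,
        ENNReal.ofReal_inv_of_pos (by positivity), ← lintegral_const_mul' _ _ (by simp [hℓ])]
      refine lintegral_congr fun y => ?_
      rw [Function.update_self]
      by_cases hy : y ∈ cube ℓ <;> simp [hy]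
    simp only [e1]
    rw [h4]
    refine lintegral_mono fun x => ?_
    rw [lintegral_const_mul' _ _ (by simp [hℓ])]
    have e5 : ∫⁻ y, ((cube ℓ).indicator 1 (x i) * (‖Ψ x‖ₑ ^ 2 * (cube ℓ).indicator 1 y)) =
        (cube ℓ).indicator 1 (x i) * (‖Ψ x‖ₑ ^ 2 * ofReal (ℓ ^ 3)) := by
      rw [lintegral_const_mul _ ((measurable_one.indicator hc).const_mul _),
        lintegral_const_mul _ (measurable_one.indicator hc), lintegral_indicator_one hc,
        volume_cube hℓ]
    rw [e5]
    by_cases hx : x i ∈ cube ℓ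
    · rw [Set.indicator_of_mem hx, Pi.one_apply, one_mul, mul_comm (‖Ψ x‖ₑ ^ 2), ← mul_assoc,
        ENNReal.inv_mul_cancel (by simp [hℓ]) ofReal_ne_top, one_mul]
    · simp [hx]
  calc _ ≤ 2 * (∫⁻ x, ‖Ψ x‖ₑ ^ 2) + 2 * (∫⁻ x, ‖Ψ x‖ₑ ^ 2) := by gcongr
    _ = _ := by rw [← add_mul]; norm_num

/-- Plancherel's theorem in the variable of one particle. -/
theorem lintegral_enorm_sq_sliceFourier (hℓ : 0 < ℓ) (hχ : IsWeight ℓ X χ) {f : Conf N → ℂ}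
    (hf : Measurable f) (hf2 : MemLp f 2) (i : Fin N) :
    ∫⁻ x, ‖sliceFourier χ i f x‖ₑ ^ 2 = ∫⁻ x, ‖(χ (x i) : ℂ) * f x‖ₑ ^ 2 := by
  have hc := measurableSet_cube ℓ
  have hL : ofReal (ℓ ^ 3) ≠ 0 := by simp [hℓ]
  have hswap : ∀ {F : Conf N → ℂ}, Measurable F →
      ofReal (ℓ ^ 3) * ∫⁻ x, ‖F x‖ₑ ^ 2 =
      ∫⁻ x : Conf N, (cube ℓ).indicator 1 (x i) * ∫⁻ y, ‖F (update x i y)‖ₑ ^ 2 := by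
    intro F hF
    have hm : Measurable fun x => ‖F x‖ₑ ^ 2 := hF.enorm.pow_const 2
    have h4 := lintegral_lintegral_update (N := N)
      (G := fun x y => (cube ℓ).indicator 1 y * ‖F x‖ₑ ^ 2)
      (((measurable_one.indicator hc).comp measurable_snd).mul (hm.comp measurable_fst)) i
    rw [← lintegral_const_mul _ hm]
    have e : ∀ x : Conf N, ∫⁻ y, (cube ℓ).indicator 1 (x i) * ‖F (update x i y)‖ₑ ^ 2 =
        (cube ℓ).indicator 1 (x i) * ∫⁻ y, ‖F (update x i y)‖ₑ ^ 2 :=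
      fun x => lintegral_const_mul _ (hm.comp (measurable_update x))
    simp only [e] at h4
    refine Eq.trans ?_ h4.symm
    refine lintegral_congr fun x => ?_
    rw [lintegral_mul_const _ (measurable_one.indicator hc), lintegral_indicator_one hc,
      volume_cube hℓ]
  have hg : Measurable fun x : Conf N => (χ (x i) : ℂ) * f x :=
    (Complex.measurable_ofReal.comp (hχ.meas.comp (measurable_pi_apply i))).mul hf
  refine (ENNReal.mul_right_inj hL ofReal_ne_top).1 ?_
  rw [hswap (measurable_sliceFourier_conf hχ i hf), hswap hg]
  refine lintegral_congr_ae ?_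
  filter_upwards [ae_memLp_update hf2 i] with x hx
  congr 1
  simp only [sliceFourier_update, Function.update_self]
  exact lintegral_sliceFourier hχ (hx.restrict _)

theorem projQ_add {Ψ Φ : Conf N → ℂ} (hΨ : MemLp Ψ 2) (hΦ : MemLp Φ 2) (i : Fin N) :
    projQ ℓ i (Ψ + Φ) =ᵐ[volume] projQ ℓ i Ψ + projQ ℓ i Φ := by
  have : IsFiniteMeasure (volume.restrict (cube ℓ)) :=
    ⟨by rw [Measure.restrict_apply_univ]; exact (isCompact_cube ℓ).measure_lt_top⟩
  filter_upwards [ae_memLp_update hΨ i, ae_memLp_update hΦ i] with x h1 h2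
  have i1 := (h1.restrict (cube ℓ)).integrable (by norm_num)
  have i2 := (h2.restrict (cube ℓ)).integrable (by norm_num)
  by_cases hx : x i ∈ cube ℓ
  · simp only [projQ, Set.indicator_of_mem hx, Pi.add_apply]
    rw [integral_add i1 i2]
    ring
  · simp [projQ_eq_zero i _ hx]

theorem projQ_smul (c : ℂ) (Ψ : Conf N → ℂ) (i : Fin N) :
    projQ ℓ i (c • Ψ) = c • projQ ℓ i Ψ := by
  funext x
  by_cases hx : x i ∈ cube ℓ
  · simp only [projQ, Set.indicator_of_mem hx, Pi.smul_apply, smul_eq_mul]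
    rw [integral_const_mul]
    ring
  · simp [projQ_eq_zero i _ hx]

theorem sliceFourier_add (hχ : IsWeight ℓ X χ) {f g : Conf N → ℂ} (hf : MemLp f 2)
    (hg : MemLp g 2) (i : Fin N) :
    sliceFourier χ i (f + g) =ᵐ[volume] sliceFourier χ i f + sliceFourier χ i g := by
  have : IsFiniteMeasure (volume.restrict (cube ℓ)) :=
    ⟨by rw [Measure.restrict_apply_univ]; exact (isCompact_cube ℓ).measure_lt_top⟩
  have key : ∀ {u : E3 → ℂ}, MemLp u 2 → ∀ k : E3,
      Integrable fun y => Real.fourierChar (-⟪y, k⟫_ℝ) • ((χ y : ℂ) * u y) := by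
    intro u hu k
    have h3 : IntegrableOn (fun y => (χ y : ℂ) * u y) (cube ℓ) :=
      (((bddMeas_ofReal hχ.meas fun x => by
        rw [abs_of_nonneg (hχ.nonneg x)]; exact hχ.le x).memLp_mul hu).restrict (cube ℓ)).integrable
        (by norm_num)
    have h4 : Integrable fun y => (χ y : ℂ) * u y :=
      (integrableOn_iff_integrable_of_support_subset fun y hy => by
        by_contra hn
        exact hy (by simp [hχ.supp y hn])).1 h3
    exact (Real.fourierIntegral_convergent_iff k).2 h4
  filter_upwards [ae_memLp_update hf i, ae_memLp_update hg i] with x h1 h2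
  simp only [sliceFourier, Real.fourier_eq, Pi.add_apply]
  rw [← integral_add (key h1 _) (key h2 _)]
  refine integral_congr_ae (.of_forall fun y => ?_)
  simp only [Circle.smul_def, smul_eq_mul]
  ring

theorem sliceFourier_smul (c : ℂ) (f : Conf N → ℂ) (i : Fin N) :
    sliceFourier χ i (c • f) = c • sliceFourier χ i f := by
  funext x
  simp only [sliceFourier, Real.fourier_eq, Pi.smul_apply, smul_eq_mul]
  rw [← integral_const_mul]
  refine integral_congr_ae (.of_forall fun y => ?_)
  simp only [Circle.smul_def, smul_eq_mul]
  ring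

theorem memLp_of_lintegral_le {α : Type*} [MeasurableSpace α] {μ : Measure α} {f g : α → ℂ}
    (hf : Measurable f) (hg : MemLp g 2 μ) {c : ℝ≥0∞} (hc : c ≠ ∞)
    (h : ∫⁻ x, ‖f x‖ₑ ^ 2 ∂μ ≤ c * ∫⁻ x, ‖g x‖ₑ ^ 2 ∂μ) : MemLp f 2 μ := by
  refine memLp_two_of_lintegral_lt_top hf.aestronglyMeasurable
    (h.trans_lt (ENNReal.mul_lt_top hc.lt_top ?_))
  rw [lintegral_enorm_sq_eq_eLpNorm]
  exact ENNReal.pow_lt_top hg.2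

end OneParticle

/-! ### The potential energy of a configuration -/

section Potential

variable {N : ℕ}

/-- The difference of two particle positions is absolutely continuous. -/
theorem ae_sub_conf {i j : Fin N} (hij : i ≠ j) {p : E3 → Prop} (hp : ∀ᵐ z, p z) :
    ∀ᵐ x : Conf N, p (x i - x j) := by
  obtain ⟨t, hpt, ht, h0⟩ := exists_measurable_superset_of_null (ae_iff.1 hp)
  have hc := measurableSet_cube 1
  have hm : Measurable fun x : Conf N => t.indicator (1 : E3 → ℝ≥0∞) (x i - x j) :=
    (measurable_one.indicator ht).comp ((measurable_pi_apply i).sub (measurable_pi_apply j))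
  have h := lintegral_lintegral_update (N := N)
    (G := fun x y => (cube 1).indicator 1 y * t.indicator 1 (x i - x j))
    (((measurable_one.indicator hc).comp measurable_snd).mul (hm.comp measurable_fst)) i
  have h1 : ∀ x : Conf N, ∫⁻ y, (cube 1).indicator (1 : E3 → ℝ≥0∞) y * t.indicator 1 (x i - x j) =
      t.indicator 1 (x i - x j) := fun x => by
    rw [lintegral_mul_const _ (measurable_one.indicator hc), lintegral_indicator_one hc,
      volume_cube one_pos]
    simp
  have h2 : ∀ x : Conf N, ∫⁻ y, (cube 1).indicator (1 : E3 → ℝ≥0∞) (x i) *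
      t.indicator 1 (update x i y i - update x i y j) = 0 := fun x => by
    simp only [Function.update_self, Function.update_of_ne hij.symm]
    have h3 := lintegral_sub_right_eq_self (μ := (volume : Measure E3))
      (fun y => t.indicator (1 : E3 → ℝ≥0∞) y) (x j)
    rw [lintegral_const_mul' _ _ (by
      by_cases hx : x i ∈ cube 1 <;> simp [hx]), h3, lintegral_indicator_one ht, h0, mul_zero]
  simp only [h1, h2, lintegral_zero] at h
  filter_upwards [(lintegral_eq_zero_iff hm).1 h.symm] with x hx
  by_contra hn
  have : x i - x j ∈ t := hpt hn
  simp [this] at hx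

theorem quasiMeasurePreserving_sub_conf {i j : Fin N} (hij : i ≠ j) :
    Measure.QuasiMeasurePreserving (fun x : Conf N => x i - x j) :=
  have hm : Measurable fun x : Conf N => x i - x j :=
    (measurable_pi_apply i).sub (measurable_pi_apply j)
  ⟨hm, Measure.AbsolutelyContinuous.mk
    fun s hs h0 => by
      rw [Measure.map_apply hm hs]
      have h1 : ∀ᵐ z : E3, z ∉ s := by rwa [ae_iff, show {z | ¬ z ∉ s} = s by ext; simp]
      have h2 := ae_sub_conf hij h1
      rw [ae_iff] at h2
      exact measure_mono_null (fun x hx => not_not.2 hx) h2⟩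

theorem sum_sum_Ioi_eq {f : Fin N → Fin N → ℝ} (hf : ∀ i j, f i j = f j i) :
    ∑ i, ∑ j ∈ Finset.Ioi i, f i j = 1 / 2 * ∑ j, ∑ i ∈ univ.erase j, f i j := by
  have h1 : ∀ j : Fin N, ∑ i ∈ univ.erase j, f i j =
      ∑ i ∈ Finset.Iio j, f i j + ∑ i ∈ Finset.Ioi j, f j i := by
    intro j
    have e : univ.erase j = Finset.Iio j ∪ Finset.Ioi j := by
      ext i; simp [lt_or_lt_iff_ne]
    rw [e, Finset.sum_union (Finset.disjoint_left.2 fun i hi hj =>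
      lt_asymm (Finset.mem_Iio.1 hi) (Finset.mem_Ioi.1 hj))]
    congr 1
    exact sum_congr rfl fun i _ => hf i j
  have h2 : ∑ j : Fin N, ∑ i ∈ Finset.Iio j, f i j = ∑ i, ∑ j ∈ Finset.Ioi i, f i j :=
    Finset.sum_comm' fun i j => by simp
  rw [sum_congr rfl fun j _ => h1 j, sum_add_distrib, h2]
  ring

namespace IsBoxSetup

variable {χ v ω : E3 → ℝ} {R ℓ X σ : ℝ}

theorem pairW_nonneg (h : IsBoxSetup χ v ω R ℓ X σ) (x y : E3) : 0 ≤ pairW χ ℓ v x y := by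
  refine mul_nonneg (mul_nonneg (h.loc.chiB_nonneg ℓ x) ?_) (h.loc.chiB_nonneg ℓ y)
  rw [bigW]
  by_cases hz : ‖x - y‖ ≤ R
  · exact div_nonneg (h.pot.nonneg _) (by linarith [h.half_le_selfConv hz])
  · rw [h.pot.finite_range _ (not_le.1 hz), zero_div]

theorem pairW_symm (h : IsBoxSetup χ v ω R ℓ X σ) (x y : E3) :
    pairW χ ℓ v x y = pairW χ ℓ v y x := by
  have e : bigW χ ℓ v (x - y) = bigW χ ℓ v (y - x) := by
    rw [bigW, bigW, h.pot.radial (x - y) (y - x) (norm_sub_rev x y), ← neg_sub y x, smul_neg,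
      h.loc.selfConv_neg]
  rw [pairW, pairW, e]; ring

theorem repulsion_eq (h : IsBoxSetup χ v ω R ℓ X σ) (x : Conf N) :
    repulsion χ ℓ v x = 1 / 2 * ∑ j, ∑ i ∈ univ.erase j, pairW χ ℓ v (x i) (x j) :=
  sum_sum_Ioi_eq fun i j => h.pairW_symm (x i) (x j)

theorem repulsion_nonneg (h : IsBoxSetup χ v ω R ℓ X σ) (x : Conf N) : 0 ≤ repulsion χ ℓ v x :=
  sum_nonneg fun _ _ => sum_nonneg fun _ _ => h.pairW_nonneg _ _

theorem pairW_le_repulsion (h : IsBoxSetup χ v ω R ℓ X σ) {i j : Fin N} (hij : i ≠ j)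
    (x : Conf N) : pairW χ ℓ v (x i) (x j) ≤ repulsion χ ℓ v x := by
  wlog hlt : i < j generalizing i j
  · rw [h.pairW_symm]
    exact this hij.symm (lt_of_le_of_ne (not_lt.1 hlt) hij.symm)
  refine (Finset.single_le_sum (f := fun j => pairW χ ℓ v (x i) (x j))
    (fun j _ => h.pairW_nonneg _ _) (Finset.mem_Ioi.2 hlt)).trans ?_
  exact Finset.single_le_sum (f := fun i => ∑ j ∈ Finset.Ioi i, pairW χ ℓ v (x i) (x j))
    (fun i _ => sum_nonneg fun j _ => h.pairW_nonneg _ _) (Finset.mem_univ i)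

theorem aestronglyMeasurable_pairW (h : IsBoxSetup χ v ω R ℓ X σ) {i j : Fin N} (hij : i ≠ j) :
    AEStronglyMeasurable (fun x : Conf N => pairW χ ℓ v (x i) (x j)) volume := by
  have hW : AEStronglyMeasurable (bigW χ ℓ v) volume :=
    (h.pot.integrable.aestronglyMeasurable.aemeasurable.div
      (h.loc.continuous_selfConv.comp (continuous_const_smul _)).measurable.aemeasurable
      ).aestronglyMeasurable
  have hc := h.loc.continuous_chiB ℓ
  exact ((hc.comp (continuous_apply i)).aestronglyMeasurable.mul
    (hW.comp_quasiMeasurePreserving (quasiMeasurePreserving_sub_conf hij))).mul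
    (hc.comp (continuous_apply j)).aestronglyMeasurable

theorem aestronglyMeasurable_repulsion (h : IsBoxSetup χ v ω R ℓ X σ) :
    AEStronglyMeasurable (fun x : Conf N => repulsion χ ℓ v x) volume :=
  Finset.aestronglyMeasurable_fun_sum _ fun _ _ => Finset.aestronglyMeasurable_fun_sum _
    fun _ hj => h.aestronglyMeasurable_pairW (Finset.mem_Ioi.1 hj).ne

/-- The mean field of the interaction `w₁` is bounded and measurable. -/
theorem exists_field_bound (h : IsBoxSetup χ v ω R ℓ X σ) :
    Measurable (fun x => ∫ y, pairW1 χ ℓ v ω x y) ∧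
      ∃ U : ℝ, ∀ x, |∫ y, pairW1 χ ℓ v ω x y| ≤ U := by
  obtain ⟨p, hp, hpe, hp0, hp1, hpω⟩ := h.exists_one_sub_representative
  choose f hf hfv using h.exists_truncated_kernel
  have hb := fun M x => h.abs_integral_pairW1_sub_le (hf M) (hfv M) hp hpe hp0 hp1 hpω x
  have hlim := h.tendsto_integral_voneCut.const_mul (2 * X ^ 2)
  rw [mul_zero] at hlim
  refine ⟨?_, ?_⟩
  · refine measurable_of_tendsto_metrizable
      (fun M => measurable_meanField h.isWeight ((hf M).mul hp hpe hp0 hp1)) ?_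
    refine tendsto_pi_nhds.2 fun x => ?_
    rw [tendsto_iff_dist_tendsto_zero]
    refine squeeze_zero (fun M => dist_nonneg) (fun M => ?_) hlim
    rw [dist_comm, Real.dist_eq]
    exact hb M x
  · obtain ⟨M⟩ : Nonempty ℕ := ⟨0⟩
    have hk := (hf M).mul hp hpe hp0 hp1
    refine ⟨X ^ 2 * (∫ z, f M z * p z) + 2 * X ^ 2 * ((∫ z, vone v ω z) - ∫ z, voneCut v ω M z),
      fun x => ?_⟩
    have h1 := meanField_nonneg h.isWeight hk x
    have h2 := meanField_le h.isWeight hk x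
    have h3 := abs_le.1 (hb M x)
    exact abs_le.2 ⟨by linarith, by linarith⟩

theorem field_eq_zero (h : IsBoxSetup χ v ω R ℓ X σ) {x : E3} (hx : x ∉ cube ℓ) :
    ∫ y, pairW1 χ ℓ v ω x y = 0 := by
  simp [pairW1, pairW, h.loc.chiB_eq_zero h.side_pos hx]

theorem pairW_eq_zero (h : IsBoxSetup χ v ω R ℓ X σ) {x y : E3} (hx : x ∉ cube ℓ ∨ y ∉ cube ℓ) :
    pairW χ ℓ v x y = 0 := by
  rcases hx with hx | hx <;> simp [pairW, h.loc.chiB_eq_zero h.side_pos hx]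

end IsBoxSetup

end Potential

/-! ### Division of the particles into groups -/

section Groups

variable {ι : Type*} [DecidableEq ι]

/-- The energy of the particles in `B`, for one-particle energies `τ` and pair energies `w`. -/
def groupEnergy (τ : ι → ℝ) (w : ι → ι → ℝ) (B : Finset ι) : ℝ :=
  ∑ i ∈ B, τ i + 1 / 2 * ∑ j ∈ B, ∑ i ∈ B, w i j

/-- If groups of `g` particles have non-negative energy, then a bound on the energies of the groups
of at most `2 g` particles holds for all groups. -/
theorem le_groupEnergy {τ : ι → ℝ} {w : ι → ι → ℝ} (hw : ∀ i j, 0 ≤ w i j) {g : ℕ} (hg : 0 < g)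
    {m : ℝ} (A : Finset ι) (h1 : ∀ B ⊆ A, B.card ≤ 2 * g → m ≤ groupEnergy τ w B)
    (h2 : ∀ B ⊆ A, B.card = g → 0 ≤ groupEnergy τ w B) : m ≤ groupEnergy τ w A := by
  induction A using Finset.strongInduction with
  | H A ih =>
    by_cases hA : A.card ≤ 2 * g
    · exact h1 A subset_rfl hA
    obtain ⟨B, hBA, hB⟩ := Finset.exists_subset_card_eq (s := A) (n := g) (by omega)
    have hBne : B.Nonempty := Finset.card_pos.1 (by omega)
    have hlt : A \ B ⊂ A := Finset.sdiff_ssubset hBA hBne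
    have h3 := ih (A \ B) hlt (fun C hC => h1 C (hC.trans hlt.1)) fun C hC => h2 C (hC.trans hlt.1)
    have h4 := h2 B hBA hB
    have e : ∀ f : ι → ℝ, ∑ i ∈ A, f i = ∑ i ∈ A \ B, f i + ∑ i ∈ B, f i := fun f =>
      (Finset.sum_sdiff hBA).symm
    have h5 : ∀ C D : Finset ι, 0 ≤ ∑ j ∈ C, ∑ i ∈ D, w i j := fun C D =>
      sum_nonneg fun j _ => sum_nonneg fun i _ => hw i j
    unfold groupEnergy at h3 h4 ⊢
    have e2 : ∑ j ∈ A, ∑ i ∈ A, w i j =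
        (∑ j ∈ A \ B, ∑ i ∈ A \ B, w i j + ∑ j ∈ A \ B, ∑ i ∈ B, w i j) +
        (∑ j ∈ B, ∑ i ∈ A \ B, w i j + ∑ j ∈ B, ∑ i ∈ B, w i j) := by
      rw [e, ← sum_add_distrib, ← sum_add_distrib]
      simp only [← e]
    rw [e, e2]
    linarith [h5 (A \ B) B, h5 B (A \ B)]

end Groups

/-! ### The energy of a cell -/

section CellEnergy

variable {N : ℕ} {χ v ω : E3 → ℝ} {R ℓ X σ : ℝ} {p : Finset (Fin N) × ℕ} {i : Fin N}

/-- The restriction of Lebesgue measure to a cell. -/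
abbrev cellMeasure (ℓ : ℝ) (p : Finset (Fin N) × ℕ) : Measure (Conf N) := volume.restrict (cell ℓ p)

/-- The restriction of a wave function to a cell. -/
def cellState (ℓ : ℝ) (p : Finset (Fin N) × ℕ) {Ψ : Conf N → ℂ} (hΨ : MemLp Ψ 2) :
    Lp ℂ 2 (cellMeasure ℓ p) := (hΨ.restrict (cell ℓ p)).toLp Ψ

theorem coeFn_cellState {Ψ : Conf N → ℂ} (hΨ : MemLp Ψ 2) :
    cellState ℓ p hΨ =ᵐ[cellMeasure ℓ p] Ψ := (hΨ.restrict (cell ℓ p)).coeFn_toLp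

theorem norm_sq_cellState {Ψ : Conf N → ℂ} (hΨ : MemLp Ψ 2) :
    ‖cellState ℓ p hΨ‖ ^ 2 = ∫ x in cell ℓ p, ‖Ψ x‖ ^ 2 := by
  rw [norm_sq_eq_integral]
  refine integral_congr_ae ?_
  filter_upwards [coeFn_cellState hΨ] with x hx
  rw [hx]

/-- The lower bound for the energy of a group, divided by the squared norm of the state. -/
def groundBound (C G ρ ℓ σ : ℝ) (v ω : E3 → ℝ) : ℝ :=
  (1 / 2 * ρ ^ 2 * ℓ ^ 3 + (21 + 400 * C * G) * ρ + 1200 * σ * ρ ^ 2 * ℓ ^ 3) * ∫ z, vone v ω z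

/-- The one-particle energies in a cell. -/
def cellTau (χ v ω : E3 → ℝ) (b Ckin ℓ ρ : ℝ) (p : Finset (Fin N) × ℕ) (Ψ : Conf N → ℂ)
    (i : Fin N) : ℝ :=
  (∫ x in cellExcept ℓ p i, kinSymbol Ckin ℓ (x i) * ‖fourierQ χ ℓ i Ψ x‖ ^ 2) +
    b * (ℓ ^ 2)⁻¹ * (∫ x in cell ℓ p, ‖projQ ℓ i Ψ x‖ ^ 2) -
    ρ * ∫ x in cell ℓ p, (∫ y, pairW1 χ ℓ v ω (x i) y) * ‖Ψ x‖ ^ 2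

/-- The interaction energies of the pairs in a cell. -/
def cellPair (χ v : E3 → ℝ) (ℓ : ℝ) (p : Finset (Fin N) × ℕ) (Ψ : Conf N → ℂ)
    (i j : Fin N) : ℝ :=
  if i = j then 0 else ∫ x in cell ℓ p, pairW χ ℓ v (x i) (x j) * ‖Ψ x‖ ^ 2

variable [IsProbabilityMeasure (boxMeasure ℓ)]

theorem cellState_sub_avgOp (hℓ : 0 < ℓ) (hi : i ∈ p.1) {Ψ : Conf N → ℂ} (hΨ : MemLp Ψ 2) :
    (cellState ℓ p hΨ - avgOp (boxMeasure ℓ) (cellMeasure ℓ p) i (cellState ℓ p hΨ) :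
      Lp ℂ 2 (cellMeasure ℓ p)) =ᵐ[cellMeasure ℓ p] projQ ℓ i Ψ := by
  have hR := resampling_cell hℓ hi
  filter_upwards [Lp.coeFn_sub (cellState ℓ p hΨ) (avgOp (boxMeasure ℓ) (cellMeasure ℓ p) i
    (cellState ℓ p hΨ)), coeFn_avgOp hR (cellState ℓ p hΨ), coeFn_cellState hΨ,
    hR.ae_ae (coeFn_cellState hΨ), ae_restrict_mem (measurableSet_cell ℓ p)] with x h1 h2 h3 h4 h5
  rw [h1, Pi.sub_apply, h2, h3, avg, integral_congr_ae h4, integral_boxMeasure hℓ, projQ,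
    Set.indicator_of_mem ((h5.1 i).2 hi), Complex.real_smul]

theorem lintegral_kin_excitation (hℓ : 0 < ℓ) {χ : E3 → ℝ} (hχ : IsWeight ℓ X (chiB χ ℓ))
    (hi : i ∈ p.1) {Ψ : Conf N → ℂ} (hm : Measurable Ψ) (hΨ : MemLp Ψ 2) (Ckin : ℝ) :
    ∫⁻ k, ofReal (kinSymbol Ckin ℓ k *
      excitation (cellMeasure ℓ p) (chiB χ ℓ) ℓ i (cellState ℓ p hΨ) k) =
    ofReal ((ℓ ^ 3)⁻¹) * ∫⁻ x in cellExcept ℓ p i,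
      ofReal (kinSymbol Ckin ℓ (x i) * ‖fourierQ χ ℓ i Ψ x‖ ^ 2) := by
  have hR := resampling_cell hℓ hi
  have hkm : Measurable fun k => ofReal (kinSymbol Ckin ℓ k) :=
    (continuous_kinSymbol Ckin ℓ).measurable.ennreal_ofReal
  have hQm := measurable_projQ (ℓ := ℓ) hm i
  have hFm := measurable_sliceFourier hχ i hQm
  have hGm : Measurable fun x : Conf N =>
      ofReal (kinSymbol Ckin ℓ (x i)) * ‖fourierQ χ ℓ i Ψ x‖ₑ ^ 2 :=
    (hkm.comp (measurable_pi_apply i)).mul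
      ((measurable_sliceFourier_conf hχ i hQm).enorm.pow_const 2)
  have e1 : ∀ k, ofReal (kinSymbol Ckin ℓ k *
      excitation (cellMeasure ℓ p) (chiB χ ℓ) ℓ i (cellState ℓ p hΨ) k) =
      ofReal ((ℓ ^ 6)⁻¹) * ∫⁻ x, ofReal (kinSymbol Ckin ℓ k) *
        ‖sliceFourier (chiB χ ℓ) i (projQ ℓ i Ψ) (update x i k)‖ₑ ^ 2
          ∂(cellMeasure ℓ p) := by
    intro k
    rw [ofReal_mul (kinSymbol_nonneg _ _ _), excitation,
      norm_avgOp_waveOp hℓ hχ k hR (cellState_sub_avgOp hℓ hi hΨ),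
      lintegral_const_mul' _ _ ofReal_ne_top]
    ring
  have e2 : ∀ x : Conf N, ofReal (kinSymbol Ckin ℓ (x i) * ‖fourierQ χ ℓ i Ψ x‖ ^ 2) =
      ofReal (kinSymbol Ckin ℓ (x i)) * ‖fourierQ χ ℓ i Ψ x‖ₑ ^ 2 := fun x => by
    rw [ofReal_mul (kinSymbol_nonneg _ _ _), ENNReal.ofReal_pow (norm_nonneg _), ofReal_norm]
  simp only [e1, e2]
  rw [lintegral_const_mul' _ _ ofReal_ne_top, lintegral_lintegral_swap
    ((((hkm.comp measurable_fst).mul ((hFm.comp measurable_swap).enorm.pow_const 2))).aemeasurable)]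
  have h := lintegral_cell_update hℓ hi hGm
  simp only [Function.update_self] at h
  refine (congrArg _ h).trans ?_
  rw [← mul_assoc, ← ofReal_mul (by positivity)]
  congr 2
  field_simp

variable (Ckin : ℝ)

theorem integrable_kin_excitation (hℓ : 0 < ℓ) (hχ : IsWeight ℓ X (chiB χ ℓ))
    (hi : i ∈ p.1) {Ψ : Conf N → ℂ} (hm : Measurable Ψ) (hΨ : MemLp Ψ 2)
    (hk : Integrable fun x : Conf N => kinSymbol Ckin ℓ (x i) * ‖fourierQ χ ℓ i Ψ x‖ ^ 2) :
    Integrable fun k => kinSymbol Ckin ℓ k *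
      excitation (cellMeasure ℓ p) (chiB χ ℓ) ℓ i (cellState ℓ p hΨ) k := by
  refine ⟨((continuous_kinSymbol Ckin ℓ).measurable.mul
    (measurable_excitation hℓ hχ (resampling_cell hℓ hi) _)).aestronglyMeasurable, ?_⟩
  rw [hasFiniteIntegral_iff_ofReal (.of_forall fun k =>
    mul_nonneg (kinSymbol_nonneg _ _ _) (excitation_nonneg _ _ _)),
    lintegral_kin_excitation hℓ hχ hi hm hΨ]
  refine ENNReal.mul_lt_top ENNReal.ofReal_lt_top ?_
  have h1 := (hasFiniteIntegral_iff_ofReal (.of_forall fun x : Conf N =>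
    mul_nonneg (kinSymbol_nonneg Ckin ℓ (x i)) (sq_nonneg _))).1 hk.2
  exact (lintegral_mono' Measure.restrict_le_self le_rfl).trans_lt h1

theorem integral_kin_excitation (hℓ : 0 < ℓ) (hχ : IsWeight ℓ X (chiB χ ℓ))
    (hi : i ∈ p.1) {Ψ : Conf N → ℂ} (hm : Measurable Ψ) (hΨ : MemLp Ψ 2)
    (hk : Integrable fun x : Conf N => kinSymbol Ckin ℓ (x i) * ‖fourierQ χ ℓ i Ψ x‖ ^ 2) :
    ℓ ^ 3 * ∫ k, kinSymbol Ckin ℓ k *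
      excitation (cellMeasure ℓ p) (chiB χ ℓ) ℓ i (cellState ℓ p hΨ) k =
    ∫ x in cellExcept ℓ p i, kinSymbol Ckin ℓ (x i) * ‖fourierQ χ ℓ i Ψ x‖ ^ 2 := by
  have h0 : 0 ≤ᵐ[volume.restrict (cellExcept ℓ p i)] fun x : Conf N =>
      kinSymbol Ckin ℓ (x i) * ‖fourierQ χ ℓ i Ψ x‖ ^ 2 :=
    .of_forall fun x => mul_nonneg (kinSymbol_nonneg Ckin ℓ (x i)) (sq_nonneg _)
  have hk' : AEStronglyMeasurable (fun x : Conf N => kinSymbol Ckin ℓ (x i) *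
      ‖fourierQ χ ℓ i Ψ x‖ ^ 2) (volume.restrict (cellExcept ℓ p i)) :=
    hk.restrict.aestronglyMeasurable
  rw [integral_eq_lintegral_of_nonneg_ae h0 hk',
    integral_eq_lintegral_of_nonneg_ae (.of_forall fun k =>
      mul_nonneg (kinSymbol_nonneg _ _ _) (excitation_nonneg _ _ _))
    (integrable_kin_excitation Ckin hℓ hχ hi hm hΨ hk).aestronglyMeasurable,
    lintegral_kin_excitation hℓ hχ hi hm hΨ, ENNReal.toReal_mul,
    ENNReal.toReal_ofReal (by positivity), ← mul_assoc, mul_inv_cancel₀ (by positivity), one_mul]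

theorem norm_sq_cellState_sub (hℓ : 0 < ℓ) (hi : i ∈ p.1) {Ψ : Conf N → ℂ} (hΨ : MemLp Ψ 2) :
    ‖cellState ℓ p hΨ - avgOp (boxMeasure ℓ) (cellMeasure ℓ p) i (cellState ℓ p hΨ)‖ ^ 2 =
      ∫ x in cell ℓ p, ‖projQ ℓ i Ψ x‖ ^ 2 := by
  rw [norm_sq_eq_integral]
  refine integral_congr_ae ?_
  filter_upwards [cellState_sub_avgOp hℓ hi hΨ] with x hx
  rw [hx]

/-- The lower bound for the energy of a cell. -/
theorem cell_energy_ge (h : IsBoxSetup χ v ω R ℓ X σ) {b Ckin ρ C G : ℝ} (hb : 0 < b)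
    (hρ : 0 < ρ) (hC : 0 ≤ C)
    (hdisp : DispersionBound Ckin (b / (4 * X ^ 2)) ℓ C)
    (hgap : ρ * (∫ z, vone v ω z) * (338 * X ^ 2 + 11) ≤ b * (ℓ ^ 2)⁻¹ / 4)
    (hG : ρ * (∫ z, vone v ω z) * ℓ ^ 2 ≤ G) (hρL : 21 + 400 * C * G ≤ ρ * ℓ ^ 3)
    (hσ : σ ≤ 1 / 600) {Ψ : Conf N → ℂ} (hm : Measurable Ψ) (hΨ : MemLp Ψ 2)
    (hk : ∀ i, Integrable fun x : Conf N =>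
      kinSymbol Ckin ℓ (x i) * ‖fourierQ χ ℓ i Ψ x‖ ^ 2)
    (hw : ∀ i j, i ≠ j → Integrable fun x : Conf N => pairW χ ℓ v (x i) (x j) * ‖Ψ x‖ ^ 2) :
    -groundBound C G ρ ℓ σ v ω * (∫ x in cell ℓ p, ‖Ψ x‖ ^ 2) ≤
      groupEnergy (cellTau χ v ω b Ckin ℓ ρ p Ψ) (cellPair χ v ℓ p Ψ) p.1 := by
  have hℓ := h.side_pos
  have hχ := h.isWeight
  have hCG : 0 ≤ C * G :=
    mul_nonneg hC (le_trans (mul_nonneg (mul_nonneg hρ.le (integral_nonneg_of_ae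
      (h.sol.vone_nonneg h.pot))) (sq_nonneg ℓ)) hG)
  have hL : 21 ≤ ρ * ℓ ^ 3 := by linarith
  have key : ∀ B ⊆ p.1, (B.card : ℝ) ≤ 20 * (ρ * ℓ ^ 3) →
      -groundBound C G ρ ℓ σ v ω * (∫ x in cell ℓ p, ‖Ψ x‖ ^ 2) ≤
        groupEnergy (cellTau χ v ω b Ckin ℓ ρ p Ψ) (cellPair χ v ℓ p Ψ) B ∧
      (6 * (ρ * ℓ ^ 3) ≤ B.card →
        0 ≤ groupEnergy (cellTau χ v ω b Ckin ℓ ρ p Ψ) (cellPair χ v ℓ p Ψ) B) := by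
    intro B hB hcard
    have hmem : ∀ i : B, (i : Fin N) ∈ p.1 := fun i => hB i.2
    have hpair : ∀ i j : Fin N, (fun y => pairW χ ℓ v (y i) (y j) * ‖cellState ℓ p hΨ y‖ ^ 2)
        =ᵐ[cellMeasure ℓ p] fun y => pairW χ ℓ v (y i) (y j) * ‖Ψ y‖ ^ 2 := fun i j => by
      filter_upwards [coeFn_cellState hΨ] with y hy
      rw [hy]
    have hfield : ∀ i : Fin N, (fun y : Conf N => (∫ y', pairW1 χ ℓ v ω (y i) y') *
        ‖cellState ℓ p hΨ y‖ ^ 2)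
        =ᵐ[cellMeasure ℓ p] fun y => (∫ y', pairW1 χ ℓ v ω (y i) y') * ‖Ψ y‖ ^ 2 := fun i => by
      filter_upwards [coeFn_cellState hΨ] with y hy
      rw [hy]
    have hE := group_energy_ge (κ := B) (e := Subtype.val) (ν := cellMeasure ℓ p) h hb hρ hC hdisp
      hgap hG hρL Subtype.val_injective (fun i => resampling_cell hℓ (hmem i))
      (by rwa [Fintype.card_coe]) (cellState ℓ p hΨ)
      (fun i => integrable_kin_excitation Ckin hℓ hχ (hmem i) hm hΨ (hk i))
      (fun i j hij => ((hw i j (Subtype.val_injective.ne hij)).restrict (s := cell ℓ p)).congr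
        (hpair i j).symm)
      (E := groupEnergy (cellTau χ v ω b Ckin ℓ ρ p Ψ) (cellPair χ v ℓ p Ψ) B) (by
        unfold groupEnergy
        congr 1
        · rw [← Finset.sum_coe_sort B]
          refine sum_congr rfl fun i _ => ?_
          rw [integral_kin_excitation Ckin hℓ hχ (hmem i) hm hΨ (hk i),
            norm_sq_cellState_sub hℓ (hmem i), integral_congr_ae (hfield i), cellTau]
        · rw [← Finset.sum_coe_sort B]
          congr 1
          refine sum_congr rfl fun j _ => ?_
          rw [← Finset.sum_coe_sort B, ← Finset.sum_erase univ (a := j)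
            (f := fun i : B => cellPair χ v ℓ p Ψ i j) (if_pos rfl)]
          refine sum_congr rfl fun i hi => ?_
          have hij : (i : Fin N) ≠ j := Subtype.val_injective.ne (Finset.ne_of_mem_erase hi)
          rw [integral_congr_ae (hpair i j), cellPair, if_neg hij])
    rw [norm_sq_cellState, Fintype.card_coe] at hE
    exact ⟨hE.1, fun h6 => hE.2 h6 hσ⟩
  have hpair0 : ∀ i j, 0 ≤ cellPair χ v ℓ p Ψ i j := fun i j => by
    unfold cellPair
    split_ifs
    · exact le_rfl
    · exact integral_nonneg fun x => mul_nonneg (h.pairW_nonneg _ _) (sq_nonneg _)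
  -- groups of `⌈6 ρ ℓ³⌉` particles have non-negative energy
  have hceil := Nat.ceil_lt_add_one (show 0 ≤ 6 * (ρ * ℓ ^ 3) by positivity)
  refine le_groupEnergy hpair0 (g := ⌈6 * (ρ * ℓ ^ 3)⌉₊) (Nat.ceil_pos.2 (by positivity)) p.1
    (fun B hB hc => (key B hB ?_).1) fun B hB hc => (key B hB ?_).2 ?_
  · have : (B.card : ℝ) ≤ 2 * ⌈6 * (ρ * ℓ ^ 3)⌉₊ := by exact_mod_cast hc
    linarith
  · rw [hc]; linarith
  · rw [hc]; exact Nat.le_ceil _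

end CellEnergy

/-! ### The lower bound for the quadratic form -/

section FormBound

variable {N : ℕ} {χ v ω : E3 → ℝ} {b Ckin ρ R ℓ X σ : ℝ}

theorem fourierQ_congr {Ψ Φ : Conf N → ℂ} (h : Ψ =ᵐ[volume] Φ) (i : Fin N) :
    fourierQ χ ℓ i Ψ =ᵐ[volume] fourierQ χ ℓ i Φ :=
  sliceFourier_congr (χ := chiB χ ℓ) (projQ_congr h i) i

theorem measurePreserving_comp_perm (s : Equiv.Perm (Fin N)) :
    MeasurePreserving fun x : Conf N => x ∘ s := by
  have hs := volume_measurePreserving_piCongrLeft (fun _ : Fin N => E3) s.symm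
  have e : ⇑(MeasurableEquiv.piCongrLeft (fun _ : Fin N => E3) s.symm) =
      fun x : Conf N => x ∘ s := by
    funext x i
    have := MeasurableEquiv.piCongrLeft_apply_apply (β := fun _ : Fin N => E3) s.symm x (s i)
    rwa [Equiv.symm_apply_apply] at this
  rwa [e] at hs

theorem inSector_congr {Ψ Φ : Conf N → ℂ} (h : Ψ =ᵐ[volume] Φ) (hΨ : InSector Ψ) : InSector Φ := by
  refine ⟨hΨ.1.ae_eq h, fun s => ?_⟩
  filter_upwards [h, hΨ.2 s, (measurePreserving_comp_perm s).quasiMeasurePreserving.ae h]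
    with x h2 h3 h4
  rw [← h4, h3, h2]

theorem inFormDomain_congr {Ψ Φ : Conf N → ℂ} (h : Ψ =ᵐ[volume] Φ)
    (hΨ : InFormDomain χ Ckin ℓ v Ψ) : InFormDomain χ Ckin ℓ v Φ := by
  refine ⟨inSector_congr h hΨ.1, fun i => (hΨ.2.1 i).congr ?_, hΨ.2.2.congr ?_⟩
  · filter_upwards [fourierQ_congr (χ := χ) (ℓ := ℓ) h i] with x hx
    rw [hx]
  · filter_upwards [h] with x hx
    rw [hx]

theorem kineticForm_congr {Ψ Φ Ψ' Φ' : Conf N → ℂ} (h : Ψ =ᵐ[volume] Ψ') (h' : Φ =ᵐ[volume] Φ')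
    (i : Fin N) : kineticForm χ b Ckin ℓ i Φ Ψ = kineticForm χ b Ckin ℓ i Φ' Ψ' := by
  unfold kineticForm
  congr 1
  · refine integral_congr_ae ?_
    filter_upwards [fourierQ_congr (χ := χ) (ℓ := ℓ) h i, fourierQ_congr (χ := χ) (ℓ := ℓ) h' i]
      with x h1 h2
    rw [h1, h2]
  · congr 1
    refine integral_congr_ae ?_
    filter_upwards [projQ_congr (ℓ := ℓ) h i, projQ_congr (ℓ := ℓ) h' i] with x h1 h2
    rw [h1, h2]

theorem boxForm_congr {Ψ Φ Ψ' Φ' : Conf N → ℂ} (h : Ψ =ᵐ[volume] Ψ') (h' : Φ =ᵐ[volume] Φ') :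
    boxForm χ b Ckin ℓ ρ v ω Φ Ψ = boxForm χ b Ckin ℓ ρ v ω Φ' Ψ' := by
  unfold boxForm
  congr 1
  · exact sum_congr rfl fun i _ => kineticForm_congr h h' i
  · refine integral_congr_ae ?_
    filter_upwards [h, h'] with x h1 h2
    rw [h1, h2]

theorem integral_ofReal_mul_conj_mul_self (r : Conf N → ℝ) (f : Conf N → ℂ) :
    ∫ x, (r x : ℂ) * (conj (f x) * f x) = ((∫ x, r x * ‖f x‖ ^ 2 : ℝ) : ℂ) := by
  refine Eq.trans ?_ (integral_ofReal (𝕜 := ℂ))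
  refine integral_congr_ae (.of_forall fun x => ?_)
  simp only
  rw [← Complex.normSq_eq_conj_mul_self, Complex.normSq_eq_norm_sq]
  push_cast; rfl

theorem boxForm_self (Ψ : Conf N → ℂ) : boxForm χ b Ckin ℓ ρ v ω Ψ Ψ =
    ((∑ i, ((∫ x : Conf N, kinSymbol Ckin ℓ (x i) * ‖fourierQ χ ℓ i Ψ x‖ ^ 2) +
      b * (ℓ ^ 2)⁻¹ * ∫ x, ‖projQ ℓ i Ψ x‖ ^ 2) +
      ∫ x, potential χ ℓ ρ v ω x * ‖Ψ x‖ ^ 2 : ℝ) : ℂ) := by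
  unfold boxForm kineticForm
  have e : ∀ i, ∫ x, conj (projQ ℓ i Ψ x) * projQ ℓ i Ψ x =
      ((∫ x, ‖projQ ℓ i Ψ x‖ ^ 2 : ℝ) : ℂ) := fun i => by
    have := integral_ofReal_mul_conj_mul_self (fun _ => 1) (projQ ℓ i Ψ)
    simpa using this
  simp only [integral_ofReal_mul_conj_mul_self (fun x : Conf N => potential χ ℓ ρ v ω x),
    fun i => integral_ofReal_mul_conj_mul_self (fun x : Conf N => kinSymbol Ckin ℓ (x i))
      (fourierQ χ ℓ i Ψ), e]
  push_cast
  rfl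

theorem integrable_norm_sq_projQ (hℓ : 0 < ℓ) {Ψ : Conf N → ℂ} (hm : Measurable Ψ)
    (hΨ : MemLp Ψ 2) (i : Fin N) : Integrable fun x => ‖projQ ℓ i Ψ x‖ ^ 2 :=
  (memLp_of_lintegral_le (measurable_projQ hm i) hΨ (by norm_num)
    (lintegral_enorm_sq_projQ_le hℓ hm i)).integrable_norm_pow (by norm_num)

namespace IsBoxSetup

theorem integrable_field (h : IsBoxSetup χ v ω R ℓ X σ) {Ψ : Conf N → ℂ} (hΨ : MemLp Ψ 2)
    (i : Fin N) : Integrable fun x : Conf N => (∫ y, pairW1 χ ℓ v ω (x i) y) * ‖Ψ x‖ ^ 2 := by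
  obtain ⟨hm, U, hU⟩ := h.exists_field_bound
  exact (hΨ.integrable_norm_pow (by norm_num)).bdd_mul
    (hm.comp (measurable_pi_apply i)).aestronglyMeasurable
    (.of_forall fun x => by rw [Real.norm_eq_abs]; exact hU (x i))

theorem integrable_pair (h : IsBoxSetup χ v ω R ℓ X σ) {Ψ : Conf N → ℂ} (hΨ : MemLp Ψ 2)
    (hr : Integrable fun x : Conf N => repulsion χ ℓ v x * ‖Ψ x‖ ^ 2) {i j : Fin N} (hij : i ≠ j) :
    Integrable fun x : Conf N => pairW χ ℓ v (x i) (x j) * ‖Ψ x‖ ^ 2 := by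
  refine hr.mono' ((h.aestronglyMeasurable_pairW hij).mul
    (hΨ.integrable_norm_pow (by norm_num)).aestronglyMeasurable)
    (.of_forall fun x => ?_)
  rw [Real.norm_of_nonneg (mul_nonneg (h.pairW_nonneg _ _) (sq_nonneg _))]
  exact mul_le_mul_of_nonneg_right (h.pairW_le_repulsion hij x) (sq_nonneg _)

theorem integral_potential (h : IsBoxSetup χ v ω R ℓ X σ) {Ψ : Conf N → ℂ} (hΨ : MemLp Ψ 2)
    (hr : Integrable fun x : Conf N => repulsion χ ℓ v x * ‖Ψ x‖ ^ 2) :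
    ∫ x, potential χ ℓ ρ v ω x * ‖Ψ x‖ ^ 2 =
      -ρ * (∑ i, ∫ x : Conf N, (∫ y, pairW1 χ ℓ v ω (x i) y) * ‖Ψ x‖ ^ 2) +
      ∫ x, repulsion χ ℓ v x * ‖Ψ x‖ ^ 2 := by
  have hf := fun i => h.integrable_field hΨ i
  have e : ∀ x : Conf N, potential χ ℓ ρ v ω x * ‖Ψ x‖ ^ 2 =
      -ρ * (∑ i, (∫ y, pairW1 χ ℓ v ω (x i) y) * ‖Ψ x‖ ^ 2) + repulsion χ ℓ v x * ‖Ψ x‖ ^ 2 := by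
    intro x
    rw [potential, add_mul, ← mul_sum, ← sum_mul, mul_assoc]
  simp only [e]
  rw [integral_add ((integrable_finsetSum _ fun i _ => hf i).const_mul _) hr, integral_const_mul,
    integral_finsetSum _ fun i _ => hf i]

/-- The quadratic form is bounded below on its domain. -/
theorem boxForm_ge (h : IsBoxSetup χ v ω R ℓ X σ) {C G : ℝ} (hb : 0 < b)
    (hρ : 0 < ρ) (hC : 0 ≤ C)
    (hdisp : DispersionBound Ckin (b / (4 * X ^ 2)) ℓ C)
    (hgap : ρ * (∫ z, vone v ω z) * (338 * X ^ 2 + 11) ≤ b * (ℓ ^ 2)⁻¹ / 4)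
    (hG : ρ * (∫ z, vone v ω z) * ℓ ^ 2 ≤ G) (hρL : 21 + 400 * C * G ≤ ρ * ℓ ^ 3)
    (hσ : σ ≤ 1 / 600) {Ψ : Conf N → ℂ} (hΨ : InFormDomain χ Ckin ℓ v Ψ) :
    -groundBound C G ρ ℓ σ v ω * (∫ x, ‖Ψ x‖ ^ 2) ≤ (boxForm χ b Ckin ℓ ρ v ω Ψ Ψ).re := by
  -- a measurable representative
  wlog hm : Measurable Ψ generalizing Ψ
  · have hae := hΨ.1.1.1.ae_eq_mk
    have h1 := this (inFormDomain_congr hae hΨ) hΨ.1.1.1.measurable_mk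
    rw [boxForm_congr hae hae]
    refine le_of_eq_of_le ?_ h1
    congr 1
    refine integral_congr_ae ?_
    filter_upwards [hae] with x hx
    rw [hx]
  obtain ⟨⟨hΨ2, -⟩, hk, hr⟩ := hΨ
  have hℓ := h.side_pos
  have hprob := isProbabilityMeasure_boxMeasure hℓ
  have hQ := fun i => integrable_norm_sq_projQ hℓ hm hΨ2 i
  have hf := fun i => h.integrable_field hΨ2 i
  have hw : ∀ i j : Fin N, i ≠ j → Integrable fun x : Conf N =>
      pairW χ ℓ v (x i) (x j) * ‖Ψ x‖ ^ 2 := fun i j hij => h.integrable_pair hΨ2 hr hij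
  have hw' : ∀ i j : Fin N, HasSum (fun p => cellPair χ v ℓ p Ψ i j)
      (if i = j then 0 else ∫ x : Conf N, pairW χ ℓ v (x i) (x j) * ‖Ψ x‖ ^ 2) := fun i j => by
    unfold cellPair
    split_ifs with hij
    · exact hasSum_zero
    · exact hasSum_integral_cell (hw i j hij) ℓ
  have hcell := fun p : Finset (Fin N) × ℕ =>
    cell_energy_ge (p := p) h hb hρ hC hdisp hgap hG hρL hσ hm hΨ2 hk hw
  have hnorm := (hasSum_integral_cell (hΨ2.integrable_norm_pow two_ne_zero) ℓ).mul_left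
    (-groundBound C G ρ ℓ σ v ω)
  have htau : HasSum (fun p => ∑ i, cellTau χ v ω b Ckin ℓ ρ p Ψ i)
      (∑ i, ((∫ x : Conf N, kinSymbol Ckin ℓ (x i) * ‖fourierQ χ ℓ i Ψ x‖ ^ 2) +
      b * (ℓ ^ 2)⁻¹ * (∫ x, ‖projQ ℓ i Ψ x‖ ^ 2) -
      ρ * ∫ x : Conf N, (∫ y, pairW1 χ ℓ v ω (x i) y) * ‖Ψ x‖ ^ 2)) :=
    hasSum_sum fun i _ => ((hasSum_integral_cellExcept (hk i) ℓ i).add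
      ((hasSum_integral_cell (hQ i) ℓ).mul_left _)).sub
      ((hasSum_integral_cell (hf i) ℓ).mul_left _)
  have hpair := (hasSum_sum (s := univ) fun j (_ : j ∈ univ) =>
    hasSum_sum (s := univ) fun i (_ : i ∈ univ) => hw' i j).mul_left (1 / 2)
  have htot := htau.add hpair
  -- particles outside the box do not contribute
  have hgroup : ∀ p : Finset (Fin N) × ℕ,
      groupEnergy (cellTau χ v ω b Ckin ℓ ρ p Ψ) (cellPair χ v ℓ p Ψ) p.1 =
      ∑ i, cellTau χ v ω b Ckin ℓ ρ p Ψ i + 1 / 2 * ∑ j, ∑ i, cellPair χ v ℓ p Ψ i j := by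
    intro p
    have hout : ∀ i, i ∉ p.1 → ∀ x ∈ cell ℓ p, x i ∉ cube ℓ := fun i hi x hx hc =>
      hi ((hx.1 i).1 hc)
    have z1 : ∀ i, i ∉ p.1 → cellTau χ v ω b Ckin ℓ ρ p Ψ i = 0 := by
      intro i hi
      have e1 : ∫ x in cell ℓ p, ‖projQ ℓ i Ψ x‖ ^ 2 = 0 :=
        setIntegral_eq_zero_of_forall_eq_zero fun x hx => by
          rw [projQ_eq_zero i Ψ (hout i hi x hx)]; simp
      have e2 : ∫ x in cell ℓ p, (∫ y, pairW1 χ ℓ v ω (x i) y) * ‖Ψ x‖ ^ 2 = 0 :=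
        setIntegral_eq_zero_of_forall_eq_zero fun x hx => by
          rw [h.field_eq_zero (hout i hi x hx), zero_mul]
      rw [cellTau, cellExcept_eq_empty hℓ hi, e1, e2]
      simp
    have z2 : ∀ i j, i ∉ p.1 ∨ j ∉ p.1 → cellPair χ v ℓ p Ψ i j = 0 := by
      intro i j hij
      unfold cellPair
      split_ifs with h1
      · rfl
      · refine setIntegral_eq_zero_of_forall_eq_zero fun x hx => ?_
        rw [h.pairW_eq_zero (hij.imp (fun hi => hout i hi x hx) fun hj => hout j hj x hx), zero_mul]
    unfold groupEnergy
    rw [Finset.sum_subset (Finset.subset_univ p.1) fun i _ hi => z1 i hi,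
      Finset.sum_subset (Finset.subset_univ p.1) fun j _ hj =>
        Finset.sum_eq_zero fun i _ => z2 i j (Or.inr hj)]
    congr 2
    exact sum_congr rfl fun j _ => Finset.sum_subset (Finset.subset_univ p.1)
      fun i _ hi => z2 i j (Or.inl hi)
  have hle := hasSum_le (fun p => (hcell p).trans_eq (hgroup p)) hnorm htot
  refine hle.trans_eq ?_
  have hrep : ∫ x : Conf N, repulsion χ ℓ v x * ‖Ψ x‖ ^ 2 = 1 / 2 * ∑ j, ∑ i,
      (if i = j then 0 else ∫ x : Conf N, pairW χ ℓ v (x i) (x j) * ‖Ψ x‖ ^ 2) := by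
    simp only [h.repulsion_eq, mul_assoc, sum_mul]
    rw [integral_const_mul, integral_finsetSum _ fun j _ => integrable_finsetSum _ fun i hi =>
      hw i j (Finset.ne_of_mem_erase hi)]
    congr 1
    refine sum_congr rfl fun j _ => ?_
    rw [integral_finsetSum _ fun i hi => hw i j (Finset.ne_of_mem_erase hi),
      ← Finset.sum_erase univ (a := j) (f := fun i => if i = j then 0 else
        ∫ x : Conf N, pairW χ ℓ v (x i) (x j) * ‖Ψ x‖ ^ 2) (if_pos rfl)]
    exact sum_congr rfl fun i hi => (if_neg (Finset.ne_of_mem_erase hi)).symm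
  rw [boxForm_self, Complex.ofReal_re, h.integral_potential hΨ2 hr, ← hrep,
    Finset.sum_sub_distrib, ← mul_sum]
  ring

end IsBoxSetup

end FormBound

/-! ### Resolvents of operators defined by quadratic forms -/

section FormResolvent

open ContinuousLinearMap in
/-- Let the form domain consist of the vectors `u` for which the equations `A c (g c) = B c u` have
a solution `g`, and which are invariant under the maps `S s`. If the form
`∑ c, ‖g c‖² + ⟨u, M u⟩` is bounded below by `e ‖u‖²`, then the resolvent equation can be solved for
`μ < e`. The equations express in terms of bounded operators that `g` is the image of `u` under
closed unbounded ones; they make the graph closed. -/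
theorem exists_form_solution {H : Type*} [NormedAddCommGroup H] [InnerProductSpace ℂ H]
    [CompleteSpace H] {κ ι : Type*} [Fintype κ] (A B : κ → H →L[ℂ] H) (S : ι → H →L[ℂ] H)
    (M : H →L[ℂ] H) {e μ : ℝ} (hμ : μ < e)
    (hge : ∀ (u : H) (g : κ → H), (∀ c, A c (g c) = B c u) → (∀ s, S s u = u) →
      e * ‖u‖ ^ 2 ≤ ∑ c, ‖g c‖ ^ 2 + (⟪u, M u⟫_ℂ).re) (f : H) :
    ∃ (u : H) (g : κ → H), (∀ c, A c (g c) = B c u) ∧ (∀ s, S s u = u) ∧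
      ∀ (u' : H) (g' : κ → H), (∀ c, A c (g' c) = B c u') → (∀ s, S s u' = u') →
        ∑ c, ⟪g' c, g c⟫_ℂ + ⟪u', M u⟫_ℂ = ⟪u', f⟫_ℂ + μ * ⟪u', u⟫_ℂ := by
  let E := PiLp 2 fun _ : Option κ => H
  let pr : Option κ → E →L[ℂ] H := fun c => PiLp.proj 2 (fun _ => H) c
  let V : Submodule ℂ E := (⨅ c, LinearMap.ker (A c ∘L pr (some c) - B c ∘L pr none).toLinearMap) ⊓
    ⨅ s, LinearMap.ker (S s ∘L pr none - pr none).toLinearMap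
  have hV : ∀ x : E, x ∈ V ↔ (∀ c, A c (x (some c)) = B c (x none)) ∧
      ∀ s, S s (x none) = x none := fun x => by
    simp only [V, Submodule.mem_inf, Submodule.mem_iInf, LinearMap.mem_ker, coe_coe, sub_apply,
      comp_apply, sub_eq_zero]
    rfl
  have hcl : IsClosed (V : Set E) := by
    have : (V : Set E) = (⋂ c, {x : E | A c (pr (some c) x) = B c (pr none x)}) ∩
        ⋂ s, {x : E | S s (pr none x) = pr none x} := by
      ext x
      simp only [SetLike.mem_coe, hV, Set.mem_inter_iff, Set.mem_iInter]
      rfl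
    rw [this]
    exact (isClosed_iInter fun c => isClosed_eq (by fun_prop) (by fun_prop)).inter
      (isClosed_iInter fun s => isClosed_eq (by fun_prop) (by fun_prop))
  have : CompleteSpace V := hcl.completeSpace_coe
  have hin : ∀ x y : E, ⟪x, y⟫_ℂ = ⟪x none, y none⟫_ℂ + ∑ c, ⟪x (some c), y (some c)⟫_ℂ :=
    fun x y => by rw [PiLp.inner_apply, Fintype.sum_option]
  let T : E →L[ℂ] E := 1 + adjoint (pr none) ∘L (M - ((μ + 1 : ℝ) : ℂ) • 1) ∘L pr none
  have hT : ∀ x y : E, ⟪x, T y⟫_ℂ = ∑ c, ⟪x (some c), y (some c)⟫_ℂ + ⟪x none, M (y none)⟫_ℂ -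
      μ * ⟪x none, y none⟫_ℂ := fun x y => by
    have e1 : T y = y + adjoint (pr none) (M (y none) - ((μ + 1 : ℝ) : ℂ) • y none) := rfl
    have e2 : pr none x = x none := rfl
    rw [e1, inner_add_right, adjoint_inner_right, e2, hin, inner_sub_right, inner_smul_right]
    push_cast; ring
  let G : V →L[ℂ] V := V.orthogonalProjectionOnto ∘L T ∘L V.subtypeL
  have hG : ∀ (x y : V), ⟪x, G y⟫_ℂ = ⟪(x : E), T y⟫_ℂ := fun x y =>
    Submodule.inner_orthogonalProjectionOnto_eq_of_mem_left x (T y)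
  -- a convex combination of the lower bound and of the trivial one
  set t : ℝ := (e - μ) / (2 * (‖M‖ + |e| + 1 + (e - μ))) with ht
  have hd : 0 < 2 * (‖M‖ + |e| + 1 + (e - μ)) := by
    have := norm_nonneg M; have := abs_nonneg e; linarith
  have ht0 : 0 < t := div_pos (by linarith) hd
  have ht1 : t * (2 * (‖M‖ + |e| + 1 + (e - μ))) = e - μ := div_mul_cancel₀ _ hd.ne'
  have hunit : IsUnit G := by
    refine isUnit_of_forall_le_norm_inner_map G (c := ⟨t, ht0.le⟩) ht0 fun x => ?_
    have hx := (hV x).1 x.2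
    have h1 := hge _ _ hx.1 hx.2
    set u := (x : E) none with hu
    set a := ∑ c, ‖(x : E) (some c)‖ ^ 2 with ha
    have ha0 : 0 ≤ a := sum_nonneg fun c _ => sq_nonneg _
    have h2 : ‖x‖ ^ 2 = ‖u‖ ^ 2 + a := by
      rw [Submodule.coe_norm, PiLp.norm_sq_eq_of_L2, Fintype.sum_option]
    have h3 : -(‖M‖ * ‖u‖ ^ 2) ≤ (⟪u, M u⟫_ℂ).re := by
      have h4 := (Complex.abs_re_le_norm _).trans (norm_inner_le_norm (𝕜 := ℂ) u (M u))
      have h5 := mul_le_mul_of_nonneg_left (M.le_opNorm u) (norm_nonneg u)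
      have := neg_le_of_abs_le (h4.trans h5)
      linarith
    have h6 : (⟪x, G x⟫_ℂ).re = a + (⟪u, M u⟫_ℂ).re - μ * ‖u‖ ^ 2 := by
      rw [hG, hT, Complex.sub_re, Complex.add_re, Complex.re_sum, re_ofReal_mul]
      congr 2
      · exact sum_congr rfl fun c _ => inner_self_eq_norm_sq (𝕜 := ℂ) _
      · exact inner_self_eq_norm_sq (𝕜 := ℂ) u
    have h7 : ‖x‖ ^ 2 * t ≤ (⟪x, G x⟫_ℂ).re := by
      have ht2 : t ≤ 1 := by
        have := norm_nonneg M; have := abs_nonneg e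
        nlinarith
      have h8 := mul_le_mul_of_nonneg_left h1 (sub_nonneg.2 ht2)
      have h9 := mul_le_mul_of_nonneg_left h3 ht0.le
      have h10 : t * (‖M‖ + e + 1) ≤ e - μ := by
        rw [← ht1]
        refine mul_le_mul_of_nonneg_left ?_ ht0.le
        have := norm_nonneg M; have := le_abs_self e; have := abs_nonneg e; linarith
      have h11 := mul_le_mul_of_nonneg_right h10 (sq_nonneg ‖u‖)
      rw [h6, h2]
      linarith
    rw [norm_inner_symm]
    exact h7.trans ((le_abs_self _).trans (Complex.abs_re_le_norm _))
  obtain ⟨x, hx⟩ := (ContinuousLinearMap.isUnit_iff_bijective.1 hunit).2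
    (V.orthogonalProjectionOnto (adjoint (pr none) f))
  have hxV := (hV x).1 x.2
  refine ⟨(x : E) none, fun c => (x : E) (some c), hxV.1, hxV.2, fun u' g' h1 h2 => ?_⟩
  let y : E := WithLp.toLp 2 fun c => c.elim u' g'
  have hy : y ∈ V := (hV y).2 ⟨h1, h2⟩
  have h3 := hG ⟨y, hy⟩ x
  rw [hx, Submodule.inner_orthogonalProjectionOnto_eq_of_mem_left, adjoint_inner_right, hT] at h3
  have h4 : pr none y = u' := rfl
  rw [h4] at h3
  rw [h3]
  exact (sub_add_cancel _ _).symm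

end FormResolvent

/-! ### The resolvent of the box Hamiltonian -/

section Resolvent

/-- The graph of the unbounded multiplication by `s`, in terms of bounded operators. -/
theorem mulOp_inv_eq_iff {X : Type*} [MeasurableSpace X] {ν : Measure X} {s : X → ℝ}
    (hs : Measurable s) (h0 : ∀ x, 0 ≤ s x) (g f : Lp ℂ 2 ν) :
    mulOp ν (fun x => (((1 + s x)⁻¹ : ℝ) : ℂ)) g =
      mulOp ν (fun x => ((s x * (1 + s x)⁻¹ : ℝ) : ℂ)) f ↔ g =ᵐ[ν] fun x => (s x : ℂ) * f x := by
  have h1 : ∀ x, 0 < 1 + s x := fun x => by linarith [h0 x]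
  have b1 : BddMeas fun x => (((1 + s x)⁻¹ : ℝ) : ℂ) :=
    bddMeas_ofReal (C := 1) (by fun_prop) fun x => by
      rw [abs_of_pos (inv_pos.2 (h1 x))]
      exact inv_le_one_of_one_le₀ (by linarith [h0 x])
  have b2 : BddMeas fun x => ((s x * (1 + s x)⁻¹ : ℝ) : ℂ) :=
    bddMeas_ofReal (C := 1) (by fun_prop) fun x => by
      rw [abs_of_nonneg (mul_nonneg (h0 x) (inv_pos.2 (h1 x)).le), ← div_eq_mul_inv,
        div_le_one (h1 x)]
      linarith
  have key : ∀ x (z w : ℂ), (((1 + s x)⁻¹ : ℝ) : ℂ) * z = ((s x * (1 + s x)⁻¹ : ℝ) : ℂ) * w ↔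
      z = s x * w := fun x z w => by
    have h2 : (((1 + s x)⁻¹ : ℝ) : ℂ) ≠ 0 := by exact_mod_cast (inv_pos.2 (h1 x)).ne'
    rw [Complex.ofReal_mul, mul_comm (s x : ℂ), mul_assoc, mul_right_inj' h2]
  rw [Lp.ext_iff]
  constructor <;> intro h
  · filter_upwards [h, coeFn_mulOp b1 g, coeFn_mulOp b2 f] with x e1 e2 e3
    rwa [e2, e3, key] at e1
  · filter_upwards [h, coeFn_mulOp b1 g, coeFn_mulOp b2 f] with x e1 e2 e3
    rwa [e2, e3, key]

variable {N : ℕ} {χ v ω : E3 → ℝ} {b Ckin ρ R ℓ X σ : ℝ}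

/-- Square integrable functions of `N` positions. -/
abbrev ConfLp (N : ℕ) : Type := Lp ℂ 2 (volume : Measure (Conf N))

/-- A linear map that is bounded on square integrable functions gives an operator on `L²`. -/
theorem exists_operator {T : (Conf N → ℂ) → Conf N → ℂ} {c : ℝ} (hc : 0 ≤ c)
    (hcongr : ∀ {f g}, f =ᵐ[volume] g → T f =ᵐ[volume] T g)
    (hm : ∀ {f}, Measurable f → Measurable (T f))
    (hadd : ∀ {f g}, MemLp f 2 → MemLp g 2 → T (f + g) =ᵐ[volume] T f + T g)
    (hsmul : ∀ (z : ℂ) (f), T (z • f) = z • T f)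
    (hb : ∀ {f}, Measurable f → MemLp f 2 →
      ∫⁻ x, ‖T f x‖ₑ ^ 2 ≤ ofReal (c ^ 2) * ∫⁻ x, ‖f x‖ₑ ^ 2) :
    ∃ L : ConfLp N →L[ℂ] ConfLp N,
      ∀ u, L u =ᵐ[volume] T u := by
  have hmu : ∀ u : ConfLp N, Measurable u := fun u =>
    (Lp.stronglyMeasurable u).measurable
  have hT : ∀ u : ConfLp N, MemLp (T u) 2 := fun u =>
    memLp_of_lintegral_le (hm (hmu u)) (Lp.memLp u) ofReal_ne_top (hb (hmu u) (Lp.memLp u))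
  refine ⟨LinearMap.mkContinuous
    { toFun := fun u => (hT u).toLp (T u)
      map_add' := fun u w => Lp.ext ?_
      map_smul' := fun z u => Lp.ext ?_ } c fun u => ?_, fun u => (hT u).coeFn_toLp⟩
  · filter_upwards [(hT (u + w)).coeFn_toLp, (hT u).coeFn_toLp, (hT w).coeFn_toLp,
      hcongr (Lp.coeFn_add u w), hadd (Lp.memLp u) (Lp.memLp w),
      Lp.coeFn_add ((hT u).toLp (T u)) ((hT w).toLp (T w))] with x h1 h2 h3 h4 h5 h6
    rw [h1, h4, h5, h6, Pi.add_apply, Pi.add_apply, h2, h3]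
  · filter_upwards [(hT (z • u)).coeFn_toLp, (hT u).coeFn_toLp, hcongr (Lp.coeFn_smul z u),
      Lp.coeFn_smul z ((hT u).toLp (T u))] with x h1 h2 h3 h4
    rw [h1, h3, hsmul, RingHom.id_apply, h4, Pi.smul_apply, Pi.smul_apply, h2]
  · have h1 := hb (hmu u) (Lp.memLp u)
    rw [lintegral_enorm_sq_eq_eLpNorm, lintegral_enorm_sq_eq_eLpNorm, ENNReal.ofReal_pow hc,
      ← mul_pow] at h1
    have h2 := (ENNReal.pow_le_pow_left_iff two_ne_zero).1 h1
    change ‖(hT u).toLp (T u)‖ ≤ _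
    rw [Lp.norm_toLp, Lp.norm_def, ← ENNReal.toReal_ofReal hc, ← ENNReal.toReal_mul]
    exact ENNReal.toReal_mono (ENNReal.mul_ne_top ofReal_ne_top (Lp.eLpNorm_ne_top u)) h2

theorem exists_operator_fourierQ (hℓ : 0 < ℓ) (hχ : IsWeight ℓ X (chiB χ ℓ)) (i : Fin N) :
    ∃ Q F : ConfLp N →L[ℂ] ConfLp N,
      ∀ u, Q u =ᵐ[volume] projQ ℓ i u ∧ F u =ᵐ[volume] fourierQ χ ℓ i u := by
  obtain ⟨Q, hQ⟩ := exists_operator (T := projQ (N := N) ℓ i) zero_le_two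
    (fun h => projQ_congr h i) (fun h => measurable_projQ h i) (fun h h' => projQ_add h h' i)
    (fun z f => projQ_smul z f i) fun h _ =>
      (lintegral_enorm_sq_projQ_le hℓ h i).trans_eq (by norm_num)
  obtain ⟨S, hS⟩ := exists_operator (T := sliceFourier (chiB χ ℓ) i) hχ.bound_nonneg
    (fun h => sliceFourier_congr h i) (fun h => measurable_sliceFourier_conf hχ i h)
    (fun h h' => sliceFourier_add hχ h h' i) (fun z f => sliceFourier_smul z f i) fun {f} h h' => by
      rw [lintegral_enorm_sq_sliceFourier hℓ hχ h h' i,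
        ← lintegral_const_mul _ (h.enorm.pow_const 2),
        ENNReal.ofReal_pow hχ.bound_nonneg]
      refine lintegral_mono fun x => ?_
      rw [enorm_mul, mul_pow, ← ofReal_norm (E := ℂ) (chiB χ ℓ (x i) : ℂ), norm_real,
        Real.norm_of_nonneg (hχ.nonneg _)]
      gcongr
      exact hχ.le _
  exact ⟨Q, S ∘L Q, fun u => ⟨hQ u, (hS _).trans (sliceFourier_congr (hQ u) i)⟩⟩

theorem inner_eq_integral {α : Type*} [MeasurableSpace α] {ν : Measure α} (f g : Lp ℂ 2 ν) :
    ⟪f, g⟫_ℂ = ∫ x, conj (f x) * g x ∂ν := by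
  rw [L2.inner_def]
  simp only [RCLike.inner_apply']

end Resolvent

section Sector

variable {N : ℕ} {χ v ω : E3 → ℝ} {b Ckin ρ R ℓ X σ : ℝ}

/-- The resolvent equation in a sector. -/
theorem IsBoxSetup.exists_sectorOp (h : IsBoxSetup χ v ω R ℓ X σ) {e μ : ℝ} (hμ : μ < e)
    (hge : ∀ Ψ : Conf N → ℂ, InFormDomain χ Ckin ℓ v Ψ →
      e * (∫ x, ‖Ψ x‖ ^ 2) ≤ (boxForm χ b Ckin ℓ ρ v ω Ψ Ψ).re)
    {f : Conf N → ℂ} (hf : InSector f) :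
    ∃ Ψ : Conf N → ℂ, InFormDomain χ Ckin ℓ v Ψ ∧ ∀ Φ : Conf N → ℂ, InFormDomain χ Ckin ℓ v Φ →
      boxForm χ b Ckin ℓ ρ v ω Φ Ψ = ∫ x, conj (Φ x) * (f x + μ * Ψ x) := by
  choose Q F hQF using fun i : Fin N => exists_operator_fourierQ h.side_pos h.isWeight i
  obtain ⟨hUm, U, hU⟩ := h.exists_field_bound
  have hUb : ∀ i : Fin N, BddMeas fun x : Conf N => ((∫ y, pairW1 χ ℓ v ω (x i) y : ℝ) : ℂ) :=
    fun i => bddMeas_ofReal (hUm.comp (measurable_pi_apply i)) fun x => hU (x i)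
  obtain ⟨r, hrm, hr⟩ := (h.aestronglyMeasurable_repulsion (N := N))
  -- the square roots of the repulsion and of the kinetic symbols
  let s : Option (Fin N) → Conf N → ℝ := fun c x =>
    c.elim (√(r x)) fun i => √(kinSymbol Ckin ℓ (x i))
  have hsm : ∀ c, Measurable (s c) := fun c => by
    cases c with
    | none => exact hrm.measurable.sqrt
    | some i => exact ((continuous_kinSymbol Ckin ℓ).measurable.comp (measurable_pi_apply i)).sqrt
  have hs0 : ∀ c x, 0 ≤ s c x := fun c x => by cases c <;> exact Real.sqrt_nonneg _
  have hsr : ∀ᵐ x : Conf N, s none x * s none x = repulsion χ ℓ v x := by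
    filter_upwards [hr] with x hx
    rw [hx]
    exact Real.mul_self_sqrt (hx ▸ h.repulsion_nonneg x)
  have hsk : ∀ i x, s (some i) x * s (some i) x = kinSymbol Ckin ℓ (x i) := fun i x =>
    Real.mul_self_sqrt (kinSymbol_nonneg _ _ _)
  let L : Option (Fin N) → ConfLp N →L[ℂ] ConfLp N := fun c => c.elim 1 F
  let A : Option (Fin N) → ConfLp N →L[ℂ] ConfLp N := fun c =>
    mulOp volume fun x => (((1 + s c x)⁻¹ : ℝ) : ℂ)
  let B : Option (Fin N) → ConfLp N →L[ℂ] ConfLp N := fun c =>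
      mulOp volume (fun x => ((s c x * (1 + s c x)⁻¹ : ℝ) : ℂ)) ∘L L c
  have hAB : ∀ c (g u : ConfLp N), A c g = B c u ↔
      g =ᵐ[volume] fun x => (s c x : ℂ) * L c u x := fun c g u =>
    mulOp_inv_eq_iff (hsm c) (hs0 c) g (L c u)
  let S : Equiv.Perm (Fin N) → ConfLp N →L[ℂ] ConfLp N := fun τ =>
      (Lp.compMeasurePreservingₗᵢ ℂ (E := ℂ) (p := 2) _
        (measurePreserving_comp_perm τ)).toContinuousLinearMap
  have hS : ∀ τ u, S τ u = u ↔ (fun x => u (x ∘ τ)) =ᵐ[volume] u := fun τ u => by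
    have e : S τ u =ᵐ[volume] fun x => u (x ∘ τ) :=
      Lp.coeFn_compMeasurePreserving u (measurePreserving_comp_perm τ)
    rw [Lp.ext_iff]
    exact ⟨fun h1 => e.symm.trans h1, fun h1 => e.trans h1⟩
  let M : ConfLp N →L[ℂ] ConfLp N :=
    ∑ i, (((b * (ℓ ^ 2)⁻¹ : ℝ) : ℂ) • (ContinuousLinearMap.adjoint (Q i) ∘L Q i) +
      (-ρ : ℂ) • mulOp volume fun x => ((∫ y, pairW1 χ ℓ v ω (x i) y : ℝ) : ℂ))
  -- vectors that satisfy the equations belong to the form domain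
  have hdom : ∀ (u : ConfLp N) (g : Option (Fin N) → ConfLp N), (∀ c, A c (g c) = B c u) →
      (∀ τ, S τ u = u) →
      InFormDomain χ Ckin ℓ v (u : Conf N → ℂ) := by
    intro u g h1 h2
    have hg := fun c => (Lp.memLp (g c)).integrable_norm_pow two_ne_zero
    refine ⟨⟨Lp.memLp u, fun τ => (hS τ u).1 (h2 τ)⟩, fun i => (hg (some i)).congr ?_,
      (hg none).congr ?_⟩
    · filter_upwards [(hAB _ _ _).1 (h1 (some i)), (hQF i u).2] with x e1 e2
      rw [e1, ← e2, norm_mul, mul_pow, norm_real, Real.norm_eq_abs, sq_abs, ← hsk, ← sq]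
      rfl
    · filter_upwards [(hAB _ _ _).1 (h1 none), hsr] with x e1 e2
      rw [e1, ← e2, norm_mul, mul_pow, norm_real, Real.norm_eq_abs, sq_abs, ← sq]
      rfl
  have hint : ∀ f g : ConfLp N, Integrable fun x => conj (f x) * g x :=
    fun f g => (Lp.memLp f).star.integrable_mul (Lp.memLp g)
  have hform : ∀ (u : ConfLp N) (g : Option (Fin N) → ConfLp N) (u' : ConfLp N)
      (g' : Option (Fin N) → ConfLp N), (∀ c, A c (g c) = B c u) → (∀ c, A c (g' c) = B c u') →
      boxForm χ b Ckin ℓ ρ v ω (u' : Conf N → ℂ) (u : Conf N → ℂ) =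
        ∑ c, ⟪g' c, g c⟫_ℂ + ⟪u', M u⟫_ℂ := by
    intro u g u' g' h1 h2
    have e1 : ∀ c, (fun x => conj (g' c x) * g c x) =ᵐ[volume] fun x =>
        ((s c x * s c x : ℝ) : ℂ) * (conj (L c u' x) * L c u x) := fun c => by
      filter_upwards [(hAB _ _ _).1 (h1 c), (hAB _ _ _).1 (h2 c)] with x e1 e2
      rw [e1, e2, map_mul, conj_ofReal]
      push_cast; ring
    have e2 : (fun x => conj (g' none x) * g none x) =ᵐ[volume] fun x =>
        (repulsion χ ℓ v x : ℂ) * (conj (u' x) * u x) := by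
      filter_upwards [e1 none, hsr] with x h3 h4
      rw [h3, h4]; rfl
    have hrep : Integrable fun x => (repulsion χ ℓ v x : ℂ) * (conj (u' x) * u x) :=
      (hint _ _).congr e2
    have e3 : ∀ i, ⟪g' (some i), g (some i)⟫_ℂ = ∫ x : Conf N, (kinSymbol Ckin ℓ (x i) : ℂ) *
        (conj (fourierQ χ ℓ i u' x) * fourierQ χ ℓ i u x) := fun i => by
      rw [inner_eq_integral]
      refine integral_congr_ae ?_
      filter_upwards [e1 (some i), (hQF i u).2, (hQF i u').2] with x h3 h4 h5
      rw [h3, hsk, ← h4, ← h5]; rfl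
    have e4 : ∀ i, ⟪Q i u', Q i u⟫_ℂ = ∫ x, conj (projQ ℓ i u' x) * projQ ℓ i u x := fun i => by
      rw [inner_eq_integral]
      refine integral_congr_ae ?_
      filter_upwards [(hQF i u).1, (hQF i u').1] with x h4 h5
      rw [h4, h5]
    have hpot : ∀ i : Fin N, Integrable fun x => (-ρ : ℂ) * (conj (u' x) *
        (((∫ y, pairW1 χ ℓ v ω (x i) y : ℝ) : ℂ) * u x)) := fun i =>
      (((Lp.memLp u').star).integrable_mul ((hUb i).memLp_mul (Lp.memLp u))).const_mul _
    have e5 : ∫ x, (potential χ ℓ ρ v ω x : ℂ) * (conj (u' x) * u x) =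
        ∑ i, (-ρ : ℂ) * ⟪u', mulOp volume (fun x : Conf N =>
          ((∫ y, pairW1 χ ℓ v ω (x i) y : ℝ) : ℂ)) u⟫_ℂ + ⟪g' none, g none⟫_ℂ := by
      rw [inner_eq_integral (g' none), integral_congr_ae e2]
      simp only [inner_mulOp (hUb _), ← integral_const_mul]
      rw [← integral_finsetSum _ fun i _ => hpot i, ← integral_add
        (integrable_finsetSum _ fun i _ => hpot i) hrep]
      refine integral_congr_ae (.of_forall fun x => ?_)
      simp only [potential, Complex.ofReal_add, Complex.ofReal_sum, Complex.ofReal_mul,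
        Complex.ofReal_neg, add_mul, sum_mul]
      congr 1
      exact sum_congr rfl fun i _ => by ring
    have e6 : ⟪u', M u⟫_ℂ = ∑ i, (((b * (ℓ ^ 2)⁻¹ : ℝ) : ℂ) * ⟪Q i u', Q i u⟫_ℂ +
        (-ρ : ℂ) * ⟪u', mulOp volume (fun x : Conf N =>
          ((∫ y, pairW1 χ ℓ v ω (x i) y : ℝ) : ℂ)) u⟫_ℂ) := by
      simp only [M, sum_apply, add_apply, smul_apply, inner_sum, inner_add_right, inner_smul_right,
        ContinuousLinearMap.comp_apply, ContinuousLinearMap.adjoint_inner_right]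
    rw [boxForm, e5, e6, Fintype.sum_option]
    simp only [kineticForm, e3, e4, sum_add_distrib]
    ring
  obtain ⟨u, g, h1, h2, h3⟩ := exists_form_solution A B S M hμ (fun u g h1 h2 => by
    have h3 := hge u (hdom u g h1 h2)
    rw [hform u g u g h1 h1, ← norm_sq_eq_integral, Complex.add_re, Complex.re_sum] at h3
    refine h3.trans_eq ?_
    congr 1
    exact sum_congr rfl fun c _ => inner_self_eq_norm_sq (𝕜 := ℂ) _) (hf.1.toLp f)
  refine ⟨u, hdom u g h1 h2, fun Φ hΦ => ?_⟩
  set w := hΦ.1.1.toLp Φ with hw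
  have hwΦ : w =ᵐ[volume] Φ := hΦ.1.1.coeFn_toLp
  have hmem : ∀ c, MemLp (fun x => (s c x : ℂ) * L c w x) 2 := fun c => by
    have hm : AEStronglyMeasurable (fun x => (s c x : ℂ) * L c w x) volume :=
      (Complex.measurable_ofReal.comp (hsm c)).aestronglyMeasurable.mul (Lp.aestronglyMeasurable _)
    refine (memLp_two_iff_integrable_sq_norm hm).2 ?_
    cases c with
    | none =>
      refine hΦ.2.2.congr ?_
      filter_upwards [hsr, hwΦ] with x e1 e2
      rw [norm_mul, mul_pow, norm_real, Real.norm_eq_abs, sq_abs, sq (s none x), e1, ← e2]; rfl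
    | some i =>
      refine (hΦ.2.1 i).congr ?_
      filter_upwards [(hQF i w).2, fourierQ_congr (χ := χ) (ℓ := ℓ) hwΦ i] with x e1 e2
      rw [norm_mul, mul_pow, norm_real, Real.norm_eq_abs, sq_abs, sq (s (some i) x), hsk,
        ← e2, ← e1]; rfl
  have hw1 : ∀ c, A c ((hmem c).toLp _) = B c w := fun c => (hAB _ _ _).2 (hmem c).coeFn_toLp
  have hw2 : ∀ τ, S τ w = w := fun τ => (hS τ w).2 ((inSector_congr hwΦ.symm hΦ.1).2 τ)
  have h4 := h3 w _ hw1 hw2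
  rw [← hform u g w _ h1 hw1] at h4
  rw [boxForm_congr (EventuallyEq.refl _ _) hwΦ.symm, h4, inner_eq_integral, inner_eq_integral,
    ← integral_const_mul, ← integral_add (hint _ _) ((hint _ _).const_mul _)]
  refine integral_congr_ae ?_
  filter_upwards [hwΦ, hf.1.coeFn_toLp] with x e1 e2
  rw [e1, e2]
  ring

theorem inSector_add_mul {f Ψ : Conf N → ℂ} (hf : InSector f) (hΨ : InSector Ψ) (μ : ℂ) :
    InSector fun x => f x + μ * Ψ x := by
  refine ⟨hf.1.add (hΨ.1.const_mul μ), fun s => ?_⟩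
  filter_upwards [hf.2 s, hΨ.2 s] with x h1 h2
  rw [h1, h2]

/-- The bound on the resolvent in a sector. -/
theorem integral_norm_sq_le_of_sectorOp {e μ : ℝ} (hμ : μ < e)
    (hge : ∀ Ψ : Conf N → ℂ, InFormDomain χ Ckin ℓ v Ψ →
      e * (∫ x, ‖Ψ x‖ ^ 2) ≤ (boxForm χ b Ckin ℓ ρ v ω Ψ Ψ).re)
    {f Ψ : Conf N → ℂ} (hf : InSector f)
    (hΨ : SectorOp χ b Ckin ℓ ρ v ω Ψ fun x => f x + μ * Ψ x) :
    ∫ x, ‖Ψ x‖ ^ 2 ≤ ((e - μ) ^ 2)⁻¹ * ∫ x, ‖f x‖ ^ 2 := by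
  have hd := sub_pos.2 hμ
  have hΨ2 := hΨ.1.1.1
  have i1 := hΨ2.integrable_norm_pow two_ne_zero
  have i2 := hf.1.integrable_norm_pow two_ne_zero
  have i3 : Integrable fun x => conj (Ψ x) * (f x + μ * Ψ x) :=
    hΨ2.star.integrable_mul (hf.1.add (hΨ2.const_mul (μ : ℂ)))
  have h1 := hge Ψ hΨ.1
  rw [hΨ.2.2 Ψ hΨ.1] at h1
  have h2 : (∫ x, conj (Ψ x) * (f x + μ * Ψ x)).re ≤
      ((e - μ) / 2 + μ) * (∫ x, ‖Ψ x‖ ^ 2) + (2 * (e - μ))⁻¹ * ∫ x, ‖f x‖ ^ 2 := by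
    rw [← RCLike.re_eq_complex_re, ← integral_re i3, ← integral_const_mul, ← integral_const_mul,
      ← integral_add (i1.const_mul _) (i2.const_mul _)]
    refine integral_mono i3.re ((i1.const_mul _).add (i2.const_mul _)) fun x => ?_
    have h3 : (conj (Ψ x) * f x).re ≤ ‖Ψ x‖ * ‖f x‖ := by
      refine (Complex.re_le_norm _).trans (le_of_eq ?_)
      rw [norm_mul, RCLike.norm_conj]
    have h4 : ‖Ψ x‖ * ‖f x‖ ≤ (e - μ) / 2 * ‖Ψ x‖ ^ 2 + (2 * (e - μ))⁻¹ * ‖f x‖ ^ 2 := by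
      have h5 : (e - μ) / 2 * ‖Ψ x‖ ^ 2 + (2 * (e - μ))⁻¹ * ‖f x‖ ^ 2 - ‖Ψ x‖ * ‖f x‖ =
          (2 * (e - μ))⁻¹ * ((e - μ) * ‖Ψ x‖ - ‖f x‖) ^ 2 := by field_simp; ring
      have h6 : 0 ≤ (2 * (e - μ))⁻¹ * ((e - μ) * ‖Ψ x‖ - ‖f x‖) ^ 2 := by positivity
      linarith
    simp only [RCLike.re_eq_complex_re]
    rw [mul_add, mul_left_comm, Complex.add_re, re_ofReal_mul, conj_mul_self_re]
    linarith
  have h7 : (2 * (e - μ))⁻¹ = (e - μ) / 2 * ((e - μ) ^ 2)⁻¹ := by field_simp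
  rw [h7] at h2
  have h8 : (e - μ) / 2 * (∫ x, ‖Ψ x‖ ^ 2) ≤
      (e - μ) / 2 * (((e - μ) ^ 2)⁻¹ * ∫ x, ‖f x‖ ^ 2) := by linarith
  exact le_of_mul_le_mul_left h8 (by linarith)

/-- A lower bound for the quadratic forms of all sectors is a lower bound for the spectrum. -/
theorem IsBoxSetup.le_boxEnergy (h : IsBoxSetup χ v ω R ℓ X σ) {e : ℝ}
    (hge : ∀ (N : ℕ) (Ψ : Conf N → ℂ), InFormDomain χ Ckin ℓ v Ψ →
      e * (∫ x, ‖Ψ x‖ ^ 2) ≤ (boxForm χ b Ckin ℓ ρ v ω Ψ Ψ).re) :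
    (e : EReal) ≤ boxEnergy χ b Ckin ℓ ρ v ω := by
  refine le_iInf₂ fun μ hμ => EReal.coe_le_coe_iff.2 (not_lt.1 fun hlt => hμ
    ⟨((e - μ) ^ 2)⁻¹, fun f hf => ⟨?_, fun Ψ hΨ => ?_⟩⟩)
  · choose Ψ hΨ hΨf using fun N => h.exists_sectorOp hlt (hge N) (hf.1 N)
    have hop : ∀ N, SectorOp χ b Ckin ℓ ρ v ω (Ψ N) fun x => f N x + μ * Ψ N x := fun N =>
      ⟨hΨ N, inSector_add_mul (hf.1 N) (hΨ N).1 μ, hΨf N⟩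
    have hsum : Summable fun N => ∫ x, ‖Ψ N x‖ ^ 2 :=
      (hf.2.mul_left ((e - μ) ^ 2)⁻¹).of_nonneg_of_le
        (fun N => integral_nonneg fun x => sq_nonneg _)
        fun N => integral_norm_sq_le_of_sectorOp hlt (hge N) (hf.1 N) (hop N)
    refine ⟨Ψ, ⟨fun N => (hΨ N).1, hsum⟩, ⟨fun N => (hop N).2.1, ?_⟩, hop⟩
    refine ((hf.2.mul_left 2).add (hsum.mul_left (2 * μ ^ 2))).of_nonneg_of_le
      (fun N => integral_nonneg fun x => sq_nonneg _) fun N => ?_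
    have i1 := (hΨ N).1.1.integrable_norm_pow two_ne_zero
    have i2 := (hf.1 N).1.integrable_norm_pow two_ne_zero
    rw [← integral_const_mul, ← integral_const_mul,
      ← integral_add (i2.const_mul _) (i1.const_mul _)]
    refine integral_mono ((hop N).2.1.1.integrable_norm_pow two_ne_zero)
      ((i2.const_mul _).add (i1.const_mul _)) fun x => ?_
    have h1 := pow_le_pow_left₀ (norm_nonneg _) (norm_add_le (f N x) (μ * Ψ N x)) 2
    have h2 := add_sq_le (a := ‖f N x‖) (b := ‖(μ : ℂ) * Ψ N x‖)
    rw [norm_mul (μ : ℂ), mul_pow _ _ 2, norm_real, Real.norm_eq_abs, sq_abs] at h2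
    rw [norm_mul (μ : ℂ), norm_real, Real.norm_eq_abs] at h1
    simp only
    linarith
  · rw [fockNormSq, fockNormSq, ← tsum_mul_left]
    exact Summable.tsum_le_tsum (fun N => integral_norm_sq_le_of_sectorOp hlt (hge N) (hf.1 N)
      (hΨ.2.2 N)) hΨ.1.2 (hf.2.mul_left _)

end Sector

/-! ### The choice of the side length -/

theorem groundBound_div_le {C G ρ ℓ σ a K c R : ℝ} {v ω : E3 → ℝ} (hC : 0 ≤ C) (hG : 0 ≤ G)
    (hρ : 0 < ρ) (ha : 0 < a) (hK : 0 < K) (hℓ : ℓ = K * (Real.sqrt (ρ * a))⁻¹)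
    (hσ : σ = c * (R / ℓ) ^ 2) (hc : 0 ≤ c) (hI : ∫ z, vone v ω z ≤ 8 * π * a) :
    groundBound C G ρ ℓ σ v ω * (ℓ ^ 3)⁻¹ ≤ 4 * π * ρ ^ 2 * a +
      (8 * π * (21 + 400 * C * G) / K ^ 3 + 9600 * π * c / K ^ 2) * ρ ^ 2 * a *
        Real.sqrt (ρ * a ^ 3) +
      (8 * π * (21 + 400 * C * G) / K ^ 3 + 9600 * π * c / K ^ 2) *
        ρ ^ 3 * a ^ 2 * R ^ 2 := by
  obtain ⟨q, hq⟩ : ∃ q, q = Real.sqrt (ρ * a) := ⟨_, rfl⟩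
  have hq0 : 0 < q := by rw [hq]; positivity
  have hqq : q ^ 2 = ρ * a := by rw [hq]; exact Real.sq_sqrt (by positivity)
  have hqa : Real.sqrt (ρ * a ^ 3) = q * a := by
    rw [show ρ * a ^ 3 = (q * a) ^ 2 by rw [mul_pow, hqq]; ring]
    exact Real.sqrt_sq (by positivity)
  have hpi := Real.pi_pos
  rw [← hq] at hℓ
  have hℓ0 : 0 < ℓ := by rw [hℓ]; positivity
  set T := 21 + 400 * C * G with hT
  have hT0 : 0 ≤ T := by positivity
  have hσ0 : 0 ≤ σ := by rw [hσ]; positivity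
  have h1 : groundBound C G ρ ℓ σ v ω * (ℓ ^ 3)⁻¹ =
      (1 / 2 * ρ ^ 2 + T * ρ * (ℓ ^ 3)⁻¹ + 1200 * σ * ρ ^ 2) * ∫ z, vone v ω z := by
    rw [groundBound, hT]; field_simp
  have h2 : ρ * a * (ℓ ^ 3)⁻¹ = ρ ^ 2 * a * (q * a) / K ^ 3 := by
    have : q ^ 3 = ρ * a * q := by rw [← hqq]; ring
    rw [hℓ, mul_pow, mul_inv, inv_pow, inv_inv, this]; field_simp
  have h3 : σ * ρ ^ 2 * a = c / K ^ 2 * ρ ^ 3 * a ^ 2 * R ^ 2 := by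
    rw [hσ, hℓ, div_pow, mul_pow, inv_pow, hqq]; field_simp
  have h4 := mul_le_mul_of_nonneg_left hI
    (show 0 ≤ 1 / 2 * ρ ^ 2 + T * ρ * (ℓ ^ 3)⁻¹ + 1200 * σ * ρ ^ 2 by positivity)
  have h5 : 0 ≤ 9600 * π * c / K ^ 2 * (ρ ^ 2 * a * (q * a)) := by positivity
  have h6 : 0 ≤ 8 * π * T / K ^ 3 * (ρ ^ 3 * a ^ 2 * R ^ 2) := by positivity
  rw [h1, hqa]
  refine h4.trans ?_
  have h7 : (1 / 2 * ρ ^ 2 + T * ρ * (ℓ ^ 3)⁻¹ + 1200 * σ * ρ ^ 2) * (8 * π * a) =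
      4 * π * ρ ^ 2 * a + 8 * π * T / K ^ 3 * (ρ ^ 2 * a * (q * a)) +
        9600 * π * c / K ^ 2 * (ρ ^ 3 * a ^ 2 * R ^ 2) := by
    linear_combination 8 * π * T * h2 + 9600 * π * h3
  rw [h7]; linarith only [h5, h6]

end BoseBox

end

open BoseBox in
theorem mainTheorem5 (χ : E3 → ℝ) (hχ : IsLocalization χ)
    (b Ckin : ℝ) (hb : 0 < b) (hCkin : 0 < Ckin)
    (D : ℝ) (hD : 0 < D) (hχD : ∀ x : E3, ‖x‖ ≤ D → |selfConv χ x - 1| ≤ 1 / 2) :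
    ∃ K₀ : ℝ, 0 < K₀ ∧ ∃ C' : ℝ, 0 < C' ∧ ∃ C : ℝ, 0 < C ∧
      ∀ (v : E3 → ℝ) (R : ℝ), IsPotential v R →
      ∀ ω : E3 → ℝ, IsScatteringSolution v ω →
      ∀ r : ℝ, R < r →
      ∀ a : ℝ, a = scatteringLength v r → 0 < a →
      ∀ ρ : ℝ, 0 < ρ →
      ∀ ℓ : ℝ, ℓ = K₀ * (ρ * a) ^ (-(1 / 2) : ℝ) →
        R / ℓ ≤ C' → ρ * a * R ^ 2 ≤ (K₀ * D) ^ 2 →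
        ((-4 * Real.pi * ρ ^ 2 * a - C * ρ ^ 2 * a * Real.sqrt (ρ * a ^ 3)
            - C * ρ ^ 3 * a ^ 2 * R ^ 2 : ℝ) : EReal)
          ≤ boxEnergyDensity χ b Ckin ℓ ρ v ω := by
  have hpi := Real.pi_pos
  obtain ⟨X, hX0, hX⟩ := hχ.exists_le
  obtain ⟨c, hc0, hc⟩ := hχ.exists_one_sub_selfConv_le
  obtain ⟨C, hC0, hC⟩ := exists_dispersionBound hCkin
    (β := b / (4 * X ^ 2)) (by positivity)
  obtain ⟨A, hA0, hA⟩ := exists_scatteringLength_le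
  -- `K₀` makes the gap `b ℓ⁻²` dominate the chemical potential term, of size `8πρa = 8π K₀² ℓ⁻²`.
  obtain ⟨K, hK⟩ : ∃ K, K = Real.sqrt (b / (32 * Real.pi * (338 * X ^ 2 + 11))) := ⟨_, rfl⟩
  have hK0 : 0 < K := by rw [hK]; positivity
  have hKK : K ^ 2 = b / (32 * Real.pi * (338 * X ^ 2 + 11)) := by
    rw [hK]; exact Real.sq_sqrt (by positivity)
  set G := 8 * Real.pi * K ^ 2 with hG
  have hG0 : 0 < G := by positivity
  set T := 21 + 400 * C * G with hT
  have hT0 : 0 < T := by positivity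
  refine ⟨K, hK0, min 1 (min (1 / (600 * c)) (K ^ 2 / (A * T))), by positivity,
    8 * Real.pi * T / K ^ 3 + 9600 * Real.pi * c / K ^ 2, by positivity, ?_⟩
  intro v R hv ω hω r hr a har ha ρ hρ ℓ hℓ hRℓ _
  have hR := hv.range_pos
  have hra : 0 < ρ * a := mul_pos hρ ha
  have hℓ' : ℓ = K * (Real.sqrt (ρ * a))⁻¹ := by
    rw [hℓ, Real.rpow_neg hra.le, Real.sqrt_eq_rpow]
  have hℓ0 : 0 < ℓ := by rw [hℓ']; positivity
  have hℓK : ρ * a * ℓ ^ 2 = K ^ 2 := by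
    rw [hℓ', mul_pow, inv_pow, Real.sq_sqrt hra.le]; field_simp
  obtain ⟨hR1, hR2, hR3⟩ : R / ℓ ≤ 1 ∧ R / ℓ ≤ 1 / (600 * c) ∧ R / ℓ ≤ K ^ 2 / (A * T) := by
    simpa only [le_min_iff] using hRℓ
  have hRl0 : 0 < R / ℓ := by positivity
  obtain ⟨σ, hσ⟩ : ∃ σ, σ = c * (R / ℓ) ^ 2 := ⟨_, rfl⟩
  have hσ600 : σ ≤ 1 / 600 := by
    have h1 : (R / ℓ) ^ 2 ≤ R / ℓ := by rw [sq]; exact mul_le_of_le_one_left hRl0.le hR1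
    calc σ ≤ c * (1 / (600 * c)) := by
          rw [hσ]; exact mul_le_mul_of_nonneg_left (h1.trans hR2) hc0.le
      _ = 1 / 600 := by field_simp
  have hset : IsBoxSetup χ v ω R ℓ X σ :=
    { loc := hχ, bound_pos := hX0, le_bound := hX, pot := hv, sol := hω, side_pos := hℓ0
      σ_nonneg := by rw [hσ]; positivity
      σ_le := by linarith
      le_selfConv := fun z hz => by
        have h1 := hc (ℓ⁻¹ • z)
        have h2 : ‖ℓ⁻¹ • z‖ ≤ R / ℓ := by
          rw [norm_smul, norm_inv, Real.norm_of_nonneg hℓ0.le, div_eq_inv_mul]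
          gcongr
        have h3 : c * ‖ℓ⁻¹ • z‖ ^ 2 ≤ σ := by rw [hσ]; gcongr
        linarith }
  set I := ∫ z, vone v ω z with hI
  have hI0 : 0 ≤ I := integral_nonneg_of_ae (hω.vone_nonneg hv)
  have hI1 : I ≤ 8 * Real.pi * a := by
    have := half_integral_vone_le_scatteringLength hv hω hr (har ▸ ha)
    rw [← har] at this
    linarith
  have hρI : ρ * I ≤ G * (ℓ ^ 2)⁻¹ := by
    rw [← div_eq_mul_inv, le_div_iff₀ (by positivity), hG, ← hℓK]
    calc ρ * I * ℓ ^ 2 = I * (ρ * ℓ ^ 2) := by ring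
      _ ≤ 8 * Real.pi * a * (ρ * ℓ ^ 2) := mul_le_mul_of_nonneg_right hI1 (by positivity)
      _ = _ := by ring
  have hgap : ρ * I * (338 * X ^ 2 + 11) ≤ b * (ℓ ^ 2)⁻¹ / 4 := by
    calc _ ≤ G * (ℓ ^ 2)⁻¹ * (338 * X ^ 2 + 11) :=
          mul_le_mul_of_nonneg_right hρI (by positivity)
      _ = _ := by rw [hG, hKK]; field_simp; ring
  have hGI : ρ * I * ℓ ^ 2 ≤ G := by
    calc _ ≤ G * (ℓ ^ 2)⁻¹ * ℓ ^ 2 := mul_le_mul_of_nonneg_right hρI (by positivity)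
      _ = G := by field_simp
  -- The box holds many particles: `ρ ℓ³ = K² ℓ / a`, and `a` is at most of the order of `R`.
  have hρL : T ≤ ρ * ℓ ^ 3 := by
    have h1 : a ≤ A * R := har ▸ hA v R r hv hr
    rw [div_le_div_iff₀ hℓ0 (by positivity)] at hR3
    refine le_of_mul_le_mul_right ?_ ha
    calc T * a ≤ T * (A * R) := mul_le_mul_of_nonneg_left h1 hT0.le
      _ = R * (A * T) := by ring
      _ ≤ K ^ 2 * ℓ := hR3
      _ = ρ * ℓ ^ 3 * a := by rw [← hℓK]; ring
  have hE := hset.le_boxEnergy fun N Ψ hΨ =>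
    hset.boxForm_ge hb hρ hC0.le (hC ℓ hℓ0) hgap hGI hρL hσ600 hΨ
  have hD := groundBound_div_le (R := R) hC0.le hG0.le hρ ha hK0 hℓ' hσ hc0.le hI1
  calc _ ≤ (((ℓ ^ 3)⁻¹ * -groundBound C G ρ ℓ σ v ω : ℝ) : EReal) := by
        rw [EReal.coe_le_coe_iff]; linarith only [hD]
    _ ≤ boxEnergyDensity χ b Ckin ℓ ρ v ω := by
        rw [EReal.coe_mul]
        exact mul_le_mul_of_nonneg_left hE (by rw [EReal.coe_nonneg]; positivity)
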